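/- Let $\nu>0$ and $\varepsilon_0>0$. For each $\varepsilon\in(0,\varepsilon_0)$ let $\mathcal S^\varepsilon_0\subset\mathbb R^3$ be a non-empty smooth compact simply connected set (near each boundary point a sublevel set $\{g\le 0\}$ of a smooth $g$ with $\nabla g\neq0$ at that point) with centre of mass at the origin and $\mathcal S_0^\varepsilon\subset B(0,\varepsilon)$, occupied by a homogeneous rigid body of density $\rho_\varepsilon>0$ and mass $m^\varepsilon=\rho_\varepsilon|\mathcal S_0^\varepsilon|$. The fluid around it has density $1$ and viscosity $\nu$. Write $D(v)=\frac12(\nabla v+\nabla v^T)$, $A:B=\sum_{i,j}A_{ij}B_{ij}$, $|A|^2=A:A$, $\mathbb R_+=[0,\infty)$, and $$(J^\varepsilon a)\cdot b=\rho_\varepsilon\int_{\mathcal S_0^\varepsilon}(a\times x)\cdot(b\times x)\,dx$$ for the inertia matrix at time $0$. **Initial data.** $\widetilde u^0_\varepsilon\in L^2(\mathbb R^3;\mathbb R^3)$ is divergence free in $\mathbb R^3$ and is a rigid velocity in the body: $\widetilde u_\varepsilon^0(x)=l^0_\varepsilon+\omega^0_\varepsilon\times x$ for almost every $x\in\mathcal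 S_0^\varepsilon$, with $l^0_\varepsilon,\omega_\varepsilon^0\in\mathbb R^3$. **Solutions.** A weak Leray solution of the fluid–rigid body system is a triple $(\widetilde u_\varepsilon,h_\varepsilon,\omega_\varepsilon)$ such that - $h_\varepsilon:\mathbb R_+\to\mathbb R^3$ is Lipschitz with $h_\varepsilon(0)=0$, and $\omega_\varepsilon\in L^\infty(\mathbb R_+;\mathbb R^3)$; with $\mathcal R_\varepsilon(t)\in SO(3)$ the Lipschitz solution of $\mathcal R_\varepsilon'\mathcal R_\varepsilon^Tz=\omega_\varepsilon\times z$ $(z\in\mathbb R^3)$, $\mathcal R_\varepsilon(0)=I$, put $\mathcal S^\varepsilon(t)=h_\varepsilon(t)+\mathcal R_\varepsilon(t)\mathcal S_0^\varepsilon$ and $\widetilde\rho_\varepsilon(t,\cdot)=1$ outside $\mathcal S^\varepsilon(t)$, $\widetilde\rho_\varepsilon(t,\cdot)=\rho_\varepsilon$ in $\mathcal S^\varepsilon(t)$; - the global velocity satisfies $\widetilde u_\varepsilon\in L^\infty(\mathbb R_+;L^2(\mathbb R^3))\cap L^2_{\rm loc}(\mathbb R_+;H^1(\mathbb R^3))\cap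 C^0_w(\mathbb R_+;L^2(\mathbb R^3))$, is divergence free in $\mathbb R^3$, and for almost every $t$ satisfies $\widetilde u_\varepsilon(t,x)=h_\varepsilon'(t)+\omega_\varepsilon(t)\times(x-h_\varepsilon(t))$ and $D(\widetilde u_\varepsilon)(t,x)=0$ for almost every $x\in\mathcal S^\varepsilon(t)$; - for every divergence free $\varphi\in W^{1,\infty}(\mathbb R_+;H^1(\mathbb R^3))$ with compact support in $\mathbb R_+\times\mathbb R^3$ such that $D(\varphi)(t,\cdot)=0$ in $\mathcal S^\varepsilon(t)$ for all $t$, $$-\int_0^\infty\!\!\int_{\mathbb R^3}\widetilde\rho_\varepsilon\widetilde u_\varepsilon\cdot\bigl(\partial_t\varphi+(\widetilde u_\varepsilon\cdot\nabla)\varphi\bigr)+2\nu\int_0^\infty\!\!\int_{\mathbb R^3}D(\widetilde u_\varepsilon):D(\varphi)=\int_{\mathbb R^3}\widetilde\rho_\varepsilon(0)\,\widetilde u_\varepsilon^0\cdot\varphi(0).$$ For every $\varepsilon\in(0,\varepsilon_0)$ let $(\widetilde u_\varepsilon,h_\varepsilon,\omega_\varepsilon)$ be such a solution which also satisfies the energy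 estimate $$\int_{\mathbb R^3}\widetilde\rho_\varepsilon|\widetilde u_\varepsilon(t)|^2+4\nu\int_0^t\!\!\int_{\mathbb R^3}|D(\widetilde u_\varepsilon)|^2\le\int_{\mathbb R^3}\widetilde\rho_\varepsilon(0)|\widetilde u_\varepsilon^0|^2\qquad\text{for all }t>0.$$ **Theorem.** Assume that $m^\varepsilon/\varepsilon^3\to\infty$ as $\varepsilon\to0$, that $\widetilde u_\varepsilon^0$ converges weakly in $L^2(\mathbb R^3)$ to some $u_0$ as $\varepsilon\to0$, and that $\sqrt{m^\varepsilon}\,l^0_\varepsilon$ and $(J^\varepsilon\omega^0_\varepsilon)\cdot\omega^0_\varepsilon$ are bounded uniformly in $\varepsilon$. Then there are a sequence $\varepsilon_k\downarrow0$ and a $u$ such that $$\widetilde u_{\varepsilon_k}\rightharpoonup u\quad\text{weak-}*\text{ in }L^\infty(\mathbb R_+;L^2(\mathbb R^3))\text{ and weakly in }L^2_{\rm loc}(\mathbb R_+;H^1(\mathbb R^3)),$$ and $u\in L^\infty(\mathbb R_+;L^2)\cap L^2_{\rm loc}(\mathbb R_+;H^1)$ is a solution of the Navier–Stokes equations in $\mathbb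 R^3$ in the sense of distributions with initial data $u_0$: $u$ is divergence free and for every $\varphi\in C_0^\infty([0,\infty)\times\mathbb R^3;\mathbb R^3)$ that is divergence free in $x$, $$-\int_0^\infty\!\!\int_{\mathbb R^3}u\cdot\partial_t\varphi+\nu\int_0^\infty\!\!\int_{\mathbb R^3}\nabla u:\nabla\varphi+\int_0^\infty\!\!\int_{\mathbb R^3}(u\cdot\nabla u)\cdot\varphi=\int_{\mathbb R^3}u_0\cdot\varphi(0).$$ Moreover $u$ (after modification on a null set of times) lies in $C^0_w(\mathbb R_+;L^2(\mathbb R^3))$ and $u(0)=u_0$. If in addition $\widetilde u_\varepsilon^0\to u_0$ strongly in $L^2(\mathbb R^3)$ and both $\sqrt{m^\varepsilon}\,l_\varepsilon^0$ and $(J^\varepsilon\omega_\varepsilon^0)\cdot\omega_\varepsilon^0$ tend to $0$ as $\varepsilon\to0$, then this $u$ satisfies $$\|u(t)\|_{L^2(\mathbb R^3)}^2+4\nu\int_0^t\|D(u)\|_{L^2(\mathbb R^3)}^2\le\|u_0\|_{L^2(\mathbb R^3)}^2\qquad\text{for all }t\ge0.$$ -/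

import Mathlib

open MeasureTheory Set Filter Topology
open scoped ENNReal NNReal

noncomputable section

/-! ## Vectors, matrices and derivatives in three dimensions -/

/-- Three dimensional Euclidean space. -/
abbrev R3 : Type := EuclideanSpace ℝ (Fin 3)

/-- The `i`-th vector of the canonical basis. -/
def basisVec (i : Fin 3) : R3 := EuclideanSpace.single i 1

/-- The cross product. -/
def cross (a b : R3) : R3 := WithLp.toLp 2 (crossProduct a.ofLp b.ofLp)

/-- The action of a matrix on a vector. -/
def matAct (M : Matrix (Fin 3) (Fin 3) ℝ) (x : R3) : R3 := WithLp.toLp 2 (M.mulVec x.ofLp)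

/-- The double dot product `M : N` of two matrices. -/
def ddot (M N : Matrix (Fin 3) (Fin 3) ℝ) : ℝ := ∑ i, ∑ j, M i j * N i j

/-- The type of the gradients of vector fields, with the Frobenius norm: `A i j` stands for
`∂ v_j / ∂ x_i`, so that `A i` is the partial derivative `∂ v / ∂ x_i`. -/
abbrev Grad3 : Type := PiLp 2 (fun _ : Fin 3 => R3)

/-- The matrix of a gradient, with entries `(∇v) i j = ∂ v_j / ∂ x_i`. -/
def gradMatrix (A : Grad3) : Matrix (Fin 3) (Fin 3) ℝ := Matrix.of fun i j => A i j

/-- The deformation tensor: the symmetric part of the gradient. -/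
def deform (A : Grad3) : Matrix (Fin 3) (Fin 3) ℝ :=
  (1 / 2 : ℝ) • (gradMatrix A + (gradMatrix A).transpose)

/-- `(w · ∇) v`, where `A` is the gradient of `v`. -/
def convect (w : R3) (A : Grad3) : R3 := ∑ i, w i • A i

/-- The gradient of a differentiable vector field. -/
def gradField (f : R3 → R3) (x : R3) : Grad3 :=
  WithLp.toLp 2 fun i => fderiv ℝ f x (basisVec i)

/-- `A` is the weak (distributional) gradient of the vector field `v` on `ℝ³`, both being
locally integrable. -/
def HasWeakGradient (v : R3 → R3) (A : R3 → Grad3) : Prop :=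
  LocallyIntegrable v ∧ LocallyIntegrable A ∧
    ∀ ψ : R3 → ℝ, ContDiff ℝ (⊤ : ℕ∞) ψ → HasCompactSupport ψ → ∀ i : Fin 3,
      ∫ x, (fderiv ℝ ψ x (basisVec i)) • v x = -∫ x, ψ x • A x i

/-- The vector field `v` is divergence free on `ℝ³` in the sense of distributions. -/
def IsWeakDivFree (v : R3 → R3) : Prop :=
  ∀ ψ : R3 → ℝ, ContDiff ℝ (⊤ : ℕ∞) ψ → HasCompactSupport ψ → ∫ x, fderiv ℝ ψ x (v x) = 0

/-- Lebesgue measure on `I × ℝ³`. -/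
def spaceTime (I : Set ℝ) : Measure (ℝ × R3) :=
  (volume.restrict I).prod volume

/-- `v ∈ C⁰_w(ℝ₊; L²(ℝ³))`. -/
def IsWeaklyContinuousL2 (v : ℝ → R3 → R3) : Prop :=
  (∀ t, 0 ≤ t → MemLp (v t) 2 volume) ∧
    ∀ g : R3 → R3, MemLp g 2 volume →
      ContinuousOn (fun t => ∫ x, inner ℝ (v t x) (g x)) (Ici 0)

/-- `v ∈ L^∞(ℝ₊; L²(ℝ³)) ∩ L²_loc(ℝ₊; H¹(ℝ³))`, with weak space gradient `G`. -/
structure IsEnergyClass (v : ℝ → R3 → R3) (G : ℝ → R3 → Grad3) : Prop where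
  measurable : AEStronglyMeasurable (Function.uncurry v) (spaceTime (Ioi 0))
  bounded : ∃ C : ℝ≥0, ∀ᵐ t ∂volume.restrict (Ioi (0 : ℝ)), eLpNorm (v t) 2 volume ≤ C
  grad_memLp : ∀ T : ℝ, 0 < T → MemLp (Function.uncurry G) 2 (spaceTime (Ioc 0 T))
  grad : ∀ᵐ t ∂volume.restrict (Ioi (0 : ℝ)), HasWeakGradient (v t) (G t)

/-! ## The rigid body -/

/-- A non-empty smooth compact simply connected subset of `ℝ³`. Smoothness: near each of its
boundary points the set is a sublevel set of a smooth function without critical point there. -/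
structure IsSmoothBody (S : Set R3) : Prop where
  nonempty : S.Nonempty
  isCompact : IsCompact S
  smooth : ∀ x ∈ frontier S, ∃ U ∈ 𝓝 x, ∃ g : R3 → ℝ,
    ContDiff ℝ (⊤ : ℕ∞) g ∧ fderiv ℝ g x ≠ 0 ∧ S ∩ U = {y | g y ≤ 0} ∩ U
  simplyConnected : SimplyConnectedSpace S

/-- The mass of a homogeneous body of density `ρ` occupying the set `S`. -/
def bodyMass (ρ : ℝ) (S : Set R3) : ℝ := ρ * volume.real S

/-- `(J a) · b`, where `J` is the matrix of inertia of the homogeneous body of density `ρ`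
occupying `S`, with centre of mass `c`. -/
def inertia (ρ : ℝ) (S : Set R3) (c a b : R3) : ℝ :=
  ρ * ∫ x in S, inner ℝ (cross a (x - c)) (cross b (x - c))

/-- The set `h + R S₀`. -/
def movedBody (S₀ : Set R3) (h : R3) (R : Matrix (Fin 3) (Fin 3) ℝ) : Set R3 :=
  (fun x₀ => h + matAct R x₀) '' S₀

/-- The global density: `1` in the fluid and `ρ` in the body `S`. -/
def globalDensity (ρ : ℝ) (S : Set R3) (x : R3) : ℝ :=
  Sᶜ.indicator (fun _ => 1) x + S.indicator (fun _ => ρ) x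

/-- The centre of mass `h` and the orientation `R(t) ∈ SO(3)` of a rigid body with angular
velocity `om`: `h` is Lipschitz on `ℝ₊` and starts at the origin, `om` is bounded, and `R` is the
Lipschitz solution of `R' Rᵀ z = om × z`, `R(0) = I`. -/
structure IsRigidMotion (h om : ℝ → R3) (R : ℝ → Matrix (Fin 3) (Fin 3) ℝ) : Prop where
  center_zero : h 0 = 0
  center_lipschitz : ∃ C : ℝ≥0, LipschitzOnWith C h (Ici 0)
  angular_bounded : MemLp om ∞ (volume.restrict (Ioi (0 : ℝ)))
  rotation_mem : ∀ t, 0 ≤ t → R t ∈ Matrix.specialOrthogonalGroup (Fin 3) ℝ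
  rotation_zero : R 0 = 1
  rotation_lipschitz : ∃ C : ℝ≥0, ∀ i j, LipschitzOnWith C (fun t => R t i j) (Ici 0)
  rotation_deriv : ∀ᵐ t ∂volume.restrict (Ioi (0 : ℝ)), ∀ z : R3,
    HasDerivAt (fun s => matAct (R s) z) (cross (om t) (matAct (R t) z)) t

/-! ## Weak solutions of the fluid--rigid body system -/

/-- The test fields of the fluid--rigid body system, for the moving body `S`: the elements `φ` of
`W^{1,∞}(ℝ₊; H¹_σ(ℝ³))` (bounded and Lipschitz on `ℝ₊` with values in the divergence free fields
of `H¹`), with compact support in `ℝ₊ × ℝ³`, whose deformation tensor vanishes in `S t`. Here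
`φt` is the time derivative of `φ` and `Gφ` its weak space gradient. -/
structure IsTestField (S : ℝ → Set R3) (φ φt : ℝ → R3 → R3) (Gφ : ℝ → R3 → Grad3) :
    Prop where
  measurable : AEStronglyMeasurable (Function.uncurry φ) (spaceTime (Ioi 0))
  grad_measurable : AEStronglyMeasurable (Function.uncurry Gφ) (spaceTime (Ioi 0))
  dt_measurable : AEStronglyMeasurable (Function.uncurry φt) (spaceTime (Ioi 0))
  memLp : ∀ t, 0 ≤ t → MemLp (φ t) 2 volume ∧ MemLp (Gφ t) 2 volume
  grad : ∀ t, 0 ≤ t → HasWeakGradient (φ t) (Gφ t)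
  divFree : ∀ t, 0 ≤ t → IsWeakDivFree (φ t)
  bounded : ∃ C : ℝ≥0, ∀ t, 0 ≤ t →
    eLpNorm (φ t) 2 volume ≤ C ∧ eLpNorm (Gφ t) 2 volume ≤ C
  lipschitz : ∃ C : ℝ≥0, ∀ s t, 0 ≤ s → s ≤ t →
    eLpNorm (φ t - φ s) 2 volume ≤ C * ENNReal.ofReal (t - s) ∧
    eLpNorm (Gφ t - Gφ s) 2 volume ≤ C * ENNReal.ofReal (t - s)
  dt_bounded : ∃ C : ℝ≥0, ∀ᵐ t ∂volume.restrict (Ioi (0 : ℝ)), eLpNorm (φt t) 2 volume ≤ C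
  dt : ∀ t, 0 ≤ t → ∀ᵐ x, φ t x = φ 0 x + ∫ s in (0 : ℝ)..t, φt s x
  compactSupport : ∃ K : ℝ, ∀ t, 0 ≤ t → ∀ᵐ x, (K < t ∨ K < ‖x‖) → φ t x = 0
  rigid : ∀ t, 0 ≤ t → ∀ᵐ x, x ∈ S t → deform (Gφ t x) = 0

/-- Weak Leray solutions `(u, h, om)` of the fluid--rigid body system with viscosity `ν`, where the
body has density `ρ` and occupies `S₀` at time `0`, and `u₀` is the initial global velocity.
`u` is the global velocity, `G` its weak space gradient, `R` the rotation of the body. -/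
structure IsWeakLeraySolution (ν ρ : ℝ) (S₀ : Set R3) (u₀ : R3 → R3)
    (u : ℝ → R3 → R3) (G : ℝ → R3 → Grad3) (h om : ℝ → R3)
    (R : ℝ → Matrix (Fin 3) (Fin 3) ℝ) : Prop where
  motion : IsRigidMotion h om R
  energyClass : IsEnergyClass u G
  weaklyContinuous : IsWeaklyContinuousL2 u
  divFree : ∀ t, 0 ≤ t → IsWeakDivFree (u t)
  velocity_body : ∀ᵐ t ∂volume.restrict (Ioi (0 : ℝ)), ∀ᵐ x, x ∈ movedBody S₀ (h t) (R t) →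
    u t x = deriv h t + cross (om t) (x - h t)
  rigid : ∀ᵐ t ∂volume.restrict (Ioi (0 : ℝ)), ∀ᵐ x, x ∈ movedBody S₀ (h t) (R t) →
    deform (G t x) = 0
  equation : ∀ (φ φt : ℝ → R3 → R3) (Gφ : ℝ → R3 → Grad3),
    IsTestField (fun t => movedBody S₀ (h t) (R t)) φ φt Gφ →
      -(∫ t in Ioi (0 : ℝ), ∫ x, globalDensity ρ (movedBody S₀ (h t) (R t)) x *
          inner ℝ (u t x) (φt t x + convect (u t x) (Gφ t x)))
        + 2 * ν * (∫ t in Ioi (0 : ℝ), ∫ x, ddot (deform (G t x)) (deform (Gφ t x)))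
      = ∫ x, globalDensity ρ S₀ x * inner ℝ (u₀ x) (φ 0 x)

/-- The energy estimate for the fluid--rigid body system. -/
def SatisfiesBodyEnergyEstimate (ν ρ : ℝ) (S₀ : Set R3) (u₀ : R3 → R3)
    (u : ℝ → R3 → R3) (G : ℝ → R3 → Grad3) (h : ℝ → R3)
    (R : ℝ → Matrix (Fin 3) (Fin 3) ℝ) : Prop :=
  ∀ t, 0 < t →
    (∫ x, globalDensity ρ (movedBody S₀ (h t) (R t)) x * ‖u t x‖ ^ 2)
      + 4 * ν * (∫ s in Ioc 0 t, ∫ x, ddot (deform (G s x)) (deform (G s x)))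
    ≤ ∫ x, globalDensity ρ S₀ x * ‖u₀ x‖ ^ 2

/-! ## The Navier--Stokes equations in the whole space -/

/-- `u`, with weak space gradient `G`, is a solution in the sense of distributions of the
Navier--Stokes equations in `ℝ³` with viscosity `ν` and initial data `u₀`. It lies in
`L^∞(ℝ₊; L²) ∩ L²_loc(ℝ₊; H¹)` and is normalised to be weakly continuous in time, so that `u t`
is meaningful for every `t ≥ 0`. -/
structure IsNavierStokesSolution (ν : ℝ) (u₀ : R3 → R3)
    (u : ℝ → R3 → R3) (G : ℝ → R3 → Grad3) : Prop where
  energyClass : IsEnergyClass u G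
  weaklyContinuous : IsWeaklyContinuousL2 u
  divFree : ∀ t, 0 ≤ t → IsWeakDivFree (u t)
  initial : u 0 =ᵐ[volume] u₀
  equation : ∀ φ : ℝ × R3 → R3, ContDiff ℝ (⊤ : ℕ∞) φ → HasCompactSupport φ →
    (∀ t x, 0 ≤ t → (gradMatrix (gradField (fun y => φ (t, y)) x)).trace = 0) →
      -(∫ t in Ioi (0 : ℝ), ∫ x, inner ℝ (u t x) (deriv (fun s => φ (s, x)) t))
        + ν * (∫ t in Ioi (0 : ℝ), ∫ x,
            ddot (gradMatrix (G t x)) (gradMatrix (gradField (fun y => φ (t, y)) x)))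
        + (∫ t in Ioi (0 : ℝ), ∫ x, inner ℝ (convect (u t x) (G t x)) (φ (t, x)))
      = ∫ x, inner ℝ (u₀ x) (φ (0, x))

/-! ## Modes of convergence -/

/-- `v k ⇀ v` weak-* in `L^∞(ℝ₊; L²(ℝ³))`, the dual of `L¹(ℝ₊; L²(ℝ³))`. -/
def TendstoWeakStar (vs : ℕ → ℝ → R3 → R3) (v : ℝ → R3 → R3) : Prop :=
  ∀ Φ : ℝ → R3 → R3, AEStronglyMeasurable (Function.uncurry Φ) (spaceTime (Ioi 0)) →
    ∫⁻ t in Ioi (0 : ℝ), eLpNorm (Φ t) 2 volume < ∞ →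
      Tendsto (fun k => ∫ t in Ioi (0 : ℝ), ∫ x, inner ℝ (vs k t x) (Φ t x)) atTop
        (𝓝 (∫ t in Ioi (0 : ℝ), ∫ x, inner ℝ (v t x) (Φ t x)))

/-- `v k ⇀ v` weakly in `L²_loc(ℝ₊; H¹(ℝ³))`: for every finite `T`, both the fields and their
weak space gradients converge weakly in `L²((0, T) × ℝ³)`. -/
def TendstoWeakL2H1 (vs : ℕ → ℝ → R3 → R3) (Gs : ℕ → ℝ → R3 → Grad3)
    (v : ℝ → R3 → R3) (G : ℝ → R3 → Grad3) : Prop :=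
  ∀ T : ℝ, 0 < T →
    (∀ Φ : ℝ → R3 → R3, MemLp (Function.uncurry Φ) 2 (spaceTime (Ioc 0 T)) →
      Tendsto (fun k => ∫ t in Ioc 0 T, ∫ x, inner ℝ (vs k t x) (Φ t x)) atTop
        (𝓝 (∫ t in Ioc 0 T, ∫ x, inner ℝ (v t x) (Φ t x)))) ∧
    (∀ Ψ : ℝ → R3 → Grad3, MemLp (Function.uncurry Ψ) 2 (spaceTime (Ioc 0 T)) →
      Tendsto (fun k => ∫ t in Ioc 0 T, ∫ x,
          ddot (gradMatrix (Gs k t x)) (gradMatrix (Ψ t x))) atTop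
        (𝓝 (∫ t in Ioc 0 T, ∫ x, ddot (gradMatrix (G t x)) (gradMatrix (Ψ t x)))))

end

/-! The body is too small to be felt by the fluid and too heavy to move fast. Since `m^ε / ε³ → ∞`,
the density is eventually at least one (`one_le_density`), so the energy estimate bounds the
velocity in `L^∞(L²)`. Korn's inequality for divergence free fields (`lintegral_korn`) turns the
dissipation into a bound for the full gradient in `L²(L²)`. As the centre of mass decouples
translation from rotation, the energy estimate also gives `m^ε |h'|² ≤ C` (`body_momentum_le`),
hence `|h'| ε^{3/2} ≤ C (m^ε / ε³)^{-1/2} → 0`. This is the only quantitative information on the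
motion that is needed. The rotation plays no role, because the moving body stays in the ball
`B(h(t), ε)`.

A divergence free field `φ` is not an admissible test field, since it is not rigid in the body. With
`b(y) = ∫₀¹ s φ(h + s y) ds` one has `curl (b × y) = φ(h + y)`, and this potential vanishes at `y =
0`. Hence the curl `W` of `χ(y/ε) b × y`, with a cut-off `χ`, is divergence free, equals `φ` in
`B(h, ε)` and vanishes outside `B(h, 2ε)`. The field `φ - W` vanishes in the ball that contains the
body, so it is admissible and the density disappears from the tested equation. It remains to
estimate the terms with `W`, for which `W = O(1)`, `∇W = O(1/ε)` and `∂ₜW = O(1 + |h'|/ε)`. The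
Hardy type inequality `‖u‖_{L²(B_r)} ≤ C r ‖∇u‖` (`lintegral_hardy`) makes the viscous term `O(√ε)`,
the convective term `O(ε)` and the term with `∂ₜW` of order `ε^{5/2} + |h'| ε^{3/2}`. All of them
tend to zero (`exists_consistency_bound`); the power `ε^{3/2}` is exactly what the hypothesis on the
mass controls.

For compactness, the consistency estimate with fields independent of time shows that the pairings of
the velocity with solenoidal test fields are equicontinuous up to a vanishing error
(`exists_equicontinuity_bound`). The velocities are divergence free in all of space and solenoidal
test fields are dense among such fields (`solenoidalSubspace_le_closure`), so an Arzelà–Ascoli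
argument yields a subsequence converging weakly in `L²` at every time
(`exists_subseq_weakly_convergent_curve`). Mollification in space upgrades this to strong local
convergence: the mollification error is controlled by the gradient, uniformly in `ε`, and the
mollified fields converge pointwise (`tendsto_local_of_weak_limit`). This suffices for the nonlinear
term (`integral_momentum_of_limit`).

The energy inequality of the limit follows from weak lower semicontinuity, because the initial
energy is at most the fluid part plus multiples of the two rigid energies (`initial_energy_le`), and
the latter vanish in the limit under the stronger assumptions. -/

noncomputable section

/-! ### Weak sequential compactness in Hilbert spaces, for vectors and for curves -/

section WeakConvergence

variable {H : Type*} [NormedAddCommGroup H] [InnerProductSpace ℝ H]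

/-- The vectors against which a bounded sequence of vectors converges weakly form a subspace. -/
def weakConvergenceSubmodule (x : ℕ → H) : Submodule ℝ H where
  carrier := {g | ∃ l : ℝ, Tendsto (fun k => inner ℝ (x k) g) atTop (𝓝 l)}
  add_mem' := by
    rintro a b ⟨l, hl⟩ ⟨m, hm⟩
    exact ⟨l + m, by simpa only [inner_add_right] using hl.add hm⟩
  zero_mem' := ⟨0, by simp⟩
  smul_mem' := by
    rintro c a ⟨l, hl⟩
    exact ⟨c * l, by simpa only [inner_smul_right] using hl.const_mul c⟩

/-- Replacing `g` by a nearby vector changes all pairings by a uniformly small amount, since the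
sequence is bounded; the Cauchy property therefore passes to the closure. It reduces weak
convergence to a total set. -/
lemma isClosed_weakConvergenceSubmodule {x : ℕ → H} {C : ℝ} (hx : ∀ k, ‖x k‖ ≤ C) :
    IsClosed (weakConvergenceSubmodule x : Set H) := by
  rw [← closure_subset_iff_isClosed]
  intro g hg
  have hC : 0 ≤ C := (norm_nonneg _).trans (hx 0)
  have : CauchySeq (fun k => inner ℝ (x k) g : ℕ → ℝ) := by
    rw [Metric.cauchySeq_iff']
    intro ε hε
    -- The bound enters as `C + 1` so that the quotient makes sense for `C = 0`.
    obtain ⟨d, ⟨l, hl⟩, hd⟩ := Metric.mem_closure_iff.1 hg (ε / (4 * (C + 1))) (by positivity)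
    obtain ⟨N, hN⟩ := Metric.cauchySeq_iff'.1 hl.cauchySeq (ε / 2) (by positivity)
    refine ⟨N, fun n hn => ?_⟩
    have h1 := hN n hn
    rw [Real.dist_eq] at h1 ⊢
    have key : ∀ k, |inner ℝ (x k) g - inner ℝ (x k) d| ≤ ε / 4 := by
      intro k
      rw [← inner_sub_right]
      refine (abs_real_inner_le_norm _ _).trans ?_
      rw [dist_eq_norm] at hd
      calc ‖x k‖ * ‖g - d‖ ≤ (C + 1) * (ε / (4 * (C + 1))) := by
            gcongr
            exact (hx k).trans (by linarith)
        _ = ε / 4 := by field_simp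
    have a := abs_le.1 (key n)
    have b := abs_le.1 (key N)
    have c := abs_lt.1 h1
    rw [abs_lt]
    constructor <;> linarith [a.1, a.2, b.1, b.2, c.1, c.2]
  exact cauchySeq_tendsto_of_complete this

/-- A bounded sequence that converges weakly against every vector has a weak limit. -/
lemma exists_weak_limit [CompleteSpace H] {x : ℕ → H} {C : ℝ} (hx : ∀ k, ‖x k‖ ≤ C)
    (h : ∀ g, g ∈ weakConvergenceSubmodule x) :
    ∃ y : H, ‖y‖ ≤ C ∧ ∀ g, Tendsto (fun k => inner ℝ (x k) g) atTop (𝓝 (inner ℝ y g)) := by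
  choose f hf using h
  have hC : 0 ≤ C := (norm_nonneg _).trans (hx 0)
  let F : H →ₗ[ℝ] ℝ :=
    { toFun := f
      map_add' := fun a b => tendsto_nhds_unique (hf (a + b)) (by
        simpa only [inner_add_right] using (hf a).add (hf b))
      map_smul' := fun c a => tendsto_nhds_unique (hf (c • a)) (by
        simpa only [inner_smul_right, RingHom.id_apply, smul_eq_mul] using (hf a).const_mul c) }
  have hF : ∀ g, ‖F g‖ ≤ C * ‖g‖ := fun g =>
    le_of_tendsto (hf g).norm (Eventually.of_forall fun k =>
      (norm_inner_le_norm _ _).trans (by gcongr; exact hx k))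
  refine ⟨(InnerProductSpace.toDual ℝ H).symm (F.mkContinuous C hF), ?_, fun g => ?_⟩
  · rw [LinearIsometryEquiv.norm_map]
    exact LinearMap.mkContinuous_norm_le _ hC hF
  · rw [InnerProductSpace.toDual_symm_apply]
    exact hf g

/-- A countable family of bounded sequences in a separable Hilbert space has a common weakly
convergent subsequence. -/
lemma exists_subseq_weak_convergence [TopologicalSpace.SeparableSpace H]
    {ι : Type*} [Countable ι] (x : ι → ℕ → H) (C : ℝ) (hx : ∀ i k, ‖x i k‖ ≤ C) :
    ∃ σ : ℕ → ℕ, StrictMono σ ∧ ∀ i g, g ∈ weakConvergenceSubmodule (fun k => x i (σ k)) := by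
  let d := TopologicalSpace.denseSeq H
  let a : ℕ → (ι × ℕ → ℝ) := fun k p => inner ℝ (x p.1 k) (d p.2)
  -- Tychonoff's theorem replaces the diagonal extraction: one subsequence serves all indices and
  -- all members of a countable dense set.
  have hcomp : IsCompact (Set.pi univ fun p : ι × ℕ => Icc (-(C * ‖d p.2‖)) (C * ‖d p.2‖)) :=
    isCompact_univ_pi fun p => isCompact_Icc
  have hmem : ∀ k, a k ∈ Set.pi univ fun p : ι × ℕ => Icc (-(C * ‖d p.2‖)) (C * ‖d p.2‖) := by
    intro k p _
    exact abs_le.1 ((abs_real_inner_le_norm _ _).trans (by gcongr; exact hx _ _))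
  obtain ⟨l, -, σ, hσ, hl⟩ := hcomp.tendsto_subseq hmem
  refine ⟨σ, hσ, fun i g => ?_⟩
  have hcl := isClosed_weakConvergenceSubmodule (fun k => hx i (σ k))
  have hsub : range d ⊆ weakConvergenceSubmodule (fun k => x i (σ k)) := by
    rintro _ ⟨j, rfl⟩
    exact ⟨l (i, j), (tendsto_pi_nhds.1 hl) (i, j)⟩
  have := closure_minimal hsub hcl
  exact this (TopologicalSpace.denseRange_denseSeq H g)

/-- A bounded sequence in a separable Hilbert space has a weakly convergent subsequence. -/
lemma exists_weakly_convergent_subseq [CompleteSpace H] [TopologicalSpace.SeparableSpace H]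
    (x : ℕ → H) (C : ℝ) (hx : ∀ k, ‖x k‖ ≤ C) :
    ∃ σ : ℕ → ℕ, StrictMono σ ∧ ∃ y : H, ‖y‖ ≤ C ∧
      ∀ g, Tendsto (fun k => inner ℝ (x (σ k)) g) atTop (𝓝 (inner ℝ y g)) := by
  obtain ⟨σ, hσ, h⟩ := exists_subseq_weak_convergence (fun _ : Unit => x) C (fun _ => hx)
  exact ⟨σ, hσ, exists_weak_limit (fun k => hx (σ k)) (h ())⟩

/-- A sequence of real functions on `[0, ∞)` is asymptotically equicontinuous, locally
uniformly. -/
def AsymptoticallyEquicontinuous (f : ℕ → ℝ → ℝ) : Prop :=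
  ∀ T : ℝ, 0 < T → ∀ η : ℝ, 0 < η → ∃ r : ℝ, 0 < r ∧ ∀ᶠ k in atTop,
    ∀ s t, 0 ≤ s → s ≤ t → t ≤ T → t - s < r → |f k t - f k s| ≤ η

/-- An Arzelà--Ascoli theorem for the weak topology of a Hilbert space: bounded curves in a closed
subspace that are asymptotically equicontinuous against a total set have a subsequence that
converges weakly at every time to a weakly continuous curve. -/
theorem exists_subseq_weakly_convergent_curve [CompleteSpace H]
    [TopologicalSpace.SeparableSpace H]
    (U : ℕ → ℝ → H) (C : ℝ) (hC : ∀ k t, 0 ≤ t → ‖U k t‖ ≤ C) (K : Submodule ℝ H) (D : Set H)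
    (hD : K ≤ (Submodule.span ℝ D).topologicalClosure) (hK : IsClosed (K : Set H))
    (hUK : ∀ k t, 0 ≤ t → U k t ∈ K)
    (hequi : ∀ ζ ∈ D, AsymptoticallyEquicontinuous fun k t => inner ℝ (U k t) ζ) :
    ∃ σ : ℕ → ℕ, StrictMono σ ∧ ∃ v : ℝ → H,
      (∀ t, 0 ≤ t → ‖v t‖ ≤ C ∧ v t ∈ K) ∧
      (∀ t, 0 ≤ t → ∀ g, Tendsto (fun k => inner ℝ (U (σ k) t) g) atTop (𝓝 (inner ℝ (v t) g))) ∧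
      ∀ g, ContinuousOn (fun t => inner ℝ (v t) g) (Ici 0) := by
  have hC0 : 0 ≤ C := (norm_nonneg _).trans (hC 0 0 le_rfl)
  obtain ⟨σ, hσ, hconv⟩ := exists_subseq_weak_convergence
    (fun (q : {q : ℚ // (0 : ℝ) ≤ q}) k => U k ((q : ℚ) : ℝ)) C (fun q k => hC k _ q.2)
  -- convergence against the elements of the total set, at every time
  have hDconv : ∀ t, 0 ≤ t → ∀ ζ ∈ D, ζ ∈ weakConvergenceSubmodule (fun k => U (σ k) t) := by
    intro t ht ζ hζ
    apply cauchySeq_tendsto_of_complete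
    rw [Metric.cauchySeq_iff]
    intro η hη
    obtain ⟨r, hr, hev⟩ := hequi ζ hζ (t + 1) (by linarith) (η / 4) (by positivity)
    obtain ⟨N₁, hN₁⟩ := eventually_atTop.1 (hσ.tendsto_atTop.eventually hev)
    -- Convergence is known at rational times. A rational `q` just after `t` is close enough for
    -- equicontinuity and, by the cap `1`, remains in `[0, t + 1]`.
    obtain ⟨q, hq1, hq2⟩ := exists_rat_btwn (show t < t + min r 1 by
      have := lt_min hr one_pos; linarith)
    have hq0 : (0 : ℝ) ≤ q := by linarith
    have hqr : (q : ℝ) - t < r := by linarith [min_le_left r 1]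
    have hqT : (q : ℝ) ≤ t + 1 := by linarith [min_le_right r 1]
    obtain ⟨l, hl⟩ := hconv ⟨q, hq0⟩ ζ
    obtain ⟨N₂, hN₂⟩ := Metric.cauchySeq_iff.1 hl.cauchySeq (η / 4) (by positivity)
    refine ⟨max N₁ N₂, fun m hm n hn => ?_⟩
    have a := abs_le.1 (hN₁ m ((le_max_left _ _).trans hm) t q ht hq1.le hqT hqr)
    have b := abs_le.1 (hN₁ n ((le_max_left _ _).trans hn) t q ht hq1.le hqT hqr)
    have c := hN₂ m ((le_max_right _ _).trans hm) n ((le_max_right _ _).trans hn)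
    rw [Real.dist_eq] at c ⊢
    have c := abs_lt.1 c
    rw [abs_lt]
    dsimp only at a b c ⊢
    constructor <;> linarith [a.1, a.2, b.1, b.2, c.1, c.2]
  have : K.HasOrthogonalProjection := by
    have : CompleteSpace K := hK.completeSpace_coe
    infer_instance
  -- Vectors of `K` only see the projection of `g` to `K`. It is therefore enough that `D` is total
  -- in `K`, although convergence is claimed against every vector.
  have hproj : ∀ x ∈ K, ∀ g : H, inner ℝ x g = inner ℝ x (K.starProjection g) := by
    intro x hx g
    rw [← sub_eq_zero, ← inner_sub_right]
    exact Submodule.inner_right_of_mem_orthogonal hx (K.sub_starProjection_mem_orthogonal g)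
  have hall : ∀ t, 0 ≤ t → ∀ g, g ∈ weakConvergenceSubmodule (fun k => U (σ k) t) := by
    intro t ht g
    have hcl := isClosed_weakConvergenceSubmodule (fun k => hC (σ k) t ht)
    have h1 : (Submodule.span ℝ D).topologicalClosure ≤
        weakConvergenceSubmodule (fun k => U (σ k) t) :=
      Submodule.topologicalClosure_minimal _ (Submodule.span_le.2 (hDconv t ht)) hcl
    obtain ⟨l, hl⟩ := h1 (hD (K.starProjection_apply_mem g))
    refine ⟨l, hl.congr fun k => ?_⟩
    exact (hproj _ (hUK _ _ ht) g).symm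
  have hlim : ∀ t, ∃ y : H, 0 ≤ t → ‖y‖ ≤ C ∧
      ∀ g, Tendsto (fun k => inner ℝ (U (σ k) t) g) atTop (𝓝 (inner ℝ y g)) := by
    intro t
    by_cases ht : 0 ≤ t
    · obtain ⟨y, hy⟩ := exists_weak_limit (fun k => hC (σ k) t ht) (hall t ht)
      exact ⟨y, fun _ => hy⟩
    · exact ⟨0, fun h => absurd h ht⟩
  choose v hv using hlim
  have hvK : ∀ t, 0 ≤ t → v t ∈ K := by
    intro t ht
    -- The component of the limit orthogonal to `K` pairs to zero with every approximant, hence with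
    -- the limit, hence with itself.
    have h2 : v t - K.starProjection (v t) = 0 := by
      rw [← inner_self_eq_zero (𝕜 := ℝ)]
      set z := v t - K.starProjection (v t) with hz
      have hz1 : z ∈ Kᗮ := K.sub_starProjection_mem_orthogonal (v t)
      have h3 : inner ℝ (v t) z = (0 : ℝ) := by
        refine tendsto_nhds_unique ((hv t ht).2 z) ?_
        refine tendsto_const_nhds.congr fun k => ?_
        exact (Submodule.inner_right_of_mem_orthogonal (hUK _ _ ht) hz1).symm
      have h4 : inner ℝ (K.starProjection (v t)) z = (0 : ℝ) :=
        Submodule.inner_right_of_mem_orthogonal (K.starProjection_apply_mem (v t)) hz1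
      calc inner ℝ z z = inner ℝ (v t) z - inner ℝ (K.starProjection (v t)) z := by
            rw [← inner_sub_left]
        _ = 0 := by rw [h3, h4, sub_zero]
    rw [sub_eq_zero.1 h2]
    exact K.starProjection_apply_mem _
  refine ⟨σ, hσ, v, fun t ht => ⟨(hv t ht).1, hvK t ht⟩, fun t ht => (hv t ht).2, ?_⟩
  -- continuity against the total set, then against all vectors
  let Q : Submodule ℝ H :=
    { carrier := {g | ContinuousOn (fun t => inner ℝ (v t) g) (Ici 0)}
      add_mem' := by
        intro a b ha hb
        simp only [mem_ofPred_eq, inner_add_right] at *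
        exact ha.add hb
      zero_mem' := by simp [continuousOn_const]
      smul_mem' := by
        intro c a ha
        simp only [mem_ofPred_eq, inner_smul_right] at *
        exact continuousOn_const.mul ha }
  have hQcl : IsClosed (Q : Set H) := by
    rw [← closure_subset_iff_isClosed]
    intro g hg
    change ContinuousOn (fun t => inner ℝ (v t) g) (Ici 0)
    obtain ⟨gs, hgs, hlimg⟩ := mem_closure_iff_seq_limit.1 hg
    -- The uniform bound on the curve makes the pairings converge uniformly in time when `gs n → g`,
    -- and continuity survives uniform limits.
    have hu : TendstoUniformlyOn (fun n t => inner ℝ (v t) (gs n)) (fun t => inner ℝ (v t) g)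
        atTop (Ici 0) := by
      rw [Metric.tendstoUniformlyOn_iff]
      intro η hη
      have := (Metric.tendsto_atTop.1 hlimg) (η / (C + 1)) (by positivity)
      obtain ⟨N, hN⟩ := this
      filter_upwards [eventually_ge_atTop N] with n hn t ht
      rw [Real.dist_eq, ← inner_sub_right]
      refine (abs_real_inner_le_norm _ _).trans_lt ?_
      have h5 := hN n hn
      rw [dist_comm, dist_eq_norm] at h5
      calc ‖v t‖ * ‖g - gs n‖ ≤ (C + 1) * ‖g - gs n‖ := by
            gcongr; exact ((hv t ht).1).trans (by linarith)
        _ < (C + 1) * (η / (C + 1)) := by gcongr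
        _ = η := by field_simp
    exact hu.continuousOn (Eventually.of_forall hgs).frequently
  have hDQ : D ⊆ Q := by
    intro ζ hζ t ht
    rw [Metric.continuousWithinAt_iff]
    intro η hη
    obtain ⟨r, hr, hev⟩ := hequi ζ hζ (t + 1) (by have := mem_Ici.1 ht; linarith) (η / 2) (by positivity)
    have hev' := hσ.tendsto_atTop.eventually hev
    have key : ∀ s s', 0 ≤ s → s ≤ s' → s' ≤ t + 1 → s' - s < r →
        |inner ℝ (v s') ζ - inner ℝ (v s) ζ| ≤ η / 2 := by
      intro s s' hs hss hT hd
      refine le_of_tendsto (((hv s' (hs.trans hss)).2 ζ).sub ((hv s hs).2 ζ)).abs ?_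
      filter_upwards [hev'] with k hk
      exact hk s s' hs hss hT hd
    refine ⟨min r 1, lt_min hr one_pos, fun {s} hs hd => ?_⟩
    rw [Real.dist_eq] at hd ⊢
    have hd1 := abs_lt.1 (hd.trans_le (min_le_left _ _))
    have hd2 := abs_lt.1 (hd.trans_le (min_le_right _ _))
    rcases le_total s t with hst | hst
    · rw [abs_sub_comm]
      exact (key s t hs hst (by linarith) (by linarith)).trans_lt (by linarith)
    · exact (key t s ht hst (by linarith) (by linarith)).trans_lt (by linarith)
  intro g
  have hmem : K.starProjection g ∈ Q :=
    (Submodule.topologicalClosure_minimal _ (Submodule.span_le.2 hDQ) hQcl)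
      (hD (K.starProjection_apply_mem g))
  exact ContinuousOn.congr hmem fun t ht => hproj _ (hvK t ht) g

end WeakConvergence

/-! ### Convolution and mollification in `L²` -/

section Convolution

/-- Cauchy–Schwarz for the measure with density `k`, after writing `k g` as `√k · (√k g)`. For a
kernel of mass one this is Jensen's inequality. -/
lemma sq_lintegral_mul_le {α : Type*} [MeasurableSpace α] {μ : Measure α} {k g : α → ℝ≥0∞}
    (hk : AEMeasurable k μ) (hg : AEMeasurable g μ) :
    (∫⁻ x, k x * g x ∂μ) ^ 2 ≤ (∫⁻ x, k x ∂μ) * ∫⁻ x, k x * g x ^ 2 ∂μ := by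
  have h := ENNReal.lintegral_mul_le_Lp_mul_Lq μ Real.HolderConjugate.two_two
    (f := fun x => k x ^ (1 / 2 : ℝ)) (g := fun x => k x ^ (1 / 2 : ℝ) * g x)
    (hk.pow_const _) ((hk.pow_const _).mul hg)
  have e1 : ∀ x, ((fun x => k x ^ (1 / 2 : ℝ)) * fun x => k x ^ (1 / 2 : ℝ) * g x) x
      = k x * g x := by
    intro x
    simp only [Pi.mul_apply]
    rw [← mul_assoc, ← ENNReal.rpow_add_of_nonneg _ _ (by norm_num) (by norm_num)]
    norm_num
  have e2 : ∀ x, (k x ^ (1 / 2 : ℝ)) ^ (2 : ℝ) = k x := by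
    intro x
    rw [← ENNReal.rpow_mul]; norm_num
  have e3 : ∀ x, (k x ^ (1 / 2 : ℝ) * g x) ^ (2 : ℝ) = k x * g x ^ 2 := by
    intro x
    rw [ENNReal.mul_rpow_of_nonneg _ _ (by norm_num), e2]
    norm_num
  simp only [e1, e2, e3] at h
  have h2 := pow_le_pow_left' h 2
  rw [mul_pow] at h2
  have e4 : ∀ a : ℝ≥0∞, (a ^ (1 / 2 : ℝ)) ^ 2 = a := by
    intro a
    rw [← ENNReal.rpow_natCast, ← ENNReal.rpow_mul]; norm_num
  rwa [e4, e4] at h2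

/-- Fatou's lemma, in the form that transfers quadratic inequalities from mollified fields to their
limits. -/
lemma lintegral_le_of_ae_tendsto {α : Type*} [MeasurableSpace α] {μ : Measure α}
    {F : ℕ → α → ℝ≥0∞} {f : α → ℝ≥0∞} {C : ℝ≥0∞} (hF : ∀ n, AEMeasurable (F n) μ)
    (h : ∀ᵐ x ∂μ, Tendsto (fun n => F n x) atTop (𝓝 (f x))) (hC : ∀ n, ∫⁻ x, F n x ∂μ ≤ C) :
    ∫⁻ x, f x ∂μ ≤ C := by
  calc ∫⁻ x, f x ∂μ = ∫⁻ x, liminf (fun n => F n x) atTop ∂μ :=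
        lintegral_congr_ae (h.mono fun x hx => hx.liminf_eq.symm)
    _ ≤ liminf (fun n => ∫⁻ x, F n x ∂μ) atTop := lintegral_liminf_le' hF
    _ ≤ C := liminf_le_of_frequently_le' (Frequently.of_forall hC)

variable {F : Type*} [NormedAddCommGroup F]

/-- The square of the `L²` norm, as a lower integral. -/
lemma eLpNorm_two_sq {α : Type*} [MeasurableSpace α] {μ : Measure α} (f : α → F) :
    eLpNorm f 2 μ ^ 2 = ∫⁻ x, ‖f x‖ₑ ^ 2 ∂μ := by
  have h := eLpNorm_nnreal_pow_eq_lintegral (p := 2) (μ := μ) (f := f) (by norm_num)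
  simpa using h

lemma memLp_two_iff_lintegral {α : Type*} [MeasurableSpace α] {μ : Measure α} {f : α → F} :
    MemLp f 2 μ ↔ AEStronglyMeasurable f μ ∧ ∫⁻ x, ‖f x‖ₑ ^ 2 ∂μ < ∞ := by
  rw [MemLp, ← eLpNorm_two_sq]
  simp

lemma ofReal_integral_norm_sq {α : Type*} [MeasurableSpace α] {μ : Measure α} {f : α → F}
    (hf : MemLp f 2 μ) : ENNReal.ofReal (∫ x, ‖f x‖ ^ 2 ∂μ) = ∫⁻ x, ‖f x‖ₑ ^ 2 ∂μ := by
  rw [ofReal_integral_eq_lintegral_ofReal ((memLp_two_iff_integrable_sq_norm hf.1).1 hf)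
    (Eventually.of_forall fun x => sq_nonneg _)]
  congr with x
  rw [ENNReal.ofReal_pow (norm_nonneg _), ofReal_norm]

lemma memLp_two_locallyIntegrable {f : R3 → F} (hf : MemLp f 2 volume) : LocallyIntegrable f :=
  hf.locallyIntegrable (by norm_num)

/-- If `fₙ → f` almost everywhere and `‖fₙ‖ ≤ ‖f‖` in `L²`, then `fₙ → f` in `L²`. -/
lemma tendsto_lintegral_sq_sub_of_ae_tendsto {α : Type*} [MeasurableSpace α] {μ : Measure α}
    {f : ℕ → α → F} {g : α → F} (hf : ∀ n, AEStronglyMeasurable (f n) μ) (hg : MemLp g 2 μ)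
    (h : ∀ᵐ x ∂μ, Tendsto (fun n => f n x) atTop (𝓝 (g x)))
    (hle : ∀ n, ∫⁻ x, ‖f n x‖ₑ ^ 2 ∂μ ≤ ∫⁻ x, ‖g x‖ₑ ^ 2 ∂μ) :
    Tendsto (fun n => ∫⁻ x, ‖f n x - g x‖ₑ ^ 2 ∂μ) atTop (𝓝 0) := by
  have hgfin := (memLp_two_iff_lintegral.1 hg).2
  have hfm : ∀ n, MemLp (f n) 2 μ := fun n =>
    memLp_two_iff_lintegral.2 ⟨hf n, (hle n).trans_lt hgfin⟩
  set A : ℝ := ∫ x, ‖g x‖ ^ 2 ∂μ with hA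
  have hint : ∀ {k : α → F}, MemLp k 2 μ → Integrable (fun x => ‖k x‖ ^ 2) μ := fun hk =>
    (memLp_two_iff_integrable_sq_norm hk.1).1 hk
  have hleA : ∀ n, ∫ x, ‖f n x‖ ^ 2 ∂μ ≤ A := by
    intro n
    have := hle n
    rwa [← ofReal_integral_norm_sq (hfm n), ← ofReal_integral_norm_sq hg,
      ENNReal.ofReal_le_ofReal_iff (integral_nonneg fun _ => sq_nonneg _)] at this
  -- The integrand on the right is nonnegative by the parallelogram inequality and tends to `4
  -- ‖g‖²`. Fatou's lemma will be applied to it.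
  have key : ∀ n, ENNReal.ofReal (4 * A - ∫ x, ‖f n x - g x‖ ^ 2 ∂μ) ≥
      ∫⁻ x, ENNReal.ofReal (2 * ‖f n x‖ ^ 2 + 2 * ‖g x‖ ^ 2 - ‖f n x - g x‖ ^ 2) ∂μ := by
    intro n
    rw [← ofReal_integral_eq_lintegral_ofReal]
    · apply ENNReal.ofReal_le_ofReal
      rw [integral_sub, integral_add, integral_const_mul, integral_const_mul]
      · linarith [hleA n]
      · exact (hint (hfm n)).const_mul 2
      · exact (hint hg).const_mul 2
      · exact ((hint (hfm n)).const_mul 2).add ((hint hg).const_mul 2)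
      · exact hint ((hfm n).sub hg)
    · exact (((hint (hfm n)).const_mul 2).add ((hint hg).const_mul 2)).sub
        (hint ((hfm n).sub hg))
    · refine Eventually.of_forall fun x => ?_
      have := norm_sub_le (f n x) (g x)
      have h0 := norm_nonneg (f n x - g x)
      simp only [Pi.zero_apply]
      nlinarith [sq_nonneg (‖f n x‖ - ‖g x‖), norm_nonneg (f n x), norm_nonneg (g x)]
  have hlim : Tendsto (fun n => ∫ x, ‖f n x - g x‖ ^ 2 ∂μ) atTop (𝓝 0) := by
    have hnn : ∀ n, 0 ≤ ∫ x, ‖f n x - g x‖ ^ 2 ∂μ := fun n => integral_nonneg fun _ => sq_nonneg _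
    rw [Metric.tendsto_atTop]
    by_contra! hcon
    obtain ⟨η, hη, hfreq⟩ := hcon
    obtain ⟨σ, hσ, hbig⟩ := extraction_of_frequently_atTop (frequently_atTop.2 hfreq)
    -- If the distances stayed above `η` along a subsequence, Fatou's lemma would yield `4 A ≤ 4 A -
    -- η`.
    have h4 : ∫⁻ x, ENNReal.ofReal (4 * ‖g x‖ ^ 2) ∂μ ≤ ENNReal.ofReal (4 * A - η) := by
      refine lintegral_le_of_ae_tendsto (F := fun n x =>
        ENNReal.ofReal (2 * ‖f (σ n) x‖ ^ 2 + 2 * ‖g x‖ ^ 2 - ‖f (σ n) x - g x‖ ^ 2)) ?_ ?_ ?_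
      · intro n
        have h1 := (hf (σ n)).norm.aemeasurable
        have h2 := hg.1.norm.aemeasurable
        have h3 := ((hf (σ n)).sub hg.1).norm.aemeasurable
        exact ((((h1.pow_const 2).const_mul 2).add ((h2.pow_const 2).const_mul 2)).sub
          (h3.pow_const 2)).ennreal_ofReal
      · filter_upwards [h] with x hx
        have hx := hx.comp hσ.tendsto_atTop
        refine ENNReal.tendsto_ofReal ?_
        have h1 := (((hx.norm.pow 2).const_mul 2).add_const (2 * ‖g x‖ ^ 2)).sub
          ((hx.sub_const (g x)).norm.pow 2)
        simp only [Function.comp_def] at h1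
        convert h1 using 2
        simp; ring
      · intro n
        refine (key (σ n)).trans (ENNReal.ofReal_le_ofReal ?_)
        have := hbig n
        rw [dist_zero_right, Real.norm_of_nonneg (hnn _)] at this
        linarith
    rw [← ofReal_integral_eq_lintegral_ofReal ((hint hg).const_mul 4)
      (Eventually.of_forall fun x => by simp only [Pi.zero_apply]; positivity), integral_const_mul] at h4
    -- `ENNReal.ofReal` truncates negative numbers, so the inequality is not yet a contradiction
    -- when `4 A ≤ η`. Then it forces `A = 0`, and the fields themselves vanish in `L²`.
    rcases le_or_gt (4 * A - η) 0 with h5 | h5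
    · rw [ENNReal.ofReal_of_nonpos h5, nonpos_iff_eq_zero, ENNReal.ofReal_eq_zero] at h4
      have h6 : A ≤ 0 := by linarith
      have h7 : (0 : ℝ) ≤ A := integral_nonneg fun _ => sq_nonneg _
      have h8 := hbig 0
      rw [dist_zero_right, Real.norm_of_nonneg (hnn _)] at h8
      have h9 : ∫ x, ‖f (σ 0) x - g x‖ ^ 2 ∂μ ≤ 2 * (∫ x, ‖f (σ 0) x‖ ^ 2 ∂μ) + 2 * A := by
        rw [hA, ← integral_const_mul, ← integral_const_mul, ← integral_add
          ((hint (hfm _)).const_mul 2) ((hint hg).const_mul 2)]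
        refine integral_mono (hint ((hfm _).sub hg))
          (((hint (hfm _)).const_mul 2).add ((hint hg).const_mul 2)) fun x => ?_
        have := norm_sub_le (f (σ 0) x) (g x)
        have h0 := norm_nonneg (f (σ 0) x - g x)
        dsimp only
        nlinarith [sq_nonneg (‖f (σ 0) x‖ - ‖g x‖), norm_nonneg (f (σ 0) x), norm_nonneg (g x)]
      linarith [hleA (σ 0)]
    · rw [ENNReal.ofReal_le_ofReal_iff h5.le] at h4
      linarith
  have := ENNReal.tendsto_ofReal hlim
  rw [ENNReal.ofReal_zero] at this
  refine this.congr fun n => ?_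
  exact ofReal_integral_norm_sq ((hfm n).sub hg)

variable [NormedSpace ℝ F]

/-- The convolution of a scalar kernel with a vector valued function on `ℝ³`. -/
def conv (k : R3 → ℝ) (f : R3 → F) (x : R3) : F := ∫ y, k (x - y) • f y

lemma conv_eq_convolution (k : R3 → ℝ) (f : R3 → F) :
    conv k f = convolution k f (ContinuousLinearMap.lsmul ℝ ℝ) volume := by
  ext x
  rw [convolution_eq_swap]
  rfl

variable {k : R3 → ℝ} {f : R3 → F}

lemma contDiff_conv (hk : ContDiff ℝ (⊤ : ℕ∞) k) (hs : HasCompactSupport k)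
    (hf : LocallyIntegrable f) : ContDiff ℝ (⊤ : ℕ∞) (conv k f) := by
  rw [conv_eq_convolution]
  exact hs.contDiff_convolution_left _ hk hf

lemma fderiv_conv_apply (hk : ContDiff ℝ (⊤ : ℕ∞) k) (hs : HasCompactSupport k)
    (hf : LocallyIntegrable f) (x v : R3) :
    fderiv ℝ (conv k f) x v = conv (fun z => fderiv ℝ k z v) f x := by
  rw [conv_eq_convolution]
  have hk1 : ContDiff ℝ 1 k := hk.of_le (by exact_mod_cast le_top)
  rw [(hs.hasFDerivAt_convolution_left _ hk1 hf x).fderiv, convolution_eq_swap]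
  have hint : Integrable (fun t => ((ContinuousLinearMap.precompL R3
      (ContinuousLinearMap.lsmul ℝ ℝ : ℝ →L[ℝ] F →L[ℝ] F)) (fderiv ℝ k (x - t))) (f t)) := by
    have := (hs.fderiv (𝕜 := ℝ)).convolutionExists_left
      (ContinuousLinearMap.precompL R3 (ContinuousLinearMap.lsmul ℝ ℝ : ℝ →L[ℝ] F →L[ℝ] F))
      (hk1.continuous_fderiv one_ne_zero) hf x
    exact this.integrable_swap
  rw [ContinuousLinearMap.integral_apply hint]
  rfl

lemma contDiff_fderiv_apply_const {k : R3 → ℝ} (hk : ContDiff ℝ (⊤ : ℕ∞) k) (v : R3) :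
    ContDiff ℝ (⊤ : ℕ∞) (fun z => fderiv ℝ k z v) :=
  (hk.fderiv_right (m := (⊤ : ℕ∞)) (by exact_mod_cast le_rfl)).clm_apply contDiff_const

/-- Young's inequality for the convolution of an integrable and a square integrable function. -/
lemma lintegral_conv_sq_le (hk : Continuous k) (hf : AEStronglyMeasurable f) :
    ∫⁻ x, ‖conv k f x‖ₑ ^ 2 ≤ (∫⁻ x, ‖k x‖ₑ) ^ 2 * ∫⁻ x, ‖f x‖ₑ ^ 2 := by
  have hkx : ∀ x, ∫⁻ y, ‖k (x - y)‖ₑ = ∫⁻ y, ‖k y‖ₑ := fun x =>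
    lintegral_sub_left_eq_self (fun y => ‖k y‖ₑ) x
  have hpt : ∀ x, ‖conv k f x‖ₑ ^ 2 ≤
      (∫⁻ y, ‖k y‖ₑ) * ∫⁻ y, ‖k (x - y)‖ₑ * ‖f y‖ₑ ^ 2 := by
    intro x
    have h1 : ‖conv k f x‖ₑ ≤ ∫⁻ y, ‖k (x - y)‖ₑ * ‖f y‖ₑ := by
      refine (enorm_integral_le_lintegral_enorm _).trans (lintegral_mono fun y => ?_)
      rw [enorm_smul]
    refine (pow_le_pow_left' h1 2).trans ?_
    rw [← hkx x]
    exact sq_lintegral_mul_le (hk.comp (continuous_const.sub continuous_id)).enorm.aemeasurable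
      hf.enorm
  have hm : AEMeasurable (Function.uncurry fun (x y : R3) => ‖k (x - y)‖ₑ * ‖f y‖ₑ ^ 2)
      (volume.prod volume) := by
    have h1 : AEMeasurable (fun p : R3 × R3 => ‖k (p.1 - p.2)‖ₑ) (volume.prod volume) :=
      (hk.comp (continuous_fst.sub continuous_snd)).enorm.aemeasurable
    have h2 : AEMeasurable (fun p : R3 × R3 => ‖f p.2‖ₑ ^ 2) (volume.prod volume) :=
      hf.comp_snd.enorm.pow_const 2
    exact h1.mul h2
  calc ∫⁻ x, ‖conv k f x‖ₑ ^ 2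
      ≤ ∫⁻ x, (∫⁻ y, ‖k y‖ₑ) * ∫⁻ y, ‖k (x - y)‖ₑ * ‖f y‖ₑ ^ 2 := lintegral_mono hpt
    _ = (∫⁻ y, ‖k y‖ₑ) * ∫⁻ x, ∫⁻ y, ‖k (x - y)‖ₑ * ‖f y‖ₑ ^ 2 := by
        rw [lintegral_const_mul'']
        exact hm.lintegral_prod_right'
    _ = (∫⁻ y, ‖k y‖ₑ) * ∫⁻ y, ∫⁻ x, ‖k (x - y)‖ₑ * ‖f y‖ₑ ^ 2 := by
        rw [lintegral_lintegral_swap hm]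
    _ = (∫⁻ y, ‖k y‖ₑ) * ∫⁻ y, (∫⁻ x, ‖k x‖ₑ) * ‖f y‖ₑ ^ 2 := by
        congr 1
        refine lintegral_congr fun y => ?_
        have h1 : AEMeasurable (fun x : R3 => ‖k (x - y)‖ₑ) volume :=
          (hk.comp (continuous_id.sub continuous_const)).enorm.aemeasurable
        rw [lintegral_mul_const'' _ h1]
        congr 1
        exact lintegral_sub_right_eq_self (fun x => ‖k x‖ₑ) y
    _ = _ := by
        rw [lintegral_const_mul'' _ (hf.enorm.pow_const 2)]
        ring

lemma memLp_conv (hk : ContDiff ℝ (⊤ : ℕ∞) k) (hs : HasCompactSupport k) (hf : MemLp f 2 volume) :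
    MemLp (conv k f) 2 volume := by
  rw [memLp_two_iff_lintegral]
  refine ⟨(contDiff_conv hk hs (memLp_two_locallyIntegrable hf)).continuous.aestronglyMeasurable,
    (lintegral_conv_sq_le hk.continuous hf.1).trans_lt ?_⟩
  have h1 : ∫⁻ x, ‖k x‖ₑ < ∞ := (hk.continuous.integrable_of_hasCompactSupport hs).2
  exact ENNReal.mul_lt_top (ENNReal.pow_lt_top h1) (memLp_two_iff_lintegral.1 hf).2

/-- A sequence of smooth bumps shrinking to the origin. -/
def shrinkingBump (n : ℕ) : ContDiffBump (0 : R3) where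
  rIn := 1 / (n + 1) / 2
  rOut := 1 / (n + 1)
  rIn_pos := by positivity
  rIn_lt_rOut := half_lt_self (by positivity)

/-- The standard mollifiers: smooth, nonnegative, of integral one, supported in the ball of radius
`1 / (n + 1)`. -/
def mollifier (n : ℕ) : R3 → ℝ := (shrinkingBump n).normed volume

lemma mollifier_contDiff (n : ℕ) : ContDiff ℝ (⊤ : ℕ∞) (mollifier n) :=
  (shrinkingBump n).contDiff_normed

lemma mollifier_hasCompactSupport (n : ℕ) : HasCompactSupport (mollifier n) :=
  (shrinkingBump n).hasCompactSupport_normed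

lemma mollifier_nonneg (n : ℕ) (x : R3) : 0 ≤ mollifier n x := (shrinkingBump n).nonneg_normed x

lemma mollifier_eq_zero {n : ℕ} {x : R3} (hx : 1 / ((n : ℝ) + 1) ≤ ‖x‖) : mollifier n x = 0 := by
  by_contra h
  have : x ∈ Function.support ((shrinkingBump n).normed volume) := h
  rw [ContDiffBump.support_normed_eq, mem_ball_zero_iff] at this
  exact absurd this (not_lt.2 hx)

lemma lintegral_mollifier (n : ℕ) : ∫⁻ x, ‖mollifier n x‖ₑ = 1 := by
  have h := ofReal_integral_eq_lintegral_ofReal (μ := (volume : Measure R3))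
    ((shrinkingBump n).integrable_normed)
    (Eventually.of_forall (mollifier_nonneg n))
  rw [(shrinkingBump n).integral_normed, ENNReal.ofReal_one] at h
  rw [h]
  refine lintegral_congr fun x => ?_
  exact Real.enorm_of_nonneg (mollifier_nonneg n x)

/-- Young's inequality with a kernel of mass one: mollification does not increase the `L²` norm,
which is what the Fatou arguments below require. -/
lemma lintegral_mollify_sq_le (n : ℕ) (hf : AEStronglyMeasurable f) :
    ∫⁻ x, ‖conv (mollifier n) f x‖ₑ ^ 2 ≤ ∫⁻ x, ‖f x‖ₑ ^ 2 := by
  have := lintegral_conv_sq_le (mollifier_contDiff n).continuous hf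
  rwa [lintegral_mollifier, one_pow, one_mul] at this

lemma ae_tendsto_mollify [CompleteSpace F] (hf : LocallyIntegrable f) :
    ∀ᵐ x, Tendsto (fun n => conv (mollifier n) f x) atTop (𝓝 (f x)) := by
  -- Here `K := 2` is the admissible ratio of the outer to the inner radius of the bumps.
  have h := ContDiffBump.ae_convolution_tendsto_right_of_locallyIntegrable (K := 2)
    (φ := shrinkingBump) (l := atTop) (μ := (volume : Measure R3))
    (by exact tendsto_one_div_add_atTop_nhds_zero_nat)
    (Eventually.of_forall fun n => by simp only [shrinkingBump]; linarith) hf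
  simp only [conv_eq_convolution]
  exact h

lemma memLp_mollify (n : ℕ) (hf : MemLp f 2 volume) : MemLp (conv (mollifier n) f) 2 volume :=
  memLp_conv (mollifier_contDiff n) (mollifier_hasCompactSupport n) hf

/-- Mollification converges in `L²`. -/
lemma tendsto_mollify_two [CompleteSpace F] (hf : MemLp f 2 volume) :
    Tendsto (fun n => ∫⁻ x, ‖conv (mollifier n) f x - f x‖ₑ ^ 2) atTop (𝓝 0) :=
  tendsto_lintegral_sq_sub_of_ae_tendsto (fun n => (memLp_mollify n hf).1) hf
    (ae_tendsto_mollify (memLp_two_locallyIntegrable hf)) (fun n => lintegral_mollify_sq_le n hf.1)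

end Convolution

/-! ### Pointwise algebra of gradients, deformation tensors and the convective term -/

section GradientAlgebra

lemma grad3_norm_sq (A : Grad3) : ‖A‖ ^ 2 = ∑ i, ∑ j, A i j ^ 2 := by
  rw [PiLp.norm_sq_eq_of_L2]
  refine Finset.sum_congr rfl fun i _ => ?_
  rw [EuclideanSpace.norm_sq_eq]
  simp

lemma grad3_inner (A B : Grad3) : inner ℝ A B = ∑ i, ∑ j, A i j * B i j := by
  rw [PiLp.inner_apply]
  refine Finset.sum_congr rfl fun i _ => ?_
  rw [PiLp.inner_apply]
  refine Finset.sum_congr rfl fun j _ => ?_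
  simp [mul_comm]

lemma r3_inner (a b : R3) : inner ℝ a b = ∑ i, a i * b i := by
  rw [PiLp.inner_apply]
  simp [mul_comm]

/-- Transposition of gradients. -/
def transposeGrad : Grad3 →L[ℝ] Grad3 :=
  (PiLp.continuousLinearEquiv 2 ℝ (fun _ : Fin 3 => R3)).symm.toContinuousLinearMap ∘L
    ContinuousLinearMap.pi fun i =>
      (PiLp.continuousLinearEquiv 2 ℝ (fun _ : Fin 3 => ℝ)).symm.toContinuousLinearMap ∘L
        ContinuousLinearMap.pi fun j =>
          (EuclideanSpace.proj (𝕜 := ℝ) i) ∘L (PiLp.proj (𝕜 := ℝ) 2 (fun _ : Fin 3 => R3) j)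

@[simp] lemma transposeGrad_apply (A : Grad3) (i j : Fin 3) : transposeGrad A i j = A j i := rfl

/-- The symmetric part of a gradient. -/
def symGrad : Grad3 →L[ℝ] Grad3 := (1 / 2 : ℝ) • (ContinuousLinearMap.id ℝ Grad3 + transposeGrad)

lemma symGrad_apply (A : Grad3) (i j : Fin 3) : symGrad A i j = (A i j + A j i) / 2 := by
  simp only [symGrad, _root_.smul_apply, _root_.add_apply,
    ContinuousLinearMap.id_apply, PiLp.smul_apply, PiLp.add_apply, transposeGrad_apply,
    smul_eq_mul]
  ring

lemma deform_apply (A : Grad3) (i j : Fin 3) : deform A i j = (A i j + A j i) / 2 := by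
  simp only [deform, gradMatrix, Matrix.smul_apply, Matrix.add_apply, Matrix.transpose_apply,
    Matrix.of_apply, smul_eq_mul]
  ring

lemma ddot_gradMatrix (A B : Grad3) : ddot (gradMatrix A) (gradMatrix B) = inner ℝ A B := by
  rw [grad3_inner]; rfl

lemma ddot_deform (A B : Grad3) : ddot (deform A) (deform B) = inner ℝ (symGrad A) (symGrad B) := by
  rw [grad3_inner]
  simp only [ddot, deform_apply, symGrad_apply]

/-- Taking the symmetric part is an orthogonal projection, so it may be dropped from one of the two
factors. -/
lemma ddot_deform' (A B : Grad3) : ddot (deform A) (deform B) = inner ℝ A (symGrad B) := by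
  rw [grad3_inner]
  simp only [ddot, deform_apply, symGrad_apply, Fin.sum_univ_three]
  ring

lemma ddot_deform_self (A : Grad3) : ddot (deform A) (deform A) = ‖symGrad A‖ ^ 2 := by
  rw [ddot_deform, real_inner_self_eq_norm_sq]

lemma norm_symGrad_le (A : Grad3) : ‖symGrad A‖ ≤ ‖A‖ := by
  have h : ‖symGrad A‖ ^ 2 ≤ ‖A‖ ^ 2 := by
    rw [grad3_norm_sq, grad3_norm_sq]
    simp only [symGrad_apply, Fin.sum_univ_three]
    nlinarith [sq_nonneg (A 0 1 - A 1 0), sq_nonneg (A 0 2 - A 2 0), sq_nonneg (A 1 2 - A 2 1)]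
  exact abs_le_of_sq_le_sq' h (norm_nonneg _) |>.2

/-- The algebra behind Korn's inequality: for a divergence free field the last sum, `A : Aᵀ`,
integrates to zero. -/
lemma norm_sq_eq_symGrad (A : Grad3) :
    ‖A‖ ^ 2 = 2 * ‖symGrad A‖ ^ 2 - ∑ i, ∑ j, A i j * A j i := by
  rw [grad3_norm_sq, grad3_norm_sq]
  simp only [symGrad_apply, Fin.sum_univ_three]
  ring

lemma trace_gradMatrix (A : Grad3) : (gradMatrix A).trace = ∑ i, A i i := rfl

lemma abs_apply_le_norm (A : Grad3) (i j : Fin 3) : |A i j| ≤ ‖A‖ := by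
  have h1 : ‖A i j‖ ≤ ‖A i‖ := PiLp.norm_apply_le (A i) j
  exact h1.trans (PiLp.norm_apply_le A i)

lemma norm_convect_le (w : R3) (A : Grad3) : ‖convect w A‖ ≤ ‖w‖ * ‖A‖ := by
  have h1 : ‖convect w A‖ ≤ ∑ i, |w i| * ‖A i‖ := by
    refine (norm_sum_le _ _).trans_eq ?_
    simp [norm_smul]
  refine h1.trans ?_
  have h2 := Finset.sum_mul_sq_le_sq_mul_sq Finset.univ (fun i => |w i|) (fun i => ‖A i‖)
  have h3 : ∑ i, |w i| ^ 2 = ‖w‖ ^ 2 := by rw [EuclideanSpace.norm_sq_eq]; simp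
  have h4 : ∑ i, ‖A i‖ ^ 2 = ‖A‖ ^ 2 := (PiLp.norm_sq_eq_of_L2 _ A).symm
  rw [h3, h4, ← mul_pow] at h2
  exact abs_le_of_sq_le_sq' h2 (by positivity) |>.2

lemma r3_eq_sum (v : R3) : v = ∑ i, v i • basisVec i := by
  ext j
  fin_cases j <;> simp [basisVec, Fin.sum_univ_three]

lemma fderiv_eq_convect {f : R3 → R3} (x v : R3) :
    fderiv ℝ f x v = convect v (gradField f x) := by
  conv_lhs => rw [r3_eq_sum v]
  rw [map_sum]
  simp [convect, gradField]

lemma norm_fderiv_apply_le (f : R3 → R3) (x v : R3) :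
    ‖fderiv ℝ f x v‖ ≤ ‖v‖ * ‖gradField f x‖ := by
  rw [fderiv_eq_convect]; exact norm_convect_le _ _

lemma gradField_apply (f : R3 → R3) (x : R3) (i : Fin 3) :
    gradField f x i = fderiv ℝ f x (basisVec i) := rfl

lemma norm_basisVec (i : Fin 3) : ‖basisVec i‖ = 1 := by simp [basisVec]

/-- The gradient as a linear function of the derivative. -/
def gradOfDeriv : (R3 →L[ℝ] R3) →L[ℝ] Grad3 :=
  (PiLp.continuousLinearEquiv 2 ℝ (fun _ : Fin 3 => R3)).symm.toContinuousLinearMap ∘L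
    ContinuousLinearMap.pi fun i => ContinuousLinearMap.apply ℝ R3 (basisVec i)

lemma gradField_eq (f : R3 → R3) : gradField f = fun x => gradOfDeriv (fderiv ℝ f x) := rfl

lemma contDiff_gradField {f : R3 → R3} (hf : ContDiff ℝ (⊤ : ℕ∞) f) :
    ContDiff ℝ (⊤ : ℕ∞) (gradField f) :=
  gradOfDeriv.contDiff.comp (hf.fderiv_right (m := (⊤ : ℕ∞)) (by exact_mod_cast le_rfl))

lemma hasCompactSupport_gradField {f : R3 → R3} (hf : HasCompactSupport f) :
    HasCompactSupport (gradField f) :=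
  (hf.fderiv (𝕜 := ℝ)).comp_left (g := gradOfDeriv) (map_zero _)

lemma contDiff_top_differentiable {E F : Type*} [NormedAddCommGroup E] [NormedSpace ℝ E]
    [NormedAddCommGroup F] [NormedSpace ℝ F] {f : E → F} (hf : ContDiff ℝ (⊤ : ℕ∞) f) :
    Differentiable ℝ f := hf.differentiable (by simp)

lemma fderiv_coord {E : Type*} [NormedAddCommGroup E] [NormedSpace ℝ E] {f : E → R3} {x : E}
    (hf : DifferentiableAt ℝ f x) (v : E) (j : Fin 3) :
    fderiv ℝ (fun y => f y j) x v = fderiv ℝ f x v j := by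
  have := (EuclideanSpace.proj (𝕜 := ℝ) j).hasFDerivAt.comp x hf.hasFDerivAt
  have h2 : HasFDerivAt (fun y => f y j) ((EuclideanSpace.proj (𝕜 := ℝ) j).comp (fderiv ℝ f x)) x :=
    this
  rw [h2.fderiv]; rfl

end GradientAlgebra

/-! ### Integration by parts for smooth fields: the cross term `∇f : ∇fᵀ` and a Hardy type
inequality -/

section SmoothFields

lemma memLp_coord {α : Type*} [MeasurableSpace α] {μ : Measure α} {f : α → R3} {p : ℝ≥0∞}
    (hf : MemLp f p μ) (j : Fin 3) : MemLp (fun x => f x j) p μ :=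
  hf.of_le ((EuclideanSpace.proj (𝕜 := ℝ) j).continuous.comp_aestronglyMeasurable hf.1)
    (Eventually.of_forall fun x => PiLp.norm_apply_le (f x) j)

lemma integrable_mul_of_memLp_two {α : Type*} [MeasurableSpace α] {μ : Measure α} {f g : α → ℝ}
    (hf : MemLp f 2 μ) (hg : MemLp g 2 μ) : Integrable (fun x => f x * g x) μ :=
  hf.integrable_mul hg

lemma integrable_inner_of_memLp_two {α : Type*} [MeasurableSpace α] {μ : Measure α}
    {E : Type*} [NormedAddCommGroup E] [InnerProductSpace ℝ E] {f g : α → E}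
    (hf : MemLp f 2 μ) (hg : MemLp g 2 μ) : Integrable (fun x => inner ℝ (f x) (g x)) μ :=
  (hf.norm.integrable_mul hg.norm).mono (hf.1.inner hg.1)
    (Eventually.of_forall fun x => by
      simpa using abs_real_inner_le_norm (f x) (g x))

/-- For a smooth divergence free field, `∫ ∂ᵢ fⱼ ∂ⱼ fᵢ = 0`. -/
lemma integral_sum_cross_gradient_eq_zero {f : R3 → R3} (hf : ContDiff ℝ (⊤ : ℕ∞) f)
    (h0 : MemLp f 2 volume) (h1 : ∀ v, MemLp (fun x => fderiv ℝ f x v) 2 volume)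
    (h2 : ∀ v w, MemLp (fun x => fderiv ℝ (fun y => fderiv ℝ f y v) x w) 2 volume)
    (hdiv : ∀ x, ∑ i, gradField f x i i = 0) :
    ∫ x, ∑ i, ∑ j, gradField f x i j * gradField f x j i = 0 := by
  have hfd := contDiff_top_differentiable hf
  have hdsm : ∀ v, ContDiff ℝ (⊤ : ℕ∞) fun y => fderiv ℝ f y v := fun v =>
    (hf.fderiv_right (m := (⊤ : ℕ∞)) (by exact_mod_cast le_rfl)).clm_apply contDiff_const
  have hcoord : ∀ (v : R3) (j : Fin 3) (x w : R3),
      fderiv ℝ (fun y => fderiv ℝ f y v j) x w = fderiv ℝ (fun y => fderiv ℝ f y v) x w j :=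
    fun v j x w => fderiv_coord (contDiff_top_differentiable (hdsm v) x) w j
  have hterm : ∀ i j : Fin 3, Integrable fun x => gradField f x i j * gradField f x j i :=
    fun i j => integrable_mul_of_memLp_two (memLp_coord (h1 (basisVec i)) j)
      (memLp_coord (h1 (basisVec j)) i)
  have hterm2 : ∀ i j : Fin 3, Integrable fun x =>
      fderiv ℝ (fun y => fderiv ℝ f y (basisVec j)) x (basisVec i) i * f x j :=
    fun i j => integrable_mul_of_memLp_two (memLp_coord (h2 _ _) i) (memLp_coord h0 j)
  -- The derivative `∂ᵢ` is moved off `fⱼ`. What remains is `fⱼ ∂ᵢ ∂ⱼ fᵢ`, whose sum over `i` is `fⱼ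
  -- ∂ⱼ (div f) = 0`. Square integrability of the second derivatives replaces compact support.
  have hibp : ∀ i j : Fin 3, ∫ x, gradField f x i j * gradField f x j i =
      -∫ x, fderiv ℝ (fun y => fderiv ℝ f y (basisVec j)) x (basisVec i) i * f x j := by
    intro i j
    have := integral_mul_fderiv_eq_neg_fderiv_mul_of_integrable (μ := (volume : Measure R3))
      (f := fun x => fderiv ℝ f x (basisVec j) i) (g := fun x => f x j) (v := basisVec i)
      (by simpa only [hcoord] using hterm2 i j)
      (by
        simp only [fun x => fderiv_coord (hfd x) (basisVec i) j]
        exact integrable_mul_of_memLp_two (memLp_coord (h1 (basisVec j)) i)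
          (memLp_coord (h1 (basisVec i)) j))
      (integrable_mul_of_memLp_two (memLp_coord (h1 (basisVec j)) i) (memLp_coord h0 j))
      (fun x _ => (EuclideanSpace.proj (𝕜 := ℝ) i).differentiableAt.comp x
        (contDiff_top_differentiable (hdsm _) x))
      (fun x _ => (EuclideanSpace.proj (𝕜 := ℝ) j).differentiableAt.comp x (hfd x))
    simp only [fun x => fderiv_coord (hfd x) (basisVec i) j, hcoord] at this
    rw [← this]
    refine integral_congr_ae (Eventually.of_forall fun x => ?_)
    simp only [gradField_apply]; ring
  have hsymm : ∀ (i j : Fin 3) (x : R3),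
      fderiv ℝ (fun y => fderiv ℝ f y (basisVec j)) x (basisVec i) =
        fderiv ℝ (fun y => fderiv ℝ f y (basisVec i)) x (basisVec j) := by
    intro i j x
    have hd : DifferentiableAt ℝ (fderiv ℝ f) x :=
      contDiff_top_differentiable (hf.fderiv_right (m := (⊤ : ℕ∞)) (by exact_mod_cast le_rfl)) x
    have hs : IsSymmSndFDerivAt ℝ f x :=
      hf.contDiffAt.isSymmSndFDerivAt (by
        simpa using (WithTop.coe_le_coe.2 (le_top : (2 : ℕ∞) ≤ ⊤)))
    have e : ∀ v w : R3, fderiv ℝ (fun y => fderiv ℝ f y v) x w = fderiv ℝ (fderiv ℝ f) x w v := by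
      intro v w
      rw [fderiv_clm_apply hd (differentiableAt_const _)]
      simp
    rw [e, e]
    exact hs _ _
  have hdd : ∀ (j : Fin 3) (x : R3),
      ∑ i, fderiv ℝ (fun y => fderiv ℝ f y (basisVec j)) x (basisVec i) i = 0 := by
    intro j x
    have hz : (fun y => ∑ i, fderiv ℝ f y (basisVec i) i) = fun _ => (0 : ℝ) :=
      funext fun y => hdiv y
    have h3 : fderiv ℝ (fun y => ∑ i, fderiv ℝ f y (basisVec i) i) x (basisVec j) = 0 := by
      rw [hz]; simp
    have hdi : ∀ i ∈ Finset.univ, DifferentiableAt ℝ (fun y => fderiv ℝ f y (basisVec i) i) x :=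
      fun i _ => (EuclideanSpace.proj (𝕜 := ℝ) i).differentiableAt.comp x
        (contDiff_top_differentiable (hdsm _) x)
    rw [fderiv_fun_sum hdi, _root_.sum_apply] at h3
    rw [← h3]
    refine Finset.sum_congr rfl fun i _ => ?_
    rw [hsymm, hcoord]
  rw [integral_finsetSum _ fun i _ => integrable_finsetSum _ fun j _ => hterm i j]
  simp only [fun i => integral_finsetSum (μ := (volume : Measure R3)) Finset.univ
    (fun j _ => hterm i j), hibp, Finset.sum_neg_distrib]
  rw [Finset.sum_comm, neg_eq_zero]
  refine Finset.sum_eq_zero fun j _ => ?_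
  rw [← integral_finsetSum _ fun i _ => hterm2 i j]
  refine integral_eq_zero_of_ae (Eventually.of_forall fun x => ?_)
  simp only [← Finset.sum_mul, hdd, zero_mul, Pi.zero_apply]

/-- A Hardy type inequality for smooth fields. -/
lemma lintegral_hardy_smooth {f : R3 → R3} (hf : ContDiff ℝ (⊤ : ℕ∞) f)
    (h0 : MemLp f 2 volume) (h1 : MemLp (gradField f) 2 volume) (a : R3) {r : ℝ} (hr : 0 < r) :
    ∫⁻ x in Metric.ball a r, ‖f x‖ₑ ^ 2 ≤
      ENNReal.ofReal (8 * r ^ 2) * ∫⁻ x, ‖gradField f x‖ₑ ^ 2 := by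
  have hfd := contDiff_top_differentiable hf
  -- the weight
  set q : R3 → ℝ := fun x => (‖x - a‖ ^ 2 + r ^ 2)⁻¹ with hq
  have hqpos : ∀ x, 0 < ‖x - a‖ ^ 2 + r ^ 2 := fun x => by positivity
  have hqsm : ContDiff ℝ (⊤ : ℕ∞) q :=
    (((contDiff_id.sub contDiff_const).norm_sq ℝ).add contDiff_const).inv fun x => (hqpos x).ne'
  have hq0 : ∀ x, 0 < q x := fun x => inv_pos.2 (hqpos x)
  have hqle : ∀ x, q x ≤ (r ^ 2)⁻¹ := fun x => by
    simp only [hq]; gcongr; nlinarith [sq_nonneg ‖x - a‖]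
  have hXle : ∀ x, (q x * ‖x - a‖) ^ 2 ≤ q x := fun x => by
    have h2 : q x * (‖x - a‖ ^ 2 + r ^ 2) = 1 := inv_mul_cancel₀ (hqpos x).ne'
    have : q x * ‖x - a‖ ^ 2 ≤ 1 := by nlinarith [hq0 x, sq_nonneg r]
    calc (q x * ‖x - a‖) ^ 2 = q x * (q x * ‖x - a‖ ^ 2) := by ring
      _ ≤ q x * 1 := by gcongr
      _ = q x := mul_one _
  set X : Fin 3 → R3 → ℝ := fun i x => q x * (x i - a i) with hX
  -- The vector field `X = q (x - a)` is bounded with bounded derivatives, hence admissible in an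
  -- integration by parts against `‖f‖²`.
  have hXsm : ∀ i, ContDiff ℝ (⊤ : ℕ∞) (X i) := fun i =>
    hqsm.mul (((EuclideanSpace.proj (𝕜 := ℝ) i).contDiff).sub contDiff_const)
  have hqd : ∀ x v, fderiv ℝ q x v = -(2 * inner ℝ (x - a) v) * q x ^ 2 := by
    intro x v
    have h := (hasDerivAt_inv (hqpos x).ne').comp_hasFDerivAt x
      (((hasFDerivAt_id x).sub_const a).norm_sq.add_const (r ^ 2))
    rw [show q = ((fun y : ℝ => y⁻¹) ∘ fun x => ‖id x - a‖ ^ 2 + r ^ 2) from rfl, h.fderiv]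
    simp [inner_sub_left]
    ring
  have hXd : ∀ i x, fderiv ℝ (X i) x (basisVec i) = q x - 2 * (x i - a i) ^ 2 * q x ^ 2 := by
    intro i x
    have h := (contDiff_top_differentiable hqsm x).hasFDerivAt.fun_mul
      (((EuclideanSpace.proj (𝕜 := ℝ) i).hasFDerivAt (x := x)).sub_const (a i))
    rw [show X i = (fun x => q x * ((EuclideanSpace.proj (𝕜 := ℝ) i) x - a i)) from rfl, h.fderiv]
    simp only [_root_.add_apply, _root_.smul_apply, hqd]
    simp [basisVec, EuclideanSpace.inner_single_right]
    ring
  -- Its divergence is `3 q - 2 q² |x - a|²`, which is at least `q` because `q |x - a|² ≤ 1`. The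
  -- dimension enters only through this `3`.
  have hdivX : ∀ x, q x ≤ ∑ i, fderiv ℝ (X i) x (basisVec i) := by
    intro x
    simp only [hXd, Finset.sum_sub_distrib, Finset.sum_const, Finset.card_univ, Fintype.card_fin,
      ← Finset.sum_mul, ← Finset.mul_sum]
    have h5 : ∑ i, (x i - a i) ^ 2 = ‖x - a‖ ^ 2 := by rw [EuclideanSpace.norm_sq_eq]; simp
    rw [h5]
    have := hXle x
    rw [mul_pow] at this
    simp only [nsmul_eq_mul, Nat.cast_ofNat]
    linarith
  have hXb : ∀ i x, |X i x| ≤ q x * ‖x - a‖ := by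
    intro i x
    rw [hX, abs_mul, abs_of_pos (hq0 x)]
    exact mul_le_mul_of_nonneg_left (PiLp.norm_apply_le (x - a) i) (hq0 x).le
  have hXb' : ∀ i x, ‖X i x‖ ≤ r⁻¹ := by
    intro i x
    have h6 : (q x * ‖x - a‖) ^ 2 ≤ (r⁻¹) ^ 2 := (hXle x).trans ((hqle x).trans (by rw [inv_pow]))
    exact (hXb i x).trans (abs_le_of_sq_le_sq' h6 (by positivity)).2
  have hXdb : ∀ i x, ‖fderiv ℝ (X i) x (basisVec i)‖ ≤ 3 * (r ^ 2)⁻¹ := by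
    intro i x
    rw [hXd, Real.norm_eq_abs]
    have h7 : (x i - a i) ^ 2 * q x ^ 2 ≤ q x := by
      have h8 := pow_le_pow_left₀ (abs_nonneg _) (hXb i x) 2
      rw [sq_abs] at h8
      have := h8.trans (hXle x)
      simp only [hX] at this
      nlinarith
    have h9 : 0 ≤ (x i - a i) ^ 2 * q x ^ 2 := by positivity
    rw [abs_le]
    constructor <;> nlinarith [hqle x, hq0 x]
  have hN : Integrable fun x => ‖f x‖ ^ 2 := (memLp_two_iff_integrable_sq_norm h0.1).1 h0
  have hG : Integrable fun x => ‖gradField f x‖ ^ 2 :=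
    (memLp_two_iff_integrable_sq_norm h1.1).1 h1
  have hNd : ∀ x v, fderiv ℝ (fun y => ‖f y‖ ^ 2) x v = 2 * inner ℝ (f x) (fderiv ℝ f x v) := by
    intro x v
    rw [(hfd x).hasFDerivAt.norm_sq.fderiv]
    simp
  have hXm : ∀ i, AEStronglyMeasurable (X i) volume := fun i =>
    (hXsm i).continuous.aestronglyMeasurable
  have hdm : ∀ i, MemLp (fun x => fderiv ℝ f x (basisVec i)) 2 volume := by
    intro i
    refine h1.of_le ?_ (Eventually.of_forall fun x => PiLp.norm_apply_le (gradField f x) i)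
    exact ((hf.continuous_fderiv (by simp)).clm_apply continuous_const).aestronglyMeasurable
  have hi1 : ∀ i, Integrable fun x => fderiv ℝ (X i) x (basisVec i) * ‖f x‖ ^ 2 := fun i =>
    hN.bdd_mul (((hXsm i).continuous_fderiv (by simp)).clm_apply
      continuous_const).aestronglyMeasurable (Eventually.of_forall (hXdb i))
  have hi2 : ∀ i, Integrable fun x => X i x * (2 * inner ℝ (f x) (fderiv ℝ f x (basisVec i))) :=
    fun i => ((integrable_inner_of_memLp_two h0 (hdm i)).const_mul 2).bdd_mul (hXm i)
      (Eventually.of_forall (hXb' i))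
  have hi3 : ∀ i, Integrable fun x => X i x * ‖f x‖ ^ 2 := fun i =>
    hN.bdd_mul (hXm i) (Eventually.of_forall (hXb' i))
  have hibp : ∀ i, ∫ x, X i x * (2 * inner ℝ (f x) (fderiv ℝ f x (basisVec i))) =
      -∫ x, fderiv ℝ (X i) x (basisVec i) * ‖f x‖ ^ 2 := by
    intro i
    have := integral_mul_fderiv_eq_neg_fderiv_mul_of_integrable (μ := (volume : Measure R3))
      (f := X i) (g := fun x => ‖f x‖ ^ 2) (v := basisVec i) (hi1 i)
      (by simpa only [hNd] using hi2 i) (hi3 i)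
      (fun x _ => contDiff_top_differentiable (hXsm i) x)
      (fun x _ => (hfd x).norm_sq ℝ)
    simpa only [hNd] using this
  have hqf : Integrable fun x => q x * ‖f x‖ ^ 2 :=
    hN.bdd_mul hqsm.continuous.aestronglyMeasurable (c := (r ^ 2)⁻¹)
      (Eventually.of_forall fun x => by rw [Real.norm_of_nonneg (hq0 x).le]; exact hqle x)
  -- `∫ q |f|² ≤ ∫ (div X) |f|² = -2 ∫ f · (X · ∇) f`. Since `|X|² ≤ q`, Young's inequality bounds
  -- this by `½ ∫ q |f|² + 2 ∫ |∇f|²`, and the first half is absorbed.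
  have hmain : ∫ x, q x * ‖f x‖ ^ 2 ≤ 4 * ∫ x, ‖gradField f x‖ ^ 2 := by
    have s1 : ∫ x, q x * ‖f x‖ ^ 2 ≤ ∫ x, ∑ i, fderiv ℝ (X i) x (basisVec i) * ‖f x‖ ^ 2 := by
      refine integral_mono hqf (integrable_finsetSum _ fun i _ => hi1 i) fun x => ?_
      dsimp only
      rw [← Finset.sum_mul]
      exact mul_le_mul_of_nonneg_right (hdivX x) (sq_nonneg _)
    have s2 : ∫ x, ∑ i, fderiv ℝ (X i) x (basisVec i) * ‖f x‖ ^ 2 =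
        ∫ x, -∑ i, X i x * (2 * inner ℝ (f x) (fderiv ℝ f x (basisVec i))) := by
      rw [integral_neg, integral_finsetSum _ fun i _ => hi1 i,
        integral_finsetSum _ fun i _ => hi2 i, ← Finset.sum_neg_distrib]
      refine Finset.sum_congr rfl fun i _ => ?_
      rw [hibp i, neg_neg]
    have s3 : ∫ x, -∑ i, X i x * (2 * inner ℝ (f x) (fderiv ℝ f x (basisVec i))) ≤
        ∫ x, ((1 / 2) * (q x * ‖f x‖ ^ 2) + 2 * ‖gradField f x‖ ^ 2) := by
      refine integral_mono (integrable_finsetSum _ fun i _ => hi2 i).neg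
        ((hqf.const_mul _).add (hG.const_mul _)) fun x => ?_
      dsimp only
      have t1 : ∑ i, X i x * (2 * inner ℝ (f x) (fderiv ℝ f x (basisVec i))) =
          2 * q x * inner ℝ (f x) (fderiv ℝ f x (x - a)) := by
        conv_rhs => rw [r3_eq_sum (x - a)]
        rw [map_sum, inner_sum, Finset.mul_sum]
        refine Finset.sum_congr rfl fun i _ => ?_
        rw [map_smul, inner_smul_right]
        simp only [hX, PiLp.sub_apply]; ring
      rw [t1]
      have t2 := abs_real_inner_le_norm (f x) (fderiv ℝ f x (x - a))
      have t3 := norm_fderiv_apply_le f x (x - a)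
      have t4 : ‖f x‖ * ‖fderiv ℝ f x (x - a)‖ ≤ ‖f x‖ * (‖x - a‖ * ‖gradField f x‖) := by gcongr
      have t5 := (neg_le_abs _).trans (t2.trans t4)
      have t6 : 2 * q x * (-inner ℝ (f x) (fderiv ℝ f x (x - a))) ≤
          2 * q x * (‖f x‖ * (‖x - a‖ * ‖gradField f x‖)) :=
        mul_le_mul_of_nonneg_left t5 (by have := hq0 x; positivity)
      have t7 : (q x * ‖x - a‖ * ‖f x‖) ^ 2 ≤ q x * ‖f x‖ ^ 2 := by
        rw [mul_pow]; exact mul_le_mul_of_nonneg_right (hXle x) (sq_nonneg _)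
      nlinarith [sq_nonneg (q x * ‖x - a‖ * ‖f x‖ - 2 * ‖gradField f x‖)]
    rw [integral_add (hqf.const_mul _) (hG.const_mul _), integral_const_mul,
      integral_const_mul] at s3
    linarith
  -- In the ball the weight is at least `1 / (2 r²)`, which produces the constant `8 r² = 2 r² · 4`.
  have hball : ∫ x in Metric.ball a r, ‖f x‖ ^ 2 ≤ 8 * r ^ 2 * ∫ x, ‖gradField f x‖ ^ 2 := by
    calc ∫ x in Metric.ball a r, ‖f x‖ ^ 2
        ≤ ∫ x in Metric.ball a r, 2 * r ^ 2 * (q x * ‖f x‖ ^ 2) := by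
          refine setIntegral_mono_on hN.integrableOn (hqf.const_mul _).integrableOn
            measurableSet_ball fun x hx => ?_
          have hx' : ‖x - a‖ < r := by rwa [Metric.mem_ball, dist_eq_norm] at hx
          have h2 : q x * (‖x - a‖ ^ 2 + r ^ 2) = 1 := inv_mul_cancel₀ (hqpos x).ne'
          have h3 : 1 ≤ 2 * r ^ 2 * q x := by
            have : ‖x - a‖ ^ 2 ≤ r ^ 2 := pow_le_pow_left₀ (norm_nonneg _) hx'.le 2
            nlinarith [hq0 x]
          nlinarith [mul_le_mul_of_nonneg_right h3 (sq_nonneg ‖f x‖)]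
      _ ≤ ∫ x, 2 * r ^ 2 * (q x * ‖f x‖ ^ 2) :=
          setIntegral_le_integral (hqf.const_mul _)
            (Eventually.of_forall fun x => by have := hq0 x; simp only [Pi.zero_apply]; positivity)
      _ ≤ _ := by
          rw [integral_const_mul]
          nlinarith [mul_le_mul_of_nonneg_left hmain (sq_nonneg r)]
  have := ENNReal.ofReal_le_ofReal hball
  rwa [ofReal_integral_norm_sq (h0.restrict _), ENNReal.ofReal_mul (by positivity),
    ofReal_integral_norm_sq h1] at this

end SmoothFields

/-! ### `H¹` fields: Korn and Hardy inequalities, translations and mollification errors -/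

section Sobolev

/-- `v ∈ H¹(ℝ³)`, with weak gradient `A`. -/
structure IsSobolevField (v : R3 → R3) (A : R3 → Grad3) : Prop where
  memLp : MemLp v 2 volume
  grad_memLp : MemLp A 2 volume
  grad : HasWeakGradient v A

variable {v : R3 → R3} {A : R3 → Grad3} {k : R3 → ℝ}

lemma hasCompactSupport_reflect (hs : HasCompactSupport k) (x : R3) :
    HasCompactSupport fun y => k (x - y) :=
  hs.comp_homeomorph (Homeomorph.subLeft x)

lemma integrable_conv_kernel {F : Type*} [NormedAddCommGroup F] [NormedSpace ℝ F] {f : R3 → F}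
    (hk : Continuous k) (hs : HasCompactSupport k) (hf : LocallyIntegrable f) (x : R3) :
    Integrable fun y => k (x - y) • f y :=
  hf.integrable_smul_left_of_hasCompactSupport (hk.comp (continuous_const.sub continuous_id))
    (hasCompactSupport_reflect hs x)

lemma fderiv_reflect (hk : ContDiff ℝ (⊤ : ℕ∞) k) (x y w : R3) :
    fderiv ℝ (fun y => k (x - y)) y w = -fderiv ℝ k (x - y) w := by
  have h := (contDiff_top_differentiable hk (x - y)).hasFDerivAt.comp y
    ((hasFDerivAt_id y).const_sub x)
  change fderiv ℝ (k ∘ HSub.hSub x) y w = _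
  rw [h.fderiv]
  simp

lemma contDiff_reflect (hk : ContDiff ℝ (⊤ : ℕ∞) k) (x : R3) :
    ContDiff ℝ (⊤ : ℕ∞) fun y => k (x - y) :=
  hk.comp (contDiff_const.sub contDiff_id)

/-- Convolution commutes with the weak gradient. -/
lemma gradField_conv (hk : ContDiff ℝ (⊤ : ℕ∞) k) (hs : HasCompactSupport k)
    (h : HasWeakGradient v A) : gradField (conv k v) = conv k A := by
  funext x
  ext1 i
  rw [gradField_apply, fderiv_conv_apply hk hs h.1]
  -- The definition of the weak gradient is tested with the reflected kernel `y ↦ k (x - y)`; the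
  -- sign from the reflection cancels the one from integration by parts.
  have h1 := h.2.2 (fun y => k (x - y)) (contDiff_reflect hk x) (hasCompactSupport_reflect hs x) i
  simp only [fderiv_reflect hk, neg_smul, integral_neg, neg_inj] at h1
  rw [conv, h1, conv]
  have h2 := ((PiLp.proj (𝕜 := ℝ) 2 (fun _ : Fin 3 => R3) i)).integral_comp_comm
    (integrable_conv_kernel hk.continuous hs h.2.1 x)
  simpa using h2

/-- The divergence of the convolution at `x` is the pairing of `v` with the gradient of `y ↦ k (x -
y)`, up to sign, and this vanishes by weak incompressibility. -/
lemma fderiv_conv_trace (hk : ContDiff ℝ (⊤ : ℕ∞) k) (hs : HasCompactSupport k)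
    (hv : LocallyIntegrable v) (hd : IsWeakDivFree v) (x : R3) :
    ∑ i, gradField (conv k v) x i i = 0 := by
  have hint : ∀ i : Fin 3, Integrable fun y => fderiv ℝ k (x - y) (basisVec i) • v y := fun i =>
    integrable_conv_kernel (contDiff_fderiv_apply_const hk _).continuous
      (hs.fderiv_apply (𝕜 := ℝ) (basisVec i)) hv x
  have h1 : ∀ i : Fin 3, gradField (conv k v) x i i =
      ∫ y, fderiv ℝ k (x - y) (basisVec i) * v y i := by
    intro i
    rw [gradField_apply, fderiv_conv_apply hk hs hv, conv]
    have h2 := (EuclideanSpace.proj (𝕜 := ℝ) i).integral_comp_comm (hint i)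
    simpa using h2.symm
  simp only [h1]
  rw [← integral_finsetSum]
  · have h3 := hd (fun y => k (x - y)) (contDiff_reflect hk x) (hasCompactSupport_reflect hs x)
    simp only [fderiv_reflect hk, integral_neg, neg_eq_zero] at h3
    rw [← h3]
    refine integral_congr_ae (Eventually.of_forall fun y => ?_)
    dsimp only
    conv_rhs => rw [r3_eq_sum (v y)]
    simp only [map_sum, map_smul, smul_eq_mul]
    exact Finset.sum_congr rfl fun i _ => mul_comm _ _
  · intro i _
    have := (EuclideanSpace.proj (𝕜 := ℝ) i).integrable_comp (hint i)
    simpa using this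

/-- All derivatives of the convolution fall on the kernel, so first and second derivatives are
square integrable for every `v` in `L²` and the integration by parts for smooth fields applies. -/
lemma integral_norm_sq_gradField_conv_eq (hk : ContDiff ℝ (⊤ : ℕ∞) k) (hs : HasCompactSupport k)
    (hv : MemLp v 2 volume) (hd : IsWeakDivFree v) :
    ∫ x, ∑ i, ∑ j, gradField (conv k v) x i j * gradField (conv k v) x j i = 0 := by
  have hvl := memLp_two_locallyIntegrable hv
  have h1 : ∀ w, (fun x => fderiv ℝ (conv k v) x w) = conv (fun z => fderiv ℝ k z w) v := fun w =>
    funext fun x => fderiv_conv_apply hk hs hvl x w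
  have hk1 : ∀ w, ContDiff ℝ (⊤ : ℕ∞) fun z => fderiv ℝ k z w := contDiff_fderiv_apply_const hk
  have hs1 : ∀ w, HasCompactSupport fun z => fderiv ℝ k z w := fun w => hs.fderiv_apply (𝕜 := ℝ) w
  refine integral_sum_cross_gradient_eq_zero (contDiff_conv hk hs hvl) (memLp_conv hk hs hv) ?_ ?_
    (fderiv_conv_trace hk hs hvl hd)
  · intro w
    rw [h1]
    exact memLp_conv (hk1 w) (hs1 w) hv
  · intro w w'
    rw [h1]
    have h2 : (fun x => fderiv ℝ (conv (fun z => fderiv ℝ k z w) v) x w') =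
        conv (fun z => fderiv ℝ (fun z => fderiv ℝ k z w) z w') v :=
      funext fun x => fderiv_conv_apply (hk1 w) (hs1 w) hvl x w'
    rw [h2]
    exact memLp_conv (contDiff_fderiv_apply_const (hk1 w) w')
      ((hs1 w).fderiv_apply (𝕜 := ℝ) w') hv

lemma memLp_gradField_conv (hk : ContDiff ℝ (⊤ : ℕ∞) k) (hs : HasCompactSupport k)
    (hv : MemLp v 2 volume) : MemLp (gradField (conv k v)) 2 volume := by
  have hvl := memLp_two_locallyIntegrable hv
  have h1 : ∀ i, MemLp (fun x => gradField (conv k v) x i) 2 volume := by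
    intro i
    have : (fun x => gradField (conv k v) x i) = conv (fun z => fderiv ℝ k z (basisVec i)) v :=
      funext fun x => fderiv_conv_apply hk hs hvl x _
    rw [this]
    exact memLp_conv (contDiff_fderiv_apply_const hk _) (hs.fderiv_apply (𝕜 := ℝ) _) hv
  rw [memLp_two_iff_lintegral]
  have hm := (contDiff_gradField (contDiff_conv hk hs hvl)).continuous.aestronglyMeasurable
    (μ := (volume : Measure R3))
  refine ⟨hm, ?_⟩
  have h2 : Integrable fun x => ‖gradField (conv k v) x‖ ^ 2 := by
    have e : ∀ x, ‖gradField (conv k v) x‖ ^ 2 = ∑ i, ‖gradField (conv k v) x i‖ ^ 2 := fun x =>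
      PiLp.norm_sq_eq_of_L2 _ _
    simp only [e]
    exact integrable_finsetSum _ fun i _ => (memLp_two_iff_integrable_sq_norm (h1 i).1).1 (h1 i)
  exact (memLp_two_iff_lintegral.1 ((memLp_two_iff_integrable_sq_norm hm).2 h2)).2

lemma conv_clm {F F' : Type*} [NormedAddCommGroup F] [NormedSpace ℝ F] [CompleteSpace F]
    [NormedAddCommGroup F'] [NormedSpace ℝ F'] [CompleteSpace F'] {f : R3 → F} (L : F →L[ℝ] F')
    (hk : Continuous k) (hs : HasCompactSupport k) (hf : LocallyIntegrable f) (x : R3) :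
    conv k (fun y => L (f y)) x = L (conv k f x) := by
  have := L.integral_comp_comm (integrable_conv_kernel hk hs hf x)
  simpa [conv] using this

/-- Korn's inequality for divergence free fields. -/
lemma lintegral_korn (h : IsSobolevField v A) (hd : IsWeakDivFree v) :
    ∫⁻ x, ‖A x‖ₑ ^ 2 ≤ 2 * ∫⁻ x, ‖symGrad (A x)‖ₑ ^ 2 := by
  have hAl := memLp_two_locallyIntegrable h.grad_memLp
  refine lintegral_le_of_ae_tendsto (F := fun n x => ‖conv (mollifier n) A x‖ₑ ^ 2) ?_ ?_ ?_
  · exact fun n => ((memLp_mollify n h.grad_memLp).1.enorm).pow_const 2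
  · filter_upwards [ae_tendsto_mollify hAl] with x hx
    exact (((ENNReal.continuous_pow 2).tendsto _).comp (continuous_enorm.tendsto _)).comp hx
  · intro n
    have hk := mollifier_contDiff n
    have hs := mollifier_hasCompactSupport n
    have hAn := memLp_mollify n h.grad_memLp
    have hSn : MemLp (fun x => symGrad (conv (mollifier n) A x)) 2 volume :=
      symGrad.comp_memLp' hAn
    have h1 := integral_norm_sq_gradField_conv_eq hk hs h.memLp hd
    rw [gradField_conv hk hs h.grad] at h1
    have hi1 := (memLp_two_iff_integrable_sq_norm hAn.1).1 hAn
    have hi2 := (memLp_two_iff_integrable_sq_norm hSn.1).1 hSn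
    -- For mollified fields Korn's inequality is an equality with constant `2`; Fatou's lemma then
    -- leaves an inequality for `A`.
    have h2 : ∫ x, ‖conv (mollifier n) A x‖ ^ 2 =
        2 * ∫ x, ‖symGrad (conv (mollifier n) A x)‖ ^ 2 := by
      have h3 : ∀ x, ∑ i, ∑ j, conv (mollifier n) A x i j * conv (mollifier n) A x j i =
          2 * ‖symGrad (conv (mollifier n) A x)‖ ^ 2 - ‖conv (mollifier n) A x‖ ^ 2 := by
        intro x
        rw [norm_sq_eq_symGrad (conv (mollifier n) A x)]; ring
      simp only [h3] at h1
      rw [integral_sub (hi2.const_mul 2) hi1, integral_const_mul] at h1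
      linarith
    rw [← ofReal_integral_norm_sq hAn, h2, ENNReal.ofReal_mul (by norm_num),
      ofReal_integral_norm_sq hSn]
    rw [ENNReal.ofReal_ofNat]
    gcongr 2 * ?_
    have h4 : ∀ x, symGrad (conv (mollifier n) A x) = conv (mollifier n) (fun y => symGrad (A y)) x :=
      fun x => (conv_clm symGrad hk.continuous hs hAl x).symm
    simp only [h4]
    exact lintegral_mollify_sq_le n (symGrad.continuous.comp_aestronglyMeasurable h.grad_memLp.1)

/-- A Hardy type inequality: the `L²` norm of an `H¹` field on a small ball. -/
lemma lintegral_hardy (h : IsSobolevField v A) (a : R3) {r : ℝ} (hr : 0 < r) :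
    ∫⁻ x in Metric.ball a r, ‖v x‖ₑ ^ 2 ≤ ENNReal.ofReal (8 * r ^ 2) * ∫⁻ x, ‖A x‖ₑ ^ 2 := by
  have hvl := memLp_two_locallyIntegrable h.memLp
  refine lintegral_le_of_ae_tendsto (F := fun n x => ‖conv (mollifier n) v x‖ₑ ^ 2) ?_ ?_ ?_
  · exact fun n => ((memLp_mollify n h.memLp).1.restrict.enorm).pow_const 2
  · filter_upwards [ae_restrict_of_ae (ae_tendsto_mollify hvl)] with x hx
    exact (((ENNReal.continuous_pow 2).tendsto _).comp (continuous_enorm.tendsto _)).comp hx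
  · intro n
    have hk := mollifier_contDiff n
    have hs := mollifier_hasCompactSupport n
    refine (lintegral_hardy_smooth (contDiff_conv hk hs hvl) (memLp_mollify n h.memLp)
      (memLp_gradField_conv hk hs h.memLp) a hr).trans ?_
    rw [gradField_conv hk hs h.grad]
    exact mul_le_mul_right (lintegral_mollify_sq_le n h.grad_memLp.1) _

/-- The increment is the integral of the derivative along the segment from `x` to `x - y`. Jensen's
inequality in the segment parameter and translation invariance in `x` give the bound. -/
lemma lintegral_translate_smooth {f : R3 → R3} (hf : ContDiff ℝ (⊤ : ℕ∞) f) (y : R3) :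
    ∫⁻ x, ‖f (x - y) - f x‖ₑ ^ 2 ≤ ‖y‖ₑ ^ 2 * ∫⁻ x, ‖gradField f x‖ₑ ^ 2 := by
  have hfd := contDiff_top_differentiable hf
  have hgc : Continuous (gradField f) := (contDiff_gradField hf).continuous
  have hpt : ∀ x, ‖f (x - y) - f x‖ₑ ^ 2 ≤
      ‖y‖ₑ ^ 2 * ∫⁻ s in Ioc (0 : ℝ) 1, ‖gradField f (x - s • y)‖ₑ ^ 2 := by
    intro x
    have hd : ∀ s : ℝ, HasDerivAt (fun s : ℝ => f (x - s • y)) (fderiv ℝ f (x - s • y) (-y)) s := by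
      intro s
      have h1 : HasDerivAt (fun s : ℝ => x - s • y) (-y) s := by
        simpa using ((hasDerivAt_id s).smul_const y).const_sub x
      exact (hfd (x - s • y)).hasFDerivAt.comp_hasDerivAt s h1
    have hc : Continuous fun s : ℝ => fderiv ℝ f (x - s • y) (-y) :=
      ((hf.continuous_fderiv (by simp)).comp (by fun_prop)).clm_apply continuous_const
    have h2 := intervalIntegral.integral_eq_sub_of_hasDerivAt (a := 0) (b := 1) (fun s _ => hd s)
      (hc.intervalIntegrable 0 1)
    simp only [one_smul, zero_smul, sub_zero] at h2
    rw [← h2, intervalIntegral.integral_of_le zero_le_one]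
    have h3 : ‖∫ s in Ioc (0 : ℝ) 1, fderiv ℝ f (x - s • y) (-y)‖ₑ ≤
        ‖y‖ₑ * ∫⁻ s in Ioc (0 : ℝ) 1, ‖gradField f (x - s • y)‖ₑ := by
      refine (enorm_integral_le_lintegral_enorm _).trans ?_
      rw [← lintegral_const_mul' _ _ enorm_ne_top]
      refine lintegral_mono fun s => ?_
      have := norm_fderiv_apply_le f (x - s • y) (-y)
      rw [norm_neg] at this
      have := ENNReal.ofReal_le_ofReal this
      rwa [ENNReal.ofReal_mul (norm_nonneg _), ofReal_norm, ofReal_norm, ofReal_norm] at this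
    refine (pow_le_pow_left' h3 2).trans ?_
    rw [mul_pow]
    gcongr
    have h4 := sq_lintegral_mul_le (μ := volume.restrict (Ioc (0 : ℝ) 1)) (k := fun _ => 1)
      (g := fun s => ‖gradField f (x - s • y)‖ₑ) aemeasurable_const
      (hgc.comp (by fun_prop)).enorm.aemeasurable
    simpa using h4
  calc ∫⁻ x, ‖f (x - y) - f x‖ₑ ^ 2
      ≤ ∫⁻ x, ‖y‖ₑ ^ 2 * ∫⁻ s in Ioc (0 : ℝ) 1, ‖gradField f (x - s • y)‖ₑ ^ 2 :=
        lintegral_mono hpt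
    _ = ‖y‖ₑ ^ 2 * ∫⁻ x, ∫⁻ s in Ioc (0 : ℝ) 1, ‖gradField f (x - s • y)‖ₑ ^ 2 :=
        lintegral_const_mul' _ _ (by finiteness)
    _ = ‖y‖ₑ ^ 2 * ∫⁻ s in Ioc (0 : ℝ) 1, ∫⁻ x, ‖gradField f (x - s • y)‖ₑ ^ 2 := by
        congr 1
        refine lintegral_lintegral_swap ?_
        have : Continuous fun p : R3 × ℝ => ‖gradField f (p.1 - p.2 • y)‖ₑ ^ 2 :=
          (ENNReal.continuous_pow 2).comp ((hgc.comp (by fun_prop)).enorm)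
        exact this.aemeasurable
    _ = ‖y‖ₑ ^ 2 * ∫⁻ s in Ioc (0 : ℝ) 1, ∫⁻ x, ‖gradField f x‖ₑ ^ 2 := by
        congr 1
        refine lintegral_congr fun s => ?_
        exact lintegral_sub_right_eq_self (fun x => ‖gradField f x‖ₑ ^ 2) (s • y)
    _ = _ := by simp

/-- Translations of `H¹` fields are controlled by the gradient. -/
lemma lintegral_translate (h : IsSobolevField v A) (y : R3) :
    ∫⁻ x, ‖v (x - y) - v x‖ₑ ^ 2 ≤ ‖y‖ₑ ^ 2 * ∫⁻ x, ‖A x‖ₑ ^ 2 := by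
  have hvl := memLp_two_locallyIntegrable h.memLp
  refine lintegral_le_of_ae_tendsto (F := fun n x =>
    ‖conv (mollifier n) v (x - y) - conv (mollifier n) v x‖ₑ ^ 2) ?_ ?_ ?_
  · intro n
    have hc := (contDiff_conv (mollifier_contDiff n) (mollifier_hasCompactSupport n) hvl).continuous
    exact ((hc.comp (continuous_id.sub continuous_const)).sub hc).enorm.aemeasurable.pow_const 2
  · have h1 := ae_tendsto_mollify hvl
    have h2 := (measurePreserving_sub_right (volume : Measure R3) y).quasiMeasurePreserving.ae h1
    filter_upwards [h1, h2] with x hx hx2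
    exact (((ENNReal.continuous_pow 2).tendsto _).comp (continuous_enorm.tendsto _)).comp (hx2.sub hx)
  · intro n
    refine (lintegral_translate_smooth (contDiff_conv (mollifier_contDiff n)
      (mollifier_hasCompactSupport n) hvl) y).trans ?_
    rw [gradField_conv (mollifier_contDiff n) (mollifier_hasCompactSupport n) h.grad]
    exact mul_le_mul_right (lintegral_mollify_sq_le n h.grad_memLp.1) _

/-- The mollification error of an `H¹` field is controlled by the gradient. -/
lemma lintegral_mollify_sub (h : IsSobolevField v A) (n : ℕ) :
    ∫⁻ x, ‖conv (mollifier n) v x - v x‖ₑ ^ 2 ≤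
      ENNReal.ofReal (1 / (n + 1)) ^ 2 * ∫⁻ x, ‖A x‖ₑ ^ 2 := by
  have hk := mollifier_contDiff n
  have hs := mollifier_hasCompactSupport n
  have hvl := memLp_two_locallyIntegrable h.memLp
  have hpt : ∀ x, ‖conv (mollifier n) v x - v x‖ₑ ^ 2 ≤
      ∫⁻ y, ‖mollifier n y‖ₑ * ‖v (x - y) - v x‖ₑ ^ 2 := by
    intro x
    have e1 : conv (mollifier n) v x = ∫ y, mollifier n y • v (x - y) := by
      rw [conv, ← integral_sub_left_eq_self _ volume x]
      simp
    have hi : Integrable fun y => mollifier n y • v (x - y) := by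
      have := (integrable_conv_kernel hk.continuous hs hvl x).comp_sub_left x
      simpa using this
    have hi2 : Integrable fun y => mollifier n y • v x :=
      ((hk.continuous.integrable_of_hasCompactSupport hs)).smul_const _
    have e2 : v x = ∫ y, mollifier n y • v x := by
      rw [integral_smul_const, mollifier, ContDiffBump.integral_normed, one_smul]
    have e3 : conv (mollifier n) v x - v x = ∫ y, mollifier n y • (v (x - y) - v x) := by
      conv_lhs => rw [e1, e2]
      rw [← integral_sub hi hi2]
      simp only [smul_sub]
    rw [e3]
    have h1 : ‖∫ y, mollifier n y • (v (x - y) - v x)‖ₑ ≤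
        ∫⁻ y, ‖mollifier n y‖ₑ * ‖v (x - y) - v x‖ₑ := by
      refine (enorm_integral_le_lintegral_enorm _).trans (lintegral_mono fun y => ?_)
      rw [enorm_smul]
    refine (pow_le_pow_left' h1 2).trans ?_
    have hvm : AEStronglyMeasurable (fun y => v (x - y)) volume :=
      h.memLp.1.comp_measurePreserving (Measure.measurePreserving_sub_left volume x)
    -- The mollification error is an average of increments `v (x - y) - v x`, and the square of an
    -- average is at most the average of the squares.
    have h2 := sq_lintegral_mul_le (μ := (volume : Measure R3)) (k := fun y => ‖mollifier n y‖ₑ)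
      (g := fun y => ‖v (x - y) - v x‖ₑ) hk.continuous.enorm.aemeasurable
      (hvm.sub aestronglyMeasurable_const).enorm
    rwa [lintegral_mollifier, one_mul] at h2
  calc ∫⁻ x, ‖conv (mollifier n) v x - v x‖ₑ ^ 2
      ≤ ∫⁻ x, ∫⁻ y, ‖mollifier n y‖ₑ * ‖v (x - y) - v x‖ₑ ^ 2 := lintegral_mono hpt
    _ = ∫⁻ y, ∫⁻ x, ‖mollifier n y‖ₑ * ‖v (x - y) - v x‖ₑ ^ 2 := by
        refine lintegral_lintegral_swap ?_
        have m1 : AEMeasurable (fun p : R3 × R3 => ‖mollifier n p.2‖ₑ) (volume.prod volume) :=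
          (hk.continuous.comp continuous_snd).enorm.aemeasurable
        have m2 : AEStronglyMeasurable (fun p : R3 × R3 => v (p.1 - p.2)) (volume.prod volume) :=
          h.memLp.1.comp_quasiMeasurePreserving
            (quasiMeasurePreserving_sub_of_right_invariant volume volume)
        have m3 : AEStronglyMeasurable (fun p : R3 × R3 => v p.1) (volume.prod volume) :=
          h.memLp.1.comp_fst
        exact m1.mul ((m2.sub m3).enorm.pow_const 2)
    _ ≤ ∫⁻ y, ‖mollifier n y‖ₑ *
          (ENNReal.ofReal (1 / (n + 1)) ^ 2 * ∫⁻ x, ‖A x‖ₑ ^ 2) := by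
        refine lintegral_mono fun y => ?_
        rw [lintegral_const_mul' _ _ enorm_ne_top]
        -- Only shifts shorter than the radius of the mollifier contribute.
        rcases le_or_gt (1 / ((n : ℝ) + 1)) ‖y‖ with hy | hy
        · rw [mollifier_eq_zero hy]; simp
        · gcongr
          refine (lintegral_translate h y).trans ?_
          gcongr
          rw [← ofReal_norm]
          exact ENNReal.ofReal_le_ofReal hy.le
    _ = _ := by
        rw [lintegral_mul_const'' _ hk.continuous.enorm.aemeasurable, lintegral_mollifier, one_mul]

end Sobolev

/-! ### Weak formulations for `H¹` fields, and solenoidal test fields -/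

section TestFields

/-- Convergence of integrals whose integrands depend on a convergent sequence in `L²`. -/
lemma tendsto_integral_of_tendsto_two {α F : Type*} [MeasurableSpace α] {μ : Measure α}
    [NormedAddCommGroup F] {a : ℕ → α → F} {b : α → F} {c : α → ℝ} {f : ℕ → α → ℝ} {g : α → ℝ}
    (ha : Tendsto (fun n => ∫⁻ x, ‖a n x - b x‖ₑ ^ 2 ∂μ) atTop (𝓝 0))
    (ham : ∀ n, AEStronglyMeasurable (a n) μ) (hbm : AEStronglyMeasurable b μ)
    (hc : MemLp c 2 μ) (hf : ∀ n, Integrable (f n) μ) (hg : Integrable g μ)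
    (hle : ∀ n, ∀ᵐ x ∂μ, |f n x - g x| ≤ c x * ‖a n x - b x‖) :
    Tendsto (fun n => ∫ x, f n x ∂μ) atTop (𝓝 (∫ x, g x ∂μ)) := by
  refine tendsto_integral_of_L1 g hg.1 (Eventually.of_forall hf) ?_
  have hb : ∀ n, ∫⁻ x, ‖f n x - g x‖ₑ ∂μ ≤
      (∫⁻ x, ‖c x‖ₑ ^ 2 ∂μ) ^ (1 / 2 : ℝ) * (∫⁻ x, ‖a n x - b x‖ₑ ^ 2 ∂μ) ^ (1 / 2 : ℝ) := by
    intro n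
    calc ∫⁻ x, ‖f n x - g x‖ₑ ∂μ ≤ ∫⁻ x, ‖c x‖ₑ * ‖a n x - b x‖ₑ ∂μ := by
          refine lintegral_mono_ae ?_
          filter_upwards [hle n] with x hx
          rw [← enorm_norm (a n x - b x), ← enorm_mul]
          refine enorm_le_iff_norm_le.2 ?_
          exact hx.trans (le_abs_self _)
      _ ≤ _ := by
          have := ENNReal.lintegral_mul_le_Lp_mul_Lq μ Real.HolderConjugate.two_two
            hc.1.enorm ((ham n).sub hbm).enorm
          simpa using this
  have hlim : Tendsto (fun n => (∫⁻ x, ‖c x‖ₑ ^ 2 ∂μ) ^ (1 / 2 : ℝ) *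
      (∫⁻ x, ‖a n x - b x‖ₑ ^ 2 ∂μ) ^ (1 / 2 : ℝ)) atTop (𝓝 0) := by
    have h1 := (ENNReal.continuous_rpow_const (y := 1 / 2)).tendsto 0 |>.comp ha
    rw [ENNReal.zero_rpow_of_pos (by norm_num)] at h1
    have h2 := ENNReal.Tendsto.const_mul (a := (∫⁻ x, ‖c x‖ₑ ^ 2 ∂μ) ^ (1 / 2 : ℝ)) h1
      (Or.inr (ENNReal.rpow_ne_top_of_nonneg (by norm_num) (memLp_two_iff_lintegral.1 hc).2.ne))
    simpa using h2
  exact tendsto_of_tendsto_of_tendsto_of_le_of_le tendsto_const_nhds hlim (fun _ => zero_le) hb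

lemma memLp_of_contDiff {F : Type*} [NormedAddCommGroup F] {f : R3 → F} (hf : Continuous f)
    (hs : HasCompactSupport f) (p : ℝ≥0∞) : MemLp f p volume :=
  hf.memLp_of_hasCompactSupport hs

/-- Smooth compactly supported fields have their gradient as a weak gradient. -/
lemma hasWeakGradient_gradField {f : R3 → R3} (hf : ContDiff ℝ (⊤ : ℕ∞) f)
    (hs : HasCompactSupport f) : HasWeakGradient f (gradField f) := by
  have hg := contDiff_gradField hf
  refine ⟨hf.continuous.locallyIntegrable, hg.continuous.locallyIntegrable, fun ψ hψ hψs i => ?_⟩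
  have hψd := contDiff_top_differentiable hψ
  have hψc : Continuous fun x => fderiv ℝ ψ x (basisVec i) :=
    (contDiff_fderiv_apply_const hψ _).continuous
  have hfc : Continuous fun x => fderiv ℝ f x (basisVec i) :=
    (hf.continuous_fderiv (by simp)).clm_apply continuous_const
  have := integral_bilinear_hasLineDerivAt_right_eq_neg_left_of_integrable
    (μ := (volume : Measure R3)) (f := ψ) (f' := fun x => fderiv ℝ ψ x (basisVec i)) (g := f)
    (g' := fun x => fderiv ℝ f x (basisVec i)) (v := basisVec i)
    (B := (ContinuousLinearMap.lsmul ℝ ℝ : ℝ →L[ℝ] R3 →L[ℝ] R3))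
    ((hψc.smul hf.continuous).integrable_of_hasCompactSupport hs.smul_left)
    ((hψ.continuous.smul hfc).integrable_of_hasCompactSupport hψs.smul_right)
    ((hψ.continuous.smul hf.continuous).integrable_of_hasCompactSupport hψs.smul_right)
    (fun x _ => (hψd x).hasFDerivAt.hasLineDerivAt _)
    (fun x _ => (contDiff_top_differentiable hf x).hasFDerivAt.hasLineDerivAt _)
  simp only [ContinuousLinearMap.lsmul_apply] at this
  rw [← neg_eq_iff_eq_neg, ← this]
  rfl

lemma isSobolevField_gradField {f : R3 → R3} (hf : ContDiff ℝ (⊤ : ℕ∞) f)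
    (hs : HasCompactSupport f) : IsSobolevField f (gradField f) where
  memLp := memLp_of_contDiff hf.continuous hs 2
  grad_memLp := memLp_of_contDiff (contDiff_gradField hf).continuous
    (hasCompactSupport_gradField hs) 2
  grad := hasWeakGradient_gradField hf hs

/-- Smooth fields with pointwise vanishing divergence are weakly divergence free. -/
lemma isWeakDivFree_of_trace {f : R3 → R3} (hf : ContDiff ℝ (⊤ : ℕ∞) f)
    (hd : ∀ x, ∑ i, gradField f x i i = 0) : IsWeakDivFree f := by
  intro ψ hψ hψs
  have hψc : ∀ i, Continuous fun x => fderiv ℝ ψ x (basisVec i) := fun i =>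
    (contDiff_fderiv_apply_const hψ _).continuous
  have hfd := contDiff_top_differentiable hf
  have hfic : ∀ i, Continuous fun x => f x i := fun i =>
    (EuclideanSpace.proj (𝕜 := ℝ) i).continuous.comp hf.continuous
  have hfc : ∀ i, Continuous fun x => fderiv ℝ f x (basisVec i) i := fun i =>
    (EuclideanSpace.proj (𝕜 := ℝ) i).continuous.comp
      ((hf.continuous_fderiv (by simp)).clm_apply continuous_const)
  have i1 : ∀ i, Integrable fun x => ψ x * fderiv ℝ f x (basisVec i) i := fun i =>
    (hψ.continuous.mul (hfc i)).integrable_of_hasCompactSupport hψs.mul_right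
  have i2 : ∀ i, Integrable fun x => fderiv ℝ ψ x (basisVec i) * f x i := fun i =>
    ((hψc i).mul (hfic i)).integrable_of_hasCompactSupport
      (hψs.fderiv_apply (𝕜 := ℝ) _).mul_right
  have hibp : ∀ i, ∫ x, fderiv ℝ ψ x (basisVec i) * f x i =
      -∫ x, ψ x * fderiv ℝ f x (basisVec i) i := by
    intro i
    have := integral_mul_fderiv_eq_neg_fderiv_mul_of_integrable (μ := (volume : Measure R3))
      (f := ψ) (g := fun x => f x i) (v := basisVec i) (i2 i)
      (by simpa only [fun x => fderiv_coord (hfd x) (basisVec i) i] using i1 i)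
      ((hψ.continuous.mul (hfic i)).integrable_of_hasCompactSupport hψs.mul_right)
      (fun x _ => contDiff_top_differentiable hψ x)
      (fun x _ => (EuclideanSpace.proj (𝕜 := ℝ) i).differentiableAt.comp x (hfd x))
    simp only [fun x => fderiv_coord (hfd x) (basisVec i) i] at this
    rw [this, neg_neg]
  calc ∫ x, fderiv ℝ ψ x (f x) = ∫ x, ∑ i, fderiv ℝ ψ x (basisVec i) * f x i := by
        refine integral_congr_ae (Eventually.of_forall fun x => ?_)
        dsimp only
        conv_lhs => rw [r3_eq_sum (f x)]
        simp only [map_sum, map_smul, smul_eq_mul]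
        exact Finset.sum_congr rfl fun i _ => mul_comm _ _
    _ = -∫ x, ∑ i, ψ x * fderiv ℝ f x (basisVec i) i := by
        rw [integral_finsetSum _ fun i _ => i2 i, integral_finsetSum _ fun i _ => i1 i,
          ← Finset.sum_neg_distrib]
        exact Finset.sum_congr rfl fun i _ => hibp i
    _ = 0 := by
        simp only [← Finset.mul_sum]
        have : ∀ x, ∑ i, fderiv ℝ f x (basisVec i) i = 0 := hd
        simp [this]

variable {v : R3 → R3} {A : R3 → Grad3}

/-- For divergence free test fields, `2 ∫ D(v) : D(φ) = ∫ ∇v : ∇φ`. -/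
lemma two_mul_integral_deform (h : IsSobolevField v A) {φ : R3 → R3}
    (hφ : ContDiff ℝ (⊤ : ℕ∞) φ) (hs : HasCompactSupport φ)
    (hd : ∀ x, ∑ i, gradField φ x i i = 0) :
    2 * ∫ x, ddot (deform (A x)) (deform (gradField φ x)) =
      ∫ x, ddot (gradMatrix (A x)) (gradMatrix (gradField φ x)) := by
  have hg := contDiff_gradField hφ
  have hgs := hasCompactSupport_gradField hs
  have hgm : MemLp (gradField φ) 2 volume := memLp_of_contDiff hg.continuous hgs 2
  have hAc : ∀ i j, MemLp (fun x => A x i j) 2 volume := fun i j =>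
    h.grad_memLp.of_le ((EuclideanSpace.proj (𝕜 := ℝ) j).continuous.comp_aestronglyMeasurable
      ((PiLp.proj (𝕜 := ℝ) 2 (fun _ : Fin 3 => R3) i).continuous.comp_aestronglyMeasurable
        h.grad_memLp.1)) (Eventually.of_forall fun x => abs_apply_le_norm (A x) i j)
  have hgc : ∀ i j, ContDiff ℝ (⊤ : ℕ∞) fun x => gradField φ x i j := fun i j =>
    (EuclideanSpace.proj (𝕜 := ℝ) j).contDiff.comp
      ((PiLp.proj (𝕜 := ℝ) 2 (fun _ : Fin 3 => R3) i).contDiff.comp hg)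
  have hgcs : ∀ i j, HasCompactSupport fun x => gradField φ x i j := fun i j =>
    hgs.comp_left (g := fun B : Grad3 => B i j) rfl
  have hgcm : ∀ i j, MemLp (fun x => gradField φ x i j) 2 volume := fun i j =>
    memLp_of_contDiff (hgc i j).continuous (hgcs i j) 2
  have hgdm : ∀ i j, MemLp (fun x => fderiv ℝ (fun y => gradField φ y j i) x (basisVec i)) 2
      volume := fun i j =>
    memLp_of_contDiff (contDiff_fderiv_apply_const (hgc j i) _).continuous
      ((hgcs j i).fderiv_apply (𝕜 := ℝ) _) 2
  -- the transposed part vanishes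
  have hz : ∫ x, ∑ i, ∑ j, A x i j * gradField φ x j i = 0 := by
    rw [integral_finsetSum _ fun i _ => integrable_finsetSum _ fun j _ =>
      integrable_mul_of_memLp_two (hAc i j) (hgcm j i)]
    simp only [fun i => integral_finsetSum (μ := (volume : Measure R3)) Finset.univ
      (fun j _ => integrable_mul_of_memLp_two (hAc i j) (hgcm j i))]
    -- The weak gradient is tested with the scalar function `∂ⱼ φᵢ`. After summation over `i` the
    -- derivatives on `φ` form `∂ⱼ (div φ)`, which is zero.
    have hterm : ∀ i j : Fin 3, ∫ x, A x i j * gradField φ x j i =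
        -∫ x, fderiv ℝ (fun y => gradField φ y j i) x (basisVec i) * v x j := by
      intro i j
      have h1 := h.grad.2.2 (fun x => gradField φ x j i) (hgc j i) (hgcs j i) i
      have h2 := congrArg (fun w : R3 => w j) h1
      have e1 := (EuclideanSpace.proj (𝕜 := ℝ) j).integral_comp_comm
        (h.grad.1.integrable_smul_left_of_hasCompactSupport
          (contDiff_fderiv_apply_const (hgc j i) (basisVec i)).continuous
          ((hgcs j i).fderiv_apply (𝕜 := ℝ) _))
      have hAi : LocallyIntegrable fun x => A x i :=
        memLp_two_locallyIntegrable (h.grad_memLp.of_le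
          ((PiLp.proj (𝕜 := ℝ) 2 (fun _ : Fin 3 => R3) i).continuous.comp_aestronglyMeasurable
            h.grad_memLp.1) (Eventually.of_forall fun x => PiLp.norm_apply_le (A x) i))
      have e2 := (EuclideanSpace.proj (𝕜 := ℝ) j).integral_comp_comm
        (hAi.integrable_smul_left_of_hasCompactSupport (hgc j i).continuous (hgcs j i))
      simp only [PiLp.proj_apply, PiLp.smul_apply, smul_eq_mul, PiLp.neg_apply] at e1 e2 h2
      rw [e1, h2, neg_neg, ← e2]
      refine integral_congr_ae (Eventually.of_forall fun x => mul_comm _ _)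
    simp only [hterm]
    rw [Finset.sum_comm]
    refine Finset.sum_eq_zero fun j _ => ?_
    rw [Finset.sum_neg_distrib, ← integral_finsetSum _ fun i _ =>
      integrable_mul_of_memLp_two (hgdm i j) (memLp_coord h.memLp j), neg_eq_zero]
    refine integral_eq_zero_of_ae (Eventually.of_forall fun x => ?_)
    simp only [← Finset.sum_mul, Pi.zero_apply]
    have hsymm : ∀ i, fderiv ℝ (fun y => gradField φ y j i) x (basisVec i) =
        fderiv ℝ (fun y => gradField φ y i i) x (basisVec j) := by
      intro i
      have hd1 : DifferentiableAt ℝ (fderiv ℝ φ) x :=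
        contDiff_top_differentiable (hφ.fderiv_right (m := (⊤ : ℕ∞)) (by exact_mod_cast le_rfl)) x
      have hs1 : IsSymmSndFDerivAt ℝ φ x := hφ.contDiffAt.isSymmSndFDerivAt (by
        simpa using (WithTop.coe_le_coe.2 (le_top : (2 : ℕ∞) ≤ ⊤)))
      have e : ∀ w w' : R3, fderiv ℝ (fun y => fderiv ℝ φ y w i) x w' =
          fderiv ℝ (fderiv ℝ φ) x w' w i := by
        intro w w'
        have hda : DifferentiableAt ℝ (fun y => fderiv ℝ φ y w) x :=
          hd1.clm_apply (differentiableAt_const _)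
        rw [fderiv_coord hda, fderiv_clm_apply hd1 (differentiableAt_const _)]
        simp
      simp only [gradField_apply]
      rw [e, e, hs1]
    simp only [hsymm]
    have hsum : ∑ i, fderiv ℝ (fun y => gradField φ y i i) x (basisVec j) = 0 := by
      have hzz : (fun y => ∑ i, gradField φ y i i) = fun _ => (0 : ℝ) := funext hd
      have h3 : fderiv ℝ (fun y => ∑ i, gradField φ y i i) x (basisVec j) = 0 := by
        rw [hzz]; simp
      rwa [fderiv_fun_sum fun i _ => contDiff_top_differentiable (hgc i i) x,
        _root_.sum_apply] at h3
    rw [hsum, zero_mul]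
  have e1 : ∀ x, 2 * ddot (deform (A x)) (deform (gradField φ x)) =
      ddot (gradMatrix (A x)) (gradMatrix (gradField φ x)) +
        ∑ i, ∑ j, A x i j * gradField φ x j i := by
    intro x
    rw [ddot_gradMatrix, grad3_inner]
    simp only [ddot, deform_apply, Fin.sum_univ_three]
    ring
  rw [← integral_const_mul]
  simp only [e1]
  rw [integral_add, hz, add_zero]
  · simp only [ddot_gradMatrix]
    exact integrable_inner_of_memLp_two h.grad_memLp hgm
  · exact integrable_finsetSum _ fun i _ => integrable_finsetSum _ fun j _ =>
      integrable_mul_of_memLp_two (hAc i j) (hgcm j i)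

lemma convect_sub (w : R3) (A B : Grad3) : convect w (A - B) = convect w A - convect w B := by
  simp [convect, smul_sub]

lemma continuous_convect : Continuous fun p : R3 × Grad3 => convect p.1 p.2 := by
  unfold convect; fun_prop

lemma exists_bound_of_continuous {F : Type*} [NormedAddCommGroup F] {f : R3 → F}
    (hf : Continuous f) (hs : HasCompactSupport f) : ∃ C : ℝ, 0 ≤ C ∧ ∀ x, ‖f x‖ ≤ C := by
  obtain ⟨C, hC⟩ := hf.bounded_above_of_compact_support hs
  exact ⟨C, (norm_nonneg _).trans (hC 0), hC⟩

/-- Integration by parts in the nonlinear term. -/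
lemma integral_inner_convect (h : IsSobolevField v A) (hd : IsWeakDivFree v) {φ : R3 → R3}
    (hφ : ContDiff ℝ (⊤ : ℕ∞) φ) (hs : HasCompactSupport φ) :
    ∫ x, inner ℝ (v x) (convect (v x) (gradField φ x)) =
      -∫ x, inner ℝ (convect (v x) (A x)) (φ x) := by
  have hvl := memLp_two_locallyIntegrable h.memLp
  have hg := contDiff_gradField hφ
  obtain ⟨C, hC0, hC⟩ := exists_bound_of_continuous hφ.continuous hs
  obtain ⟨C', hC0', hC'⟩ :=
    exists_bound_of_continuous hg.continuous (hasCompactSupport_gradField hs)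
  have hvn := h.memLp.norm
  -- integrability of the two kinds of terms
  have int1 : ∀ {w : R3 → R3}, MemLp w 2 volume →
      Integrable fun x => inner ℝ (w x) (convect (v x) (gradField φ x)) := by
    intro w hw
    refine ((hw.norm.integrable_mul hvn).mul_const C').mono
      (hw.1.inner (continuous_convect.comp_aestronglyMeasurable
        (h.memLp.1.prodMk hg.continuous.aestronglyMeasurable)))
      (Eventually.of_forall fun x => ?_)
    refine (norm_inner_le_norm _ _).trans ?_
    have := norm_convect_le (v x) (gradField φ x)
    simp only [Pi.mul_apply, norm_mul, norm_norm, Real.norm_of_nonneg hC0']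
    rw [mul_assoc]
    gcongr
    exact this.trans (by gcongr; exact hC' x)
  have int2 : ∀ {B : R3 → Grad3}, MemLp B 2 volume →
      Integrable fun x => inner ℝ (convect (v x) (B x)) (φ x) := by
    intro B hB
    refine ((hvn.integrable_mul hB.norm).mul_const C).mono
      ((continuous_convect.comp_aestronglyMeasurable (h.memLp.1.prodMk hB.1)).inner
        hφ.continuous.aestronglyMeasurable)
      (Eventually.of_forall fun x => ?_)
    refine (norm_inner_le_norm _ _).trans ?_
    have := norm_convect_le (v x) (B x)
    simp only [Pi.mul_apply, norm_mul, norm_norm, Real.norm_of_nonneg hC0]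
    gcongr
    exact hC x
  -- The incompressibility of `v` is tested with the scalar `vₙ · φ`, where `vₙ` is the mollified
  -- field. Only the factor that is differentiated gets mollified; the transporting field stays `v`,
  -- and its weak incompressibility can be used as it stands.
  have hkey : ∀ n, ∫ x, inner ℝ (conv (mollifier n) v x) (convect (v x) (gradField φ x)) =
      -∫ x, inner ℝ (convect (v x) (conv (mollifier n) A x)) (φ x) := by
    intro n
    have hk := mollifier_contDiff n
    have hks := mollifier_hasCompactSupport n
    have hsm := contDiff_conv hk hks hvl
    have h1 := hd (fun x => inner ℝ (conv (mollifier n) v x) (φ x)) (hsm.inner ℝ hφ)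
      (hs.mono fun x hx hx0 => hx (by simp [hx0]))
    have h2 : ∀ x, fderiv ℝ (fun x => inner ℝ (conv (mollifier n) v x) (φ x)) x (v x) =
        inner ℝ (conv (mollifier n) v x) (convect (v x) (gradField φ x)) +
          inner ℝ (convect (v x) (conv (mollifier n) A x)) (φ x) := by
      intro x
      rw [fderiv_inner_apply ℝ (contDiff_top_differentiable hsm x)
        (contDiff_top_differentiable hφ x), fderiv_eq_convect, fderiv_eq_convect,
        gradField_conv hk hks h.grad]
    simp only [h2] at h1
    rw [integral_add (int1 (memLp_mollify n h.memLp)) (int2 (memLp_mollify n h.grad_memLp))] at h1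
    linarith
  have t1 : Tendsto (fun n => ∫ x, inner ℝ (conv (mollifier n) v x)
      (convect (v x) (gradField φ x))) atTop
      (𝓝 (∫ x, inner ℝ (v x) (convect (v x) (gradField φ x)))) := by
    refine tendsto_integral_of_tendsto_two (tendsto_mollify_two h.memLp)
      (fun n => (memLp_mollify n h.memLp).1) h.memLp.1 (hvn.mul_const C')
      (fun n => int1 (memLp_mollify n h.memLp)) (int1 h.memLp)
      (fun n => Eventually.of_forall fun x => ?_)
    rw [← inner_sub_left]
    refine (abs_real_inner_le_norm _ _).trans ?_
    rw [mul_comm]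
    gcongr
    exact (norm_convect_le _ _).trans (by gcongr; exact hC' x)
  have t2 : Tendsto (fun n => ∫ x, inner ℝ (convect (v x) (conv (mollifier n) A x)) (φ x)) atTop
      (𝓝 (∫ x, inner ℝ (convect (v x) (A x)) (φ x))) := by
    refine tendsto_integral_of_tendsto_two (tendsto_mollify_two h.grad_memLp)
      (fun n => (memLp_mollify n h.grad_memLp).1) h.grad_memLp.1 (hvn.mul_const C)
      (fun n => int2 (memLp_mollify n h.grad_memLp)) (int2 h.grad_memLp)
      (fun n => Eventually.of_forall fun x => ?_)
    rw [← inner_sub_left, ← convect_sub]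
    refine (abs_real_inner_le_norm _ _).trans ?_
    calc ‖convect (v x) (conv (mollifier n) A x - A x)‖ * ‖φ x‖
        ≤ (‖v x‖ * ‖conv (mollifier n) A x - A x‖) * C := by
          gcongr
          · exact norm_convect_le _ _
          · exact hC x
      _ = _ := by ring
  exact tendsto_nhds_unique t1 (t2.neg.congr fun n => (hkey n).symm)

/-- The smooth compactly supported divergence free vector fields. -/
structure IsSolenoidalTest (ζ : R3 → R3) : Prop where
  contDiff : ContDiff ℝ (⊤ : ℕ∞) ζ
  hasCompactSupport : HasCompactSupport ζ
  divFree : ∀ x, ∑ i, gradField ζ x i i = 0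

/-- The field `∂ᵢψ eⱼ - ∂ⱼψ eᵢ`. -/
def planarCurl (ψ : R3 → ℝ) (i j : Fin 3) (x : R3) : R3 :=
  fderiv ℝ ψ x (basisVec i) • basisVec j - fderiv ℝ ψ x (basisVec j) • basisVec i

/-- The divergence is `∂ⱼ∂ᵢψ - ∂ᵢ∂ⱼψ`. These fields are the components of curls, and orthogonality
to all of them expresses that a field is curl free. -/
lemma isSolenoidalTest_planarCurl {ψ : R3 → ℝ} (hψ : ContDiff ℝ (⊤ : ℕ∞) ψ)
    (hs : HasCompactSupport ψ) (i j : Fin 3) : IsSolenoidalTest (planarCurl ψ i j) where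
  contDiff := ((contDiff_fderiv_apply_const hψ _).smul contDiff_const).sub
    ((contDiff_fderiv_apply_const hψ _).smul contDiff_const)
  hasCompactSupport := ((hs.fderiv_apply (𝕜 := ℝ) _).smul_right).sub
    ((hs.fderiv_apply (𝕜 := ℝ) _).smul_right)
  divFree := by
    intro x
    have hd1 : DifferentiableAt ℝ (fderiv ℝ ψ) x :=
      contDiff_top_differentiable (hψ.fderiv_right (m := (⊤ : ℕ∞)) (by exact_mod_cast le_rfl)) x
    have hs1 : IsSymmSndFDerivAt ℝ ψ x := hψ.contDiffAt.isSymmSndFDerivAt (by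
      simpa using (WithTop.coe_le_coe.2 (le_top : (2 : ℕ∞) ≤ ⊤)))
    have hda : ∀ w, HasFDerivAt (fun y => fderiv ℝ ψ y w)
        ((fderiv ℝ (fderiv ℝ ψ) x).flip w) x := by
      intro w
      simpa using hd1.hasFDerivAt.clm_apply (hasFDerivAt_const w x)
    have h1 : ∀ l, gradField (planarCurl ψ i j) x l =
        fderiv ℝ (fderiv ℝ ψ) x (basisVec l) (basisVec i) • basisVec j -
          fderiv ℝ (fderiv ℝ ψ) x (basisVec l) (basisVec j) • basisVec i := by
      intro l
      have h2 : HasFDerivAt (planarCurl ψ i j) _ x :=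
        ((hda (basisVec i)).smul_const (basisVec j)).sub
          ((hda (basisVec j)).smul_const (basisVec i))
      rw [gradField_apply, h2.fderiv]
      simp
    simp only [h1]
    have h3 := hs1 (basisVec i) (basisVec j)
    have h4 : ∀ (a : Fin 3) (w : R3), ∑ l, fderiv ℝ (fderiv ℝ ψ) x (basisVec l) w *
        basisVec a l = fderiv ℝ (fderiv ℝ ψ) x (basisVec a) w := by
      intro a w
      rw [Finset.sum_eq_single a]
      · simp [basisVec]
      · intro l _ hl
        simp [basisVec, hl]
      · simp
    simp only [PiLp.sub_apply, PiLp.smul_apply, smul_eq_mul, Finset.sum_sub_distrib, h4]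
    rw [hs1, sub_self]

/-- A divergence free field of `L²` that is orthogonal to all divergence free test fields
vanishes. -/
lemma ae_eq_zero_of_orthogonal_solenoidal (hv : MemLp v 2 volume) (hd : IsWeakDivFree v)
    (horth : ∀ ζ, IsSolenoidalTest ζ → ∫ x, inner ℝ (v x) (ζ x) = 0) : v =ᵐ[volume] 0 := by
  have hvl := memLp_two_locallyIntegrable hv
  have hzero : ∀ n, conv (mollifier n) v = 0 := by
    intro n
    have hk := mollifier_contDiff n
    have hs := mollifier_hasCompactSupport n
    set f := conv (mollifier n) v with hf
    have hfs : ContDiff ℝ (⊤ : ℕ∞) f := contDiff_conv hk hs hvl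
    have hint : ∀ (x w : R3), Integrable fun y => fderiv ℝ (mollifier n) (x - y) w • v y :=
      fun x w => integrable_conv_kernel (contDiff_fderiv_apply_const hk _).continuous
        (hs.fderiv_apply (𝕜 := ℝ) w) hvl x
    have hgrad : ∀ x i j, gradField f x i j =
        ∫ y, fderiv ℝ (mollifier n) (x - y) (basisVec i) * v y j := by
      intro x i j
      rw [gradField_apply, fderiv_conv_apply hk hs hvl, conv]
      have h2 := (EuclideanSpace.proj (𝕜 := ℝ) j).integral_comp_comm (hint x (basisVec i))
      simpa using h2.symm
    have hintc : ∀ (x w : R3) (j : Fin 3),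
        Integrable fun y => fderiv ℝ (mollifier n) (x - y) w * v y j := fun x w j => by
      simpa using (EuclideanSpace.proj (𝕜 := ℝ) j).integrable_comp (hint x w)
    -- Orthogonality to the planar curls of the reflected mollifier says that the mollified field is
    -- curl free, that is, its gradient is symmetric.
    have hsym : ∀ x i j, gradField f x i j = gradField f x j i := by
      intro x i j
      have h1 := horth _ (isSolenoidalTest_planarCurl (contDiff_reflect hk x)
        (hasCompactSupport_reflect hs x) i j)
      simp only [planarCurl, fderiv_reflect hk, inner_sub_right, inner_smul_right] at h1
      have h5 : ∀ (y : R3) (l : Fin 3), inner ℝ (v y) (basisVec l) = v y l := by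
        intro y l; simp [basisVec, EuclideanSpace.inner_single_right]
      simp only [h5, neg_mul, sub_neg_eq_add] at h1
      have h6 := integral_add (hintc x (basisVec i) j).neg (hintc x (basisVec j) i)
      simp only [Pi.neg_apply, integral_neg] at h6
      rw [h6] at h1
      rw [hgrad, hgrad]
      linarith
    have hGm := memLp_gradField_conv hk hs hv
    have h0 := integral_norm_sq_gradField_conv_eq hk hs hv hd
    -- For a symmetric gradient the cross term is `|∇f|²`. Incompressibility makes its integral
    -- zero, so `f` is constant.
    have h1 : ∀ x, ∑ i, ∑ j, gradField f x i j * gradField f x j i = ‖gradField f x‖ ^ 2 := by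
      intro x
      rw [grad3_norm_sq]
      refine Finset.sum_congr rfl fun i _ => Finset.sum_congr rfl fun j _ => ?_
      rw [← hsym x i j, sq]
    rw [← hf] at h0 hGm
    simp only [h1] at h0
    rw [integral_eq_zero_iff_of_nonneg (fun x => sq_nonneg _)
      ((memLp_two_iff_integrable_sq_norm hGm.1).1 hGm)] at h0
    have hGc : Continuous fun x => ‖gradField f x‖ ^ 2 :=
      ((contDiff_gradField hfs).continuous.norm.pow 2)
    have h2 := (hGc.ae_eq_iff_eq volume continuous_const).1 h0
    have h3 : ∀ x, fderiv ℝ f x = 0 := by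
      intro x
      have h4 : ‖gradField f x‖ ^ 2 = 0 := congrFun h2 x
      have h5 : gradField f x = 0 := by simpa using h4
      ext1 w
      rw [fderiv_eq_convect, h5]
      simp [convect]
    have hconst := is_const_of_fderiv_eq_zero (contDiff_top_differentiable hfs) h3
    have hfm : MemLp f 2 volume := memLp_mollify n hv
    -- A constant that is square integrable over a space of infinite measure is zero.
    have hfc : f = fun _ => f 0 := funext fun x => hconst x 0
    rw [hfc, memLp_const_iff (by norm_num) (by norm_num)] at hfm
    have : f 0 = 0 := by
      rcases hfm with h | h
      · exact h
      · simp at h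
    rw [hfc, this]; rfl
  filter_upwards [ae_tendsto_mollify hvl] with x hx
  simp only [hzero, Pi.zero_apply] at hx
  exact (tendsto_nhds_unique hx tendsto_const_nhds)

end TestFields

/-! ### The corrector: a solenoidal field near the body that coincides with the test field in the
body -/

section Corrector

/-- Integrals over `[0, 1]` of smooth functions depend smoothly on the parameter. -/
lemma contDiff_integral_unit_interval {P F : Type*} [NormedAddCommGroup P] [NormedSpace ℝ P]
    [NormedAddCommGroup F] [NormedSpace ℝ F] [CompleteSpace F] {g : P × ℝ → F}
    (hg : ContDiff ℝ (⊤ : ℕ∞) g) :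
    ContDiff ℝ (⊤ : ℕ∞) fun p => ∫ s in (0 : ℝ)..1, g (p, s) := by
  -- The integral is the value at `0` of the convolution of the indicator function of `(0, 1]` with
  -- `s ↦ κ(s) g(p, -s)`. The bump `κ` is `1` on `[-1, 1]` and only provides compact support; the
  -- sign undoes the reflection in the convolution.
  let κ : ContDiffBump (0 : ℝ) := ⟨1, 2, one_pos, one_lt_two⟩
  let f : ℝ → ℝ := (Ioc (0 : ℝ) 1).indicator fun _ => 1
  have hf : LocallyIntegrable f := by
    refine Integrable.locallyIntegrable ?_
    rw [integrable_indicator_iff measurableSet_Ioc]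
    exact integrableOn_const (by simp)
  let G : P → ℝ → F := fun p s => κ s • g (p, -s)
  have hG : ContDiffOn ℝ ((⊤ : ℕ∞) : ℕ∞) (Function.uncurry G) (univ ×ˢ univ) := by
    refine ContDiff.contDiffOn ?_
    exact (κ.contDiff.comp contDiff_snd).smul (hg.comp (contDiff_fst.prodMk contDiff_snd.neg))
  have h := contDiffOn_convolution_right_with_param (μ := volume)
    (ContinuousLinearMap.lsmul ℝ ℝ : ℝ →L[ℝ] F →L[ℝ] F) (g := G) (s := univ)
    (k := tsupport κ) isOpen_univ κ.hasCompactSupport (fun p x _ hx => by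
      simp [G, image_eq_zero_of_notMem_tsupport hx]) hf hG
  rw [univ_prod_univ, contDiffOn_univ] at h
  have h2 := h.comp (contDiff_id.prodMk (contDiff_const (c := (0 : ℝ))) : ContDiff ℝ (⊤ : ℕ∞)
    fun p : P => (p, (0 : ℝ)))
  convert h2 using 2 with p
  simp only [Function.comp_apply, convolution_def, ContinuousLinearMap.lsmul_apply]
  rw [intervalIntegral.integral_of_le zero_le_one, ← integral_indicator measurableSet_Ioc]
  refine integral_congr_ae (Eventually.of_forall fun s => ?_)
  by_cases hs : s ∈ Ioc (0 : ℝ) 1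
  · have hκ : κ (0 - s) = 1 := κ.one_of_mem_closedBall (by
      simp only [mem_closedBall_zero_iff, zero_sub, norm_neg, κ, Real.norm_eq_abs]
      rw [abs_of_pos hs.1]; exact hs.2)
    simp only [indicator_of_mem hs, f, G, hκ, one_smul, id]
    simp
  · simp [indicator_of_notMem hs, f]

variable {φ : ℝ × R3 → R3}

/-- The average `∫₀¹ s φ(t, a + s y) ds` of a field along a segment. -/
def segmentAverage (φ : ℝ × R3 → R3) (t : ℝ) (a y : R3) : R3 :=
  ∫ s in (0 : ℝ)..1, s • φ (t, a + s • y)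

lemma contDiff_segmentAverage (hφ : ContDiff ℝ (⊤ : ℕ∞) φ) :
    ContDiff ℝ (⊤ : ℕ∞) fun q : ℝ × R3 × R3 => segmentAverage φ q.1 q.2.1 q.2.2 := by
  refine contDiff_integral_unit_interval
    (g := fun r : (ℝ × R3 × R3) × ℝ => r.2 • φ (r.1.1, r.1.2.1 + r.2 • r.1.2.2)) ?_
  fun_prop

lemma contDiff_slice (hφ : ContDiff ℝ (⊤ : ℕ∞) φ) (t : ℝ) :
    ContDiff ℝ (⊤ : ℕ∞) fun x => φ (t, x) := hφ.comp (contDiff_const.prodMk contDiff_id)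

lemma hasCompactSupport_slice (hs : HasCompactSupport φ) (t : ℝ) :
    HasCompactSupport fun x => φ (t, x) := by
  refine HasCompactSupport.of_support_subset_isCompact (hs.isCompact.image continuous_snd) ?_
  intro x hx
  exact ⟨(t, x), subset_tsupport _ hx, rfl⟩

/-- Differentiation under the integral sign. In `s ^ 2` one factor is the weight of the average and
the other comes from the chain rule. -/
lemma hasFDerivAt_segmentAverage (hφ : ContDiff ℝ (⊤ : ℕ∞) φ) (hs : HasCompactSupport φ)
    (t : ℝ) (a y : R3) :
    HasFDerivAt (segmentAverage φ t a)
      (∫ s in (0 : ℝ)..1, s ^ 2 • fderiv ℝ (fun x => φ (t, x)) (a + s • y)) y := by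
  have hsl := contDiff_slice hφ t
  have hc : Continuous (fderiv ℝ fun x => φ (t, x)) := hsl.continuous_fderiv (by simp)
  obtain ⟨C, hC⟩ := hc.bounded_above_of_compact_support
    ((hasCompactSupport_slice hs t).fderiv (𝕜 := ℝ))
  have hC0 : 0 ≤ C := (norm_nonneg _).trans (hC 0)
  refine intervalIntegral.hasFDerivAt_integral_of_dominated_of_fderiv_le (s := univ)
    (F := fun y s => s • φ (t, a + s • y))
    (F' := fun y s => s ^ 2 • fderiv ℝ (fun x => φ (t, x)) (a + s • y)) (bound := fun _ => C)
    univ_mem ?_ ?_ ?_ ?_ ?_ ?_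
  · refine Eventually.of_forall fun z => Continuous.aestronglyMeasurable ?_
    exact continuous_id.smul (hsl.continuous.comp (by fun_prop))
  · refine Continuous.intervalIntegrable ?_ _ _
    exact continuous_id.smul (hsl.continuous.comp (by fun_prop))
  · refine Continuous.aestronglyMeasurable ?_
    exact (continuous_id.pow 2).smul (hc.comp (by fun_prop))
  · refine Eventually.of_forall fun s hs z _ => ?_
    rw [uIoc_of_le zero_le_one] at hs
    rw [norm_smul, Real.norm_of_nonneg (sq_nonneg _)]
    calc s ^ 2 * _ ≤ 1 * C := by
          gcongr
          · nlinarith [hs.1, hs.2]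
          · exact hC _
      _ = C := one_mul _
  · exact intervalIntegrable_const
  · refine Eventually.of_forall fun s _ z _ => ?_
    have h1 : HasFDerivAt (fun z : R3 => a + s • z) (s • ContinuousLinearMap.id ℝ R3) z :=
      ((hasFDerivAt_id z).const_smul s).const_add a
    have h2 := ((contDiff_top_differentiable hsl (a + s • z)).hasFDerivAt.comp z h1).const_smul s
    refine h2.congr_fderiv ?_
    ext1 w
    simp [sq, mul_smul]

lemma fderiv_segmentAverage_apply (hφ : ContDiff ℝ (⊤ : ℕ∞) φ) (hs : HasCompactSupport φ)
    (t : ℝ) (a y v : R3) :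
    fderiv ℝ (segmentAverage φ t a) y v =
      ∫ s in (0 : ℝ)..1, s ^ 2 • fderiv ℝ (fun x => φ (t, x)) (a + s • y) v := by
  have hc : Continuous (fderiv ℝ fun x => φ (t, x)) :=
    (contDiff_slice hφ t).continuous_fderiv (by simp)
  rw [(hasFDerivAt_segmentAverage hφ hs t a y).fderiv, ContinuousLinearMap.intervalIntegral_apply]
  · simp
  · refine Continuous.intervalIntegrable ?_ _ _
    exact (continuous_id.pow 2).smul (hc.comp (by fun_prop))

/-- The homotopy identity behind the Poincaré lemma. -/
lemma two_smul_segmentAverage (hφ : ContDiff ℝ (⊤ : ℕ∞) φ) (hs : HasCompactSupport φ)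
    (t : ℝ) (a y : R3) :
    (2 : ℝ) • segmentAverage φ t a y + fderiv ℝ (segmentAverage φ t a) y y = φ (t, a + y) := by
  have hsl := contDiff_slice hφ t
  have hc : Continuous (fderiv ℝ fun x => φ (t, x)) := hsl.continuous_fderiv (by simp)
  have c1 : Continuous fun s : ℝ => s • φ (t, a + s • y) :=
    continuous_id.smul (hsl.continuous.comp (by fun_prop))
  have c2 : Continuous fun s : ℝ => s ^ 2 • fderiv ℝ (fun x => φ (t, x)) (a + s • y) y :=
    (continuous_id.pow 2).smul ((hc.comp (by fun_prop)).clm_apply continuous_const)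
  -- The identity is the fundamental theorem of calculus for `s² φ(t, a + s y)` on `[0, 1]`. The
  -- weight `s` in the average is the one for which this derivative appears.
  have hd : ∀ s : ℝ, HasDerivAt (fun s : ℝ => s ^ 2 • φ (t, a + s • y))
      ((2 : ℝ) • (s • φ (t, a + s • y)) +
        s ^ 2 • fderiv ℝ (fun x => φ (t, x)) (a + s • y) y) s := by
    intro s
    have h1 : HasDerivAt (fun s : ℝ => a + s • y) y s := by
      simpa using ((hasDerivAt_id s).smul_const y).const_add a
    have h2 := (contDiff_top_differentiable hsl (a + s • y)).hasFDerivAt.comp_hasDerivAt s h1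
    have h3 := (hasDerivAt_pow 2 s).smul h2
    refine h3.congr_deriv ?_
    simp only [Function.comp_apply, Nat.cast_ofNat, Nat.add_one_sub_one, pow_one, mul_smul]
    exact add_comm _ _
  have h4 := intervalIntegral.integral_eq_sub_of_hasDerivAt (a := 0) (b := 1) (fun s _ => hd s)
    (((c1.const_smul (2 : ℝ)).add c2).intervalIntegrable 0 1)
  have h5 : ∫ s in (0 : ℝ)..1, ((2 : ℝ) • (s • φ (t, a + s • y)) +
      s ^ 2 • fderiv ℝ (fun x => φ (t, x)) (a + s • y) y) =
      (2 : ℝ) • segmentAverage φ t a y + fderiv ℝ (segmentAverage φ t a) y y := by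
    have c3 : Continuous fun s : ℝ => (2 : ℝ) • (s • φ (t, a + s • y)) := c1.const_smul (2 : ℝ)
    rw [intervalIntegral.integral_add (hf := c3.intervalIntegrable 0 1)
      (hg := c2.intervalIntegrable 0 1), fderiv_segmentAverage_apply hφ hs, segmentAverage,
      intervalIntegral.integral_smul]
  rw [← h5, h4]
  simp

/-- The gradient of the average is a weighted average of the gradients of `φ` along the segment, so
the divergence is one of vanishing divergences. -/
lemma trace_segmentAverage (hφ : ContDiff ℝ (⊤ : ℕ∞) φ) (hs : HasCompactSupport φ)
    (t : ℝ) (hd : ∀ x, ∑ i, gradField (fun y => φ (t, y)) x i i = 0) (a y : R3) :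
    ∑ i, gradField (segmentAverage φ t a) y i i = 0 := by
  have hc : Continuous (fderiv ℝ fun x => φ (t, x)) :=
    (contDiff_slice hφ t).continuous_fderiv (by simp)
  have c2 : ∀ v : R3, Continuous fun s : ℝ => s ^ 2 • fderiv ℝ (fun x => φ (t, x)) (a + s • y) v :=
    fun v => (continuous_id.pow 2).smul ((hc.comp (by fun_prop)).clm_apply continuous_const)
  have h1 : ∀ i, gradField (segmentAverage φ t a) y i i =
      ∫ s in (0 : ℝ)..1, s ^ 2 * gradField (fun x => φ (t, x)) (a + s • y) i i := by
    intro i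
    rw [gradField_apply, fderiv_segmentAverage_apply hφ hs]
    have h2 : IntervalIntegrable
        (fun s : ℝ => s ^ 2 • fderiv ℝ (fun x => φ (t, x)) (a + s • y) (basisVec i)) volume 0 1 :=
      (c2 (basisVec i)).intervalIntegrable 0 1
    have h3 := (EuclideanSpace.proj (𝕜 := ℝ) i).intervalIntegral_comp_comm h2
    simpa [gradField_apply] using h3.symm
  simp only [h1]
  rw [← intervalIntegral.integral_finsetSum (μ := volume)]
  · simp [← Finset.mul_sum, hd]
  · intro i _
    have h2 : Continuous fun s : ℝ => s ^ 2 * gradField (fun x => φ (t, x)) (a + s • y) i i :=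
      (EuclideanSpace.proj (𝕜 := ℝ) i).continuous.comp (c2 (basisVec i))
    exact h2.intervalIntegrable 0 1

/-- The cut-off function around the body, equal to `1` on the unit ball. -/
def bodyCutoff : ContDiffBump (0 : R3) := ⟨1, 2, one_pos, one_lt_two⟩

/-- A cut-off function for the size of the body. -/
def sizeCutoff : ContDiffBump (0 : ℝ) := ⟨1, 2, one_pos, one_lt_two⟩

/-- In rescaled coordinates `z = (x - a) / e` around the centre `a` of a body of size `e`, the
divergence free field, supported near the body, that coincides with `φ` in the body. It is the
curl of the product of a cut-off function and a vector potential of `φ` vanishing at `a`. -/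
def corrector (φ : ℝ × R3 → R3) (q : ℝ × R3 × ℝ × R3) : R3 :=
  sizeCutoff q.2.2.1 • (bodyCutoff q.2.2.2 • φ (q.1, q.2.1 + q.2.2.1 • q.2.2.2)
    + fderiv ℝ bodyCutoff q.2.2.2 q.2.2.2 • segmentAverage φ q.1 q.2.1 (q.2.2.1 • q.2.2.2)
    - fderiv ℝ bodyCutoff q.2.2.2 (segmentAverage φ q.1 q.2.1 (q.2.2.1 • q.2.2.2)) • q.2.2.2)

lemma contDiff_corrector (hφ : ContDiff ℝ (⊤ : ℕ∞) φ) : ContDiff ℝ (⊤ : ℕ∞) (corrector φ) := by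
  have h1 : ContDiff ℝ (⊤ : ℕ∞) fun q : ℝ × R3 × ℝ × R3 => sizeCutoff q.2.2.1 :=
    sizeCutoff.contDiff.comp (by fun_prop)
  have h2 : ContDiff ℝ (⊤ : ℕ∞) fun q : ℝ × R3 × ℝ × R3 => bodyCutoff q.2.2.2 :=
    bodyCutoff.contDiff.comp (by fun_prop)
  have h3 : ContDiff ℝ (⊤ : ℕ∞) fun q : ℝ × R3 × ℝ × R3 => fderiv ℝ bodyCutoff q.2.2.2 :=
    ((bodyCutoff.contDiff (n := (⊤ : ℕ∞))).fderiv_right (m := (⊤ : ℕ∞))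
      (by exact_mod_cast le_rfl)).comp (by fun_prop)
  have h4 : ContDiff ℝ (⊤ : ℕ∞) fun q : ℝ × R3 × ℝ × R3 =>
      segmentAverage φ q.1 q.2.1 (q.2.2.1 • q.2.2.2) :=
    (contDiff_segmentAverage hφ).comp (g := fun q : ℝ × R3 × R3 => segmentAverage φ q.1 q.2.1 q.2.2)
      (f := fun q : ℝ × R3 × ℝ × R3 => (q.1, q.2.1, q.2.2.1 • q.2.2.2)) (by fun_prop)
  have h5 : ContDiff ℝ (⊤ : ℕ∞) fun q : ℝ × R3 × ℝ × R3 =>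
      φ (q.1, q.2.1 + q.2.2.1 • q.2.2.2) := hφ.comp (by fun_prop)
  have h6 : ContDiff ℝ (⊤ : ℕ∞) fun q : ℝ × R3 × ℝ × R3 => q.2.2.2 := by fun_prop
  exact h1.smul (((h2.smul h5).add ((h3.clm_apply h6).smul h4)).sub ((h3.clm_apply h4).smul h6))

lemma bodyCutoff_eq_zero {z : R3} (hz : 2 ≤ ‖z‖) : bodyCutoff z = 0 :=
  bodyCutoff.zero_of_le_dist (by simpa [bodyCutoff] using hz)

/-- Wherever the nonnegative cut-off vanishes it has a minimum; this covers the sphere `‖z‖ = 2`,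
where it need not vanish nearby. -/
lemma fderiv_bodyCutoff_eq_zero {z : R3} (hz : 2 ≤ ‖z‖) : fderiv ℝ bodyCutoff z = 0 := by
  have hmin : IsLocalMin bodyCutoff z := by
    refine Eventually.of_forall fun y => ?_
    rw [bodyCutoff_eq_zero hz]
    exact bodyCutoff.nonneg
  exact hmin.fderiv_eq_zero

lemma corrector_eq_zero {q : ℝ × R3 × ℝ × R3} (hz : 2 ≤ ‖q.2.2.2‖) : corrector φ q = 0 := by
  simp [corrector, bodyCutoff_eq_zero hz, fderiv_bodyCutoff_eq_zero hz]

lemma hasCompactSupport_corrector (hs : HasCompactSupport φ) :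
    HasCompactSupport (corrector φ) := by
  obtain ⟨M, hM⟩ := hs.isCompact.isBounded.subset_closedBall 0
  refine HasCompactSupport.of_support_subset_isCompact
    (isCompact_closedBall (0 : ℝ × R3 × ℝ × R3) (|M| + 4)) ?_
  intro q hq
  rw [Function.mem_support] at hq
  have hz : ‖q.2.2.2‖ < 2 := by
    by_contra h
    exact hq (corrector_eq_zero (not_lt.1 h))
  have he : ‖q.2.2.1‖ < 2 := by
    by_contra h
    exact hq (by simp [corrector, sizeCutoff.zero_of_le_dist (x := q.2.2.1)
      (by simpa [sizeCutoff] using not_lt.1 h)])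
  -- The corrector only involves the values of `φ` on the segment from `a` to `a + e z`. If `φ`
  -- vanishes there, so does the corrector; otherwise `a` is close to the support of `φ`, since `‖e
  -- z‖ ≤ 4`.
  have hex : ∃ s ∈ Icc (0 : ℝ) 1, φ (q.1, q.2.1 + s • (q.2.2.1 • q.2.2.2)) ≠ 0 := by
    by_contra! hcon
    apply hq
    have h1 := hcon 1 (by simp)
    have h2 : segmentAverage φ q.1 q.2.1 (q.2.2.1 • q.2.2.2) = 0 := by
      rw [segmentAverage, intervalIntegral.integral_of_le zero_le_one]
      refine setIntegral_eq_zero_of_forall_eq_zero fun s hs => ?_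
      rw [hcon s ⟨hs.1.le, hs.2⟩, smul_zero]
    rw [one_smul] at h1
    simp [corrector, h1, h2]
  obtain ⟨s, hs1, hne⟩ := hex
  have h3 := hM (subset_tsupport _ hne)
  rw [mem_closedBall_zero_iff, Prod.norm_def, max_le_iff] at h3
  have hez : ‖s • (q.2.2.1 • q.2.2.2)‖ ≤ 4 := by
    rw [norm_smul, norm_smul, Real.norm_of_nonneg hs1.1]
    calc s * (‖q.2.2.1‖ * ‖q.2.2.2‖) ≤ 1 * (2 * 2) := by gcongr; exact hs1.2
      _ = 4 := by norm_num
  have ha : ‖q.2.1‖ ≤ |M| + 4 := by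
    calc ‖q.2.1‖ = ‖(q.2.1 + s • (q.2.2.1 • q.2.2.2)) - s • (q.2.2.1 • q.2.2.2)‖ := by simp
      _ ≤ _ := norm_sub_le _ _
      _ ≤ |M| + 4 := add_le_add (h3.2.trans (le_abs_self M)) hez
  have hM0 := abs_nonneg M
  rw [mem_closedBall_zero_iff]
  simp only [Prod.norm_def, max_le_iff]
  exact ⟨h3.1.trans ((le_abs_self M).trans (by linarith)), ha, by linarith, by linarith⟩

/-- The corrector field at time `t` for a body of size `e` centred at `a`. -/
def bodyCorrector (φ : ℝ × R3 → R3) (e t : ℝ) (a x : R3) : R3 :=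
  corrector φ (t, a, e, e⁻¹ • (x - a))

variable {e : ℝ}

lemma sizeCutoff_eq_one (he : 0 < e) (he1 : e ≤ 1) : sizeCutoff e = 1 :=
  sizeCutoff.one_of_mem_closedBall (by
    simpa [sizeCutoff, abs_of_pos he] using he1)

/-- Near such points the cut-off is constantly `1`, so the two terms with its derivative drop out.
-/
lemma bodyCorrector_eq_of_mem (he : 0 < e) (he1 : e ≤ 1) {t : ℝ} {a x : R3} (hx : ‖x - a‖ < e) :
    bodyCorrector φ e t a x = φ (t, x) := by
  have hz : e⁻¹ • (x - a) ∈ Metric.ball (0 : R3) 1 := by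
    rw [mem_ball_zero_iff, norm_smul, norm_inv, Real.norm_of_nonneg he.le, inv_mul_lt_iff₀ he]
    simpa using hx
  have h1 : bodyCutoff =ᶠ[𝓝 (e⁻¹ • (x - a))] fun _ => 1 :=
    bodyCutoff.eventuallyEq_one_of_mem_ball hz
  have h2 : fderiv ℝ bodyCutoff (e⁻¹ • (x - a)) = 0 := by rw [h1.fderiv_eq]; simp
  simp only [bodyCorrector, corrector, h2, h1.eq_of_nhds, sizeCutoff_eq_one he he1]
  simp [smul_smul, he.ne']

lemma bodyCorrector_eq_zero (he : 0 < e) {t : ℝ} {a x : R3} (hx : 2 * e ≤ ‖x - a‖) :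
    bodyCorrector φ e t a x = 0 := by
  refine corrector_eq_zero ?_
  simp only
  rw [norm_smul, norm_inv, Real.norm_of_nonneg he.le, le_inv_mul_iff₀ he]
  linarith

/-- With `b` the segment average, `c` the field `φ` and `χ` the cut-off in rescaled coordinates, the
homotopy identity reads `c = 2 b + (z · ∇) b` and `b` is divergence free, hence `χ c + (∇χ · z) b -
(∇χ · b) z = curl (χ b × z)`. The vanishing of the divergence is checked directly, which needs only
the symmetry of the second derivatives of `χ`. -/
lemma trace_corrector (hφ : ContDiff ℝ (⊤ : ℕ∞) φ) (hs : HasCompactSupport φ)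
    (t : ℝ) (hd : ∀ x, ∑ i, gradField (fun y => φ (t, y)) x i i = 0) (a : R3) (e : ℝ) (z : R3) :
    ∑ i, gradField (fun z => corrector φ (t, a, e, z)) z i i = 0 := by
  set b : R3 → R3 := fun z => segmentAverage φ t a (e • z) with hb
  set c : R3 → R3 := fun z => φ (t, a + e • z) with hc
  have hsa := contDiff_top_differentiable (contDiff_segmentAverage hφ)
  have hlin : HasFDerivAt (fun z : R3 => e • z) (e • ContinuousLinearMap.id ℝ R3) z :=
    (hasFDerivAt_id z).const_smul e
  have hbd : HasFDerivAt b (e • fderiv ℝ (segmentAverage φ t a) (e • z)) z := by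
    have h1 := (hasFDerivAt_segmentAverage hφ hs t a (e • z)).differentiableAt.hasFDerivAt.comp z hlin
    refine h1.congr_fderiv ?_
    ext1 w; simp
  have hcd : HasFDerivAt c (e • fderiv ℝ (fun x => φ (t, x)) (a + e • z)) z := by
    have h1 := (contDiff_top_differentiable (contDiff_slice hφ t)
      (a + e • z)).hasFDerivAt.comp z (hlin.const_add a)
    refine h1.congr_fderiv ?_
    ext1 w; simp
  set χ : R3 → ℝ := ⇑bodyCutoff with hχ
  have hχs : ContDiff ℝ (⊤ : ℕ∞) χ := bodyCutoff.contDiff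
  have hχd : HasFDerivAt χ (fderiv ℝ χ z) z := (contDiff_top_differentiable hχs z).hasFDerivAt
  have hχ2 : HasFDerivAt (fderiv ℝ χ) (fderiv ℝ (fderiv ℝ χ) z) z :=
    (contDiff_top_differentiable (hχs.fderiv_right (m := (⊤ : ℕ∞))
      (by exact_mod_cast le_rfl)) z).hasFDerivAt
  have hsym : IsSymmSndFDerivAt ℝ χ z := hχs.contDiffAt.isSymmSndFDerivAt (by
    simpa using (WithTop.coe_le_coe.2 (le_top : (2 : ℕ∞) ≤ ⊤)))
  have hmain := (((hχd.smul hcd).add ((hχ2.clm_apply (hasFDerivAt_id z)).smul hbd)).sub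
    ((hχ2.clm_apply hbd).smul (hasFDerivAt_id z))).const_smul (sizeCutoff e : ℝ)
  have hfun : (fun z => corrector φ (t, a, e, z)) = (sizeCutoff e : ℝ) • fun z =>
      ((χ • c + (fun z => fderiv ℝ χ z (id z)) • b) -
        (fun z => fderiv ℝ χ z (b z)) • id : R3 → R3) z := rfl
  have hgrad : ∀ i, gradField (fun z => corrector φ (t, a, e, z)) z i i = sizeCutoff e *
      ((χ z * (e * gradField (fun x => φ (t, x)) (a + e • z) i i) +
        fderiv ℝ χ z (basisVec i) * c z i) +
      (fderiv ℝ χ z z * (e * gradField (segmentAverage φ t a) (e • z) i i) +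
        (fderiv ℝ (fderiv ℝ χ) z (basisVec i) z + fderiv ℝ χ z (basisVec i)) * b z i) -
      (fderiv ℝ χ z (b z) * 1 +
        (fderiv ℝ (fderiv ℝ χ) z (basisVec i) (b z) +
          e * fderiv ℝ χ z (gradField (segmentAverage φ t a) (e • z) i)) * z i)) := by
    intro i
    have h1 : HasFDerivAt (fun z => corrector φ (t, a, e, z)) _ z := hmain
    rw [gradField_apply, h1.fderiv]
    simp only [gradField_apply]
    simp [basisVec, -mul_eq_mul_left_iff]
    ring
  simp only [hgrad, ← Finset.mul_sum]
  -- Contracting a linear form with coordinates rewrites each sum over `i` as a single evaluation,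
  -- after which the second derivatives of `χ` cancel by symmetry and the first derivatives by the
  -- homotopy identity.
  have hlinsum : ∀ (L : R3 →L[ℝ] ℝ) (w : R3), ∑ i, L (basisVec i) * w i = L w := by
    intro L w
    conv_rhs => rw [r3_eq_sum w]
    simp only [map_sum, map_smul, smul_eq_mul]
    exact Finset.sum_congr rfl fun i _ => mul_comm _ _
  have e1 : ∑ i, fderiv ℝ χ z (gradField (segmentAverage φ t a) (e • z) i) * z i =
      fderiv ℝ χ z (fderiv ℝ (segmentAverage φ t a) (e • z) z) :=
    hlinsum ((fderiv ℝ χ z).comp (fderiv ℝ (segmentAverage φ t a) (e • z))) z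
  have e2 : ∑ i, fderiv ℝ (fderiv ℝ χ) z (basisVec i) (b z) * z i =
      fderiv ℝ (fderiv ℝ χ) z z (b z) :=
    hlinsum ((fderiv ℝ (fderiv ℝ χ) z).flip (b z)) z
  have e3 : ∑ i, fderiv ℝ (fderiv ℝ χ) z (basisVec i) z * b z i =
      fderiv ℝ (fderiv ℝ χ) z (b z) z :=
    hlinsum ((fderiv ℝ (fderiv ℝ χ) z).flip z) (b z)
  have e4 := hlinsum (fderiv ℝ χ z) (c z)
  have e5 := hlinsum (fderiv ℝ χ z) (b z)
  have e6 := hd (a + e • z)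
  have e7 := trace_segmentAverage hφ hs t hd a (e • z)
  have e8 := congrArg (fderiv ℝ χ z) (two_smul_segmentAverage hφ hs t a (e • z))
  simp only [map_add, map_smul, smul_eq_mul] at e8
  have e9 : fderiv ℝ (fderiv ℝ χ) z (b z) z = fderiv ℝ (fderiv ℝ χ) z z (b z) := hsym _ _
  have e10 : fderiv ℝ χ z (c z) = 2 * fderiv ℝ χ z (b z) +
      e * fderiv ℝ χ z (fderiv ℝ (segmentAverage φ t a) (e • z) z) := e8.symm
  simp only [Fin.sum_univ_three] at *
  linear_combination (sizeCutoff e : ℝ) * (χ z * e * e6 + e4 + fderiv ℝ χ z z * e * e7 + e3 + e5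
    - e2 - e * e1 + e9 + e10)

lemma trace_bodyCorrector (hφ : ContDiff ℝ (⊤ : ℕ∞) φ) (hs : HasCompactSupport φ)
    (t : ℝ) (hd : ∀ x, ∑ i, gradField (fun y => φ (t, y)) x i i = 0) (a : R3) (e : ℝ) (x : R3) :
    ∑ i, gradField (bodyCorrector φ e t a) x i i = 0 := by
  have h1 : HasFDerivAt (fun x : R3 => e⁻¹ • (x - a)) (e⁻¹ • ContinuousLinearMap.id ℝ R3) x :=
    ((hasFDerivAt_id x).sub_const a).const_smul e⁻¹
  have h2 : ContDiff ℝ (⊤ : ℕ∞) fun z => corrector φ (t, a, e, z) :=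
    (contDiff_corrector hφ).comp (by fun_prop)
  have h3 := (contDiff_top_differentiable h2 (e⁻¹ • (x - a))).hasFDerivAt.comp x h1
  have h4 : ∀ i, gradField (bodyCorrector φ e t a) x i i =
      e⁻¹ * gradField (fun z => corrector φ (t, a, e, z)) (e⁻¹ • (x - a)) i i := by
    intro i
    rw [gradField_apply]
    change fderiv ℝ ((fun z => corrector φ (t, a, e, z)) ∘ fun x : R3 => e⁻¹ • (x - a)) x
      (basisVec i) i = _
    rw [h3.fderiv, gradField_apply]
    simp
  simp only [h4, ← Finset.mul_sum]
  rw [trace_corrector hφ hs t hd, mul_zero]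

end Corrector

/-! ### Admissible test fields from smooth families and Lipschitz curves of parameters -/

section CurveTestFields

/-- The square root of the volume of a ball. -/
def ballConst (K : ℝ) : ℝ≥0 := ((volume (Metric.closedBall (0 : R3) K)) ^ (1 / 2 : ℝ)).toNNReal

lemma eLpNorm_two_le_of_bound {F : Type*} [NormedAddCommGroup F] {f : R3 → F} {c K : ℝ}
    (hb : ∀ x, ‖f x‖ ≤ c) (hz : ∀ x, K < ‖x‖ → f x = 0) :
    eLpNorm f 2 volume ≤ ballConst K * ENNReal.ofReal c := by
  have h1 : f = (Metric.closedBall (0 : R3) K).indicator f := by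
    ext x
    by_cases hx : x ∈ Metric.closedBall (0 : R3) K
    · rw [indicator_of_mem hx]
    · rw [indicator_of_notMem hx]
      exact hz x (by simpa using hx)
  rw [h1, eLpNorm_indicator_eq_eLpNorm_restrict measurableSet_closedBall]
  refine (eLpNorm_le_of_ae_bound (C := c) (Eventually.of_forall hb)).trans_eq ?_
  rw [ballConst, ENNReal.coe_toNNReal]
  · simp
  · exact ENNReal.rpow_ne_top_of_nonneg (by norm_num) measure_closedBall_lt_top.ne

variable {P : Type*} [NormedAddCommGroup P] [NormedSpace ℝ P] {E : P × R3 → R3}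

/-- The gradient of a field in the space variable, as a function of all variables. -/
def partialGrad (E : P × R3 → R3) (q : P × R3) : Grad3 :=
  gradOfDeriv ((fderiv ℝ E q).comp (ContinuousLinearMap.inr ℝ P R3))

lemma contDiff_partialGrad (hE : ContDiff ℝ (⊤ : ℕ∞) E) : ContDiff ℝ (⊤ : ℕ∞) (partialGrad E) :=
  gradOfDeriv.contDiff.comp
    ((hE.fderiv_right (m := (⊤ : ℕ∞)) (by exact_mod_cast le_rfl)).clm_comp contDiff_const)

lemma gradField_slice (hE : ContDiff ℝ (⊤ : ℕ∞) E) (p : P) (x : R3) :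
    gradField (fun y => E (p, y)) x = partialGrad E (p, x) := by
  rw [gradField_eq, partialGrad]
  have h := (contDiff_top_differentiable hE (p, x)).hasFDerivAt.comp x
    ((hasFDerivAt_const p x).prodMk (hasFDerivAt_id x))
  have h2 : HasFDerivAt (fun y => E (p, y)) _ x := h
  change gradOfDeriv (fderiv ℝ (fun y => E (p, y)) x) = _
  rw [h2.fderiv]
  congr 1

/-- Compositions of smooth families of divergence free fields with Lipschitz curves of parameters
are test fields. -/
theorem isTestField_of_curve [FiniteDimensional ℝ P] {S : ℝ → Set R3} {p : ℝ → P} {L : ℝ≥0}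
    {K M T : ℝ} (hE : ContDiff ℝ (⊤ : ℕ∞) E) (hp : LipschitzWith L p) (hpM : ∀ t, ‖p t‖ < M)
    (hsupp : ∀ q x, ‖q‖ < M → K < ‖x‖ → E (q, x) = 0)
    (hT : ∀ t, T < t → ∀ x, E (p t, x) = 0)
    (hdiv : ∀ t, 0 ≤ t → ∀ x, ∑ i, partialGrad E (p t, x) i i = 0)
    (hrigid : ∀ t, 0 ≤ t → ∀ x ∈ S t, partialGrad E (p t, x) = 0) :
    IsTestField S (fun t x => E (p t, x)) (fun t x => fderiv ℝ E (p t, x) (deriv p t, 0))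
      (fun t x => partialGrad E (p t, x)) := by
  have hpc : Continuous fun q : ℝ × R3 => (p q.1, q.2) :=
    (hp.continuous.comp continuous_fst).prodMk continuous_snd
  have hG := contDiff_partialGrad hE
  have hEd : Continuous (fderiv ℝ E) := hE.continuous_fderiv (by simp)
  -- the derivatives vanish outside a ball
  have hnear : ∀ q x, ‖q‖ < M → K < ‖x‖ → E =ᶠ[𝓝 (q, x)] fun _ => 0 := by
    intro q x hq hx
    have ho1 : IsOpen {r : P × R3 | ‖r.1‖ < M} := isOpen_lt (by fun_prop) continuous_const
    have ho2 : IsOpen {r : P × R3 | K < ‖r.2‖} := isOpen_lt continuous_const (by fun_prop)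
    have ho : IsOpen {r : P × R3 | ‖r.1‖ < M ∧ K < ‖r.2‖} := ho1.inter ho2
    filter_upwards [ho.mem_nhds (show (q, x) ∈ _ from ⟨hq, hx⟩)] with r hr
    exact hsupp r.1 r.2 hr.1 hr.2
  have hfd0 : ∀ q x, ‖q‖ < M → K < ‖x‖ → fderiv ℝ E (q, x) = 0 := by
    intro q x hq hx
    rw [(hnear q x hq hx).fderiv_eq]; simp
  have hG0 : ∀ q x, ‖q‖ < M → K < ‖x‖ → partialGrad E (q, x) = 0 := by
    intro q x hq hx
    rw [partialGrad, hfd0 q x hq hx]; simp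
  -- bounds on a compact convex set
  set B : Set (P × R3) := Metric.closedBall 0 M ×ˢ Metric.closedBall 0 K with hB
  have hBc : IsCompact B := (isCompact_closedBall _ _).prod (isCompact_closedBall _ _)
  have hBv : Convex ℝ B := (convex_closedBall _ _).prod (convex_closedBall _ _)
  obtain ⟨C₀, hC₀⟩ := hBc.exists_bound_of_continuousOn hE.continuous.continuousOn
  obtain ⟨C₁, hC₁⟩ := hBc.exists_bound_of_continuousOn hG.continuous.continuousOn
  obtain ⟨C₂, hC₂⟩ := hBc.exists_bound_of_continuousOn hEd.continuousOn
  obtain ⟨L₀, hL₀⟩ := (hE.contDiffOn (s := B)).exists_lipschitzOnWith (by simp) hBv hBc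
  obtain ⟨L₁, hL₁⟩ := (hG.contDiffOn (s := B)).exists_lipschitzOnWith (by simp) hBv hBc
  have hmem : ∀ t x, ‖x‖ ≤ K → (p t, x) ∈ B := fun t x hx =>
    ⟨by simpa using (hpM t).le, by simpa using hx⟩
  have b0 : ∀ t x, ‖E (p t, x)‖ ≤ max C₀ 0 := by
    intro t x
    rcases le_or_gt ‖x‖ K with hx | hx
    · exact (hC₀ _ (hmem t x hx)).trans (le_max_left _ _)
    · rw [hsupp _ _ (hpM t) hx, norm_zero]; exact le_max_right _ _
  have b1 : ∀ t x, ‖partialGrad E (p t, x)‖ ≤ max C₁ 0 := by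
    intro t x
    rcases le_or_gt ‖x‖ K with hx | hx
    · exact (hC₁ _ (hmem t x hx)).trans (le_max_left _ _)
    · rw [hG0 _ _ (hpM t) hx, norm_zero]; exact le_max_right _ _
  have b2 : ∀ t x, ‖fderiv ℝ E (p t, x) (deriv p t, 0)‖ ≤ max C₂ 0 * L := by
    intro t x
    have hdp : ‖((deriv p t, 0) : P × R3)‖ ≤ L := by
      simpa [Prod.norm_def] using norm_deriv_le_of_lipschitz hp
    rcases le_or_gt ‖x‖ K with hx | hx
    · refine ((fderiv ℝ E (p t, x)).le_opNorm _).trans ?_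
      have := (hC₂ _ (hmem t x hx)).trans (le_max_left C₂ 0)
      gcongr
    · rw [hfd0 _ _ (hpM t) hx]; simp; positivity
  have l0 : ∀ s t, s ≤ t → ∀ x, ‖E (p t, x) - E (p s, x)‖ ≤ L₀ * L * (t - s) := by
    intro s t hst x
    have h0 : 0 ≤ (L₀ : ℝ) * L * (t - s) := mul_nonneg (by positivity) (by linarith)
    rcases le_or_gt ‖x‖ K with hx | hx
    · have h1 := hL₀.dist_le_mul _ (hmem t x hx) _ (hmem s x hx)
      have h2 := hp.dist_le_mul t s
      rw [Real.dist_eq, abs_of_nonneg (by linarith)] at h2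
      rw [dist_eq_norm, Prod.dist_eq, dist_self, max_eq_left dist_nonneg] at h1
      refine h1.trans ?_
      rw [mul_assoc]; gcongr
    · rw [hsupp _ _ (hpM t) hx, hsupp _ _ (hpM s) hx]; simpa using h0
  have l1 : ∀ s t, s ≤ t → ∀ x, ‖partialGrad E (p t, x) - partialGrad E (p s, x)‖ ≤
      L₁ * L * (t - s) := by
    intro s t hst x
    have h0 : 0 ≤ (L₁ : ℝ) * L * (t - s) := mul_nonneg (by positivity) (by linarith)
    rcases le_or_gt ‖x‖ K with hx | hx
    · have h1 := hL₁.dist_le_mul _ (hmem t x hx) _ (hmem s x hx)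
      have h2 := hp.dist_le_mul t s
      rw [Real.dist_eq, abs_of_nonneg (by linarith)] at h2
      rw [dist_eq_norm, Prod.dist_eq, dist_self, max_eq_left dist_nonneg] at h1
      refine h1.trans ?_
      rw [mul_assoc]; gcongr
    · rw [hG0 _ _ (hpM t) hx, hG0 _ _ (hpM s) hx]; simpa using h0
  have hsl : ∀ t, ContDiff ℝ (⊤ : ℕ∞) fun x => E (p t, x) := fun t =>
    hE.comp (contDiff_const.prodMk contDiff_id)
  have hcs : ∀ t, HasCompactSupport fun x => E (p t, x) := fun t =>
    HasCompactSupport.of_support_subset_isCompact (isCompact_closedBall (0 : R3) K) fun x hx => by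
      by_contra h
      exact hx (hsupp _ _ (hpM t) (by simpa using h))
  have hgs : ∀ t, gradField (fun x => E (p t, x)) = fun x => partialGrad E (p t, x) := fun t =>
    funext fun x => gradField_slice hE (p t) x
  have hSob : ∀ t, IsSobolevField (fun x => E (p t, x)) fun x => partialGrad E (p t, x) := by
    intro t
    rw [← hgs t]
    exact isSobolevField_gradField (hsl t) (hcs t)
  have hdtm : Measurable fun q : ℝ × R3 => fderiv ℝ E (p q.1, q.2) (deriv p q.1, 0) := by
    borelize P
    have h1 : Measurable fun q : ℝ × R3 => (deriv p q.1, (0 : R3)) :=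
      ((measurable_deriv p).comp measurable_fst).prodMk measurable_const
    have h2 : Measurable fun q : ℝ × R3 => fderiv ℝ E (p q.1, q.2) := (hEd.comp hpc).measurable
    have h3 : Continuous fun r : (P × R3 →L[ℝ] R3) × (P × R3) => r.1 r.2 := by fun_prop
    exact h3.measurable.comp (h2.prodMk h1)
  refine
    { measurable := (hE.continuous.comp hpc).aestronglyMeasurable
      grad_measurable := (hG.continuous.comp hpc).aestronglyMeasurable
      dt_measurable := hdtm.aestronglyMeasurable
      memLp := fun t _ => ⟨(hSob t).memLp, (hSob t).grad_memLp⟩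
      grad := fun t _ => (hSob t).grad
      divFree := fun t ht => isWeakDivFree_of_trace (hsl t) fun x => by
        rw [hgs]; exact hdiv t ht x
      bounded := ?_
      lipschitz := ?_
      dt_bounded := ?_
      dt := ?_
      compactSupport := ⟨max K T, fun t _ => Eventually.of_forall fun x hx => ?_⟩
      rigid := fun t ht => Eventually.of_forall fun x hx => ?_ }
  · refine ⟨ballConst K * Real.toNNReal (max (max C₀ 0) (max C₁ 0)), fun t _ => ⟨?_, ?_⟩⟩
    · rw [ENNReal.coe_mul]
      exact eLpNorm_two_le_of_bound (fun x => (b0 t x).trans (le_max_left _ _))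
        fun x hx => hsupp _ _ (hpM t) hx
    · rw [ENNReal.coe_mul]
      exact eLpNorm_two_le_of_bound (fun x => (b1 t x).trans (le_max_right _ _))
        fun x hx => hG0 _ _ (hpM t) hx
  · refine ⟨ballConst K * (max L₀ L₁ * L), fun s t _ hst => ⟨?_, ?_⟩⟩
    · rw [ENNReal.coe_mul, mul_assoc, ← ENNReal.ofReal_coe_nnreal (p := max L₀ L₁ * L),
        ← ENNReal.ofReal_mul (by positivity)]
      refine eLpNorm_two_le_of_bound (fun x => (l0 s t hst x).trans ?_) fun x hx => ?_
      · have : 0 ≤ t - s := by linarith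
        push_cast; gcongr; exact le_max_left _ _
      · simp [hsupp _ _ (hpM t) hx, hsupp _ _ (hpM s) hx]
    · rw [ENNReal.coe_mul, mul_assoc, ← ENNReal.ofReal_coe_nnreal (p := max L₀ L₁ * L),
        ← ENNReal.ofReal_mul (by positivity)]
      refine eLpNorm_two_le_of_bound (fun x => (l1 s t hst x).trans ?_) fun x hx => ?_
      · have : 0 ≤ t - s := by linarith
        push_cast; gcongr; exact le_max_right _ _
      · simp [hG0 _ _ (hpM t) hx, hG0 _ _ (hpM s) hx]
  · refine ⟨ballConst K * Real.toNNReal (max C₂ 0 * L), Eventually.of_forall fun t => ?_⟩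
    rw [ENNReal.coe_mul]
    exact eLpNorm_two_le_of_bound (b2 t) fun x hx => by rw [hfd0 _ _ (hpM t) hx]; simp
  · intro t ht
    refine Eventually.of_forall fun x => ?_
    have hint : IntervalIntegrable (fun s => fderiv ℝ E (p s, x) (deriv p s, 0)) volume 0 t := by
      refine (intervalIntegrable_const (c := max C₂ 0 * L)).mono_fun
        ((hdtm.comp (measurable_id.prodMk measurable_const)).aestronglyMeasurable)
        (Eventually.of_forall fun s => ?_)
      exact (b2 s x).trans (le_abs_self _)
    have hder : ∀ᵐ s, HasDerivAt (fun s => E (p s, x))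
        (fderiv ℝ E (p s, x) (deriv p s, 0)) s := by
      filter_upwards [hp.ae_differentiableAt_real] with s hs
      exact (contDiff_top_differentiable hE (p s, x)).hasFDerivAt.comp_hasDerivAt s
        (hs.hasDerivAt.prodMk (hasDerivAt_const s x))
    -- The passage to components makes the fundamental theorem for absolutely continuous real
    -- functions available; along the curve each component is only Lipschitz in time.
    ext j
    have e1 : (∫ s in (0 : ℝ)..t, fderiv ℝ E (p s, x) (deriv p s, 0)) j =
        ∫ s in (0 : ℝ)..t, fderiv ℝ E (p s, x) (deriv p s, 0) j := by
      have := (EuclideanSpace.proj (𝕜 := ℝ) j).intervalIntegral_comp_comm hint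
      simpa using this.symm
    have hac : AbsolutelyContinuousOnInterval (fun s => E (p s, x) j) 0 t := by
      refine LipschitzOnWith.absolutelyContinuousOnInterval (K := L₀ * L) ?_
      refine LipschitzOnWith.of_dist_le_mul fun s _ s' _ => ?_
      rw [Real.dist_eq, Real.dist_eq]
      push_cast
      have key : ∀ a b, a ≤ b → |E (p b, x) j - E (p a, x) j| ≤ L₀ * L * (b - a) := fun a b hab =>
        (PiLp.norm_apply_le (E (p b, x) - E (p a, x)) j).trans (l0 a b hab x)
      rcases le_total s s' with h | h
      · rw [abs_sub_comm, abs_sub_comm s s', abs_of_nonneg (sub_nonneg.2 h)]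
        exact key s s' h
      · rw [abs_of_nonneg (sub_nonneg.2 h)]
        exact key s' s h
    have e2 := hac.integral_deriv_eq_sub
    have e3 : ∫ s in (0 : ℝ)..t, deriv (fun s => E (p s, x) j) s =
        ∫ s in (0 : ℝ)..t, fderiv ℝ E (p s, x) (deriv p s, 0) j := by
      refine intervalIntegral.integral_congr_ae ?_
      filter_upwards [hder] with s hs _
      exact ((EuclideanSpace.proj (𝕜 := ℝ) j).hasFDerivAt.comp_hasDerivAt s hs).deriv
    rw [PiLp.add_apply, e1, ← e3, e2]
    ring
  · rcases hx with hx | hx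
    · exact hT t ((le_max_right _ _).trans_lt hx) x
    · exact hsupp _ _ (hpM t) ((le_max_left _ _).trans_lt hx)
  · rw [hrigid t ht x hx]
    ext i j
    simp [deform_apply]

end CurveTestFields

/-! ### Square integrable functions of time and space -/

section SpaceTime

variable {F : Type*} [NormedAddCommGroup F]

lemma spaceTime_eq_restrict (I : Set ℝ) :
    spaceTime I = (volume.prod volume : Measure (ℝ × R3)).restrict (I ×ˢ univ) := by
  rw [spaceTime, ← Measure.prod_restrict, Measure.restrict_univ]

instance (I : Set ℝ) : SigmaFinite (spaceTime I) := by
  rw [spaceTime]; infer_instance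

lemma lintegral_spaceTime {I : Set ℝ} {f : ℝ → R3 → F}
    (hf : AEStronglyMeasurable (Function.uncurry f) (spaceTime I)) :
    ∫⁻ z, ‖Function.uncurry f z‖ₑ ^ 2 ∂spaceTime I = ∫⁻ t in I, ∫⁻ x, ‖f t x‖ₑ ^ 2 :=
  lintegral_prod _ (hf.enorm.pow_const 2)

lemma ae_memLp_of_memLp_spaceTime {I : Set ℝ} {f : ℝ → R3 → F}
    (hf : MemLp (Function.uncurry f) 2 (spaceTime I)) :
    ∀ᵐ t ∂volume.restrict I, MemLp (f t) 2 volume := by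
  have h1 : ∀ᵐ t ∂volume.restrict I, AEStronglyMeasurable (f t) volume :=
    AEStronglyMeasurable.prodMk_left (f := Function.uncurry f) hf.1
  have h2 : ∀ᵐ t ∂volume.restrict I, Integrable (fun x => ‖f t x‖ ^ 2) volume :=
    Integrable.prod_right_ae (f := fun z : ℝ × R3 => ‖Function.uncurry f z‖ ^ 2)
      ((memLp_two_iff_integrable_sq_norm hf.1).1 hf)
  filter_upwards [h1, h2] with t ht1 ht2
  exact (memLp_two_iff_integrable_sq_norm ht1).2 ht2

/-- Monotone convergence along the intervals `(0, n + 1]`: bounds that are uniform in the final time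
hold on the whole half-line. -/
lemma memLp_spaceTime_Ioi {f : ℝ → R3 → F} {C : ℝ≥0∞} (hC : C < ∞)
    (hf : ∀ T : ℝ, 0 < T → MemLp (Function.uncurry f) 2 (spaceTime (Ioc 0 T)))
    (hb : ∀ T : ℝ, 0 < T → ∫⁻ z, ‖Function.uncurry f z‖ₑ ^ 2 ∂spaceTime (Ioc 0 T) ≤ C) :
    MemLp (Function.uncurry f) 2 (spaceTime (Ioi 0)) ∧
      ∫⁻ z, ‖Function.uncurry f z‖ₑ ^ 2 ∂spaceTime (Ioi 0) ≤ C := by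
  have hU : (Ioi (0 : ℝ) ×ˢ (univ : Set R3)) = ⋃ n : ℕ, Ioc (0 : ℝ) (n + 1) ×ˢ univ := by
    ext ⟨t, x⟩
    simp only [mem_prod, mem_Ioi, mem_univ, and_true, mem_iUnion, mem_Ioc]
    constructor
    · intro ht
      obtain ⟨n, hn⟩ := exists_nat_ge t
      exact ⟨n, ht, by linarith⟩
    · rintro ⟨n, h, _⟩; exact h
  have hmono : Monotone fun n : ℕ => Ioc (0 : ℝ) (n + 1) ×ˢ (univ : Set R3) := by
    intro m n hmn
    have : (m : ℝ) ≤ n := by exact_mod_cast hmn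
    exact prod_mono (Ioc_subset_Ioc_right (by linarith)) le_rfl
  have hm : AEStronglyMeasurable (Function.uncurry f) (spaceTime (Ioi 0)) := by
    rw [spaceTime_eq_restrict, hU, aestronglyMeasurable_iUnion_iff]
    intro n
    rw [← spaceTime_eq_restrict]
    exact (hf _ (by positivity)).1
  have hle : ∫⁻ z, ‖Function.uncurry f z‖ₑ ^ 2 ∂spaceTime (Ioi 0) ≤ C := by
    rw [spaceTime_eq_restrict, hU, setLIntegral_iUnion_of_directed _ hmono.directed_le]
    refine iSup_le fun n => ?_
    rw [← spaceTime_eq_restrict]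
    exact hb _ (by positivity)
  exact ⟨memLp_two_iff_lintegral.2 ⟨hm, hle.trans_lt hC⟩, hle⟩

end SpaceTime

/-! ### Rigid motions, and the a priori bounds drawn from the energy estimate -/

section RigidBody

variable {R : Matrix (Fin 3) (Fin 3) ℝ} {S₀ : Set R3}

lemma norm_matAct (hR : R ∈ Matrix.specialOrthogonalGroup (Fin 3) ℝ) (x : R3) :
    ‖matAct R x‖ = ‖x‖ := by
  have h1 : R.transpose * R = 1 :=
    (Matrix.mem_orthogonalGroup_iff' _ _).1 (Matrix.mem_specialOrthogonalGroup_iff.1 hR).1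
  have h2 : ‖matAct R x‖ ^ 2 = ‖x‖ ^ 2 := by
    rw [← real_inner_self_eq_norm_sq, ← real_inner_self_eq_norm_sq]
    have e : ∀ y : R3, inner ℝ y y = dotProduct y.ofLp y.ofLp := fun y => by
      rw [r3_inner]; rfl
    rw [e, e]
    change dotProduct (R.mulVec x.ofLp) (R.mulVec x.ofLp) = _
    rw [Matrix.dotProduct_mulVec, ← Matrix.mulVec_transpose, Matrix.mulVec_mulVec, h1,
      Matrix.one_mulVec]
  exact (pow_left_inj₀ (norm_nonneg _) (norm_nonneg _) two_ne_zero).1 h2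

/-- A rotation as a linear isometry. -/
def rotationIsometry (hR : R ∈ Matrix.specialOrthogonalGroup (Fin 3) ℝ) : R3 ≃ₗᵢ[ℝ] R3 :=
  LinearIsometry.toLinearIsometryEquiv
    { toFun := matAct R
      map_add' := fun x y => by simp [matAct, Matrix.mulVec_add]
      map_smul' := fun c x => by simp [matAct, Matrix.mulVec_smul]
      norm_map' := norm_matAct hR } rfl

lemma movedBody_eq_image (hR : R ∈ Matrix.specialOrthogonalGroup (Fin 3) ℝ) (h : R3) :
    movedBody S₀ h R = ((rotationIsometry hR).toHomeomorph.trans (Homeomorph.addLeft h)) '' S₀ :=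
  rfl

lemma measurePreserving_rigid (hR : R ∈ Matrix.specialOrthogonalGroup (Fin 3) ℝ) (h : R3) :
    MeasurePreserving ((rotationIsometry hR).toHomeomorph.trans (Homeomorph.addLeft h))
      volume volume :=
  (measurePreserving_add_left volume h).comp (rotationIsometry hR).measurePreserving

lemma isCompact_movedBody (hS : IsCompact S₀) (hR : R ∈ Matrix.specialOrthogonalGroup (Fin 3) ℝ)
    (h : R3) : IsCompact (movedBody S₀ h R) := by
  rw [movedBody_eq_image hR]
  exact hS.image (Homeomorph.continuous _)

lemma movedBody_subset_ball {r : ℝ} (hS : S₀ ⊆ Metric.ball 0 r)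
    (hR : R ∈ Matrix.specialOrthogonalGroup (Fin 3) ℝ) (h : R3) :
    movedBody S₀ h R ⊆ Metric.ball h r := by
  rintro _ ⟨x, hx, rfl⟩
  have := hS hx
  rw [mem_ball_zero_iff] at this
  simpa [norm_matAct hR] using this

lemma volume_movedBody (hR : R ∈ Matrix.specialOrthogonalGroup (Fin 3) ℝ) (h : R3) :
    volume.real (movedBody S₀ h R) = volume.real S₀ := by
  rw [movedBody_eq_image hR, measureReal_def, measureReal_def,
    ← (measurePreserving_rigid hR h).measure_preimage_emb (Homeomorph.measurableEmbedding _),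
    preimage_image_eq _ (Homeomorph.injective _)]

/-- A rigid motion preserves volume and carries the centre of mass from the origin to `h`. -/
lemma integral_movedBody (hR : R ∈ Matrix.specialOrthogonalGroup (Fin 3) ℝ) (h : R3)
    (hc : ∫ x in S₀, x = 0) : ∫ x in movedBody S₀ h R, (x - h) = 0 := by
  rw [movedBody_eq_image hR, (measurePreserving_rigid hR h).setIntegral_image_emb
    (Homeomorph.measurableEmbedding _)]
  have : ∀ x, (((rotationIsometry hR).toHomeomorph.trans (Homeomorph.addLeft h)) x - h) =
      (rotationIsometry hR) x := fun x => by
    change h + rotationIsometry hR x - h = _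
    simp
  simp only [this]
  have h2 := (rotationIsometry hR).toContinuousLinearEquiv.integral_comp_comm
    (μ := volume.restrict S₀) (fun x => x)
  simp only [hc, map_zero] at h2
  exact h2

/-- The momentum of the body is controlled by its kinetic energy. -/
lemma volume_mul_sq_le_of_rigid {S : Set R3} (hS : IsCompact S) {c V om : R3}
    (hc : ∫ x in S, (x - c) = 0) {u : R3 → R3} (hu : MemLp u 2 volume)
    (hrig : ∀ᵐ x, x ∈ S → u x = V + cross om (x - c)) :
    volume.real S * ‖V‖ ^ 2 ≤ ∫ x in S, ‖u x‖ ^ 2 := by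
  have hcst : ∀ c : ℝ, Integrable (fun _ : R3 => c) (volume.restrict S) :=
    fun c => integrableOn_const hS.measure_lt_top.ne
  let ℓ : R3 →L[ℝ] ℝ := LinearMap.toContinuousLinearMap
    { toFun := fun y => inner ℝ V (cross om y)
      map_add' := fun y z => by simp [cross, inner_add_right]
      map_smul' := fun k y => by simp [cross, inner_smul_right] }
  have hint : IntegrableOn (fun x : R3 => x - c) S := by
    exact (by fun_prop : Continuous fun x : R3 => x - c).continuousOn.integrableOn_compact hS
  -- The rotational part of the velocity has zero mean about the centre of mass, so `|S| |V|² = ∫ V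
  -- · u`. The estimate `V · u ≤ ½ |V|² + ½ |u|²` then suffices.
  have hℓ : ∫ x in S, ℓ (x - c) = 0 := by
    rw [ContinuousLinearMap.integral_comp_comm ℓ hint, hc, map_zero]
  have hu2 : IntegrableOn (fun x => ‖u x‖ ^ 2) S :=
    ((memLp_two_iff_integrable_sq_norm hu.1).1 hu).integrableOn
  have h1 : ∫ x in S, (‖V‖ ^ 2 + ℓ (x - c)) ≤
      ∫ x in S, ((1 / 2) * ‖u x‖ ^ 2 + (1 / 2) * ‖V‖ ^ 2) := by
    refine setIntegral_mono_on_ae ((hcst _).add (ℓ.integrable_comp hint))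
      ((hu2.const_mul _).add (hcst _)) hS.measurableSet ?_
    filter_upwards [hrig] with x hx hxS
    have e : ‖V‖ ^ 2 + ℓ (x - c) = inner ℝ V (u x) := by
      rw [hx hxS, inner_add_right, real_inner_self_eq_norm_sq]; rfl
    rw [e]
    have := real_inner_le_norm V (u x)
    nlinarith [sq_nonneg (‖V‖ - ‖u x‖)]
  rw [integral_add (hcst _) (ℓ.integrable_comp hint), hℓ,
    integral_add (hu2.const_mul _) (hcst _), integral_const_mul] at h1
  simp only [setIntegral_const, smul_eq_mul] at h1
  linarith

lemma globalDensity_of_mem {ρ : ℝ} {S : Set R3} {x : R3} (hx : x ∈ S) :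
    globalDensity ρ S x = ρ := by simp [globalDensity, hx]

lemma globalDensity_of_notMem {ρ : ℝ} {S : Set R3} {x : R3} (hx : x ∉ S) :
    globalDensity ρ S x = 1 := by simp [globalDensity, hx]

lemma measurable_globalDensity {ρ : ℝ} {S : Set R3} (hS : MeasurableSet S) :
    Measurable (globalDensity ρ S) :=
  (measurable_const.indicator hS.compl).add (measurable_const.indicator hS)

lemma one_le_globalDensity {ρ : ℝ} (hρ : 1 ≤ ρ) (S : Set R3) (x : R3) :
    1 ≤ globalDensity ρ S x := by
  by_cases hx : x ∈ S
  · rwa [globalDensity_of_mem hx]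
  · rw [globalDensity_of_notMem hx]

lemma globalDensity_le {ρ : ℝ} (hρ : 1 ≤ ρ) (S : Set R3) (x : R3) :
    globalDensity ρ S x ≤ ρ := by
  by_cases hx : x ∈ S
  · rw [globalDensity_of_mem hx]
  · rwa [globalDensity_of_notMem hx]

lemma integrable_globalDensity_mul_sq {ρ : ℝ} (hρ : 1 ≤ ρ) {S : Set R3} (hS : MeasurableSet S)
    {u : R3 → R3} (hu : MemLp u 2 volume) :
    Integrable fun x => globalDensity ρ S x * ‖u x‖ ^ 2 :=
  ((memLp_two_iff_integrable_sq_norm hu.1).1 hu).bdd_mul (c := ρ)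
    (measurable_globalDensity hS).aestronglyMeasurable
    (Eventually.of_forall fun x => by
      rw [Real.norm_of_nonneg (zero_le_one.trans (one_le_globalDensity hρ S x))]
      exact globalDensity_le hρ S x)

/-- The kinetic energy of the initial data. -/
lemma initial_energy_le {ρ : ℝ} (hρ : 1 ≤ ρ) (hS : IsCompact S₀) {u₀ : R3 → R3}
    (hu : MemLp u₀ 2 volume) {l om : R3} (hrig : ∀ᵐ x, x ∈ S₀ → u₀ x = l + cross om x) :
    ∫ x, globalDensity ρ S₀ x * ‖u₀ x‖ ^ 2 ≤ (∫ x, ‖u₀ x‖ ^ 2) +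
      2 * ‖√(bodyMass ρ S₀) • l‖ ^ 2 + 2 * inertia ρ S₀ 0 om om := by
  have hcst : ∀ c : ℝ, Integrable (fun _ : R3 => c) (volume.restrict S₀) :=
    fun c => integrableOn_const hS.measure_lt_top.ne
  have hρ0 : 0 ≤ ρ := by linarith
  have hu2 := (memLp_two_iff_integrable_sq_norm hu.1).1 hu
  have hcc : Continuous fun x : R3 => cross om x := by
    have : IsLinearMap ℝ fun x : R3 => cross om x :=
      ⟨fun y z => by simp [cross], fun k y => by simp [cross]⟩
    exact (this.mk' _).continuous_of_finiteDimensional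
  have hci : IntegrableOn (fun x : R3 => inner ℝ (cross om x) (cross om x)) S₀ :=
    (hcc.inner hcc).continuousOn.integrableOn_compact hS
  have hm : 0 ≤ bodyMass ρ S₀ := mul_nonneg hρ0 measureReal_nonneg
  have e1 : ‖√(bodyMass ρ S₀) • l‖ ^ 2 = ρ * (volume.real S₀ * ‖l‖ ^ 2) := by
    rw [norm_smul, mul_pow, Real.norm_of_nonneg (Real.sqrt_nonneg _), Real.sq_sqrt hm, bodyMass]
    ring
  have h1 : ∫ x in S₀, ‖u₀ x‖ ^ 2 ≤ 2 * (volume.real S₀ * ‖l‖ ^ 2) +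
      2 * ∫ x in S₀, inner ℝ (cross om x) (cross om x) := by
    have h2 : ∫ x in S₀, ‖u₀ x‖ ^ 2 ≤
        ∫ x in S₀, (2 * ‖l‖ ^ 2 + 2 * inner ℝ (cross om x) (cross om x)) := by
      refine setIntegral_mono_on_ae hu2.integrableOn
        ((hcst _).add (hci.const_mul 2)) hS.measurableSet ?_
      filter_upwards [hrig] with x hx hxS
      rw [hx hxS, real_inner_self_eq_norm_sq]
      have := norm_add_le l (cross om x)
      have h0 := norm_nonneg (l + cross om x)
      nlinarith [sq_nonneg (‖l‖ - ‖cross om x‖), norm_nonneg l, norm_nonneg (cross om x)]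
    rw [integral_add (hcst _) (hci.const_mul 2)] at h2
    simp only [integral_const_mul, setIntegral_const, smul_eq_mul] at h2
    linarith
  -- The body is counted with `ρ` instead of `ρ - 1`, on top of the whole fluid energy. This
  -- overestimate is harmless, since the rigid energies vanish in the sharp case.
  have h3 : ∀ x, globalDensity ρ S₀ x * ‖u₀ x‖ ^ 2 ≤
      ‖u₀ x‖ ^ 2 + ρ * S₀.indicator (fun x => ‖u₀ x‖ ^ 2) x := by
    intro x
    by_cases hx : x ∈ S₀
    · rw [globalDensity_of_mem hx, indicator_of_mem hx]
      nlinarith [sq_nonneg ‖u₀ x‖]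
    · rw [globalDensity_of_notMem hx, indicator_of_notMem hx]; simp
  have h4 : ∫ x, globalDensity ρ S₀ x * ‖u₀ x‖ ^ 2 ≤
      (∫ x, ‖u₀ x‖ ^ 2) + ρ * ∫ x in S₀, ‖u₀ x‖ ^ 2 := by
    rw [← integral_indicator hS.measurableSet, ← integral_const_mul, ← integral_add hu2
      ((hu2.indicator hS.measurableSet).const_mul ρ)]
    exact integral_mono (integrable_globalDensity_mul_sq hρ hS.measurableSet hu)
      (hu2.add ((hu2.indicator hS.measurableSet).const_mul ρ)) h3
  have e2 : inertia ρ S₀ 0 om om = ρ * ∫ x in S₀, inner ℝ (cross om x) (cross om x) := by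
    simp [inertia]
  rw [e1, e2]
  nlinarith [mul_le_mul_of_nonneg_left h1 hρ0]

variable {ν ρ ε : ℝ} {u₀ : R3 → R3} {u : ℝ → R3 → R3} {G : ℝ → R3 → Grad3} {h om : ℝ → R3}
  {Rt : ℝ → Matrix (Fin 3) (Fin 3) ℝ}

lemma IsWeakLeraySolution.ae_isSobolevField (hsol : IsWeakLeraySolution ν ρ S₀ u₀ u G h om Rt) :
    ∀ᵐ t ∂volume.restrict (Ioi (0 : ℝ)), IsSobolevField (u t) (G t) := by
  have h1 : ∀ n : ℕ, ∀ᵐ t ∂volume.restrict (Ioi (0 : ℝ)), t ∈ Ioc (0 : ℝ) (n + 1) →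
      MemLp (G t) 2 volume := by
    intro n
    have := ae_memLp_of_memLp_spaceTime (hsol.energyClass.grad_memLp (n + 1) (by positivity))
    rw [ae_restrict_iff' measurableSet_Ioc] at this
    exact ae_restrict_of_ae this
  filter_upwards [ae_all_iff.2 h1, hsol.energyClass.grad, ae_restrict_mem measurableSet_Ioi]
    with t ht1 ht2 ht3
  obtain ⟨n, hn⟩ := exists_nat_ge t
  exact ⟨hsol.weaklyContinuous.1 t (mem_Ioi.1 ht3).le, ht1 n ⟨ht3, by linarith⟩, ht2⟩

lemma integrable_symGrad_sq {I : Set ℝ} {G : ℝ → R3 → Grad3}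
    (hG : MemLp (Function.uncurry G) 2 (spaceTime I)) :
    Integrable (fun z : ℝ × R3 => ‖symGrad (Function.uncurry G z)‖ ^ 2) (spaceTime I) := by
  have := symGrad.comp_memLp' hG
  exact (memLp_two_iff_integrable_sq_norm this.1).1 this

lemma energy_dissipation_nonneg (G : ℝ → R3 → Grad3) (t : ℝ) :
    0 ≤ ∫ s in Ioc 0 t, ∫ x, ddot (deform (G s x)) (deform (G s x)) := by
  refine integral_nonneg fun s => integral_nonneg fun x => ?_
  simp only [Pi.zero_apply]
  rw [ddot_deform_self]; positivity

/-- For positive times the dissipation is dropped and the density is bounded below by one. The case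
`t = 0` is not part of the energy estimate and is recovered from weak continuity. -/
lemma kinetic_energy_le (hν : 0 < ν) (hsol : IsWeakLeraySolution ν ρ S₀ u₀ u G h om Rt)
    (hen : SatisfiesBodyEnergyEstimate ν ρ S₀ u₀ u G h Rt) (hρ : 1 ≤ ρ) (hS : IsCompact S₀)
    {t : ℝ} (ht : 0 ≤ t) :
    ∫ x, ‖u t x‖ ^ 2 ≤ ∫ x, globalDensity ρ S₀ x * ‖u₀ x‖ ^ 2 := by
  have hL := hsol.weaklyContinuous.1
  have hpos : ∀ t, 0 < t → ∫ x, ‖u t x‖ ^ 2 ≤ ∫ x, globalDensity ρ S₀ x * ‖u₀ x‖ ^ 2 := by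
    intro t ht
    have h1 := hen t ht
    have h2 := mul_nonneg (by positivity : 0 ≤ 4 * ν) (energy_dissipation_nonneg G t)
    refine le_trans ?_ (le_trans (le_add_of_nonneg_right h2) h1)
    have hm := (isCompact_movedBody hS (hsol.motion.rotation_mem t ht.le) (h t)).measurableSet
    refine integral_mono ((memLp_two_iff_integrable_sq_norm (hL t ht.le).1).1 (hL t ht.le))
      (integrable_globalDensity_mul_sq hρ hm (hL t ht.le)) fun x => ?_
    have := one_le_globalDensity hρ (movedBody S₀ (h t) (Rt t)) x
    dsimp only
    nlinarith [sq_nonneg ‖u t x‖]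
  -- At `t = 0` weak lower semicontinuity is obtained by passing to the limit in `2 ⟨u(t), u(0)⟩ -
  -- ‖u(0)‖² ≤ ‖u(t)‖²`.
  rcases ht.eq_or_lt with rfl | ht
  · have hc := hsol.weaklyContinuous.2 (u 0) (hL 0 le_rfl) 0 self_mem_Ici
    have hc2 : Tendsto (fun t => ∫ x, inner ℝ (u t x) (u 0 x)) (𝓝[>] 0)
        (𝓝 (∫ x, inner ℝ (u 0 x) (u 0 x))) := hc.mono_left (nhdsWithin_mono _ Ioi_subset_Ici_self)
    simp only [real_inner_self_eq_norm_sq] at hc2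
    have h5 := (hc2.const_mul 2).sub_const (∫ x, ‖u 0 x‖ ^ 2)
    have h6 : 2 * (∫ x, ‖u 0 x‖ ^ 2) - ∫ x, ‖u 0 x‖ ^ 2 ≤
        ∫ x, globalDensity ρ S₀ x * ‖u₀ x‖ ^ 2 := by
      refine le_of_tendsto h5 ?_
      filter_upwards [self_mem_nhdsWithin] with t ht
      refine le_trans ?_ (hpos t ht)
      have hLt := hL t (mem_Ioi.1 ht).le
      have i1 := integrable_inner_of_memLp_two hLt (hL 0 le_rfl)
      have i2 := (memLp_two_iff_integrable_sq_norm (hL 0 le_rfl).1).1 (hL 0 le_rfl)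
      rw [← integral_const_mul, ← integral_sub (i1.const_mul 2) i2]
      refine integral_mono ((i1.const_mul 2).sub i2)
        ((memLp_two_iff_integrable_sq_norm hLt.1).1 hLt) fun x => ?_
      have := real_inner_le_norm (u t x) (u 0 x)
      dsimp only
      nlinarith [sq_nonneg (‖u t x‖ - ‖u 0 x‖)]
    linarith
  · exact hpos t ht

lemma two_mul_ofReal (r : ℝ) : 2 * ENNReal.ofReal r = ENNReal.ofReal (2 * r) := by
  rw [ENNReal.ofReal_mul (by norm_num), ENNReal.ofReal_ofNat]

/-- The energy estimate bounds `4 ν ∫∫ |D(u)|²`, and Korn's inequality costs a factor `2`; hence the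
denominator `2 ν`. The bound does not depend on the final time. -/
lemma gradient_energy_le (hν : 0 < ν) (hsol : IsWeakLeraySolution ν ρ S₀ u₀ u G h om Rt)
    (hen : SatisfiesBodyEnergyEstimate ν ρ S₀ u₀ u G h Rt) (hρ : 1 ≤ ρ) :
    MemLp (Function.uncurry G) 2 (spaceTime (Ioi 0)) ∧
      ∫⁻ z, ‖Function.uncurry G z‖ₑ ^ 2 ∂spaceTime (Ioi 0) ≤
        ENNReal.ofReal ((∫ x, globalDensity ρ S₀ x * ‖u₀ x‖ ^ 2) / (2 * ν)) := by
  refine memLp_spaceTime_Ioi ENNReal.ofReal_lt_top hsol.energyClass.grad_memLp fun T hT => ?_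
  have hGT := hsol.energyClass.grad_memLp T hT
  have h1 := hen T hT
  have h2 : 0 ≤ ∫ x, globalDensity ρ (movedBody S₀ (h T) (Rt T)) x * ‖u T x‖ ^ 2 :=
    integral_nonneg fun x => mul_nonneg
      (zero_le_one.trans (one_le_globalDensity hρ _ x)) (sq_nonneg _)
  rw [lintegral_spaceTime hGT.1]
  have hint : Integrable (fun t => ∫ x, ‖symGrad (G t x)‖ ^ 2) (volume.restrict (Ioc 0 T)) :=
    (integrable_symGrad_sq hGT).integral_prod_left
  have h3 : ∫⁻ t in Ioc 0 T, ∫⁻ x, ‖G t x‖ₑ ^ 2 ≤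
      ∫⁻ t in Ioc 0 T, 2 * ENNReal.ofReal (∫ x, ‖symGrad (G t x)‖ ^ 2) := by
    refine lintegral_mono_ae ?_
    have h4 : ∀ᵐ t ∂volume.restrict (Ioc 0 T), IsSobolevField (u t) (G t) :=
      ae_restrict_of_ae_restrict_of_subset Ioc_subset_Ioi_self hsol.ae_isSobolevField
    filter_upwards [h4, ae_restrict_mem measurableSet_Ioc] with t ht ht2
    refine (lintegral_korn ht (hsol.divFree t ht2.1.le)).trans_eq ?_
    rw [ofReal_integral_norm_sq (f := fun x => symGrad (G t x)) (symGrad.comp_memLp' ht.grad_memLp)]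
  refine h3.trans ?_
  rw [lintegral_const_mul' _ _ (by norm_num), ← ofReal_integral_eq_lintegral_ofReal hint
    (Eventually.of_forall fun t => integral_nonneg fun x => sq_nonneg _),
    two_mul_ofReal]
  apply ENNReal.ofReal_le_ofReal
  simp only [ddot_deform_self] at h1
  rw [le_div_iff₀ (by positivity)]
  linarith

/-- The kinetic energy of the body is part of the total energy and dominates that of its
translation. This is the only place where the speed of the body is estimated. -/
lemma body_momentum_le (hν : 0 < ν) (hsol : IsWeakLeraySolution ν ρ S₀ u₀ u G h om Rt)
    (hen : SatisfiesBodyEnergyEstimate ν ρ S₀ u₀ u G h Rt) (hρ : 1 ≤ ρ) (hS : IsCompact S₀)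
    (hc : ∫ x in S₀, x = 0) :
    ∀ᵐ t ∂volume.restrict (Ioi (0 : ℝ)),
      bodyMass ρ S₀ * ‖deriv h t‖ ^ 2 ≤ ∫ x, globalDensity ρ S₀ x * ‖u₀ x‖ ^ 2 := by
  filter_upwards [hsol.velocity_body, ae_restrict_mem measurableSet_Ioi] with t ht ht0
  have ht0' : 0 ≤ t := (mem_Ioi.1 ht0).le
  have hR := hsol.motion.rotation_mem t ht0'
  have hL := hsol.weaklyContinuous.1 t ht0'
  have hcpt := isCompact_movedBody hS hR (h t)
  have h1 := volume_mul_sq_le_of_rigid hcpt (integral_movedBody hR (h t) hc) hL ht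
  rw [volume_movedBody hR] at h1
  have h2 := hen t ht0
  have h3 := mul_nonneg (by positivity : 0 ≤ 4 * ν) (energy_dissipation_nonneg G t)
  have hi := integrable_globalDensity_mul_sq hρ hcpt.measurableSet hL
  have h4 : ρ * ∫ x in movedBody S₀ (h t) (Rt t), ‖u t x‖ ^ 2 ≤
      ∫ x, globalDensity ρ (movedBody S₀ (h t) (Rt t)) x * ‖u t x‖ ^ 2 := by
    have h5 := setIntegral_le_integral (s := movedBody S₀ (h t) (Rt t)) hi
      (Eventually.of_forall fun x => mul_nonneg
        (zero_le_one.trans (one_le_globalDensity hρ _ x)) (sq_nonneg _))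
    refine le_trans (le_of_eq ?_) h5
    rw [← integral_const_mul]
    refine setIntegral_congr_fun hcpt.measurableSet fun x hx => ?_
    simp only [globalDensity_of_mem hx]
  have h6 : bodyMass ρ S₀ * ‖deriv h t‖ ^ 2 = ρ * (volume.real S₀ * ‖deriv h t‖ ^ 2) := by
    rw [bodyMass]; ring
  rw [h6]
  have h7 := mul_le_mul_of_nonneg_left h1 (zero_le_one.trans hρ)
  linarith

end RigidBody

/-! ### The integrand of the momentum equation, and pairings localised in small balls -/

section Momentum

/-- The integrand of the weak formulation of the momentum equation, for the velocity `w` with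
gradient `A`, tested with a field with time derivative `a` and gradient `b`. -/
def momentum (ν : ℝ) (w : R3) (A : Grad3) (a : R3) (b : Grad3) : ℝ :=
  inner ℝ w (a + convect w b) - 2 * ν * inner ℝ A (symGrad b)

variable {ν : ℝ}

lemma momentum_sub (w : R3) (A : Grad3) (a a' : R3) (b b' : Grad3) :
    momentum ν w A (a - a') (b - b') = momentum ν w A a b - momentum ν w A a' b' := by
  simp only [momentum, convect_sub, map_sub, inner_sub_right, inner_add_right]
  ring

lemma convect_smul (c : ℝ) (w : R3) (A : Grad3) : convect w (c • A) = c • convect w A := by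
  simp only [convect, Finset.smul_sum, PiLp.smul_apply]
  exact Finset.sum_congr rfl fun i _ => smul_comm _ _ _

lemma momentum_smul (w : R3) (A : Grad3) (c : ℝ) (a : R3) (b : Grad3) :
    momentum ν w A (c • a) (c • b) = c * momentum ν w A a b := by
  simp only [momentum, convect_smul, map_smul, ← smul_add, inner_smul_right]
  ring

section Integrability

variable {α : Type*} [MeasurableSpace α] {μ : Measure α} {w a : α → R3} {A b : α → Grad3}

lemma integrable_inner_convect {c : ℝ} (hw : MemLp w 2 μ) (hb : AEStronglyMeasurable b μ)
    (hbc : ∀ᵐ z ∂μ, ‖b z‖ ≤ c) : Integrable (fun z => inner ℝ (w z) (convect (w z) (b z))) μ := by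
  have hm : AEStronglyMeasurable (fun z => convect (w z) (b z)) μ :=
    continuous_convect.comp_aestronglyMeasurable (hw.1.prodMk hb)
  refine Integrable.mono' (((memLp_two_iff_integrable_sq_norm hw.1).1 hw).const_mul c)
    (hw.1.inner hm) ?_
  filter_upwards [hbc] with z hz
  refine (norm_inner_le_norm _ _).trans ?_
  have h1 := norm_convect_le (w z) (b z)
  calc ‖w z‖ * ‖convect (w z) (b z)‖ ≤ ‖w z‖ * (‖w z‖ * c) := by
        gcongr; exact h1.trans (by gcongr)
    _ = c * ‖w z‖ ^ 2 := by ring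

lemma integrable_inner_symGrad (hA : MemLp A 2 μ) (hb : MemLp b 2 μ) :
    Integrable (fun z => inner ℝ (A z) (symGrad (b z))) μ :=
  integrable_inner_of_memLp_two hA (symGrad.comp_memLp' hb)

lemma integrable_inner_dt_add_convect {c : ℝ} (hw : MemLp w 2 μ) (ha : MemLp a 2 μ)
    (hb : AEStronglyMeasurable b μ) (hbc : ∀ᵐ z ∂μ, ‖b z‖ ≤ c) :
    Integrable (fun z => inner ℝ (w z) (a z + convect (w z) (b z))) μ := by
  simp only [inner_add_right]
  exact (integrable_inner_of_memLp_two hw ha).add (integrable_inner_convect hw hb hbc)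

lemma integrable_momentum {c : ℝ} (hw : MemLp w 2 μ) (hA : MemLp A 2 μ) (ha : MemLp a 2 μ)
    (hb : MemLp b 2 μ) (hbc : ∀ᵐ z ∂μ, ‖b z‖ ≤ c) :
    Integrable (fun z => momentum ν (w z) (A z) (a z) (b z)) μ :=
  (integrable_inner_dt_add_convect hw ha hb.1 hbc).sub
    ((integrable_inner_symGrad hA hb).const_mul (2 * ν))

end Integrability

/-- Bounded fields with bounded support are square integrable on bounded time intervals. -/
lemma memLp_spaceTime_of_bound {F : Type*} [NormedAddCommGroup F] {a : ℝ × R3 → F} {T c K : ℝ}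
    (ha : AEStronglyMeasurable a (spaceTime (Ioc 0 T)))
    (hc : ∀ᵐ z ∂spaceTime (Ioc 0 T), ‖a z‖ ≤ c)
    (hK : ∀ᵐ z ∂spaceTime (Ioc 0 T), K < ‖z.2‖ → a z = 0) :
    MemLp a 2 (spaceTime (Ioc 0 T)) := by
  have hfin : spaceTime (Ioc 0 T) (univ ×ˢ Metric.closedBall (0 : R3) K) ≠ ∞ := by
    rw [spaceTime, Measure.prod_prod]
    exact ENNReal.mul_ne_top (by simp) measure_closedBall_lt_top.ne
  have hms : MeasurableSet ((univ : Set ℝ) ×ˢ Metric.closedBall (0 : R3) K) :=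
    MeasurableSet.univ.prod measurableSet_closedBall
  have h1 : MemLp (((univ : Set ℝ) ×ˢ Metric.closedBall (0 : R3) K).indicator fun _ => c) 2
      (spaceTime (Ioc 0 T)) := memLp_indicator_const 2 hms c (Or.inr hfin)
  refine h1.mono ha ?_
  filter_upwards [hc, hK] with z hz1 hz2
  by_cases hz : z ∈ (univ : Set ℝ) ×ˢ Metric.closedBall (0 : R3) K
  · rw [indicator_of_mem hz]
    exact hz1.trans (le_abs_self c)
  · rw [hz2 (by simpa using hz)]
    simp

lemma integral_ball_norm_sq_le {v : R3 → R3} {A : R3 → Grad3} (h : IsSobolevField v A) (a : R3)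
    {r : ℝ} (hr : 0 < r) :
    ∫ x in Metric.ball a r, ‖v x‖ ^ 2 ≤ 8 * r ^ 2 * ∫ x, ‖A x‖ ^ 2 := by
  have h0 : 0 ≤ ∫ x, ‖A x‖ ^ 2 := integral_nonneg fun x => sq_nonneg _
  rw [← ENNReal.ofReal_le_ofReal_iff (by positivity), ENNReal.ofReal_mul (by positivity),
    ofReal_integral_norm_sq (h.memLp.restrict _), ofReal_integral_norm_sq h.grad_memLp]
  exact lintegral_hardy h a hr

/-- The pairing of a square integrable field and a bounded field supported in a ball. -/
lemma abs_integral_inner_le {E : Type*} [NormedAddCommGroup E] [InnerProductSpace ℝ E]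
    {f g : R3 → E} (hf : MemLp f 2 volume) {c r : ℝ} {a : R3} (hg : ∀ x, ‖g x‖ ≤ c)
    (hs : ∀ x, x ∉ Metric.ball a r → g x = 0) {l : ℝ} (hl : 0 < l) :
    |∫ x, inner ℝ (f x) (g x)| ≤
      c * (l * volume.real (Metric.ball a r) + l⁻¹ * ∫ x in Metric.ball a r, ‖f x‖ ^ 2) := by
  have hc : 0 ≤ c := (norm_nonneg _).trans (hg 0)
  have hi : Integrable (fun x => ‖f x‖ ^ 2) (volume.restrict (Metric.ball a r)) :=
    ((memLp_two_iff_integrable_sq_norm hf.1).1 hf).integrableOn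
  have hcst : Integrable (fun _ => l) (volume.restrict (Metric.ball a r)) :=
    integrableOn_const measure_ball_lt_top.ne
  have e1 : c * (l * volume.real (Metric.ball a r) + l⁻¹ * ∫ x in Metric.ball a r, ‖f x‖ ^ 2) =
      ∫ x, (Metric.ball a r).indicator (fun x => c * (l + l⁻¹ * ‖f x‖ ^ 2)) x := by
    rw [integral_indicator measurableSet_ball, integral_const_mul,
      integral_add hcst (hi.const_mul _), integral_const_mul, setIntegral_const, smul_eq_mul]
    ring
  rw [e1, ← Real.norm_eq_abs]
  refine norm_integral_le_of_norm_le
    (IntegrableOn.integrable_indicator ((hcst.add (hi.const_mul l⁻¹)).const_mul c)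
      measurableSet_ball)
    (Eventually.of_forall fun x => ?_)
  by_cases hx : x ∈ Metric.ball a r
  · rw [indicator_of_mem hx]
    refine (norm_inner_le_norm _ _).trans ?_
    -- A substitute for Cauchy–Schwarz; the free parameter `l` is later tuned to the radius of the
    -- ball and to the size of `g`.
    have h1 : ‖f x‖ ≤ l + l⁻¹ * ‖f x‖ ^ 2 := by
      have h2 : l⁻¹ * ‖f x‖ ^ 2 - ‖f x‖ + l = l⁻¹ * ((‖f x‖ - l / 2) ^ 2 + 3 / 4 * l ^ 2) := by
        field_simp; ring
      have h3 : 0 ≤ l⁻¹ * ((‖f x‖ - l / 2) ^ 2 + 3 / 4 * l ^ 2) := by positivity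
      linarith
    calc ‖f x‖ * ‖g x‖ ≤ (l + l⁻¹ * ‖f x‖ ^ 2) * c := by
          gcongr
          exact hg x
      _ = _ := mul_comm _ _
  · rw [indicator_of_notMem hx, hs x hx]; simp

lemma abs_integral_inner_convect_le {f : R3 → R3} {g : R3 → Grad3} (hf : MemLp f 2 volume)
    {c r : ℝ} {a : R3} (hg : ∀ x, ‖g x‖ ≤ c) (hs : ∀ x, x ∉ Metric.ball a r → g x = 0) :
    |∫ x, inner ℝ (f x) (convect (f x) (g x))| ≤ c * ∫ x in Metric.ball a r, ‖f x‖ ^ 2 := by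
  have hi : Integrable (fun x => ‖f x‖ ^ 2) (volume.restrict (Metric.ball a r)) :=
    ((memLp_two_iff_integrable_sq_norm hf.1).1 hf).integrableOn
  rw [← integral_const_mul, ← integral_indicator measurableSet_ball, ← Real.norm_eq_abs]
  refine norm_integral_le_of_norm_le
    (IntegrableOn.integrable_indicator (hi.const_mul c) measurableSet_ball)
    (Eventually.of_forall fun x => ?_)
  by_cases hx : x ∈ Metric.ball a r
  · rw [indicator_of_mem hx]
    refine (norm_inner_le_norm _ _).trans ?_
    have h1 := norm_convect_le (f x) (g x)
    calc ‖f x‖ * ‖convect (f x) (g x)‖ ≤ ‖f x‖ * (‖f x‖ * c) := by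
          gcongr
          exact h1.trans (by gcongr; exact hg x)
      _ = c * ‖f x‖ ^ 2 := by ring
  · rw [indicator_of_notMem hx, hs x hx]
    simp [convect]

end Momentum

/-! ### Bounds for the corrector and for its contribution to the momentum equation -/

section CorrectorFamily

variable {φ : ℝ × R3 → R3}

/-- The corrector as a function of time, of the position of the body, and of the space variable. -/
def correctorMap (φ : ℝ × R3 → R3) (e : ℝ) (q : ℝ × R3 × R3) : R3 :=
  bodyCorrector φ e q.1 q.2.1 q.2.2

lemma contDiff_correctorMap (hφ : ContDiff ℝ (⊤ : ℕ∞) φ) (e : ℝ) :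
    ContDiff ℝ (⊤ : ℕ∞) (correctorMap φ e) :=
  (contDiff_corrector hφ).comp
    (f := fun q : ℝ × R3 × R3 => (q.1, q.2.1, e, e⁻¹ • (q.2.2 - q.2.1))) (by fun_prop)

/-- The chain rule: motion of the centre enters both directly and through `-v / e` in the rescaled
variable. The latter is the origin of the factor `‖b‖ / e` in the bound of the time derivative. -/
lemma fderiv_correctorMap_apply (hφ : ContDiff ℝ (⊤ : ℕ∞) φ) (e : ℝ) (q v : ℝ × R3 × R3) :
    fderiv ℝ (correctorMap φ e) q v =
      fderiv ℝ (corrector φ) (q.1, q.2.1, e, e⁻¹ • (q.2.2 - q.2.1))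
        (v.1, v.2.1, 0, e⁻¹ • (v.2.2 - v.2.1)) := by
  let L : (ℝ × R3 × R3) →L[ℝ] (ℝ × R3 × ℝ × R3) :=
    (ContinuousLinearMap.fst ℝ ℝ (R3 × R3)).prod
      (((ContinuousLinearMap.fst ℝ R3 R3).comp (ContinuousLinearMap.snd ℝ ℝ (R3 × R3))).prod
        ((0 : (ℝ × R3 × R3) →L[ℝ] ℝ).prod
          (e⁻¹ • ((ContinuousLinearMap.snd ℝ R3 R3).comp (ContinuousLinearMap.snd ℝ ℝ (R3 × R3)) -
            (ContinuousLinearMap.fst ℝ R3 R3).comp (ContinuousLinearMap.snd ℝ ℝ (R3 × R3))))))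
  have h1 : HasFDerivAt (fun q => L q + (0, 0, e, 0)) L q := L.hasFDerivAt.add_const _
  have h2 := (contDiff_top_differentiable (contDiff_corrector hφ)
    (L q + (0, 0, e, 0))).hasFDerivAt.comp q h1
  have hfun : correctorMap φ e = corrector φ ∘ fun q => L q + (0, 0, e, 0) := by
    ext1 q
    simp [correctorMap, bodyCorrector, L]
  rw [hfun, h2.fderiv]
  simp [L]

lemma correctorMap_near_zero {e : ℝ} (he : 0 < e) {q : ℝ × R3 × R3}
    (hq : 2 * e < ‖q.2.2 - q.2.1‖) : correctorMap φ e =ᶠ[𝓝 q] fun _ => 0 := by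
  have ho : IsOpen {q : ℝ × R3 × R3 | 2 * e < ‖q.2.2 - q.2.1‖} :=
    isOpen_lt continuous_const (by fun_prop)
  filter_upwards [ho.mem_nhds hq] with r hr
  exact bodyCorrector_eq_zero he (le_of_lt hr)

lemma gradField_bodyCorrector (hφ : ContDiff ℝ (⊤ : ℕ∞) φ) (e t : ℝ) (a x : R3) (i : Fin 3) :
    gradField (bodyCorrector φ e t a) x i =
      fderiv ℝ (correctorMap φ e) (t, a, x) (0, 0, basisVec i) := by
  have h0 : HasFDerivAt (fun y : R3 => (t, a, y)) ((0 : R3 →L[ℝ] ℝ).prod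
      ((0 : R3 →L[ℝ] R3).prod (ContinuousLinearMap.id ℝ R3))) x :=
    (hasFDerivAt_const t x).prodMk ((hasFDerivAt_const a x).prodMk (hasFDerivAt_id x))
  have h := (contDiff_top_differentiable (contDiff_correctorMap hφ e) (t, a, x)).hasFDerivAt.comp x
    h0
  rw [gradField_apply]
  change fderiv ℝ (correctorMap φ e ∘ fun x => (t, a, x)) x (basisVec i) = _
  rw [h.fderiv]
  simp

/-- Bounds for the corrector and its derivatives, for bodies of size `e`. -/
lemma exists_corrector_bounds (hφ : ContDiff ℝ (⊤ : ℕ∞) φ) (hs : HasCompactSupport φ) :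
    ∃ C : ℝ, 0 ≤ C ∧ ∀ e : ℝ, 0 < e → e ≤ 1 → ∀ (t : ℝ) (a x : R3),
      ‖bodyCorrector φ e t a x‖ ≤ C ∧ ‖gradField (bodyCorrector φ e t a) x‖ ≤ C / e ∧
      ∀ b : R3, ‖fderiv ℝ (correctorMap φ e) (t, a, x) (1, b, 0)‖ ≤ C * (1 + ‖b‖ / e) := by
  -- In rescaled coordinates, with the size as a variable, the corrector is a single smooth
  -- compactly supported function. Its bounds are therefore uniform in `e`, and all powers of `1 /
  -- e` come from the rescaling.
  have hc := contDiff_corrector hφ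
  have hcs := hasCompactSupport_corrector hs
  obtain ⟨C₀, hC₀⟩ := hcs.exists_bound_of_continuous hc.continuous
  obtain ⟨C₁, hC₁⟩ := (hcs.fderiv (𝕜 := ℝ)).exists_bound_of_continuous
    (hc.continuous_fderiv (by simp))
  have h0 : 0 ≤ C₀ := (norm_nonneg _).trans (hC₀ 0)
  have h1 : 0 ≤ C₁ := (norm_nonneg _).trans (hC₁ 0)
  refine ⟨C₀ + 3 * C₁, by positivity, fun e he he1 t a x => ⟨?_, ?_, fun b => ?_⟩⟩
  · exact (hC₀ _).trans (by linarith)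
  · have hi : ∀ i, ‖gradField (bodyCorrector φ e t a) x i‖ ≤ C₁ / e := by
      intro i
      rw [gradField_bodyCorrector hφ, fderiv_correctorMap_apply hφ]
      refine (ContinuousLinearMap.le_opNorm _ _).trans ?_
      have hn : ‖((0 : ℝ), (0 : R3), (0 : ℝ), e⁻¹ • (basisVec i - 0))‖ ≤ e⁻¹ := by
        simp [Prod.norm_def, norm_smul, norm_basisVec, abs_of_pos he, he.le]
      rw [div_eq_mul_inv]
      exact mul_le_mul (hC₁ _) hn (norm_nonneg _) h1
    have hsq : ‖gradField (bodyCorrector φ e t a) x‖ ^ 2 ≤ (3 * C₁ / e) ^ 2 := by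
      rw [PiLp.norm_sq_eq_of_L2, Fin.sum_univ_three]
      have h2 : ∀ i, ‖gradField (bodyCorrector φ e t a) x i‖ ^ 2 ≤ (C₁ / e) ^ 2 := fun i =>
        pow_le_pow_left₀ (norm_nonneg _) (hi i) 2
      have e1 : (3 * C₁ / e) ^ 2 = 9 * (C₁ / e) ^ 2 := by ring
      have h3 := sq_nonneg (C₁ / e)
      linarith [h2 0, h2 1, h2 2]
    have h4 := abs_le_of_sq_le_sq hsq (by positivity)
    rw [abs_of_nonneg (norm_nonneg _)] at h4
    refine h4.trans ?_
    gcongr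
    linarith
  · rw [fderiv_correctorMap_apply hφ]
    refine (ContinuousLinearMap.le_opNorm _ _).trans ?_
    have hn : ‖((1 : ℝ), b, (0 : ℝ), e⁻¹ • ((0 : R3) - b))‖ ≤ 1 + ‖b‖ / e := by
      have hbe : ‖b‖ ≤ ‖b‖ / e := by
        rw [le_div_iff₀ he]
        exact mul_le_of_le_one_right (norm_nonneg _) he1
      have hb0 : 0 ≤ ‖b‖ / e := by positivity
      simp only [Prod.norm_def, norm_zero, zero_sub, norm_smul, norm_neg, norm_one, norm_inv,
        Real.norm_of_nonneg he.le]
      rw [inv_mul_eq_div]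
      refine max_le (by linarith) (max_le (by linarith) (max_le (by linarith) (by linarith)))
    exact mul_le_mul ((hC₁ _).trans (by linarith)) hn (norm_nonneg _) (by positivity)

variable {e : ℝ}

/-- The support lies in the ball of radius `2 e`. The larger radius `3 e` is used throughout because
the derivatives vanish on the open set `‖x - a‖ > 2 e`. -/
lemma bodyCorrector_eq_zero_of_notMem (he : 0 < e) {t : ℝ} {a x : R3}
    (hx : x ∉ Metric.ball a (3 * e)) : bodyCorrector φ e t a x = 0 := by
  rw [Metric.mem_ball, dist_eq_norm, not_lt] at hx
  exact bodyCorrector_eq_zero he (by linarith)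

lemma fderiv_correctorMap_eq_zero_of_notMem (he : 0 < e) {t : ℝ} {a x : R3}
    (hx : x ∉ Metric.ball a (3 * e)) : fderiv ℝ (correctorMap φ e) (t, a, x) = 0 := by
  rw [Metric.mem_ball, dist_eq_norm, not_lt] at hx
  rw [(correctorMap_near_zero he (q := (t, a, x)) (by simp only; linarith)).fderiv_eq]
  simp

lemma gradField_bodyCorrector_eq_zero_of_notMem (hφ : ContDiff ℝ (⊤ : ℕ∞) φ) (he : 0 < e) {t : ℝ}
    {a x : R3} (hx : x ∉ Metric.ball a (3 * e)) : gradField (bodyCorrector φ e t a) x = 0 := by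
  ext i : 1
  rw [gradField_bodyCorrector hφ, fderiv_correctorMap_eq_zero_of_notMem he hx]
  simp

lemma volume_real_ball (a : R3) {r : ℝ} (hr : 0 ≤ r) :
    volume.real (Metric.ball a r) = r ^ 3 * volume.real (Metric.ball (0 : R3) 1) := by
  rw [measureReal_def, Measure.addHaar_ball _ _ hr, ENNReal.toReal_mul,
    ENNReal.toReal_ofReal (by positivity), measureReal_def]
  simp

/-- The constant in the bounds for the terms due to the presence of the body. -/
def bodyConst : ℝ := 108 * volume.real (Metric.ball (0 : R3) 1) + 216

/-- The pairing with the corrector is small. -/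
lemma abs_integral_inner_corrector_le {C s E : ℝ} {f g : R3 → R3} {a : R3} (hs : 0 < s)
    (hs1 : s ≤ 1) (hf : MemLp f 2 volume) (hE : ∫ x, ‖f x‖ ^ 2 ≤ E) (hC : ∀ x, ‖g x‖ ≤ C)
    (hsupp : ∀ x, x ∉ Metric.ball a (3 * s ^ 2) → g x = 0) :
    |∫ x, inner ℝ (f x) (g x)| ≤ C * bodyConst * s * (1 + E) := by
  have hC0 : 0 ≤ C := (norm_nonneg _).trans (hC 0)
  have hi := (memLp_two_iff_integrable_sq_norm hf.1).1 hf
  have hE1 : ∫ x in Metric.ball a (3 * s ^ 2), ‖f x‖ ^ 2 ≤ E :=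
    (setIntegral_le_integral hi (Eventually.of_forall fun x => sq_nonneg _)).trans hE
  have hE0 : 0 ≤ E := (integral_nonneg fun x => sq_nonneg _).trans hE
  refine (abs_integral_inner_le hf hC hsupp (l := s⁻¹) (by positivity)).trans ?_
  rw [volume_real_ball _ (by positivity), inv_inv, bodyConst]
  set κ := volume.real (Metric.ball (0 : R3) 1)
  have hκ : 0 ≤ κ := measureReal_nonneg
  rw [mul_assoc C, mul_assoc C]
  gcongr
  calc s⁻¹ * ((3 * s ^ 2) ^ 3 * κ) + s * ∫ x in Metric.ball a (3 * s ^ 2), ‖f x‖ ^ 2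
      ≤ s⁻¹ * ((3 * s ^ 2) ^ 3 * κ) + s * E := by gcongr
    _ = s * (27 * s ^ 4 * κ + E) := by field_simp; ring
    _ ≤ s * (27 * 1 * κ + E) := by
        gcongr
        exact pow_le_one₀ hs.le hs1
    _ ≤ (108 * κ + 216) * s * (1 + E) := by
        nlinarith [mul_nonneg hs.le hE0, mul_nonneg hs.le hκ, mul_nonneg (mul_nonneg hs.le hE0) hκ]

/-- The contribution of the corrector to the momentum equation is small, for a body of size `s ^ 2`
moving with velocity `b`. -/
lemma abs_integral_momentum_corrector_le {ν C s m E th th' : ℝ} {v : R3 → R3} {A : R3 → Grad3}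
    (hν : 0 < ν) (h : IsSobolevField v A) (hs : 0 < s) (hs1 : s ≤ 1) (hE : ∫ x, ‖v x‖ ^ 2 ≤ E)
    (hC0 : 0 ≤ C) (hth0 : 0 ≤ th) (hth1 : th ≤ 1) {a : R3} {w w' : R3 → R3} {W : R3 → Grad3} {b : ℝ}
    (hb : 0 ≤ b) (hbm : b * s ^ 3 ≤ m)
    (hw : ∀ x, ‖w x‖ ≤ C) (hw' : ∀ x, ‖w' x‖ ≤ C * (1 + b / s ^ 2)) (hW : ∀ x, ‖W x‖ ≤ C / s ^ 2)
    (hws : ∀ x, x ∉ Metric.ball a (3 * s ^ 2) → w x = 0)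
    (hws' : ∀ x, x ∉ Metric.ball a (3 * s ^ 2) → w' x = 0)
    (hWs : ∀ x, x ∉ Metric.ball a (3 * s ^ 2) → W x = 0)
    (hwm : MemLp w 2 volume) (hwm' : MemLp w' 2 volume) (hWm : MemLp W 2 volume) :
    |∫ x, momentum ν (v x) (A x) (th' • w x + th • w' x) (th • W x)| ≤
      C * bodyConst * (s + m) * (|th'| * (1 + E) + (1 + ν) * (1 + ∫ x, ‖A x‖ ^ 2)) := by
  have i1 := integrable_inner_of_memLp_two h.memLp hwm
  have i2 := integrable_inner_of_memLp_two h.memLp hwm'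
  have i3 := integrable_inner_convect (b := W) h.memLp hWm.1 (Eventually.of_forall hW)
  have i4 := integrable_inner_symGrad h.grad_memLp hWm
  have e1 : ∫ x, momentum ν (v x) (A x) (th' • w x + th • w' x) (th • W x) =
      th' * (∫ x, inner ℝ (v x) (w x)) + th * ((∫ x, inner ℝ (v x) (w' x)) +
        (∫ x, inner ℝ (v x) (convect (v x) (W x))) -
          2 * ν * ∫ x, inner ℝ (A x) (symGrad (W x))) := by
    have i23 : Integrable (fun x => inner ℝ (v x) (w' x) + inner ℝ (v x) (convect (v x) (W x)))
        volume := i2.add i3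
    have i234 : Integrable (fun x => inner ℝ (v x) (w' x) + inner ℝ (v x) (convect (v x) (W x)) -
        2 * ν * inner ℝ (A x) (symGrad (W x))) volume := i23.sub (i4.const_mul _)
    rw [← integral_const_mul (2 * ν), ← integral_add i2 i3, ← integral_sub i23 (i4.const_mul _),
      ← integral_const_mul, ← integral_const_mul, ← integral_add (i1.const_mul _)
      (i234.const_mul _)]
    refine integral_congr_ae (Eventually.of_forall fun x => ?_)
    simp only [momentum, convect_smul, map_smul, inner_smul_right, inner_add_right]
    ring
  set g := ∫ x, ‖A x‖ ^ 2 with hg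
  have hg0 : 0 ≤ g := integral_nonneg fun x => sq_nonneg _
  have hE0 : 0 ≤ E := (integral_nonneg fun x => sq_nonneg _).trans hE
  have hball := integral_ball_norm_sq_le h a (r := 3 * s ^ 2) (by positivity)
  rw [← hg] at hball
  set κ := volume.real (Metric.ball (0 : R3) 1) with hκd
  have hκ : 0 ≤ κ := measureReal_nonneg
  have hm : 0 ≤ m := le_trans (by positivity) hbm
  have s4 : s ^ 4 ≤ 1 := pow_le_one₀ hs.le hs1
  have hB0 : 0 ≤ ∫ x in Metric.ball a (3 * s ^ 2), ‖v x‖ ^ 2 := integral_nonneg fun x => sq_nonneg _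
  -- The parameter `s` is the square root of the size of the body, so balls have radius of order
  -- `s²`. In this term smallness comes from the volume of the ball alone, with `l = 1 / s`.
  have b1 : |∫ x, inner ℝ (v x) (w x)| ≤ C * bodyConst * s * (1 + E) :=
    abs_integral_inner_corrector_le hs hs1 h.memLp hE hw hws
  -- The Hardy inequality gains `s⁴`, and with `l = 1 / s` both contributions are of order `s⁵ (1 +
  -- b / s²) = s⁵ + b s³`. This is where the bound on the speed is needed.
  have b2 : |∫ x, inner ℝ (v x) (w' x)| ≤ C * (s + m) * (27 * κ + 72 * g) := by
    refine (abs_integral_inner_le h.memLp hw' hws' (l := s⁻¹) (by positivity)).trans ?_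
    rw [volume_real_ball _ (by positivity), inv_inv]
    calc C * (1 + b / s ^ 2) * (s⁻¹ * ((3 * s ^ 2) ^ 3 * κ) +
          s * ∫ x in Metric.ball a (3 * s ^ 2), ‖v x‖ ^ 2)
        ≤ C * (1 + b / s ^ 2) * (s⁻¹ * ((3 * s ^ 2) ^ 3 * κ) + s * (8 * (3 * s ^ 2) ^ 2 * g)) := by
          gcongr
      _ = C * (s ^ 5 + b * s ^ 3) * (27 * κ + 72 * g) := by field_simp; ring
      _ ≤ C * (s + m) * (27 * κ + 72 * g) := by
          gcongr
          calc s ^ 5 = s * s ^ 4 := by ring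
            _ ≤ s * 1 := by gcongr
            _ = s := mul_one s
  -- The square of the velocity over the ball is of order `s⁴` by Hardy and beats the factor `1 /
  -- s²` of the gradient of the corrector.
  have b3 : |∫ x, inner ℝ (v x) (convect (v x) (W x))| ≤ C * s * (72 * g) := by
    refine (abs_integral_inner_convect_le h.memLp hW hWs).trans ?_
    calc C / s ^ 2 * ∫ x in Metric.ball a (3 * s ^ 2), ‖v x‖ ^ 2
        ≤ C / s ^ 2 * (8 * (3 * s ^ 2) ^ 2 * g) := by gcongr
      _ = C * (s * s) * (72 * g) := by field_simp; ring
      _ ≤ C * (s * 1) * (72 * g) := by gcongr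
      _ = _ := by ring
  -- The gradient of the velocity has no Hardy gain. The choice `l = s⁻³` balances the volume `s⁶`
  -- against `l⁻¹`, leaving `s³ / s² = s`.
  have b4 : |∫ x, inner ℝ (A x) (symGrad (W x))| ≤ C * s * (27 * κ + g) := by
    have hWx : ∀ x, ‖symGrad (W x)‖ ≤ C / s ^ 2 := fun x => (norm_symGrad_le _).trans (hW x)
    have hWsx : ∀ x, x ∉ Metric.ball a (3 * s ^ 2) → symGrad (W x) = 0 := fun x hx => by
      rw [hWs x hx, map_zero]
    refine (abs_integral_inner_le h.grad_memLp hWx hWsx (l := (s ^ 3)⁻¹) (by positivity)).trans ?_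
    rw [volume_real_ball _ (by positivity), inv_inv]
    have hA : ∫ x in Metric.ball a (3 * s ^ 2), ‖A x‖ ^ 2 ≤ g :=
      setIntegral_le_integral ((memLp_two_iff_integrable_sq_norm h.grad_memLp.1).1 h.grad_memLp)
        (Eventually.of_forall fun x => sq_nonneg _)
    calc C / s ^ 2 * ((s ^ 3)⁻¹ * ((3 * s ^ 2) ^ 3 * κ) +
          s ^ 3 * ∫ x in Metric.ball a (3 * s ^ 2), ‖A x‖ ^ 2)
        ≤ C / s ^ 2 * ((s ^ 3)⁻¹ * ((3 * s ^ 2) ^ 3 * κ) + s ^ 3 * g) := by gcongr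
      _ = C * s * (27 * κ + g) := by field_simp; ring
  have hκg : 0 ≤ κ * g := mul_nonneg hκ hg0
  rw [e1]
  have t1 : |th' * (∫ x, inner ℝ (v x) (w x))| ≤ C * bodyConst * (s + m) * (|th'| * (1 + E)) := by
    rw [abs_mul]
    have hbc : 0 ≤ bodyConst := by rw [bodyConst]; positivity
    calc |th'| * |∫ x, inner ℝ (v x) (w x)| ≤ |th'| * (C * bodyConst * (s + m) * (1 + E)) := by
          gcongr
          refine b1.trans ?_
          gcongr
          linarith
      _ = _ := by ring
  have t2 : |th * ((∫ x, inner ℝ (v x) (w' x)) + (∫ x, inner ℝ (v x) (convect (v x) (W x))) -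
      2 * ν * ∫ x, inner ℝ (A x) (symGrad (W x)))| ≤
        C * bodyConst * (s + m) * ((1 + ν) * (1 + g)) := by
    rw [abs_mul, abs_of_nonneg hth0]
    refine (mul_le_of_le_one_left (abs_nonneg _) hth1).trans ?_
    have h5 : |(∫ x, inner ℝ (v x) (w' x)) + (∫ x, inner ℝ (v x) (convect (v x) (W x))) -
        2 * ν * ∫ x, inner ℝ (A x) (symGrad (W x))| ≤
        C * (s + m) * (27 * κ + 72 * g) + C * s * (72 * g) + 2 * ν * (C * s * (27 * κ + g)) := by
      refine (abs_sub _ _).trans (add_le_add ((abs_add_le _ _).trans (add_le_add b2 b3)) ?_)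
      rw [abs_mul, abs_of_pos (by positivity : 0 < 2 * ν)]
      gcongr
    refine h5.trans ?_
    have h6 : C * s * (72 * g) ≤ C * (s + m) * (72 * g) := by gcongr; linarith
    have h7 : 2 * ν * (C * s * (27 * κ + g)) ≤ 2 * ν * (C * (s + m) * (27 * κ + g)) := by
      gcongr; linarith
    have h8 : (27 * κ + 144 * g) + 2 * ν * (27 * κ + g) ≤ bodyConst * ((1 + ν) * (1 + g)) := by
      rw [bodyConst, ← hκd]
      nlinarith [mul_nonneg hν.le hκ, mul_nonneg hν.le hg0, mul_nonneg hν.le hκg]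
    calc _ ≤ C * (s + m) * ((27 * κ + 144 * g) + 2 * ν * (27 * κ + g)) := by linarith
      _ ≤ C * (s + m) * (bodyConst * ((1 + ν) * (1 + g))) := by gcongr
      _ = _ := by ring
  calc _ ≤ _ := abs_add_le _ _
    _ ≤ _ := add_le_add t1 t2
    _ = _ := by ring

end CorrectorFamily

/-! ### Fubini's theorem and restriction for integrals over time and space -/

section SpaceTimeIntegrals

lemma integral_spaceTime {E : Type*} [NormedAddCommGroup E] [NormedSpace ℝ E] {I : Set ℝ}
    {f : ℝ × R3 → E} (hf : Integrable f (spaceTime I)) :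
    ∫ z, f z ∂spaceTime I = ∫ t in I, ∫ x, f (t, x) := integral_prod _ hf

lemma integrable_spaceTime_left {E : Type*} [NormedAddCommGroup E] [NormedSpace ℝ E] {I : Set ℝ}
    {f : ℝ × R3 → E} (hf : Integrable f (spaceTime I)) :
    Integrable (fun t => ∫ x, f (t, x)) (volume.restrict I) := hf.integral_prod_left

lemma spaceTime_mono {I J : Set ℝ} (h : I ⊆ J) : spaceTime I ≤ spaceTime J := by
  rw [spaceTime_eq_restrict, spaceTime_eq_restrict]
  exact Measure.restrict_mono (prod_mono h le_rfl) le_rfl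

lemma memLp_spaceTime_of_eLpNorm_le {F : Type*} [NormedAddCommGroup F] {T : ℝ} {f : ℝ → R3 → F}
    {C : ℝ≥0} (hm : AEStronglyMeasurable (Function.uncurry f) (spaceTime (Ioc 0 T)))
    (hC : ∀ᵐ t ∂volume.restrict (Ioc 0 T), eLpNorm (f t) 2 volume ≤ C) :
    MemLp (Function.uncurry f) 2 (spaceTime (Ioc 0 T)) := by
  refine memLp_two_iff_lintegral.2 ⟨hm, ?_⟩
  rw [lintegral_spaceTime hm]
  calc ∫⁻ t in Ioc 0 T, ∫⁻ x, ‖f t x‖ₑ ^ 2 ≤ ∫⁻ _ in Ioc 0 T, (C : ℝ≥0∞) ^ 2 := by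
        refine lintegral_mono_ae ?_
        filter_upwards [hC] with t ht
        rw [← eLpNorm_two_sq]
        gcongr
    _ < ∞ := by
        rw [setLIntegral_const]
        exact ENNReal.mul_lt_top (ENNReal.pow_lt_top ENNReal.coe_lt_top) (by simp)

end SpaceTimeIntegrals

/-! ### The family of corrected test fields and its derivatives -/

section TestFamily

variable {φ : ℝ × R3 → R3}

/-- The test fields obtained from `φ` by subtracting the corrector and multiplying with a scalar,
as functions of the scalar, of time, of the position of the body, and of the space variable. -/
def testFamily (φ : ℝ × R3 → R3) (e : ℝ) (q : (ℝ × ℝ × R3) × R3) : R3 :=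
  q.1.1 • (φ (q.1.2.1, q.2) - correctorMap φ e (q.1.2.1, q.1.2.2, q.2))

lemma contDiff_testFamily (hφ : ContDiff ℝ (⊤ : ℕ∞) φ) (e : ℝ) :
    ContDiff ℝ (⊤ : ℕ∞) (testFamily φ e) := by
  have h0 : ContDiff ℝ (⊤ : ℕ∞) fun q : (ℝ × ℝ × R3) × R3 => q.1.1 := by fun_prop
  have h1 : ContDiff ℝ (⊤ : ℕ∞) fun q : (ℝ × ℝ × R3) × R3 => φ (q.1.2.1, q.2) :=
    hφ.comp (by fun_prop)
  have h2 : ContDiff ℝ (⊤ : ℕ∞) fun q : (ℝ × ℝ × R3) × R3 =>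
      correctorMap φ e (q.1.2.1, q.1.2.2, q.2) := (contDiff_correctorMap hφ e).comp (by fun_prop)
  exact h0.smul (h1.sub h2)

/-- The direction is the velocity of a curve of parameters with unit speed in time. Both sides are
derivatives along the same line, one by the chain rule for the whole family and one by the product
rule, so they agree. -/
lemma fderiv_testFamily_apply (hφ : ContDiff ℝ (⊤ : ℕ∞) φ) (e r s r' : ℝ) (a a' x : R3) :
    fderiv ℝ (testFamily φ e) ((r, s, a), x) ((r', 1, a'), 0) =
      (r' • φ (s, x) + r • fderiv ℝ φ (s, x) (1, 0)) -
        (r' • bodyCorrector φ e s a x + r • fderiv ℝ (correctorMap φ e) (s, a, x) (1, a', 0)) := by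
  have hl : HasDerivAt (fun y : ℝ => ((r + y * r', s + y, a + y • a'), x))
      (((r', 1, a'), (0 : R3)) : (ℝ × ℝ × R3) × R3) 0 := by
    have h1 : HasDerivAt (fun y : ℝ => r + y * r') r' 0 := by
      simpa using ((hasDerivAt_id (0 : ℝ)).mul_const r').const_add r
    have h2 : HasDerivAt (fun y : ℝ => s + y) 1 0 := (hasDerivAt_id (0 : ℝ)).const_add s
    have h3 : HasDerivAt (fun y : ℝ => a + y • a') a' 0 := by
      simpa using ((hasDerivAt_id (0 : ℝ)).smul_const a').const_add a
    exact (h1.prodMk (h2.prodMk h3)).prodMk (hasDerivAt_const 0 x)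
  have e0 : ((r + 0 * r', s + 0, a + (0 : ℝ) • a'), x) = ((r, s, a), x) := by simp
  have hd1 := (contDiff_top_differentiable (contDiff_testFamily hφ e)
    ((r + 0 * r', s + 0, a + (0 : ℝ) • a'), x)).hasFDerivAt.comp_hasDerivAt 0 hl
  rw [e0] at hd1
  have hr : HasDerivAt (fun y : ℝ => r + y * r') r' 0 := by
    simpa using ((hasDerivAt_id (0 : ℝ)).mul_const r').const_add r
  have hs2 : HasDerivAt (fun y : ℝ => s + y) 1 0 := (hasDerivAt_id (0 : ℝ)).const_add s
  have ha : HasDerivAt (fun y : ℝ => a + y • a') a' 0 := by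
    simpa using ((hasDerivAt_id (0 : ℝ)).smul_const a').const_add a
  have hd2 := (contDiff_top_differentiable hφ (s + 0, x)).hasFDerivAt.comp_hasDerivAt 0
    (hs2.prodMk (hasDerivAt_const 0 x))
  have hd3 := (contDiff_top_differentiable (contDiff_correctorMap hφ e)
    (s + 0, a + (0 : ℝ) • a', x)).hasFDerivAt.comp_hasDerivAt 0
    (hs2.prodMk (ha.prodMk (hasDerivAt_const 0 x)))
  have hd4 := hr.smul (hd2.sub hd3)
  have := hd1.unique hd4
  rw [this]
  simp only [Pi.sub_apply, Function.comp_apply, add_zero, zero_smul, zero_mul, correctorMap,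
    smul_sub]
  abel

lemma partialGrad_testFamily (hφ : ContDiff ℝ (⊤ : ℕ∞) φ) (e r s : ℝ) (a x : R3) :
    partialGrad (testFamily φ e) ((r, s, a), x) =
      r • partialGrad φ (s, x) - r • gradField (bodyCorrector φ e s a) x := by
  rw [← gradField_slice (contDiff_testFamily hφ e), ← gradField_slice hφ]
  have h1 : DifferentiableAt ℝ (fun y => φ (s, y)) x :=
    (contDiff_top_differentiable (contDiff_slice hφ s)) x
  have h2 : DifferentiableAt ℝ (bodyCorrector φ e s a) x :=
    (contDiff_top_differentiable (f := fun y => correctorMap φ e (s, a, y))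
      ((contDiff_correctorMap hφ e).comp (by fun_prop))) x
  have h3 := (h1.hasFDerivAt.sub h2.hasFDerivAt).const_smul r
  have h4 : HasFDerivAt (fun y => testFamily φ e ((r, s, a), y)) _ x := h3
  rw [gradField_eq, gradField_eq, gradField_eq]
  dsimp only
  rw [h4.fderiv, map_smul, map_sub, smul_sub]

/-- The field vanishes on an open set of parameters and positions, so its derivatives in time and
space vanish in the body as well. -/
lemma testFamily_near_zero {e : ℝ} (he : 0 < e) (he1 : e ≤ 1) {q : (ℝ × ℝ × R3) × R3}
    (hq : ‖q.2 - q.1.2.2‖ < e) : testFamily φ e =ᶠ[𝓝 q] fun _ => 0 := by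
  have ho : IsOpen {q : (ℝ × ℝ × R3) × R3 | ‖q.2 - q.1.2.2‖ < e} :=
    isOpen_lt (by fun_prop) continuous_const
  filter_upwards [ho.mem_nhds hq] with r hr
  simp only [testFamily, correctorMap, bodyCorrector_eq_of_mem he he1 hr, sub_self, smul_zero]

end TestFamily

/-! ### The Lipschitz curve of parameters: cut-off in time, time, and position of the body -/

section ClampedCurve

/-- The projection of the time variable to `[0, T]`. -/
def clampTime (T t : ℝ) : ℝ := max 0 (min t T)

lemma clampTime_nonneg (T t : ℝ) : 0 ≤ clampTime T t := le_max_left _ _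

lemma clampTime_le {T : ℝ} (hT : 0 ≤ T) (t : ℝ) : clampTime T t ≤ T := max_le hT (min_le_right _ _)

lemma clampTime_eq {T t : ℝ} (h0 : 0 ≤ t) (h1 : t ≤ T) : clampTime T t = t := by
  rw [clampTime, min_eq_left h1, max_eq_right h0]

lemma clampTime_eq_right {T t : ℝ} (hT : 0 ≤ T) (h1 : T ≤ t) : clampTime T t = T := by
  rw [clampTime, min_eq_right h1, max_eq_right hT]

lemma lipschitzWith_clampTime (T : ℝ) : LipschitzWith 1 (clampTime T) :=
  (LipschitzWith.id.min_const T).const_max 0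

variable {θ : ℝ → ℝ} {h : ℝ → R3} {Lθ Lh : ℝ≥0} {T : ℝ}

/-- The curve of the parameters of the test fields. -/
def testCurve (θ : ℝ → ℝ) (h : ℝ → R3) (T t : ℝ) : ℝ × ℝ × R3 :=
  (θ t, clampTime T t, h (clampTime T t))

/-- The position `h` is controlled only on `[0, ∞)` and may be unbounded there; composition with the
clamp makes the curve globally Lipschitz and keeps the position bounded. -/
lemma lipschitzWith_testCurve (hθ : LipschitzWith Lθ θ) (hh : LipschitzOnWith Lh h (Ici 0)) :
    LipschitzWith (max Lθ (max 1 Lh)) (testCurve θ h T) := by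
  have h1 : LipschitzWith (Lh * 1) (h ∘ clampTime T) := by
    rw [← lipschitzOnWith_univ]
    exact hh.comp (lipschitzWith_clampTime T).lipschitzOnWith fun t _ => clampTime_nonneg T t
  rw [mul_one] at h1
  exact hθ.prodMk ((lipschitzWith_clampTime T).prodMk h1)

/-- Inside the interval the clamp is the identity nearby. The corner at `t = T` is a null set. -/
lemma ae_deriv_testCurve (hθ : LipschitzWith Lθ θ) (hh : LipschitzOnWith Lh h (Ici 0)) :
    ∀ᵐ t ∂volume.restrict (Ioc 0 T), deriv (testCurve θ h T) t = (deriv θ t, 1, deriv h t) := by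
  have h0 : ∀ᵐ t : ℝ, t ≠ T := by simp [ae_iff]
  rw [ae_restrict_iff' measurableSet_Ioc]
  filter_upwards [(lipschitzWith_testCurve (T := T) hθ hh).ae_differentiableAt_real, h0]
    with t ht htT htI
  have hnear : ∀ᶠ s in 𝓝 t, clampTime T s = s := by
    filter_upwards [Ioo_mem_nhds htI.1 (lt_of_le_of_ne htI.2 htT)] with s hs
    exact clampTime_eq hs.1.le hs.2.le
  have hd := ht.hasDerivAt
  have hd1 : HasDerivAt θ (deriv (testCurve θ h T) t).1 t :=
    (ContinuousLinearMap.fst ℝ ℝ (ℝ × R3)).hasFDerivAt.comp_hasDerivAt t hd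
  have hd2 : HasDerivAt (clampTime T) (deriv (testCurve θ h T) t).2.1 t :=
    ((ContinuousLinearMap.fst ℝ ℝ R3).comp
      (ContinuousLinearMap.snd ℝ ℝ (ℝ × R3))).hasFDerivAt.comp_hasDerivAt t hd
  have hd3 : HasDerivAt (fun s => h (clampTime T s)) (deriv (testCurve θ h T) t).2.2 t :=
    ((ContinuousLinearMap.snd ℝ ℝ R3).comp
      (ContinuousLinearMap.snd ℝ ℝ (ℝ × R3))).hasFDerivAt.comp_hasDerivAt t hd
  have e2 := hd2.unique ((hasDerivAt_id t).congr_of_eventuallyEq hnear)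
  have hd3' : HasDerivAt h (deriv (testCurve θ h T) t).2.2 t :=
    hd3.congr_of_eventuallyEq (by filter_upwards [hnear] with s hs; rw [hs])
  rw [hd1.deriv, hd3'.deriv, ← e2]

lemma deriv_testCurve_of_lt (hT : 0 ≤ T) (hθ : ∀ t, T ≤ t → θ t = 0) {t : ℝ} (ht : T < t) :
    deriv (testCurve θ h T) t = 0 := by
  have : testCurve θ h T =ᶠ[𝓝 t] fun _ => (0, T, h T) := by
    filter_upwards [Ioi_mem_nhds ht] with s hs
    rw [testCurve, hθ s (le_of_lt hs), clampTime_eq_right hT (le_of_lt hs)]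
  rw [this.deriv_eq]
  simp

end ClampedCurve

/-! ### Consistency of the fluid–body system with the Navier–Stokes momentum equation -/

section Consistency

/-- A weak solution for a body of size at most `e` whose velocity, gradient and initial velocity
are bounded by `E` in `L²`, and for which the speed of the body is at most `m / e ^ (3 / 2)`. -/
structure IsBoundedBodyFlow (ν ρ e E m : ℝ) (S₀ : Set R3) (u₀ : R3 → R3) (u : ℝ → R3 → R3)
    (G : ℝ → R3 → Grad3) (h om : ℝ → R3) (R : ℝ → Matrix (Fin 3) (Fin 3) ℝ) : Prop where
  size_pos : 0 < e
  size_le_one : e ≤ 1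
  subset_ball : S₀ ⊆ Metric.ball 0 e
  solution : IsWeakLeraySolution ν ρ S₀ u₀ u G h om R
  initial_memLp : MemLp u₀ 2 volume
  initial_le : ∫ x, ‖u₀ x‖ ^ 2 ≤ E
  velocity_le : ∀ t, 0 ≤ t → ∫ x, ‖u t x‖ ^ 2 ≤ E
  grad_memLp : MemLp (Function.uncurry G) 2 (spaceTime (Ioi 0))
  grad_le : ∫⁻ z, ‖Function.uncurry G z‖ₑ ^ 2 ∂spaceTime (Ioi 0) ≤ ENNReal.ofReal E
  speed_le : ∀ᵐ t ∂volume.restrict (Ioi (0 : ℝ)), ‖deriv h t‖ * √e ^ 3 ≤ m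

variable {ν ρ e E m T : ℝ} {S₀ : Set R3} {u₀ : R3 → R3} {u : ℝ → R3 → R3}
    {G : ℝ → R3 → Grad3} {h om : ℝ → R3} {R : ℝ → Matrix (Fin 3) (Fin 3) ℝ}

namespace IsBoundedBodyFlow

variable (H : IsBoundedBodyFlow ν ρ e E m S₀ u₀ u G h om R)
include H

lemma bound_nonneg : 0 ≤ E := (integral_nonneg fun _ => sq_nonneg _).trans H.initial_le

lemma speed_bound_nonneg : 0 ≤ m := by
  have : (ae (volume.restrict (Ioi (0 : ℝ)))).NeBot := by
    rw [ae_neBot, Ne, Measure.restrict_eq_zero]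
    simp
  obtain ⟨t, ht⟩ := H.speed_le.exists
  exact le_trans (by positivity) ht

lemma eLpNorm_velocity_le {t : ℝ} (ht : 0 ≤ t) : eLpNorm (u t) 2 volume ≤ (√E).toNNReal := by
  have h1 : eLpNorm (u t) 2 volume ^ 2 ≤ ((√E).toNNReal : ℝ≥0∞) ^ 2 := by
    rw [eLpNorm_two_sq, ← ofReal_integral_norm_sq (H.solution.weaklyContinuous.1 t ht)]
    change _ ≤ ENNReal.ofReal √E ^ 2
    rw [← ENNReal.ofReal_pow (Real.sqrt_nonneg _), Real.sq_sqrt H.bound_nonneg]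
    exact ENNReal.ofReal_le_ofReal (H.velocity_le t ht)
  exact (ENNReal.pow_le_pow_left_iff two_ne_zero).1 h1

lemma velocity_memLp (T : ℝ) : MemLp (Function.uncurry u) 2 (spaceTime (Ioc 0 T)) :=
  memLp_spaceTime_of_eLpNorm_le
    (H.solution.energyClass.measurable.mono_measure (spaceTime_mono Ioc_subset_Ioi_self))
    ((ae_restrict_mem measurableSet_Ioc).mono fun _ ht => H.eLpNorm_velocity_le ht.1.le)

lemma grad_memLp_Ioc (T : ℝ) : MemLp (Function.uncurry G) 2 (spaceTime (Ioc 0 T)) :=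
  H.grad_memLp.mono_measure (spaceTime_mono Ioc_subset_Ioi_self)

lemma integrable_grad_sq : Integrable (fun t => ∫ x, ‖G t x‖ ^ 2) (volume.restrict (Ioi (0 : ℝ))) :=
  integrable_spaceTime_left (f := fun z => ‖Function.uncurry G z‖ ^ 2)
    ((memLp_two_iff_integrable_sq_norm H.grad_memLp.1).1 H.grad_memLp)

lemma integral_grad_sq_le {s : Set ℝ} (hs : s ⊆ Ioi 0) :
    ∫ t in s, ∫ x, ‖G t x‖ ^ 2 ≤ E := by
  refine (setIntegral_mono_set H.integrable_grad_sq
    (Eventually.of_forall fun t => integral_nonneg fun x => sq_nonneg _)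
    (LE.le.eventuallyLE hs)).trans ?_
  have h1 := integral_spaceTime (f := fun z => ‖Function.uncurry G z‖ ^ 2)
    ((memLp_two_iff_integrable_sq_norm H.grad_memLp.1).1 H.grad_memLp)
  have h2 : ∫ t in Ioi (0 : ℝ), ∫ x, ‖G t x‖ ^ 2 =
      ∫ z, ‖Function.uncurry G z‖ ^ 2 ∂spaceTime (Ioi 0) := h1.symm
  rw [h2, ← ENNReal.ofReal_le_ofReal_iff H.bound_nonneg, ofReal_integral_norm_sq H.grad_memLp]
  exact H.grad_le

end IsBoundedBodyFlow

variable {φ : ℝ × R3 → R3}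

lemma exists_partialGrad_bound (hφ : ContDiff ℝ (⊤ : ℕ∞) φ) (hs : HasCompactSupport φ) :
    ∃ C : ℝ, ∀ z, ‖partialGrad φ z‖ ≤ C := by
  refine HasCompactSupport.exists_bound_of_continuous ?_ (contDiff_partialGrad hφ).continuous
  exact (hs.fderiv (𝕜 := ℝ)).comp_left (g := fun L : (ℝ × R3 →L[ℝ] R3) =>
    gradOfDeriv (L.comp (ContinuousLinearMap.inr ℝ ℝ R3))) (by simp)

lemma hasCompactSupport_partialGrad (hs : HasCompactSupport φ) :
    HasCompactSupport (partialGrad φ) :=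
  (hs.fderiv (𝕜 := ℝ)).comp_left (g := fun L : (ℝ × R3 →L[ℝ] R3) =>
    gradOfDeriv (L.comp (ContinuousLinearMap.inr ℝ ℝ R3))) (by simp)

/-- Compactly supported continuous functions of time and space are square integrable. -/
lemma memLp_spaceTime_of_continuous {F : Type*} [NormedAddCommGroup F] {a : ℝ × R3 → F}
    (ha : Continuous a) (hs : HasCompactSupport a) (T : ℝ) : MemLp a 2 (spaceTime (Ioc 0 T)) := by
  have : MemLp a 2 (volume.prod volume) := ha.memLp_of_hasCompactSupport hs
  rw [spaceTime_eq_restrict]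
  exact this.restrict _

/-- Multiplication with a bounded function of time. -/
lemma memLp_spaceTime_smul {F : Type*} [NormedAddCommGroup F] [NormedSpace ℝ F] {a : ℝ × R3 → F}
    {I : Set ℝ} (ha : MemLp a 2 (spaceTime I)) {θ : ℝ → ℝ} (hθ : Measurable θ) {c : ℝ}
    (hc : ∀ t, |θ t| ≤ c) : MemLp (fun z => θ z.1 • a z) 2 (spaceTime I) := by
  refine (ha.const_smul c).mono
    ((hθ.comp measurable_fst).aestronglyMeasurable.smul ha.1) (Eventually.of_forall fun z => ?_)
  rw [Pi.smul_apply, norm_smul, norm_smul]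
  gcongr
  exact (hc z.1).trans (le_abs_self c)

variable {θ : ℝ → ℝ} {Lθ : ℝ≥0}

/-- The momentum equation of the body, tested with the field obtained from a corrector. -/
lemma momentum_testCurve (H : IsBoundedBodyFlow ν ρ e E m S₀ u₀ u G h om R)
    (hφ : ContDiff ℝ (⊤ : ℕ∞) φ) (hs : HasCompactSupport φ)
    (hd : ∀ t x, 0 ≤ t → ∑ i, partialGrad φ (t, x) i i = 0) (hT : 0 < T)
    (hθ : LipschitzWith Lθ θ) (hθ0 : ∀ t, 0 ≤ θ t) (hθ1 : ∀ t, θ t ≤ 1)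
    (hθT : ∀ t, T ≤ t → θ t = 0) :
    Integrable (fun z : ℝ × R3 => momentum ν (u z.1 z.2) (G z.1 z.2)
        (fderiv ℝ (testFamily φ e) (testCurve θ h T z.1, z.2) (deriv (testCurve θ h T) z.1, 0))
        (partialGrad (testFamily φ e) (testCurve θ h T z.1, z.2))) (spaceTime (Ioc 0 T)) ∧
      ∫ z, momentum ν (u z.1 z.2) (G z.1 z.2)
          (fderiv ℝ (testFamily φ e) (testCurve θ h T z.1, z.2) (deriv (testCurve θ h T) z.1, 0))
          (partialGrad (testFamily φ e) (testCurve θ h T z.1, z.2)) ∂spaceTime (Ioc 0 T) =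
        -∫ x, inner ℝ (u₀ x) (testFamily φ e ((θ 0, 0, 0), x)) := by
  have he := H.size_pos
  have he1 := H.size_le_one
  obtain ⟨Lh, hLh⟩ := H.solution.motion.center_lipschitz
  set p := testCurve θ h T with hp
  set S : ℝ → Set R3 := fun t => movedBody S₀ (h t) (R t) with hS
  have hSball : ∀ t, 0 ≤ t → S t ⊆ Metric.ball (h t) e := fun t ht =>
    movedBody_subset_ball H.subset_ball (H.solution.motion.rotation_mem t ht) (h t)
  have hE := contDiff_testFamily hφ e
  set φt : ℝ → R3 → R3 := fun t x => fderiv ℝ (testFamily φ e) (p t, x) (deriv p t, 0) with hφt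
  set Gφ : ℝ → R3 → Grad3 := fun t x => partialGrad (testFamily φ e) (p t, x) with hGφ
  -- the fields vanish after time `T`, and in the body
  have hlate : ∀ t, T < t → ∀ x, φt t x = 0 ∧ Gφ t x = 0 := by
    intro t ht x
    constructor
    · simp only [hφt, hp, deriv_testCurve_of_lt hT.le hθT ht]
      exact map_zero _
    · simp only [hGφ, hp, testCurve, partialGrad_testFamily hφ, hθT t ht.le, zero_smul, sub_zero]
  -- Up to time `T` the body lies in the open ball where the corrector equals `φ`; after `T` the
  -- cut-off `θ` is zero.
  have hbody : ∀ t, 0 ≤ t → ∀ x ∈ S t, φt t x = 0 ∧ Gφ t x = 0 := by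
    intro t ht x hx
    rcases le_or_gt t T with htT | htT
    · have hq : ‖x - (p t).2.2‖ < e := by
        rw [hp, testCurve, clampTime_eq ht htT]
        simpa [dist_eq_norm] using hSball t ht hx
      have h1 : fderiv ℝ (testFamily φ e) (p t, x) = 0 := by
        rw [(testFamily_near_zero he he1 (q := (p t, x)) hq).fderiv_eq]
        simp
      simp only [hφt, hGφ, partialGrad, h1]
      simp
    · exact hlate t htT x
  -- bounds
  set M : ℝ := 2 + T + Lh * T with hMdef
  have hLT : 0 ≤ (Lh : ℝ) * T := by positivity
  have hpM : ∀ t, ‖p t‖ < M := by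
    intro t
    have h1 : ‖h (clampTime T t)‖ ≤ Lh * T := by
      have h2 := hLh.dist_le_mul _ (clampTime_nonneg T t) 0 self_mem_Ici
      rw [H.solution.motion.center_zero, dist_zero_right, Real.dist_eq, sub_zero,
        abs_of_nonneg (clampTime_nonneg T t)] at h2
      exact h2.trans (by gcongr; exact clampTime_le hT.le t)
    simp only [hp, testCurve, Prod.norm_def, Real.norm_eq_abs, abs_of_nonneg (hθ0 t),
      abs_of_nonneg (clampTime_nonneg T t)]
    refine max_lt (by linarith [hθ1 t]) (max_lt (by linarith [clampTime_le hT.le t]) (by linarith))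
  obtain ⟨Kφ, hKφ⟩ := hs.isCompact.isBounded.subset_closedBall 0
  have hφ0 : ∀ s x, Kφ < ‖x‖ → φ (s, x) = 0 := by
    intro s x hx
    by_contra hne
    have h3 := hKφ (subset_tsupport _ hne)
    rw [mem_closedBall_zero_iff, Prod.norm_def, max_le_iff] at h3
    exact absurd h3.2 (not_le.2 hx)
  -- The radius `M + 2` accounts for the position of the body, bounded by `M`, and for the support
  -- of the corrector, of radius `2 e ≤ 2`.
  have htest : IsTestField S (fun t x => testFamily φ e (p t, x)) φt Gφ := by
    refine isTestField_of_curve (K := max Kφ (M + 2)) (M := M) (T := T) hE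
      (lipschitzWith_testCurve hθ hLh) hpM ?_ ?_ ?_ fun t ht x hx => (hbody t ht x hx).2
    · rintro ⟨r, s, a⟩ x hq hx
      have ha : ‖a‖ < M := ((le_max_right _ _).trans (le_max_right _ _)).trans_lt hq
      have hxa : 2 * e ≤ ‖x - a‖ := by
        have h1 := norm_sub_norm_le x a
        have h2 := (le_max_right Kφ (M + 2)).trans_lt hx
        linarith
      simp only [testFamily, correctorMap, bodyCorrector_eq_zero he hxa,
        hφ0 s x ((le_max_left _ _).trans_lt hx), sub_zero, smul_zero]
    · intro t ht x
      simp only [testFamily, hp, testCurve, hθT t ht.le, zero_smul]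
    · intro t _ x
      have h1 : ∀ x, ∑ i, gradField (fun y => φ (clampTime T t, y)) x i i = 0 := fun x => by
        simp only [gradField_slice hφ]
        exact hd _ x (clampTime_nonneg T t)
      have h2 := trace_bodyCorrector hφ hs (clampTime T t) h1 (h (clampTime T t)) e x
      have h3 := hd (clampTime T t) x (clampTime_nonneg T t)
      simp only [hp, testCurve, partialGrad_testFamily hφ, PiLp.sub_apply, PiLp.smul_apply,
        smul_eq_mul, Finset.sum_sub_distrib, ← Finset.mul_sum, h2, h3, mul_zero, sub_zero]
  -- integrability
  have hmono := spaceTime_mono (Ioc_subset_Ioi_self : Ioc 0 T ⊆ Ioi 0)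
  obtain ⟨Ct, hCt⟩ := htest.dt_bounded
  obtain ⟨Cg, hCg⟩ := htest.bounded
  have hφtm : MemLp (Function.uncurry φt) 2 (spaceTime (Ioc 0 T)) :=
    memLp_spaceTime_of_eLpNorm_le (htest.dt_measurable.mono_measure hmono)
      (ae_restrict_of_ae_restrict_of_subset Ioc_subset_Ioi_self hCt)
  have hGφm : MemLp (Function.uncurry Gφ) 2 (spaceTime (Ioc 0 T)) :=
    memLp_spaceTime_of_eLpNorm_le (htest.grad_measurable.mono_measure hmono)
      ((ae_restrict_mem measurableSet_Ioc).mono fun t ht => (hCg t ht.1.le).2)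
  obtain ⟨C₁, hC₁⟩ := exists_partialGrad_bound hφ hs
  obtain ⟨C₂, -, hC₂⟩ := exists_corrector_bounds hφ hs
  have hGb : ∀ z : ℝ × R3, ‖Function.uncurry Gφ z‖ ≤ C₁ + C₂ / e := by
    intro z
    simp only [Function.uncurry, hGφ, hp, testCurve, partialGrad_testFamily hφ, ← smul_sub]
    rw [norm_smul, Real.norm_of_nonneg (hθ0 _)]
    refine (mul_le_of_le_one_left (norm_nonneg _) (hθ1 _)).trans ((norm_sub_le _ _).trans ?_)
    exact add_le_add (hC₁ _) (hC₂ e he he1 _ _ _).2.1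
  have i1 := integrable_inner_dt_add_convect (H.velocity_memLp T) hφtm hGφm.1
    (Eventually.of_forall hGb)
  have i2 := integrable_inner_symGrad (H.grad_memLp_Ioc T) hGφm
  refine ⟨i1.sub (i2.const_mul (2 * ν)), ?_⟩
  have heq := H.solution.equation _ _ _ htest
  -- Where the density differs from one the tested fields vanish, so it can be replaced by one.
  have e1 : ∫ t in Ioi (0 : ℝ), ∫ x, globalDensity ρ (movedBody S₀ (h t) (R t)) x *
      inner ℝ (u t x) (φt t x + convect (u t x) (Gφ t x)) =
      ∫ z, inner ℝ (Function.uncurry u z) (Function.uncurry φt z +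
        convect (Function.uncurry u z) (Function.uncurry Gφ z)) ∂spaceTime (Ioc 0 T) := by
    rw [integral_spaceTime i1]
    have hc : ∀ t ∈ Ioi (0 : ℝ), ∫ x, globalDensity ρ (movedBody S₀ (h t) (R t)) x *
        inner ℝ (u t x) (φt t x + convect (u t x) (Gφ t x)) =
        ∫ x, inner ℝ (u t x) (φt t x + convect (u t x) (Gφ t x)) := by
      intro t ht
      refine integral_congr_ae (Eventually.of_forall fun x => ?_)
      by_cases hx : x ∈ movedBody S₀ (h t) (R t)
      · obtain ⟨z1, z2⟩ := hbody t (le_of_lt ht) x hx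
        simp [z1, z2, convect]
      · simp only [globalDensity_of_notMem hx, one_mul]
    rw [setIntegral_congr_fun measurableSet_Ioi hc]
    refine (setIntegral_eq_of_subset_of_forall_sdiff_eq_zero measurableSet_Ioi
      Ioc_subset_Ioi_self fun t ht => ?_)
    have htT : T < t := not_le.1 fun hle => ht.2 ⟨ht.1, hle⟩
    simp [hlate t htT, convect]
  have e2 : ∫ t in Ioi (0 : ℝ), ∫ x, ddot (deform (G t x)) (deform (Gφ t x)) =
      ∫ z, inner ℝ (Function.uncurry G z) (symGrad (Function.uncurry Gφ z))
        ∂spaceTime (Ioc 0 T) := by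
    rw [integral_spaceTime i2]
    simp only [ddot_deform']
    refine (setIntegral_eq_of_subset_of_forall_sdiff_eq_zero measurableSet_Ioi
      Ioc_subset_Ioi_self fun t ht => ?_)
    have htT : T < t := not_le.1 fun hle => ht.2 ⟨ht.1, hle⟩
    simp [hlate t htT]
  have e3 : ∫ x, globalDensity ρ S₀ x * inner ℝ (u₀ x) (testFamily φ e (p 0, x)) =
      ∫ x, inner ℝ (u₀ x) (testFamily φ e ((θ 0, 0, 0), x)) := by
    have hp0 : p 0 = (θ 0, 0, 0) := by
      simp [hp, testCurve, clampTime_eq le_rfl hT.le, H.solution.motion.center_zero]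
    rw [hp0]
    refine integral_congr_ae (Eventually.of_forall fun x => ?_)
    by_cases hx : x ∈ S₀
    · have h1 : ‖x - 0‖ < e := by simpa using H.subset_ball hx
      have h2 : testFamily φ e ((θ 0, 0, 0), x) = 0 :=
        (testFamily_near_zero he he1 (q := ((θ 0, 0, 0), x)) h1).eq_of_nhds
      simp [h2]
    · simp only [globalDensity_of_notMem hx, one_mul]
  rw [e1, e2, e3] at heq
  have e4 : ∫ z, momentum ν (u z.1 z.2) (G z.1 z.2) (φt z.1 z.2) (Gφ z.1 z.2)
      ∂spaceTime (Ioc 0 T) = (∫ z, inner ℝ (Function.uncurry u z) (Function.uncurry φt z +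
        convect (Function.uncurry u z) (Function.uncurry Gφ z)) ∂spaceTime (Ioc 0 T)) -
      2 * ν * ∫ z, inner ℝ (Function.uncurry G z) (symGrad (Function.uncurry Gφ z))
        ∂spaceTime (Ioc 0 T) := by
    rw [← integral_const_mul, ← integral_sub i1 (i2.const_mul _)]
    rfl
  refine e4.trans ?_
  linarith

/-- The density of the momentum equation tested with the product of `θ` and `φ`. -/
def momentumDensity (ν : ℝ) (φ : ℝ × R3 → R3) (θ : ℝ → ℝ) (u : ℝ → R3 → R3) (G : ℝ → R3 → Grad3)
    (z : ℝ × R3) : ℝ :=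
  momentum ν (u z.1 z.2) (G z.1 z.2) (deriv θ z.1 • φ z + θ z.1 • fderiv ℝ φ z (1, 0))
    (θ z.1 • partialGrad φ z)

lemma integrable_momentumDensity (H : IsBoundedBodyFlow ν ρ e E m S₀ u₀ u G h om R)
    (hφ : ContDiff ℝ (⊤ : ℕ∞) φ) (hs : HasCompactSupport φ) (T : ℝ) (hθ : LipschitzWith Lθ θ)
    (hθ0 : ∀ t, 0 ≤ θ t) (hθ1 : ∀ t, θ t ≤ 1) :
    Integrable (momentumDensity ν φ θ u G) (spaceTime (Ioc 0 T)) := by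
  obtain ⟨C₁, hC₁⟩ := exists_partialGrad_bound hφ hs
  have hθa : ∀ t, |θ t| ≤ 1 := fun t => abs_le.2 ⟨by linarith [hθ0 t], hθ1 t⟩
  have hθ' : ∀ t, |deriv θ t| ≤ Lθ := fun t => norm_deriv_le_of_lipschitz hθ
  have hdt : MemLp (fun z => fderiv ℝ φ z (1, 0)) 2 (spaceTime (Ioc 0 T)) :=
    memLp_spaceTime_of_continuous ((hφ.continuous_fderiv (by simp)).clm_apply continuous_const)
      (hs.fderiv_apply (𝕜 := ℝ) _) T
  refine integrable_momentum (c := C₁) (H.velocity_memLp T) (H.grad_memLp_Ioc T)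
    ((memLp_spaceTime_smul (memLp_spaceTime_of_continuous hφ.continuous hs T)
      (measurable_deriv θ) hθ').add (memLp_spaceTime_smul hdt hθ.continuous.measurable hθa))
    (memLp_spaceTime_smul (memLp_spaceTime_of_continuous (contDiff_partialGrad hφ).continuous
      (hasCompactSupport_partialGrad hs) T) hθ.continuous.measurable hθa)
    (Eventually.of_forall fun z => ?_)
  rw [norm_smul, Real.norm_eq_abs]
  exact (mul_le_of_le_one_left (norm_nonneg _) (hθa _)).trans (hC₁ z)

/-- The fluid--body system is consistent with the momentum equation of the fluid, with an error
that is controlled by the size and the speed of the body. -/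
theorem exists_consistency_bound (hν : 0 < ν) (hφ : ContDiff ℝ (⊤ : ℕ∞) φ)
    (hs : HasCompactSupport φ) (hd : ∀ t x, 0 ≤ t → ∑ i, partialGrad φ (t, x) i i = 0) :
    ∃ C : ℝ, 0 ≤ C ∧ ∀ {ρ e E m : ℝ} {S₀ : Set R3} {u₀ : R3 → R3} {u : ℝ → R3 → R3}
      {G : ℝ → R3 → Grad3} {h om : ℝ → R3} {R : ℝ → Matrix (Fin 3) (Fin 3) ℝ},
      IsBoundedBodyFlow ν ρ e E m S₀ u₀ u G h om R → ∀ {θ : ℝ → ℝ} {Lθ : ℝ≥0} {T : ℝ}, 0 < T →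
      LipschitzWith Lθ θ → (∀ t, 0 ≤ θ t) → (∀ t, θ t ≤ 1) → (∀ t, T ≤ t → θ t = 0) →
      ∫ t in Ioc 0 T, |deriv θ t| ≤ 1 →
      |(∫ z, momentumDensity ν φ θ u G z ∂spaceTime (Ioc 0 T)) +
        θ 0 * ∫ x, inner ℝ (u₀ x) (φ (0, x))| ≤ C * (√e + m) * ((1 + T) * (1 + E)) := by
  obtain ⟨C, hC0, hC⟩ := exists_corrector_bounds hφ hs
  have hbc : 0 ≤ bodyConst := by rw [bodyConst]; positivity
  refine ⟨C * bodyConst * (3 + ν), by positivity, ?_⟩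
  intro ρ e E m S₀ u₀ u G h om R H θ Lθ T hT hθ hθ0 hθ1 hθT hθv
  have he := H.size_pos
  have he1 := H.size_le_one
  obtain ⟨Lh, hLh⟩ := H.solution.motion.center_lipschitz
  obtain ⟨hAi, hA⟩ := momentum_testCurve H hφ hs hd hT hθ hθ0 hθ1 hθT
  have hMi := integrable_momentumDensity H hφ hs T hθ hθ0 hθ1
  have hsq : √e ^ 2 = e := Real.sq_sqrt he.le
  have hs0 : 0 < √e := Real.sqrt_pos.2 he
  have hs1 : √e ≤ 1 := Real.sqrt_le_one.2 he1
  have hE0 := H.bound_nonneg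
  set p := testCurve θ h T with hp
  set W : ℝ → R3 → R3 := fun t => bodyCorrector φ e t (h t) with hW
  set Wt : ℝ → R3 → R3 := fun t x => fderiv ℝ (correctorMap φ e) (t, h t, x) (1, deriv h t, 0)
    with hWt
  have hWs : ∀ t, ContDiff ℝ (⊤ : ℕ∞) (W t) := fun t =>
    (contDiff_correctorMap hφ e).comp (f := fun y => (t, h t, y)) (by fun_prop)
  have hcs : ∀ {F : Type} [NormedAddCommGroup F] {f : R3 → F} (a : R3),
      (∀ x, x ∉ Metric.ball a (3 * e) → f x = 0) → HasCompactSupport f := by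
    intro F _ f a hf
    refine HasCompactSupport.of_support_subset_isCompact (isCompact_closedBall a (3 * e)) ?_
    intro x hx
    by_contra hn
    exact hx (hf x fun hm => hn (Metric.ball_subset_closedBall hm))
  have hWc : ∀ t, HasCompactSupport (W t) := fun t =>
    hcs (h t) fun x hx => bodyCorrector_eq_zero_of_notMem he hx
  have hWtm : ∀ t, MemLp (Wt t) 2 volume := fun t => by
    refine memLp_of_contDiff ?_ (hcs (h t) fun x hx => ?_) 2
    · exact (((contDiff_correctorMap hφ e).continuous_fderiv (by simp)).comp
        (by fun_prop)).clm_apply continuous_const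
    · simp only [hWt, fderiv_correctorMap_eq_zero_of_notMem he hx, _root_.zero_apply]
  -- the difference of the two densities is due to the corrector
  have hdiff : ∀ᵐ t ∂volume.restrict (Ioc 0 T), ∀ x,
      momentumDensity ν φ θ u G (t, x) - momentum ν (u t x) (G t x)
        (fderiv ℝ (testFamily φ e) (p t, x) (deriv p t, 0))
        (partialGrad (testFamily φ e) (p t, x)) =
      momentum ν (u t x) (G t x) (deriv θ t • W t x + θ t • Wt t x)
        (θ t • gradField (W t) x) := by
    filter_upwards [ae_deriv_testCurve hθ hLh, ae_restrict_mem measurableSet_Ioc] with t ht htI x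
    rw [momentumDensity, ← momentum_sub, hp, ht]
    simp only [testCurve, clampTime_eq htI.1.le htI.2, fderiv_testFamily_apply hφ,
      partialGrad_testFamily hφ, sub_sub_cancel, hW, hWt]
  have e1 : (∫ z, momentumDensity ν φ θ u G z ∂spaceTime (Ioc 0 T)) -
      ∫ z, momentum ν (u z.1 z.2) (G z.1 z.2)
        (fderiv ℝ (testFamily φ e) (p z.1, z.2) (deriv p z.1, 0))
        (partialGrad (testFamily φ e) (p z.1, z.2)) ∂spaceTime (Ioc 0 T) =
      ∫ t in Ioc 0 T, ∫ x, momentum ν (u t x) (G t x) (deriv θ t • W t x + θ t • Wt t x)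
        (θ t • gradField (W t) x) := by
    rw [← integral_sub hMi hAi]
    refine (integral_spaceTime (hMi.sub hAi)).trans (integral_congr_ae ?_)
    filter_upwards [hdiff] with t ht
    exact integral_congr_ae (Eventually.of_forall ht)
  have hθ' : Integrable (fun t => |deriv θ t|) (volume.restrict (Ioc 0 T)) := by
    refine Integrable.mono' (g := fun _ => (Lθ : ℝ)) (integrable_const _)
      (measurable_deriv θ).norm.aestronglyMeasurable (Eventually.of_forall fun t => ?_)
    rw [Real.norm_eq_abs, abs_abs]
    exact norm_deriv_le_of_lipschitz hθ
  have hgi : Integrable (fun t => ∫ x, ‖G t x‖ ^ 2) (volume.restrict (Ioc 0 T)) :=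
    IntegrableOn.mono_set H.integrable_grad_sq Ioc_subset_Ioi_self
  have hm0 := H.speed_bound_nonneg
  have i1 : Integrable (fun t => |deriv θ t| * (1 + E)) (volume.restrict (Ioc 0 T)) :=
    hθ'.mul_const _
  have i2 : Integrable (fun t => 1 + ∫ x, ‖G t x‖ ^ 2) (volume.restrict (Ioc 0 T)) :=
    (integrable_const _).add hgi
  have e2 : |∫ t in Ioc 0 T, ∫ x, momentum ν (u t x) (G t x)
      (deriv θ t • W t x + θ t • Wt t x) (θ t • gradField (W t) x)| ≤
      C * bodyConst * (√e + m) * ((1 + E) + (1 + ν) * (T + E)) := by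
    have h1 : |∫ t in Ioc 0 T, ∫ x, momentum ν (u t x) (G t x)
        (deriv θ t • W t x + θ t • Wt t x) (θ t • gradField (W t) x)| ≤
        ∫ t in Ioc 0 T, C * bodyConst * (√e + m) *
          (|deriv θ t| * (1 + E) + (1 + ν) * (1 + ∫ x, ‖G t x‖ ^ 2)) := by
      rw [← Real.norm_eq_abs]
      refine norm_integral_le_of_norm_le ((i1.add (i2.const_mul _)).const_mul _) ?_
      have hsob := ae_restrict_of_ae_restrict_of_subset (Ioc_subset_Ioi_self : Ioc 0 T ⊆ Ioi 0)
        H.solution.ae_isSobolevField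
      have hsp := ae_restrict_of_ae_restrict_of_subset (Ioc_subset_Ioi_self : Ioc 0 T ⊆ Ioi 0)
        H.speed_le
      filter_upwards [hsob, hsp, ae_restrict_mem measurableSet_Ioc] with t ht1 ht2 ht3
      have hb := fun x => hC e he he1 t (h t) x
      -- With `s = √e` the bound on the speed is the hypothesis `b s³ ≤ m`, and `hsq` converts `s²`
      -- back into the size of the body.
      refine abs_integral_momentum_corrector_le (a := h t) (b := ‖deriv h t‖) hν ht1 hs0 hs1
        (H.velocity_le t ht3.1.le) hC0 (hθ0 t) (hθ1 t) (norm_nonneg _) ht2 (fun x => (hb x).1)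
        (fun x => ?_) (fun x => ?_) ?_ ?_ ?_ (memLp_of_contDiff (hWs t).continuous (hWc t) 2)
        (hWtm t) (memLp_of_contDiff (contDiff_gradField (hWs t)).continuous
          (hasCompactSupport_gradField (hWc t)) 2)
      · rw [hsq]; exact (hb x).2.2 _
      · rw [hsq]; exact (hb x).2.1
      · rw [hsq]; exact fun x hx => bodyCorrector_eq_zero_of_notMem he hx
      · rw [hsq]
        intro x hx
        simp only [hWt, fderiv_correctorMap_eq_zero_of_notMem he hx, _root_.zero_apply]
      · rw [hsq]; exact fun x hx => gradField_bodyCorrector_eq_zero_of_notMem hφ he hx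
    refine h1.trans ?_
    rw [integral_const_mul, integral_add i1 (i2.const_mul _), integral_mul_const,
      integral_const_mul, integral_add (integrable_const _) hgi]
    have h2 := H.integral_grad_sq_le (Ioc_subset_Ioi_self : Ioc 0 T ⊆ Ioi 0)
    have h3 : ∫ _ in Ioc 0 T, (1 : ℝ) = T := by simp [hT.le]
    rw [h3]
    -- Of the cut-off only its total variation, at most one, enters the bound. The Lipschitz
    -- constant does not, so the cut-offs may later become steep.
    gcongr
    exact mul_le_of_le_one_left (by positivity) hθv
  have e3 : ∫ x, inner ℝ (u₀ x) (testFamily φ e ((θ 0, 0, 0), x)) =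
      θ 0 * (∫ x, inner ℝ (u₀ x) (φ (0, x))) -
        θ 0 * ∫ x, inner ℝ (u₀ x) (bodyCorrector φ e 0 0 x) := by
    have hc0 : ContDiff ℝ (⊤ : ℕ∞) (bodyCorrector φ e 0 0) :=
      (contDiff_correctorMap hφ e).comp (f := fun y => ((0 : ℝ), (0 : R3), y)) (by fun_prop)
    have i3 := integrable_inner_of_memLp_two H.initial_memLp
      (memLp_of_contDiff (contDiff_slice hφ 0).continuous (hasCompactSupport_slice hs 0) 2)
    have i4 := integrable_inner_of_memLp_two H.initial_memLp
      (memLp_of_contDiff hc0.continuous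
        (hcs 0 fun x hx => bodyCorrector_eq_zero_of_notMem he hx) 2)
    rw [← integral_const_mul, ← integral_const_mul, ← integral_sub (i3.const_mul _)
      (i4.const_mul _)]
    refine integral_congr_ae (Eventually.of_forall fun x => ?_)
    simp only [testFamily, correctorMap, inner_smul_right, inner_sub_right, mul_sub]
  -- The initial velocity has no gradient bound; smallness comes from the volume of the support of
  -- the corrector.
  have e4 : |θ 0 * ∫ x, inner ℝ (u₀ x) (bodyCorrector φ e 0 0 x)| ≤
      C * bodyConst * √e * (1 + E) := by
    rw [abs_mul, abs_of_nonneg (hθ0 0)]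
    refine (mul_le_of_le_one_left (abs_nonneg _) (hθ1 0)).trans ?_
    refine abs_integral_inner_corrector_le (a := 0) hs0 hs1 H.initial_memLp H.initial_le
      (fun x => (hC e he he1 0 0 x).1) ?_
    rw [hsq]
    exact fun x hx => bodyCorrector_eq_zero_of_notMem he hx
  rw [e3] at hA
  have e5 : (∫ z, momentumDensity ν φ θ u G z ∂spaceTime (Ioc 0 T)) +
      θ 0 * ∫ x, inner ℝ (u₀ x) (φ (0, x)) =
      (∫ t in Ioc 0 T, ∫ x, momentum ν (u t x) (G t x) (deriv θ t • W t x + θ t • Wt t x)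
        (θ t • gradField (W t) x)) + θ 0 * ∫ x, inner ℝ (u₀ x) (bodyCorrector φ e 0 0 x) := by
    linarith
  rw [e5]
  have hCb : 0 ≤ C * bodyConst := mul_nonneg hC0 hbc
  calc _ ≤ _ := abs_add_le _ _
    _ ≤ C * bodyConst * (√e + m) * ((1 + E) + (1 + ν) * (T + E)) +
        C * bodyConst * √e * (1 + E) := add_le_add e2 e4
    _ ≤ C * bodyConst * (√e + m) * ((1 + E) + (1 + ν) * (T + E)) +
        C * bodyConst * (√e + m) * (1 + E) := by
        gcongr
        linarith
    _ = C * bodyConst * (√e + m) * (2 * (1 + E) + (1 + ν) * (T + E)) := by ring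
    _ ≤ C * bodyConst * (√e + m) * ((3 + ν) * ((1 + T) * (1 + E))) := by
        gcongr
        nlinarith [mul_nonneg hT.le hE0, mul_nonneg hν.le hT.le, mul_nonneg hν.le hE0,
          mul_nonneg (mul_nonneg hν.le hT.le) hE0]
    _ = _ := by ring

end Consistency

/-! ### Affine cut-offs in time -/

section Ramp

/-- The function of `r` equal to `1` before `t`, equal to `0` after `t + w`, affine between. -/
def ramp (t w r : ℝ) : ℝ := max 0 (min 1 ((t + w - r) / w))

variable {t w r : ℝ}

lemma ramp_nonneg : 0 ≤ ramp t w r := le_max_left _ _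

lemma ramp_le_one : ramp t w r ≤ 1 := max_le zero_le_one (min_le_left _ _)

lemma abs_ramp_sub_le {s : ℝ} : |ramp t w r - ramp s w r| ≤ 1 := by
  have h1 := ramp_nonneg (t := t) (w := w) (r := r)
  have h2 := ramp_nonneg (t := s) (w := w) (r := r)
  have h3 := ramp_le_one (t := t) (w := w) (r := r)
  have h4 := ramp_le_one (t := s) (w := w) (r := r)
  rw [abs_le]
  constructor <;> linarith

lemma ramp_eq_one (hw : 0 < w) (hr : r ≤ t) : ramp t w r = 1 := by
  have : 1 ≤ (t + w - r) / w := by rw [le_div_iff₀ hw]; linarith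
  rw [ramp, min_eq_left this, max_eq_right zero_le_one]

lemma ramp_eq_zero (hw : 0 < w) (hr : t + w ≤ r) : ramp t w r = 0 := by
  have : (t + w - r) / w ≤ 0 := div_nonpos_of_nonpos_of_nonneg (by linarith) hw.le
  rw [ramp, max_eq_left ((min_le_right _ _).trans this)]

lemma lipschitzWith_ramp (hw : 0 < w) : LipschitzWith (Real.toNNReal w⁻¹) (ramp t w) := by
  have h1 : LipschitzWith (Real.toNNReal w⁻¹) fun r => (t + w - r) / w := by
    refine LipschitzWith.of_dist_le_mul fun x y => ?_
    rw [Real.coe_toNNReal _ (by positivity), Real.dist_eq, Real.dist_eq, ← sub_div, abs_div,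
      abs_of_pos hw, div_eq_inv_mul]
    apply le_of_eq
    congr 1
    rw [abs_sub_comm]
    congr 1; ring
  exact (h1.const_min 1).const_max 0

lemma deriv_ramp_of_lt (hw : 0 < w) (hr : r < t) : deriv (ramp t w) r = 0 := by
  have : ramp t w =ᶠ[𝓝 r] fun _ => 1 := by
    filter_upwards [Iio_mem_nhds hr] with s hs
    exact ramp_eq_one hw (le_of_lt hs)
  rw [this.deriv_eq]; simp

lemma deriv_ramp_of_gt (hw : 0 < w) (hr : t + w < r) : deriv (ramp t w) r = 0 := by
  have : ramp t w =ᶠ[𝓝 r] fun _ => 0 := by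
    filter_upwards [Ioi_mem_nhds hr] with s hs
    exact ramp_eq_zero hw (le_of_lt hs)
  rw [this.deriv_eq]; simp

lemma deriv_ramp_of_mem (hw : 0 < w) (hr : r ∈ Ioo t (t + w)) :
    deriv (ramp t w) r = -w⁻¹ := by
  have h1 : ramp t w =ᶠ[𝓝 r] fun s => (t + w - s) / w := by
    filter_upwards [Ioo_mem_nhds hr.1 hr.2] with s hs
    have a1 : (t + w - s) / w ≤ 1 := by rw [div_le_one hw]; linarith [hs.1]
    have a2 : 0 ≤ (t + w - s) / w := div_nonneg (by linarith [hs.2]) hw.le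
    rw [ramp, min_eq_right a1, max_eq_right a2]
  rw [h1.deriv_eq]
  have h2 : HasDerivAt (fun s => (t + w - s) / w) (-1 / w) r :=
    ((hasDerivAt_id r).const_sub (t + w)).div_const w
  rw [h2.deriv]
  field_simp

lemma ae_deriv_ramp (hw : 0 < w) :
    ∀ᵐ r, deriv (ramp t w) r = (Ioc t (t + w)).indicator (fun _ => -w⁻¹) r := by
  have h0 : ∀ᵐ r : ℝ, r ≠ t := by simp [ae_iff]
  have h1 : ∀ᵐ r : ℝ, r ≠ t + w := by simp [ae_iff]
  filter_upwards [h0, h1] with r hr0 hr1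
  rcases lt_or_gt_of_ne hr0 with h | h
  · rw [deriv_ramp_of_lt hw h, indicator_of_notMem]
    exact fun hm => absurd hm.1 (not_lt.2 h.le)
  · rcases lt_or_gt_of_ne hr1 with h' | h'
    · have hm : r ∈ Ioc t (t + w) := ⟨h, h'.le⟩
      rw [deriv_ramp_of_mem hw ⟨h, h'⟩, indicator_of_mem hm]
    · rw [deriv_ramp_of_gt hw h', indicator_of_notMem]
      exact fun hm => absurd hm.2 (not_le.2 h')

/-- The ramp decreases from `1` to `0`, so its variation is at most one whatever its width; the
consistency error is thus uniform as `w → 0`. -/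
lemma integral_abs_deriv_ramp_le (hw : 0 < w) (T : ℝ) :
    ∫ r in Ioc 0 T, |deriv (ramp t w) r| ≤ 1 := by
  have h1 : ∫ r in Ioc 0 T, |deriv (ramp t w) r| =
      ∫ r in Ioc 0 T, (Ioc t (t + w)).indicator (fun _ => w⁻¹) r := by
    refine integral_congr_ae (ae_restrict_of_ae ?_)
    filter_upwards [ae_deriv_ramp (t := t) hw] with r hr
    rw [hr]
    by_cases hm : r ∈ Ioc t (t + w)
    · rw [indicator_of_mem hm, indicator_of_mem hm, abs_neg, abs_of_pos (by positivity)]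
    · rw [indicator_of_notMem hm, indicator_of_notMem hm, abs_zero]
  have hi : Integrable ((Ioc t (t + w)).indicator fun _ => w⁻¹) (volume : Measure ℝ) :=
    (integrableOn_const (by simp)).integrable_indicator measurableSet_Ioc
  rw [h1]
  refine (setIntegral_le_integral hi (Eventually.of_forall fun r =>
    indicator_nonneg (fun _ _ => by positivity) r)).trans ?_
  rw [integral_indicator measurableSet_Ioc, setIntegral_const]
  simp [hw.le, hw.ne']

/-- Right averages of continuous functions. -/
lemma tendsto_right_average {f : ℝ → ℝ} (hf : ContinuousOn f (Ici 0)) (ht : 0 ≤ t) :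
    Tendsto (fun w => w⁻¹ * ∫ r in Ioc t (t + w), f r) (𝓝[>] 0) (𝓝 (f t)) := by
  have hsub : Ici t ⊆ Ici (0 : ℝ) := Ici_subset_Ici.2 ht
  have hmeas : StronglyMeasurableAtFilter f (𝓝[>] t) volume :=
    ⟨Ioi t, self_mem_nhdsWithin,
      (hf.mono (Ioi_subset_Ici_self.trans hsub)).aestronglyMeasurable measurableSet_Ioi⟩
  have h1 : HasDerivWithinAt (fun y => ∫ r in t..y, f r) (f t) (Ici t) t :=
    intervalIntegral.integral_hasDerivWithinAt_right (by simp) hmeas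
      ((hf t ht).mono (Ioi_subset_Ici_self.trans hsub))
  have h2 := (hasDerivWithinAt_Ioi_iff_Ici.2 h1)
  rw [hasDerivWithinAt_iff_tendsto_slope' (by simp)] at h2
  have h3 : Tendsto (fun w => t + w) (𝓝[>] (0 : ℝ)) (𝓝[>] t) := by
    refine tendsto_nhdsWithin_iff.2 ⟨?_, ?_⟩
    · have : Tendsto (fun w => t + w) (𝓝 (0 : ℝ)) (𝓝 (t + 0)) :=
        (continuous_const.add continuous_id).tendsto 0
      rw [add_zero] at this
      exact this.mono_left nhdsWithin_le_nhds
    · filter_upwards [self_mem_nhdsWithin] with w hw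
      have : (0 : ℝ) < w := hw
      simpa using this
  refine (h2.comp h3).congr' ?_
  filter_upwards [self_mem_nhdsWithin] with w hw
  have hw0 : (0 : ℝ) < w := hw
  simp only [Function.comp_apply, slope_def_field, intervalIntegral.integral_same, sub_zero,
    add_sub_cancel_left]
  rw [intervalIntegral.integral_of_le (by linarith), div_eq_inv_mul]

end Ramp

/-! ### Equicontinuity in time of the pairings with solenoidal fields -/

section Equicontinuity

variable {ζ : R3 → R3}

/-- The product of a field with a cut-off function of time equal to `1` on `[-T, T]`. -/
def timeExtension (T : ℝ) (hT : 0 < T) (ζ : R3 → R3) (z : ℝ × R3) : R3 :=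
  (⟨T + 1, T + 2, by linarith, by linarith⟩ : ContDiffBump (0 : ℝ)) z.1 • ζ z.2

variable {T : ℝ}

/-- The consistency estimate requires compact support in time. The cut-off equals `1` up to `T + 1`,
so it leaves no trace on `(0, T]`, not even in the time derivative. -/
lemma timeExtension_eq (hT : 0 < T) {z : ℝ × R3} (hz : |z.1| ≤ T + 1) :
    timeExtension T hT ζ z = ζ z.2 := by
  rw [timeExtension, ContDiffBump.one_of_mem_closedBall _ (by simpa using hz), one_smul]

lemma contDiff_timeExtension (hT : 0 < T) (hζ : ContDiff ℝ (⊤ : ℕ∞) ζ) :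
    ContDiff ℝ (⊤ : ℕ∞) (timeExtension T hT ζ) :=
  ((ContDiffBump.contDiff _).comp contDiff_fst).smul (hζ.comp contDiff_snd)

lemma hasCompactSupport_timeExtension (hT : 0 < T) (hζ : HasCompactSupport ζ) :
    HasCompactSupport (timeExtension T hT ζ) := by
  refine HasCompactSupport.of_support_subset_isCompact
    ((isCompact_closedBall (0 : ℝ) (T + 2)).prod hζ.isCompact) fun z hz => ⟨?_, ?_⟩
  · by_contra hn
    refine hz ?_
    rw [timeExtension, ContDiffBump.zero_of_le_dist, zero_smul]
    rw [Metric.mem_closedBall, not_le] at hn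
    exact hn.le
  · refine subset_tsupport _ fun h0 => hz ?_
    rw [timeExtension, h0, smul_zero]

lemma partialGrad_timeExtension (hT : 0 < T) (hζ : ContDiff ℝ (⊤ : ℕ∞) ζ) (z : ℝ × R3) :
    partialGrad (timeExtension T hT ζ) z =
      (⟨T + 1, T + 2, by linarith, by linarith⟩ : ContDiffBump (0 : ℝ)) z.1 • gradField ζ z.2 := by
  rw [← gradField_slice (contDiff_timeExtension hT hζ) z.1 z.2]
  have h : HasFDerivAt (fun y => timeExtension T hT ζ (z.1, y)) _ z.2 :=
    (contDiff_top_differentiable hζ z.2).hasFDerivAt.const_smul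
      ((⟨T + 1, T + 2, by linarith, by linarith⟩ : ContDiffBump (0 : ℝ)) z.1)
  rw [gradField_eq, gradField_eq]
  dsimp only
  rw [h.fderiv, map_smul]

lemma partialGrad_timeExtension_eq (hT : 0 < T) (hζ : ContDiff ℝ (⊤ : ℕ∞) ζ) {z : ℝ × R3}
    (hz : |z.1| ≤ T + 1) : partialGrad (timeExtension T hT ζ) z = gradField ζ z.2 := by
  rw [partialGrad_timeExtension hT hζ, ContDiffBump.one_of_mem_closedBall _ (by simpa using hz),
    one_smul]

lemma fderiv_timeExtension_eq_zero (hT : 0 < T) (hζ : ContDiff ℝ (⊤ : ℕ∞) ζ) {z : ℝ × R3}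
    (hz : |z.1| < T + 1) : fderiv ℝ (timeExtension T hT ζ) z (1, 0) = 0 := by
  have h : HasFDerivAt (fun z : ℝ × R3 => ζ z.2)
      ((fderiv ℝ ζ z.2).comp (ContinuousLinearMap.snd ℝ ℝ R3)) z :=
    (contDiff_top_differentiable hζ z.2).hasFDerivAt.comp z hasFDerivAt_snd
  have he : timeExtension T hT ζ =ᶠ[𝓝 z] fun z => ζ z.2 := by
    have ho : IsOpen {z : ℝ × R3 | |z.1| < T + 1} := isOpen_lt (by fun_prop) continuous_const
    filter_upwards [ho.mem_nhds hz] with y hy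
    exact timeExtension_eq hT (le_of_lt hy)
  rw [he.fderiv_eq, h.fderiv]
  simp

variable {ν ρ e E m : ℝ} {S₀ : Set R3} {u₀ : R3 → R3} {u : ℝ → R3 → R3}
    {G : ℝ → R3 → Grad3} {h om : ℝ → R3} {R : ℝ → Matrix (Fin 3) (Fin 3) ℝ}

/-- The flux in the momentum equation tested with a field that does not depend on time. -/
def momentumFlux (ν : ℝ) (ζ : R3 → R3) (u : ℝ → R3 → R3) (G : ℝ → R3 → Grad3) (t : ℝ) : ℝ :=
  ∫ x, momentum ν (u t x) (G t x) 0 (gradField ζ x)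

lemma integrable_momentumFlux (H : IsBoundedBodyFlow ν ρ e E m S₀ u₀ u G h om R)
    (hζ : IsSolenoidalTest ζ) (T : ℝ) :
    Integrable (momentumFlux ν ζ u G) (volume.restrict (Ioc 0 T)) := by
  have hg := contDiff_gradField hζ.contDiff
  have hgs := hasCompactSupport_gradField hζ.hasCompactSupport
  obtain ⟨c, -, hc⟩ := exists_bound_of_continuous hg.continuous hgs
  obtain ⟨K, hK⟩ := hgs.isCompact.isBounded.subset_closedBall 0
  have hb : MemLp (fun z : ℝ × R3 => gradField ζ z.2) 2 (spaceTime (Ioc 0 T)) := by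
    refine memLp_spaceTime_of_bound (c := c) (K := K)
      (hg.continuous.comp continuous_snd).aestronglyMeasurable
      (Eventually.of_forall fun z => hc z.2) (Eventually.of_forall fun z hz => ?_)
    by_contra hne
    have := hK (subset_tsupport _ hne)
    rw [mem_closedBall_zero_iff] at this
    exact absurd hz (not_lt.2 this)
  exact integrable_spaceTime_left (integrable_momentum (ν := ν) (a := fun _ => 0)
    (H.velocity_memLp T) (H.grad_memLp_Ioc T) MemLp.zero hb (Eventually.of_forall fun z => hc z.2))

/-- A bound for the flux. -/
lemma exists_momentumFlux_bound (hν : 0 < ν) (hζ : IsSolenoidalTest ζ) :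
    ∃ C : ℝ, 0 ≤ C ∧ ∀ {ρ e E m : ℝ} {S₀ : Set R3} {u₀ : R3 → R3} {u : ℝ → R3 → R3}
      {G : ℝ → R3 → Grad3} {h om : ℝ → R3} {R : ℝ → Matrix (Fin 3) (Fin 3) ℝ},
      IsBoundedBodyFlow ν ρ e E m S₀ u₀ u G h om R → ∀ l : ℝ, 0 < l → ∀ s t : ℝ, 0 ≤ s → s ≤ t →
        ∫ r in Ioc s t, |momentumFlux ν ζ u G r| ≤ C * ((1 + l) * (1 + E) * (t - s) + l⁻¹ * E) := by
  have hg := contDiff_gradField hζ.contDiff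
  have hgs := hasCompactSupport_gradField hζ.hasCompactSupport
  obtain ⟨c, hc0, hc⟩ := exists_bound_of_continuous hg.continuous hgs
  have hgm := memLp_of_contDiff hg.continuous hgs 2
  set κ := ∫ x, ‖gradField ζ x‖ ^ 2 with hκ
  have hκ0 : 0 ≤ κ := integral_nonneg fun x => sq_nonneg _
  refine ⟨c + 2 * ν * (κ + 1), by positivity, ?_⟩
  intro ρ e E m S₀ u₀ u G h om R H l hl s t hs hst
  have hE0 := H.bound_nonneg
  have hsub : Ioc s t ⊆ Ioc 0 t := Ioc_subset_Ioc_left hs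
  have hsub' : Ioc s t ⊆ Ioi 0 := hsub.trans Ioc_subset_Ioi_self
  have hgi : Integrable (fun t => ∫ x, ‖G t x‖ ^ 2) (volume.restrict (Ioc s t)) :=
    IntegrableOn.mono_set H.integrable_grad_sq hsub'
  -- The convective part is bounded at each time by the kinetic energy. The viscous part is only
  -- square integrable in time, and the parameter `l` trades the length of the interval against the
  -- total dissipation.
  have hb : ∫ r in Ioc s t, |momentumFlux ν ζ u G r| ≤
      ∫ r in Ioc s t, (c * E + 2 * ν * (l * κ) + 2 * ν * l⁻¹ * ∫ x, ‖G r x‖ ^ 2) := by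
    refine integral_mono_ae (IntegrableOn.mono_set (integrable_momentumFlux H hζ t) hsub).abs
      ((integrable_const _).add (hgi.const_mul _)) ?_
    filter_upwards [ae_restrict_of_ae_restrict_of_subset hsub' H.solution.ae_isSobolevField,
      ae_restrict_mem measurableSet_Ioc] with r hr hrI
    have hr0 : 0 ≤ r := hs.trans hrI.1.le
    have i1 := integrable_inner_convect (b := gradField ζ) hr.memLp hgm.1
      (Eventually.of_forall hc)
    have i2 := integrable_inner_symGrad hr.grad_memLp hgm
    have e1 : momentumFlux ν ζ u G r = (∫ x, inner ℝ (u r x) (convect (u r x) (gradField ζ x))) -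
        2 * ν * ∫ x, inner ℝ (G r x) (symGrad (gradField ζ x)) := by
      rw [← integral_const_mul, ← integral_sub i1 (i2.const_mul _)]
      simp only [momentumFlux, momentum, zero_add]
    have b1 : |∫ x, inner ℝ (u r x) (convect (u r x) (gradField ζ x))| ≤ c * E := by
      refine le_trans ?_ (mul_le_mul_of_nonneg_left (H.velocity_le r hr0) hc0)
      rw [← integral_const_mul, ← Real.norm_eq_abs]
      refine norm_integral_le_of_norm_le
        (((memLp_two_iff_integrable_sq_norm hr.memLp.1).1 hr.memLp).const_mul c)
        (Eventually.of_forall fun x => ?_)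
      refine (norm_inner_le_norm _ _).trans ?_
      calc ‖u r x‖ * ‖convect (u r x) (gradField ζ x)‖ ≤ ‖u r x‖ * (‖u r x‖ * c) := by
            gcongr
            exact (norm_convect_le _ _).trans (by gcongr; exact hc x)
        _ = c * ‖u r x‖ ^ 2 := by ring
    have b2 : |∫ x, inner ℝ (G r x) (symGrad (gradField ζ x))| ≤
        l * κ + l⁻¹ * ∫ x, ‖G r x‖ ^ 2 := by
      have j1 := (memLp_two_iff_integrable_sq_norm hgm.1).1 hgm
      have j2 := (memLp_two_iff_integrable_sq_norm hr.grad_memLp.1).1 hr.grad_memLp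
      rw [hκ, ← integral_const_mul, ← integral_const_mul, ← integral_add (j1.const_mul _)
        (j2.const_mul _), ← Real.norm_eq_abs]
      refine norm_integral_le_of_norm_le ((j1.const_mul _).add (j2.const_mul _))
        (Eventually.of_forall fun x => ?_)
      refine (norm_inner_le_norm _ _).trans ?_
      have h1 : ‖G r x‖ * ‖symGrad (gradField ζ x)‖ ≤ ‖G r x‖ * ‖gradField ζ x‖ := by
        gcongr
        exact norm_symGrad_le _
      refine h1.trans ?_
      set α := ‖G r x‖
      set β := ‖gradField ζ x‖
      have h2 : l * β ^ 2 + l⁻¹ * α ^ 2 - α * β = l⁻¹ * ((α - l * β / 2) ^ 2 +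
          3 / 4 * (l * β) ^ 2) := by field_simp; ring
      have h3 : 0 ≤ l⁻¹ * ((α - l * β / 2) ^ 2 + 3 / 4 * (l * β) ^ 2) := by positivity
      linarith
    rw [e1]
    refine (abs_sub _ _).trans ?_
    rw [abs_mul, abs_of_pos (by positivity : 0 < 2 * ν)]
    have b3 := mul_le_mul_of_nonneg_left b2 (by positivity : 0 ≤ 2 * ν)
    linarith
  refine hb.trans ?_
  rw [integral_add (integrable_const _) (hgi.const_mul _), integral_const_mul, setIntegral_const,
    smul_eq_mul, Real.volume_real_Ioc_of_le hst]
  have h1 := H.integral_grad_sq_le hsub'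
  have h2 : 0 ≤ t - s := by linarith
  have h3 : 2 * ν * l⁻¹ * ∫ r in Ioc s t, ∫ x, ‖G r x‖ ^ 2 ≤ 2 * ν * (κ + 1) * (l⁻¹ * E) := by
    calc _ ≤ 2 * ν * l⁻¹ * E := by gcongr
      _ = 2 * ν * 1 * (l⁻¹ * E) := by ring
      _ ≤ _ := by gcongr; linarith
  have h4 : c * E + 2 * ν * (l * κ) ≤ (c + 2 * ν * (κ + 1)) * ((1 + l) * (1 + E)) := by
    have a1 : c * E ≤ c * ((1 + l) * (1 + E)) := by
      gcongr
      nlinarith [mul_nonneg hl.le hE0]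
    have a2 : 2 * ν * (l * κ) ≤ 2 * ν * (κ + 1) * ((1 + l) * (1 + E)) := by
      have : l * κ ≤ (κ + 1) * ((1 + l) * (1 + E)) := by
        calc l * κ ≤ (1 + l) * (κ + 1) := by nlinarith
          _ = (κ + 1) * ((1 + l) * 1) := by ring
          _ ≤ _ := by gcongr; linarith
      calc 2 * ν * (l * κ) ≤ 2 * ν * ((κ + 1) * ((1 + l) * (1 + E))) := by gcongr
        _ = _ := by ring
    linarith
  have h5 : 0 ≤ c * (l⁻¹ * E) := by positivity
  calc _ ≤ (t - s) * ((c + 2 * ν * (κ + 1)) * ((1 + l) * (1 + E))) +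
        2 * ν * (κ + 1) * (l⁻¹ * E) := by gcongr
    _ ≤ _ := by linarith

/-- The averaged weak formulation for fields that do not depend on time. -/
lemma exists_averaged_momentum_bound (hν : 0 < ν) (hζ : IsSolenoidalTest ζ) (hT : 0 < T) :
    ∃ C : ℝ, 0 ≤ C ∧ ∀ {ρ e E m : ℝ} {S₀ : Set R3} {u₀ : R3 → R3} {u : ℝ → R3 → R3}
      {G : ℝ → R3 → Grad3} {h om : ℝ → R3} {R : ℝ → Matrix (Fin 3) (Fin 3) ℝ},
      IsBoundedBodyFlow ν ρ e E m S₀ u₀ u G h om R → ∀ t w : ℝ, 0 ≤ t → 0 < w → t + w ≤ T →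
        |w⁻¹ * (∫ r in Ioc t (t + w), ∫ x, inner ℝ (u r x) (ζ x)) - (∫ x, inner ℝ (u₀ x) (ζ x)) -
          ∫ r in Ioc 0 T, ramp t w r * momentumFlux ν ζ u G r| ≤ C * ((√e + m) * (1 + E)) := by
  have hφ := contDiff_timeExtension hT hζ.contDiff
  have hφs := hasCompactSupport_timeExtension hT hζ.hasCompactSupport
  obtain ⟨C, hC0, hC⟩ := exists_consistency_bound hν hφ hφs fun t x _ => by
    rw [partialGrad_timeExtension hT hζ.contDiff]
    simp only [PiLp.smul_apply, smul_eq_mul, ← Finset.mul_sum, hζ.divFree x, mul_zero]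
  refine ⟨C * (1 + T), by positivity, ?_⟩
  intro ρ e E m S₀ u₀ u G h om R H t w ht hw htw
  have hlip := lipschitzWith_ramp (t := t) hw
  have h1 := hC H hT hlip (fun _ => ramp_nonneg) (fun _ => ramp_le_one)
    (fun r hr => ramp_eq_zero hw (htw.trans hr)) (integral_abs_deriv_ramp_le hw T)
  have hint := integrable_momentumDensity H hφ hφs T hlip (fun _ => ramp_nonneg)
    (fun _ => ramp_le_one)
  have hζm := memLp_of_contDiff hζ.contDiff.continuous hζ.hasCompactSupport 2
  have hgm := memLp_of_contDiff (contDiff_gradField hζ.contDiff).continuous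
    (hasCompactSupport_gradField hζ.hasCompactSupport) 2
  obtain ⟨c, -, hc⟩ := exists_bound_of_continuous (contDiff_gradField hζ.contDiff).continuous
    (hasCompactSupport_gradField hζ.hasCompactSupport)
  set f : ℝ → ℝ := fun r => ∫ x, inner ℝ (u r x) (ζ x) with hf
  have hfc : ContinuousOn f (Ici 0) := H.solution.weaklyContinuous.2 ζ hζm
  have hQ := integrable_momentumFlux H hζ T
  -- Where the field does not depend on time, the time derivative only hits the ramp and produces
  -- the average over `(t, t + w]`; the rest is the flux weighted with the ramp.
  have hin : ∀ᵐ r ∂volume.restrict (Ioc 0 T),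
      ∫ x, momentumDensity ν (timeExtension T hT ζ) (ramp t w) u G (r, x) =
        (Ioc t (t + w)).indicator (fun r => -w⁻¹ * f r) r + ramp t w r * momentumFlux ν ζ u G r := by
    filter_upwards [ae_restrict_of_ae_restrict_of_subset (Ioc_subset_Ioi_self : Ioc 0 T ⊆ Ioi 0)
      H.solution.ae_isSobolevField, ae_restrict_of_ae (ae_deriv_ramp (t := t) hw),
      ae_restrict_mem measurableSet_Ioc] with r hr hr2 hrI
    have habs : |r| < T + 1 := by rw [abs_of_pos hrI.1]; linarith [hrI.2]
    have e1 : ∀ x, momentumDensity ν (timeExtension T hT ζ) (ramp t w) u G (r, x) =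
        deriv (ramp t w) r * inner ℝ (u r x) (ζ x) +
          ramp t w r * momentum ν (u r x) (G r x) 0 (gradField ζ x) := by
      intro x
      rw [momentumDensity, timeExtension_eq hT (z := (r, x)) habs.le,
        partialGrad_timeExtension_eq hT hζ.contDiff (z := (r, x)) habs.le,
        fderiv_timeExtension_eq_zero hT hζ.contDiff (z := (r, x)) habs, ← momentum_smul]
      simp only [momentum, inner_add_right, inner_smul_right, smul_zero, add_zero, inner_zero_right]
      ring
    have i1 := integrable_inner_of_memLp_two hr.memLp hζm
    have i2 := integrable_momentum (ν := ν) (a := fun _ : R3 => (0 : R3)) hr.memLp hr.grad_memLp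
      MemLp.zero hgm (Eventually.of_forall hc)
    simp only [e1]
    rw [integral_add (i1.const_mul _) (i2.const_mul _), integral_const_mul, integral_const_mul, hr2]
    congr 1
    by_cases hm : r ∈ Ioc t (t + w)
    · rw [indicator_of_mem hm, indicator_of_mem hm]
    · rw [indicator_of_notMem hm, indicator_of_notMem hm, zero_mul]
  have hfi : IntegrableOn (fun r => -w⁻¹ * f r) (Ioc t (t + w)) := by
    refine Integrable.const_mul ?_ _
    have : ContinuousOn f (Icc t (t + w)) := hfc.mono fun r hr => ht.trans hr.1
    exact (this.integrableOn_compact isCompact_Icc).mono_set Ioc_subset_Icc_self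
  have j1 : Integrable ((Ioc t (t + w)).indicator fun r => -w⁻¹ * f r)
      (volume.restrict (Ioc 0 T)) := (hfi.integrable_indicator measurableSet_Ioc).restrict
  have j2 : Integrable (fun r => ramp t w r * momentumFlux ν ζ u G r)
      (volume.restrict (Ioc 0 T)) := by
    refine hQ.bdd_mul (c := 1) hlip.continuous.aestronglyMeasurable
      (Eventually.of_forall fun r => ?_)
    rw [Real.norm_of_nonneg ramp_nonneg]
    exact ramp_le_one
  have e2 : ∫ z, momentumDensity ν (timeExtension T hT ζ) (ramp t w) u G z
      ∂spaceTime (Ioc 0 T) = -(w⁻¹ * ∫ r in Ioc t (t + w), f r) +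
        ∫ r in Ioc 0 T, ramp t w r * momentumFlux ν ζ u G r := by
    rw [integral_spaceTime hint, integral_congr_ae hin, integral_add j1 j2,
      setIntegral_indicator measurableSet_Ioc, inter_eq_self_of_subset_right
        (Ioc_subset_Ioc ht htw), integral_const_mul]
    ring
  have e3 : ∫ x, inner ℝ (u₀ x) (timeExtension T hT ζ (0, x)) = ∫ x, inner ℝ (u₀ x) (ζ x) := by
    refine integral_congr_ae (Eventually.of_forall fun x => ?_)
    simp only
    rw [timeExtension_eq hT (z := (0, x)) (by simpa using by linarith)]
  rw [e2, e3, ramp_eq_one hw ht, one_mul] at h1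
  rw [← abs_neg]
  refine (le_of_eq ?_).trans (h1.trans (le_of_eq ?_))
  · congr 1; ring
  · ring

/-- The pairings of the velocity with solenoidal fields are equicontinuous up to an error that is
controlled by the size and the speed of the body. -/
theorem exists_equicontinuity_bound (hν : 0 < ν) (hζ : IsSolenoidalTest ζ) (hT : 0 < T) :
    ∃ C : ℝ, 0 ≤ C ∧ ∀ {ρ e E m : ℝ} {S₀ : Set R3} {u₀ : R3 → R3} {u : ℝ → R3 → R3}
      {G : ℝ → R3 → Grad3} {h om : ℝ → R3} {R : ℝ → Matrix (Fin 3) (Fin 3) ℝ},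
      IsBoundedBodyFlow ν ρ e E m S₀ u₀ u G h om R → ∀ l : ℝ, 0 < l →
        (∀ s t, 0 ≤ s → s ≤ t → t ≤ T →
          |(∫ x, inner ℝ (u t x) (ζ x)) - ∫ x, inner ℝ (u s x) (ζ x)| ≤
            C * ((√e + m) * (1 + E) + (1 + l) * (1 + E) * (t - s) + l⁻¹ * E)) ∧
        |(∫ x, inner ℝ (u 0 x) (ζ x)) - ∫ x, inner ℝ (u₀ x) (ζ x)| ≤
          C * ((√e + m) * (1 + E) + l⁻¹ * E) := by
  -- The horizon `T + 1` leaves room for the averaging window `(t, t + w]` with `w ≤ 1`, also for `t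
  -- = T`.
  obtain ⟨C₁, hC₁0, hC₁⟩ := exists_averaged_momentum_bound hν hζ (by linarith : 0 < T + 1)
  obtain ⟨C₂, hC₂0, hC₂⟩ := exists_momentumFlux_bound hν hζ
  refine ⟨2 * C₁ + C₂, by positivity, ?_⟩
  intro ρ e E m S₀ u₀ u G h om R H l hl
  have hE0 := H.bound_nonneg
  have hm0 := H.speed_bound_nonneg
  have hζm := memLp_of_contDiff hζ.contDiff.continuous hζ.hasCompactSupport 2
  set f : ℝ → ℝ := fun r => ∫ x, inner ℝ (u r x) (ζ x) with hf
  have hfc : ContinuousOn f (Ici 0) := H.solution.weaklyContinuous.2 ζ hζm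
  have hQ := integrable_momentumFlux H hζ (T + 1)
  have hQb : ∀ {q : ℝ → ℝ} {s t : ℝ}, 0 ≤ s → s ≤ t → t ≤ T + 1 →
      (∀ r, |q r| ≤ 1) → (∀ r, r ∉ Ioc s t → q r = 0) →
      |∫ r in Ioc 0 (T + 1), q r * momentumFlux ν ζ u G r| ≤
        C₂ * ((1 + l) * (1 + E) * (t - s) + l⁻¹ * E) := by
    intro q s t hs hst ht hq hq0
    have hsub : Ioc s t ⊆ Ioc 0 (T + 1) := Ioc_subset_Ioc hs ht
    refine le_trans ?_ (hC₂ H l hl s t hs hst)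
    have e1 : ∫ r in Ioc s t, |momentumFlux ν ζ u G r| =
        ∫ r in Ioc 0 (T + 1), (Ioc s t).indicator (fun r => |momentumFlux ν ζ u G r|) r := by
      rw [setIntegral_indicator measurableSet_Ioc, inter_eq_self_of_subset_right hsub]
    rw [e1, ← Real.norm_eq_abs]
    refine norm_integral_le_of_norm_le (hQ.abs.indicator measurableSet_Ioc)
      (Eventually.of_forall fun r => ?_)
    by_cases hr : r ∈ Ioc s t
    · rw [indicator_of_mem hr, norm_mul, Real.norm_eq_abs, Real.norm_eq_abs]
      exact mul_le_of_le_one_left (abs_nonneg _) (hq r)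
    · rw [indicator_of_notMem hr, hq0 r hr]; simp
  have hw1 : ∀ᶠ w in 𝓝[>] (0 : ℝ), 0 < w ∧ w ≤ 1 := by
    filter_upwards [Ioc_mem_nhdsGT one_pos] with w hw
    exact hw
  have hδ : 0 ≤ (√e + m) * (1 + E) := by positivity
  constructor
  · intro s t hs hst htT
    -- Weak continuity in time turns the averages into values at `t` and `s` as `w → 0`. The error
    -- bounds are uniform in `w`.
    have hlim := ((tendsto_right_average hfc (hs.trans hst)).sub (tendsto_right_average hfc hs)).abs
    have hlim2 : Tendsto (fun w : ℝ => 2 * (C₁ * ((√e + m) * (1 + E))) +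
        C₂ * ((1 + l) * (1 + E) * (t + w - s) + l⁻¹ * E)) (𝓝[>] 0)
        (𝓝 (2 * (C₁ * ((√e + m) * (1 + E))) +
          C₂ * ((1 + l) * (1 + E) * (t + 0 - s) + l⁻¹ * E))) := by
      refine Tendsto.mono_left (Continuous.tendsto ?_ 0) nhdsWithin_le_nhds
      fun_prop
    refine (le_of_tendsto_of_tendsto hlim hlim2 ?_).trans ?_
    · filter_upwards [hw1] with w hw
      have a1 := hC₁ H t w (hs.trans hst) hw.1 (by linarith [hw.2])
      have a2 := hC₁ H s w hs hw.1 (by linarith [hw.2])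
      -- The difference of the two ramps is supported in `(s, t + w]`, so only the flux over that
      -- interval counts.
      have a3 := hQb (q := fun r => ramp t w r - ramp s w r) (s := s) (t := t + w) hs
        (by linarith [hw.1]) (by linarith [hw.2])
        (fun r => abs_ramp_sub_le)
        (fun r hr => by
          by_cases h1 : r ≤ s
          · rw [ramp_eq_one hw.1 h1, ramp_eq_one hw.1 (h1.trans hst), sub_self]
          · have h2 : t + w ≤ r := by
              by_contra hn
              exact hr ⟨not_le.1 h1, (not_le.1 hn).le⟩
            rw [ramp_eq_zero hw.1 h2, ramp_eq_zero hw.1 (by linarith), sub_self])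
      have j : ∀ t, Integrable (fun r => ramp t w r * momentumFlux ν ζ u G r)
          (volume.restrict (Ioc 0 (T + 1))) := fun t => by
        refine hQ.bdd_mul (c := 1) (lipschitzWith_ramp hw.1).continuous.aestronglyMeasurable
          (Eventually.of_forall fun r => ?_)
        rw [Real.norm_of_nonneg ramp_nonneg]
        exact ramp_le_one
      have e1 : ∫ r in Ioc 0 (T + 1), (ramp t w r - ramp s w r) * momentumFlux ν ζ u G r =
          (∫ r in Ioc 0 (T + 1), ramp t w r * momentumFlux ν ζ u G r) -
            ∫ r in Ioc 0 (T + 1), ramp s w r * momentumFlux ν ζ u G r := by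
        rw [← integral_sub (j t) (j s)]
        simp only [sub_mul]
      rw [e1] at a3
      rw [abs_le] at a1 a2 a3 ⊢
      constructor <;> linarith [a1.1, a1.2, a2.1, a2.2, a3.1, a3.2]
    · rw [add_zero]
      have h1 : 0 ≤ (1 + l) * (1 + E) * (t - s) + l⁻¹ * E :=
        add_nonneg (mul_nonneg (by positivity) (by linarith)) (by positivity)
      nlinarith [mul_nonneg hC₁0 h1, mul_nonneg hC₂0 hδ]
  · have hlim := ((tendsto_right_average hfc le_rfl).sub_const
      (∫ x, inner ℝ (u₀ x) (ζ x))).abs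
    have hlim2 : Tendsto (fun w : ℝ => C₁ * ((√e + m) * (1 + E)) +
        C₂ * ((1 + l) * (1 + E) * (0 + w - 0) + l⁻¹ * E)) (𝓝[>] 0)
        (𝓝 (C₁ * ((√e + m) * (1 + E)) + C₂ * ((1 + l) * (1 + E) * (0 + 0 - 0) + l⁻¹ * E))) := by
      refine Tendsto.mono_left (Continuous.tendsto ?_ 0) nhdsWithin_le_nhds
      fun_prop
    refine (le_of_tendsto_of_tendsto hlim hlim2 ?_).trans ?_
    · filter_upwards [hw1] with w hw
      have a1 := hC₁ H 0 w le_rfl hw.1 (by linarith [hw.2])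
      -- The ramp equals `1` at negative times, whereas the bound asks for a factor vanishing
      -- outside `(0, w]`. The truncation changes nothing on the domain of integration.
      have a3 := hQb (q := fun r => if 0 < r then ramp 0 w r else 0) (s := 0) (t := 0 + w) le_rfl
        (by linarith [hw.1]) (by linarith [hw.2])
        (fun r => by
          split_ifs
          · rw [abs_of_nonneg ramp_nonneg]; exact ramp_le_one
          · simp)
        (fun r hr => by
          split_ifs with h1
          · refine ramp_eq_zero hw.1 ?_
            by_contra hn
            exact hr ⟨h1, (not_le.1 hn).le⟩
          · rfl)
      have e1 : ∫ r in Ioc 0 (T + 1), (if 0 < r then ramp 0 w r else 0) * momentumFlux ν ζ u G r =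
          ∫ r in Ioc 0 (T + 1), ramp 0 w r * momentumFlux ν ζ u G r :=
        setIntegral_congr_fun measurableSet_Ioc fun r hr => by simp only [hr.1, if_true]
      rw [e1] at a3
      rw [abs_le] at a1 a3 ⊢
      constructor <;> linarith [a1.1, a1.2, a3.1, a3.2]
    · have h1 : 0 ≤ l⁻¹ * E := by positivity
      simp only [add_zero, sub_zero, mul_zero, zero_add]
      nlinarith [mul_nonneg hC₁0 h1, mul_nonneg hC₂0 hδ, mul_nonneg hC₁0 hδ]

end Equicontinuity

/-! ### Inner products and norms in `L²` as integrals -/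

section LpPairing

lemma inner_toLp {α E : Type*} [MeasurableSpace α] {μ : Measure α} [NormedAddCommGroup E]
    [InnerProductSpace ℝ E] {f g : α → E} (hf : MemLp f 2 μ) (hg : MemLp g 2 μ) :
    inner ℝ (hf.toLp f) (hg.toLp g) = ∫ x, inner ℝ (f x) (g x) ∂μ := by
  rw [L2.inner_def]
  refine integral_congr_ae ?_
  filter_upwards [hf.coeFn_toLp, hg.coeFn_toLp] with x h1 h2
  rw [h1, h2]

lemma inner_Lp_toLp {α E : Type*} [MeasurableSpace α] {μ : Measure α} [NormedAddCommGroup E]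
    [InnerProductSpace ℝ E] (f : Lp E 2 μ) {g : α → E} (hg : MemLp g 2 μ) :
    inner ℝ f (hg.toLp g) = ∫ x, inner ℝ (f x) (g x) ∂μ := by
  rw [L2.inner_def]
  refine integral_congr_ae ?_
  filter_upwards [hg.coeFn_toLp] with x h2
  rw [h2]

lemma norm_Lp_sq {α E : Type*} [MeasurableSpace α] {μ : Measure α} [NormedAddCommGroup E]
    [InnerProductSpace ℝ E] (f : Lp E 2 μ) : ‖f‖ ^ 2 = ∫ x, ‖f x‖ ^ 2 ∂μ := by
  rw [← real_inner_self_eq_norm_sq, L2.inner_def]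
  simp only [real_inner_self_eq_norm_sq]

lemma norm_toLp_sq {α E : Type*} [MeasurableSpace α] {μ : Measure α} [NormedAddCommGroup E]
    [InnerProductSpace ℝ E] {f : α → E} (hf : MemLp f 2 μ) :
    ‖hf.toLp f‖ ^ 2 = ∫ x, ‖f x‖ ^ 2 ∂μ := by
  rw [← real_inner_self_eq_norm_sq, inner_toLp]
  simp only [real_inner_self_eq_norm_sq]

end LpPairing

/-! ### Density of solenoidal test fields in the divergence free fields of `L²` -/

section SolenoidalSubspace

/-- The gradient of a scalar function. -/
def scalarGrad (ψ : R3 → ℝ) (x : R3) : R3 := ∑ i, fderiv ℝ ψ x (basisVec i) • basisVec i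

lemma inner_scalarGrad (ψ : R3 → ℝ) (x v : R3) : inner ℝ v (scalarGrad ψ x) = fderiv ℝ ψ x v := by
  conv_rhs => rw [r3_eq_sum v]
  simp only [scalarGrad, inner_sum, inner_smul_right, map_sum, map_smul, smul_eq_mul]
  refine Finset.sum_congr rfl fun i _ => ?_
  rw [basisVec, EuclideanSpace.inner_single_right]
  simp [mul_comm]

lemma memLp_scalarGrad {ψ : R3 → ℝ} (hψ : ContDiff ℝ (⊤ : ℕ∞) ψ) (hs : HasCompactSupport ψ) :
    MemLp (scalarGrad ψ) 2 volume := by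
  refine memLp_finsetSum (f := fun i x => fderiv ℝ ψ x (basisVec i) • basisVec i) Finset.univ
    fun i _ => ?_
  exact memLp_of_contDiff ((contDiff_fderiv_apply_const hψ _).continuous.smul continuous_const)
    (hs.fderiv_apply (𝕜 := ℝ) _).smul_right 2

/-- The gradients of test functions, as elements of `L²`. -/
def gradientSet : Set (Lp R3 2 (volume : Measure R3)) :=
  {f | ∃ ψ : R3 → ℝ, ContDiff ℝ (⊤ : ℕ∞) ψ ∧ HasCompactSupport ψ ∧ f =ᵐ[volume] scalarGrad ψ}

/-- The solenoidal test fields, as elements of `L²`. -/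
def solenoidalSet : Set (Lp R3 2 (volume : Measure R3)) :=
  {f | ∃ ζ, IsSolenoidalTest ζ ∧ f =ᵐ[volume] ζ}

/-- The divergence free fields in `L²`. -/
def solenoidalSubspace : Submodule ℝ (Lp R3 2 (volume : Measure R3)) :=
  (Submodule.span ℝ gradientSet)ᗮ

lemma isWeakDivFree_congr {f g : R3 → R3} (h : f =ᵐ[volume] g) (hf : IsWeakDivFree f) :
    IsWeakDivFree g := fun ψ hψ hs => by
  rw [← hf ψ hψ hs]
  refine integral_congr_ae ?_
  filter_upwards [h] with x hx
  rw [hx]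

/-- Weak incompressibility is orthogonality to gradients of test functions. As an orthogonal
complement the space is closed, which makes it stable under weak limits. -/
lemma mem_solenoidalSubspace_iff (f : Lp R3 2 (volume : Measure R3)) :
    f ∈ solenoidalSubspace ↔ IsWeakDivFree f := by
  rw [solenoidalSubspace, Submodule.mem_orthogonal']
  constructor
  · intro h ψ hψ hs
    have h1 := h ((memLp_scalarGrad hψ hs).toLp _)
      (Submodule.subset_span ⟨ψ, hψ, hs, (memLp_scalarGrad hψ hs).coeFn_toLp⟩)
    rw [inner_Lp_toLp] at h1
    simpa only [inner_scalarGrad] using h1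
  · intro h g hg
    refine Submodule.span_induction (p := fun g _ => inner ℝ f g = 0) ?_ (by simp)
      (fun a b _ _ ha hb => by rw [inner_add_right, ha, hb, add_zero])
      (fun c a _ ha => by rw [inner_smul_right, ha, mul_zero]) hg
    rintro g ⟨ψ, hψ, hs, hgψ⟩
    rw [L2.inner_def, ← h ψ hψ hs]
    refine integral_congr_ae ?_
    filter_upwards [hgψ] with x hx
    rw [hx, inner_scalarGrad]

/-- The closed span of the test fields is a closed subspace of the divergence free fields, and its
orthogonal complement within them is trivial by `ae_eq_zero_of_orthogonal_solenoidal`. It is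
therefore everything. -/
lemma solenoidalSubspace_le_closure :
    solenoidalSubspace ≤ (Submodule.span ℝ solenoidalSet).topologicalClosure := by
  set P := (Submodule.span ℝ solenoidalSet).topologicalClosure with hP
  have hPc : IsClosed (P : Set (Lp R3 2 (volume : Measure R3))) :=
    Submodule.isClosed_topologicalClosure _
  have hcomplete : CompleteSpace P := hPc.completeSpace_coe
  have hPK : P ≤ solenoidalSubspace := by
    refine Submodule.topologicalClosure_minimal _ (Submodule.span_le.2 ?_)
      (Submodule.isClosed_orthogonal _)
    rintro f ⟨ζ, hζ, hf⟩
    exact (mem_solenoidalSubspace_iff f).2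
      (isWeakDivFree_congr hf.symm (isWeakDivFree_of_trace hζ.contDiff hζ.divFree))
  have hbot : Pᗮ ⊓ solenoidalSubspace = ⊥ := by
    rw [eq_bot_iff]
    rintro f ⟨hf1, hf2⟩
    rw [Submodule.mem_bot, Lp.eq_zero_iff_ae_eq_zero]
    refine ae_eq_zero_of_orthogonal_solenoidal (Lp.memLp f)
      ((mem_solenoidalSubspace_iff f).1 hf2) fun ζ hζ => ?_
    have hm := memLp_of_contDiff hζ.contDiff.continuous hζ.hasCompactSupport 2
    rw [← inner_Lp_toLp f hm]
    exact (Submodule.mem_orthogonal' _ _).1 hf1 _ (Submodule.le_topologicalClosure _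
      (Submodule.subset_span ⟨ζ, hζ, hm.coeFn_toLp⟩))
  have h1 := Submodule.sup_orthogonal_inf_of_hasOrthogonalProjection hPK
  rw [hbot, sup_bot_eq] at h1
  exact h1.ge

end SolenoidalSubspace

/-! ### Jointly measurable representatives of weakly continuous curves -/

section Representatives

/-- Pairing a mollified field with a vector. -/
lemma inner_conv {k : R3 → ℝ} (hk : Continuous k) (hs : HasCompactSupport k) {f : R3 → R3}
    (hf : LocallyIntegrable f) (x c : R3) :
    inner ℝ (conv k f x) c = ∫ y, inner ℝ (f y) (k (x - y) • c) := by
  rw [real_inner_comm, conv, ← integral_inner (integrable_conv_kernel hk hs hf x)]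
  refine integral_congr_ae (Eventually.of_forall fun y => ?_)
  simp only [inner_smul_right]
  rw [real_inner_comm]

lemma memLp_reflect_smul {k : R3 → ℝ} (hk : Continuous k) (hs : HasCompactSupport k) (x c : R3) :
    MemLp (fun y => k (x - y) • c) 2 volume :=
  memLp_of_contDiff ((hk.comp (continuous_const.sub continuous_id)).smul continuous_const)
    ((hasCompactSupport_reflect hs x).smul_right) 2

/-- A family of vectors converges if its inner products with the basis vectors do. -/
lemma tendsto_of_tendsto_inner {ι : Type*} {l : Filter ι} {a : ι → R3} {b : R3}
    (h : ∀ c : R3, Tendsto (fun i => inner ℝ (a i) c) l (𝓝 (inner ℝ b c))) :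
    Tendsto a l (𝓝 b) := by
  have e : ∀ v : R3, v = ∑ i, inner ℝ v (basisVec i) • basisVec i := fun v => by
    conv_lhs => rw [r3_eq_sum v]
    refine Finset.sum_congr rfl fun i _ => ?_
    rw [basisVec, EuclideanSpace.inner_single_right]
    simp
  rw [e b, show a = fun k => ∑ i, inner ℝ (a k) (basisVec i) • basisVec i from
    funext fun k => e (a k)]
  exact tendsto_finsetSum _ fun i _ => (h (basisVec i)).smul_const _

/-- The value of a mollified field at a point is a pairing with a fixed `L²` field, so weak
convergence becomes pointwise convergence. It is used both for continuity in time and for strong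
compactness. -/
lemma tendsto_conv_of_weak {ι : Type*} {l : Filter ι} {k : R3 → ℝ} (hk : Continuous k)
    (hs : HasCompactSupport k) {f : ι → R3 → R3} {g : R3 → R3} (hf : ∀ i, MemLp (f i) 2 volume)
    (hg : MemLp g 2 volume) (h : ∀ c : R3 → R3, MemLp c 2 volume →
      Tendsto (fun i => ∫ x, inner ℝ (f i x) (c x)) l (𝓝 (∫ x, inner ℝ (g x) (c x)))) (x : R3) :
    Tendsto (fun i => conv k (f i) x) l (𝓝 (conv k g x)) := by
  refine tendsto_of_tendsto_inner fun c => ?_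
  rw [inner_conv hk hs (memLp_two_locallyIntegrable hg)]
  simp only [inner_conv hk hs (memLp_two_locallyIntegrable (hf _))]
  exact h _ (memLp_reflect_smul hk hs x c)

/-- The mollification in space of a weakly continuous curve is jointly measurable. -/
lemma stronglyMeasurable_mollify {w : ℝ → R3 → R3} (hw : IsWeaklyContinuousL2 w) (n : ℕ) :
    StronglyMeasurable
      (Function.uncurry fun t x => conv (mollifier n) (w (max t 0)) x) := by
  have hk := (mollifier_contDiff n).continuous
  have hs := mollifier_hasCompactSupport n
  have hm : ∀ t, MemLp (w (max t 0)) 2 volume := fun t => hw.1 _ (le_max_right _ _)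
  refine stronglyMeasurable_uncurry_of_continuous_of_stronglyMeasurable (fun x => ?_) fun t =>
    (contDiff_conv (mollifier_contDiff n) hs (memLp_two_locallyIntegrable
      (hm t))).continuous.stronglyMeasurable
  rw [continuous_iff_continuousAt]
  intro t
  refine tendsto_conv_of_weak hk hs hm (hm t) (fun c hc => ?_) x
  have h1 : Continuous fun t => ∫ x, inner ℝ (w (max t 0) x) (c x) :=
    (hw.2 c hc).comp_continuous (by fun_prop) fun t => le_max_right t 0
  exact h1.tendsto t

/-- Weakly continuous curves in `L²` have jointly measurable representatives. -/
lemma exists_measurable_representative {w : ℝ → R3 → R3} (hw : IsWeaklyContinuousL2 w) :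
    ∃ v : ℝ → R3 → R3, StronglyMeasurable (Function.uncurry v) ∧
      ∀ t, 0 ≤ t → v t =ᵐ[volume] w t := by
  -- Mollified curves are continuous in time and in space, hence jointly measurable, and so is the
  -- limit over the mollification parameter; at fixed time it agrees almost everywhere with the
  -- curve. `max t 0` is a harmless extension to negative times.
  refine ⟨fun t x => limUnder atTop fun n => conv (mollifier n) (w (max t 0)) x, ?_,
    fun t ht => ?_⟩
  · exact StronglyMeasurable.limUnder (l := atTop)
      (f := fun n => Function.uncurry fun t x => conv (mollifier n) (w (max t 0)) x)
      fun n => stronglyMeasurable_mollify hw n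
  · filter_upwards [ae_tendsto_mollify (memLp_two_locallyIntegrable (hw.1 t ht))] with x hx
    simp only [max_eq_left ht]
    exact hx.limUnder_eq

end Representatives

/-! ### Weak convergence of the velocities at every time -/

section Compactness

/-- Velocities, gradients and initial velocities of flows that contain bodies of vanishing size and
of large mass, with uniformly bounded energies. -/
def IsVanishingBodySequence (ν E : ℝ) (u₀s : ℕ → R3 → R3) (us : ℕ → ℝ → R3 → R3)
    (Gs : ℕ → ℝ → R3 → Grad3) : Prop :=
  ∃ δ : ℕ → ℝ, Tendsto δ atTop (𝓝 0) ∧ ∀ k, ∃ (ρ e m : ℝ) (S₀ : Set R3) (h om : ℝ → R3)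
    (R : ℝ → Matrix (Fin 3) (Fin 3) ℝ),
      IsBoundedBodyFlow ν ρ e E m S₀ (u₀s k) (us k) (Gs k) h om R ∧ √e + m ≤ δ k

lemma IsVanishingBodySequence.subseq {ν E : ℝ} {u₀s : ℕ → R3 → R3} {us : ℕ → ℝ → R3 → R3}
    {Gs : ℕ → ℝ → R3 → Grad3} (H : IsVanishingBodySequence ν E u₀s us Gs) {σ : ℕ → ℕ}
    (hσ : StrictMono σ) :
    IsVanishingBodySequence ν E (fun k => u₀s (σ k)) (fun k => us (σ k)) fun k => Gs (σ k) := by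
  obtain ⟨δ, hδ, h⟩ := H
  exact ⟨fun k => δ (σ k), hδ.comp hσ.tendsto_atTop, fun k => h (σ k)⟩

variable {ν E : ℝ} {u₀s : ℕ → R3 → R3} {us : ℕ → ℝ → R3 → R3} {Gs : ℕ → ℝ → R3 → Grad3}

/-- Three thirds of `η`: first `l` is large enough to make the dissipation term small, then the time
step is small depending on `l`, and finally `k` is large so that the error due to the body is small.
-/
lemma asymptoticallyEquicontinuous_pairing (hν : 0 < ν)
    (H : IsVanishingBodySequence ν E u₀s us Gs) {ζ : R3 → R3} (hζ : IsSolenoidalTest ζ) :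
    AsymptoticallyEquicontinuous fun k t => ∫ x, inner ℝ (us k t x) (ζ x) := by
  obtain ⟨δ, hδ, h⟩ := H
  intro T hT η hη
  have hE0 : 0 ≤ E := by
    obtain ⟨ρ, e, m, S₀, h', om, R, hf, -⟩ := h 0
    exact hf.bound_nonneg
  obtain ⟨C, hC0, hC⟩ := exists_equicontinuity_bound hν hζ hT
  set l : ℝ := 3 * (C + 1) * (E + 1) / η with hl
  have hl0 : 0 < l := by positivity
  have hlE : C * (l⁻¹ * E) ≤ η / 3 := by
    rw [hl, inv_div, div_mul_eq_mul_div, mul_div_assoc', div_le_iff₀ (by positivity)]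
    have : C * E ≤ (C + 1) * (E + 1) := by nlinarith
    nlinarith
  have hr0 : 0 < η / (3 * ((C + 1) * ((1 + l) * (1 + E)))) := by positivity
  refine ⟨_, hr0, ?_⟩
  have hδ2 : Tendsto (fun k => C * (δ k * (1 + E))) atTop (𝓝 0) := by
    simpa using (hδ.mul_const (1 + E)).const_mul C
  filter_upwards [hδ2.eventually (gt_mem_nhds (by positivity : (0 : ℝ) < η / 3))] with k hk
  intro s t hs hst ht hr
  obtain ⟨ρ, e, m, S₀, h', om, R, hf, hem⟩ := h k
  refine ((hC hf l hl0).1 s t hs hst ht).trans ?_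
  have h1 : C * ((√e + m) * (1 + E)) ≤ C * (δ k * (1 + E)) := by gcongr
  rw [lt_div_iff₀ (by positivity)] at hr
  have hts : 0 ≤ t - s := by linarith
  have h2 : C * ((1 + l) * (1 + E) * (t - s)) ≤ η / 3 := by
    have h3 : C * ((1 + l) * (1 + E) * (t - s)) ≤ (C + 1) * ((1 + l) * (1 + E) * (t - s)) := by
      have : 0 ≤ (1 + l) * (1 + E) * (t - s) := by positivity
      nlinarith
    nlinarith
  nlinarith

/-- A subsequence of the velocities converges weakly at all times. -/
theorem exists_weak_limit_velocity (hν : 0 < ν) (H : IsVanishingBodySequence ν E u₀s us Gs)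
    {u₀ : R3 → R3} (hu₀ : MemLp u₀ 2 volume) (hdiv : ∀ k, IsWeakDivFree (u₀s k))
    (hweak : ∀ g : R3 → R3, MemLp g 2 volume →
      Tendsto (fun k => ∫ x, inner ℝ (u₀s k x) (g x)) atTop (𝓝 (∫ x, inner ℝ (u₀ x) (g x)))) :
    ∃ σ : ℕ → ℕ, StrictMono σ ∧ ∃ v : ℝ → R3 → R3, StronglyMeasurable (Function.uncurry v) ∧
      IsWeaklyContinuousL2 v ∧ (∀ t, 0 ≤ t → ∫ x, ‖v t x‖ ^ 2 ≤ E ∧ IsWeakDivFree (v t)) ∧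
      (∀ t, 0 ≤ t → ∀ g : R3 → R3, MemLp g 2 volume →
        Tendsto (fun k => ∫ x, inner ℝ (us (σ k) t x) (g x)) atTop
          (𝓝 (∫ x, inner ℝ (v t x) (g x)))) ∧ v 0 =ᵐ[volume] u₀ := by
  have hflow := H.choose_spec.2
  have hm : ∀ k t, 0 ≤ t → MemLp (us k t) 2 volume := fun k t ht => by
    obtain ⟨ρ, e, m, S₀, h', om, R, hf, -⟩ := hflow k
    exact hf.solution.weaklyContinuous.1 t ht
  have hE : ∀ k t, 0 ≤ t → ∫ x, ‖us k t x‖ ^ 2 ≤ E := fun k t ht => by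
    obtain ⟨ρ, e, m, S₀, h', om, R, hf, -⟩ := hflow k
    exact hf.velocity_le t ht
  have hd : ∀ k t, 0 ≤ t → IsWeakDivFree (us k t) := fun k t ht => by
    obtain ⟨ρ, e, m, S₀, h', om, R, hf, -⟩ := hflow k
    exact hf.solution.divFree t ht
  have hE0 : 0 ≤ E := (integral_nonneg fun _ => sq_nonneg _).trans (hE 0 0 le_rfl)
  -- Square integrability is known for nonnegative times only, hence `max t 0`.
  let U : ℕ → ℝ → Lp R3 2 (volume : Measure R3) := fun k t =>
    (hm k (max t 0) (le_max_right _ _)).toLp _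
  have hUae : ∀ k t, 0 ≤ t → U k t =ᵐ[volume] us k t := fun k t ht => by
    have := (hm k (max t 0) (le_max_right _ _)).coeFn_toLp
    have h2 : us k (max t 0) = us k t := by rw [max_eq_left ht]
    exact this.trans (by rw [h2])
  have hUin : ∀ k t, 0 ≤ t → ∀ {g : R3 → R3} (hg : MemLp g 2 volume),
      inner ℝ (U k t) (hg.toLp g) = ∫ x, inner ℝ (us k t x) (g x) := fun k t ht g hg => by
    rw [inner_Lp_toLp]
    refine integral_congr_ae ?_
    filter_upwards [hUae k t ht] with x hx
    rw [hx]
  have hUC : ∀ k t, 0 ≤ t → ‖U k t‖ ≤ √E := fun k t ht => by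
    refine Real.le_sqrt_of_sq_le ?_
    rw [norm_toLp_sq, max_eq_left ht]
    exact hE k t ht
  have hUK : ∀ k t, 0 ≤ t → U k t ∈ solenoidalSubspace := fun k t ht =>
    (mem_solenoidalSubspace_iff _).2 (isWeakDivFree_congr (hUae k t ht).symm (hd k t ht))
  have : SecondCountableTopology (Lp R3 2 (volume : Measure R3)) := by
    have : Fact ((2 : ℝ≥0∞) ≠ ∞) := ⟨by norm_num⟩
    infer_instance
  obtain ⟨σ, hσ, V, hV1, hV2, hV3⟩ := exists_subseq_weakly_convergent_curve U (√E) hUC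
    solenoidalSubspace solenoidalSet solenoidalSubspace_le_closure
    (Submodule.isClosed_orthogonal _) hUK (by
      rintro f ⟨ζ, hζ, hfζ⟩
      have hζm := memLp_of_contDiff hζ.contDiff.continuous hζ.hasCompactSupport 2
      have hf : f = hζm.toLp ζ := Lp.ext (hfζ.trans hζm.coeFn_toLp.symm)
      intro T hT η hη
      obtain ⟨r, hr, hev⟩ := asymptoticallyEquicontinuous_pairing hν H hζ T hT η hη
      refine ⟨r, hr, hev.mono fun k hk s t hs hst ht htr => ?_⟩
      dsimp only
      rw [hf, hUin k t (hs.trans hst) hζm, hUin k s hs hζm]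
      exact hk s t hs hst ht htr)
  have hVc : IsWeaklyContinuousL2 fun t => ⇑(V t) := by
    refine ⟨fun t _ => Lp.memLp (V t), fun g hg => ?_⟩
    refine (hV3 (hg.toLp g)).congr fun t _ => ?_
    exact (inner_Lp_toLp (V t) hg).symm
  obtain ⟨v, hv1, hv2⟩ := exists_measurable_representative hVc
  have hvin : ∀ t, 0 ≤ t → ∀ g : R3 → R3, ∫ x, inner ℝ (V t x) (g x) = ∫ x, inner ℝ (v t x) (g x) :=
    fun t ht g => by
      refine integral_congr_ae ?_
      filter_upwards [hv2 t ht] with x hx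
      rw [hx]
  have hvm : ∀ t, 0 ≤ t → MemLp (v t) 2 volume := fun t ht =>
    (memLp_congr_ae (hv2 t ht)).2 (Lp.memLp (V t))
  have hvd : ∀ t, 0 ≤ t → IsWeakDivFree (v t) := fun t ht =>
    isWeakDivFree_congr (hv2 t ht).symm ((mem_solenoidalSubspace_iff _).1 (hV1 t ht).2)
  have hlim : ∀ t, 0 ≤ t → ∀ g : R3 → R3, MemLp g 2 volume →
      Tendsto (fun k => ∫ x, inner ℝ (us (σ k) t x) (g x)) atTop
        (𝓝 (∫ x, inner ℝ (v t x) (g x))) := by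
    intro t ht g hg
    have := hV2 t ht (hg.toLp g)
    rw [inner_Lp_toLp, hvin t ht] at this
    exact this.congr fun k => hUin (σ k) t ht hg
  refine ⟨σ, hσ, v, hv1, ⟨hvm, fun g hg => ?_⟩, fun t ht => ⟨?_, hvd t ht⟩, hlim, ?_⟩
  · exact (hVc.2 g hg).congr fun t ht => (hvin t ht g).symm
  · have h1 : ∫ x, ‖v t x‖ ^ 2 = ‖V t‖ ^ 2 := by
      rw [norm_Lp_sq]
      refine integral_congr_ae ?_
      filter_upwards [hv2 t ht] with x hx
      rw [hx]
    rw [h1]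
    calc ‖V t‖ ^ 2 ≤ √E ^ 2 := pow_le_pow_left₀ (norm_nonneg _) (hV1 t ht).1 2
      _ = E := Real.sq_sqrt hE0
  -- The limit of the initial data is divergence free because incompressibility is a family of
  -- pairings.
  · have hu₀d : IsWeakDivFree u₀ := by
      intro ψ hψ hs
      have h1 := hweak _ (memLp_scalarGrad hψ hs)
      simp only [inner_scalarGrad] at h1
      refine tendsto_nhds_unique h1 ?_
      simp only [hdiv _ ψ hψ hs]
      exact tendsto_const_nhds
    -- The difference is divergence free and orthogonal to all solenoidal test fields, so it
    -- vanishes. Solenoidal fields are the only ones on which the equation identifies the initial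
    -- value.
    have h0 : (fun x => v 0 x - u₀ x) =ᵐ[volume] 0 := by
      refine ae_eq_zero_of_orthogonal_solenoidal ((hvm 0 le_rfl).sub hu₀) ?_ fun ζ hζ => ?_
      · intro ψ hψ hs
        have i1 := integrable_inner_of_memLp_two (hvm 0 le_rfl) (memLp_scalarGrad hψ hs)
        have i2 := integrable_inner_of_memLp_two hu₀ (memLp_scalarGrad hψ hs)
        simp only [inner_scalarGrad] at i1 i2
        simp only [map_sub]
        rw [integral_sub i1 i2, hvd 0 le_rfl ψ hψ hs, hu₀d ψ hψ hs, sub_zero]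
      · have hζm := memLp_of_contDiff hζ.contDiff.continuous hζ.hasCompactSupport 2
        have i1 := integrable_inner_of_memLp_two (hvm 0 le_rfl) hζm
        have i2 := integrable_inner_of_memLp_two hu₀ hζm
        simp only [inner_sub_left]
        rw [integral_sub i1 i2]
        obtain ⟨δ, hδ, h⟩ := H
        obtain ⟨C, hC0, hC⟩ := exists_equicontinuity_bound hν hζ one_pos
        have hb : ∀ k, |(∫ x, inner ℝ (us (σ k) 0 x) (ζ x)) - ∫ x, inner ℝ (u₀s (σ k) x) (ζ x)| ≤
            C * (δ (σ k) * (1 + E)) := by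
          intro k
          obtain ⟨ρ, e, m, S₀, h', om, R, hf, hem⟩ := h (σ k)
          have h1 : C * ((√e + m) * (1 + E)) ≤ C * (δ (σ k) * (1 + E)) := by gcongr
          refine le_trans ?_ h1
          -- At time zero no interval is left, so the parameter `l` can be sent to infinity and the
          -- dissipation term disappears.
          have h2 : Tendsto (fun l : ℝ => C * ((√e + m) * (1 + E) + l⁻¹ * E)) atTop
              (𝓝 (C * ((√e + m) * (1 + E) + 0 * E))) :=
            ((tendsto_inv_atTop_zero.mul_const E).const_add _).const_mul C
          rw [zero_mul, add_zero] at h2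
          refine ge_of_tendsto h2 ?_
          filter_upwards [eventually_gt_atTop 0] with l hl
          exact (hC hf l hl).2
        have hz : Tendsto (fun k => C * (δ (σ k) * (1 + E))) atTop (𝓝 0) := by
          simpa using ((hδ.comp hσ.tendsto_atTop).mul_const (1 + E)).const_mul C
        have h3 : Tendsto (fun k => (∫ x, inner ℝ (us (σ k) 0 x) (ζ x)) -
            ∫ x, inner ℝ (u₀s (σ k) x) (ζ x)) atTop (𝓝 0) := squeeze_zero_norm hb hz
        exact tendsto_nhds_unique ((hlim 0 le_rfl ζ hζm).sub
          ((hweak ζ hζm).comp hσ.tendsto_atTop)) h3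
    filter_upwards [h0] with x hx
    exact sub_eq_zero.1 hx

end Compactness

/-! ### From weak convergence at all times to weak convergence in time and space -/

section SliceConvergence

variable {F : Type*} [NormedAddCommGroup F]

lemma aemeasurable_eLpNorm_slice {I : Set ℝ} {Φ : ℝ → R3 → F}
    (hΦ : AEStronglyMeasurable (Function.uncurry Φ) (spaceTime I)) :
    AEMeasurable (fun t => eLpNorm (Φ t) 2 volume) (volume.restrict I) := by
  have h1 : AEMeasurable (fun t => ∫⁻ x, ‖Φ t x‖ₑ ^ 2) (volume.restrict I) :=
    (hΦ.enorm.pow_const 2).lintegral_prod_right'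
  refine (h1.pow_const (1 / 2 : ℝ)).congr (Eventually.of_forall fun t => ?_)
  dsimp only
  rw [← eLpNorm_two_sq, ← ENNReal.rpow_natCast, ← ENNReal.rpow_mul]
  norm_num

/-- On a bounded interval `L²` in time embeds in `L¹`, here through `x ≤ 1 + x²`. Thus weak-*
convergence covers the test fields of local weak convergence. -/
lemma lintegral_eLpNorm_slice_lt_top {T : ℝ} {Φ : ℝ → R3 → F}
    (hΦ : MemLp (Function.uncurry Φ) 2 (spaceTime (Ioc 0 T))) :
    ∫⁻ t in Ioc 0 T, eLpNorm (Φ t) 2 volume < ∞ := by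
  have h1 := (memLp_two_iff_lintegral.1 hΦ).2
  rw [lintegral_spaceTime hΦ.1] at h1
  calc ∫⁻ t in Ioc 0 T, eLpNorm (Φ t) 2 volume
      ≤ ∫⁻ t in Ioc 0 T, (1 + ∫⁻ x, ‖Φ t x‖ₑ ^ 2) := by
        refine lintegral_mono fun t => ?_
        dsimp only
        rw [← eLpNorm_two_sq]
        rcases le_total (eLpNorm (Φ t) 2 volume) 1 with h | h
        · exact h.trans le_self_add
        · refine le_trans ?_ le_add_self
          rw [sq]
          exact le_mul_of_one_le_left' h
    _ = (∫⁻ _ in Ioc 0 T, (1 : ℝ≥0∞)) + ∫⁻ t in Ioc 0 T, ∫⁻ x, ‖Φ t x‖ₑ ^ 2 :=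
        lintegral_add_left measurable_const _
    _ < ∞ := by
        refine ENNReal.add_lt_top.2 ⟨?_, h1⟩
        simp

lemma norm_integral_inner_le {α : Type*} [MeasurableSpace α] {μ : Measure α}
    [InnerProductSpace ℝ F] {f g : α → F} (hf : MemLp f 2 μ) (hg : MemLp g 2 μ) :
    ‖∫ x, inner ℝ (f x) (g x) ∂μ‖ ≤ (eLpNorm f 2 μ).toReal * (eLpNorm g 2 μ).toReal := by
  rw [← inner_toLp hf hg, ← Lp.norm_toLp f hf, ← Lp.norm_toLp g hg]
  exact norm_inner_le_norm _ _

lemma eLpNorm_le_of_integral_sq_le {f : R3 → F} {E : ℝ} (hf : MemLp f 2 volume)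
    (h : ∫ x, ‖f x‖ ^ 2 ≤ E) : eLpNorm f 2 volume ≤ (√E).toNNReal := by
  have h1 : eLpNorm f 2 volume ^ 2 ≤ ((√E).toNNReal : ℝ≥0∞) ^ 2 := by
    rw [eLpNorm_two_sq, ← ofReal_integral_norm_sq hf]
    change _ ≤ ENNReal.ofReal √E ^ 2
    rw [← ENNReal.ofReal_pow (Real.sqrt_nonneg _),
      Real.sq_sqrt ((integral_nonneg fun _ => sq_nonneg _).trans h)]
    exact ENNReal.ofReal_le_ofReal h
  exact (ENNReal.pow_le_pow_left_iff two_ne_zero).1 h1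

/-- Weak convergence at all times, with a uniform bound, implies weak convergence in time and
space. -/
lemma tendsto_integral_inner_of_slices {I : Set ℝ} (hI : MeasurableSet I) (hI0 : I ⊆ Ioi 0)
    {us : ℕ → ℝ → R3 → R3} {v : ℝ → R3 → R3} {C : ℝ≥0}
    (hm : ∀ k, AEStronglyMeasurable (Function.uncurry (us k)) (spaceTime I))
    (hC : ∀ k t, 0 ≤ t → MemLp (us k t) 2 volume ∧ eLpNorm (us k t) 2 volume ≤ C)
    (hlim : ∀ t, 0 ≤ t → ∀ g : R3 → R3, MemLp g 2 volume →
      Tendsto (fun k => ∫ x, inner ℝ (us k t x) (g x)) atTop (𝓝 (∫ x, inner ℝ (v t x) (g x))))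
    {Φ : ℝ → R3 → R3} (hΦ : AEStronglyMeasurable (Function.uncurry Φ) (spaceTime I))
    (hΦ1 : ∫⁻ t in I, eLpNorm (Φ t) 2 volume < ∞) :
    Tendsto (fun k => ∫ t in I, ∫ x, inner ℝ (us k t x) (Φ t x)) atTop
      (𝓝 (∫ t in I, ∫ x, inner ℝ (v t x) (Φ t x))) := by
  have hΦm := aemeasurable_eLpNorm_slice hΦ
  have hmem : ∀ᵐ t ∂volume.restrict I, MemLp (Φ t) 2 volume := by
    have h1 : ∀ᵐ t ∂volume.restrict I, AEStronglyMeasurable (Φ t) volume :=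
      AEStronglyMeasurable.prodMk_left (f := Function.uncurry Φ) hΦ
    filter_upwards [h1, ae_lt_top' hΦm hΦ1.ne] with t h2 h3 using ⟨h2, h3⟩
  refine tendsto_integral_of_dominated_convergence
    (fun t => C * (eLpNorm (Φ t) 2 volume).toReal) (fun k => ?_) ?_ (fun k => ?_) ?_
  · have h1 : AEStronglyMeasurable (fun z : ℝ × R3 => inner ℝ (Function.uncurry (us k) z)
        (Function.uncurry Φ z)) (spaceTime I) := (hm k).inner hΦ
    exact h1.integral_prod_right'
  · exact (integrable_toReal_of_lintegral_ne_top hΦm hΦ1.ne).const_mul _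
  · filter_upwards [hmem, ae_restrict_mem hI] with t ht htI
    obtain ⟨h1, h2⟩ := hC k t (le_of_lt (hI0 htI))
    refine (norm_integral_inner_le h1 ht).trans ?_
    gcongr
    exact ENNReal.toReal_le_coe_of_le_coe h2
  · filter_upwards [hmem, ae_restrict_mem hI] with t ht htI
    exact hlim t (le_of_lt (hI0 htI)) _ ht

end SliceConvergence

/-! ### Weak limits of the gradients -/

section GradientLimit

/-- The pairs of fields that detect weak gradients by their inner products. -/
def gradientTestSet : Set (Lp R3 2 (volume : Measure R3) × Lp Grad3 2 (volume : Measure R3)) :=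
  {p | ∃ (ψ : R3 → ℝ) (i j : Fin 3), ContDiff ℝ (⊤ : ℕ∞) ψ ∧ HasCompactSupport ψ ∧
    p.1 =ᵐ[volume] (fun x => fderiv ℝ ψ x (basisVec i) • basisVec j) ∧
    p.2 =ᵐ[volume] fun x => ψ x • (WithLp.toLp 2 (Pi.single i (basisVec j)) : Grad3)}

lemma inner_gradUnit (A : Grad3) (i j : Fin 3) :
    inner ℝ A (WithLp.toLp 2 (Pi.single i (basisVec j)) : Grad3) = A i j := by
  rw [PiLp.inner_apply, Finset.sum_eq_single i]
  · simp [basisVec, EuclideanSpace.inner_single_right]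
  · intro b _ hb
    simp [hb]
  · simp

lemma hasWeakGradient_of_forall_test {w : R3 → R3} {A : R3 → Grad3} (hw : MemLp w 2 volume)
    (hA : MemLp A 2 volume) (h : ∀ p ∈ gradientTestSet,
      inner ℝ (hw.toLp w) p.1 + inner ℝ (hA.toLp A) p.2 = 0) : HasWeakGradient w A := by
  refine ⟨memLp_two_locallyIntegrable hw, memLp_two_locallyIntegrable hA, fun ψ hψ hs i => ?_⟩
  have hd : Continuous fun x => fderiv ℝ ψ x (basisVec i) :=
    (contDiff_fderiv_apply_const hψ _).continuous
  have hds : HasCompactSupport fun x => fderiv ℝ ψ x (basisVec i) := hs.fderiv_apply (𝕜 := ℝ) _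
  have hi1 : Integrable fun x => fderiv ℝ ψ x (basisVec i) • w x :=
    (memLp_two_locallyIntegrable hw).integrable_smul_left_of_hasCompactSupport hd hds
  have hAi : LocallyIntegrable fun x => A x i := memLp_two_locallyIntegrable
    ((PiLp.proj 2 (fun _ : Fin 3 => R3) i (𝕜 := ℝ)).comp_memLp' hA)
  have hi2 : Integrable fun x => ψ x • A x i :=
    hAi.integrable_smul_left_of_hasCompactSupport hψ.continuous hs
  rw [← integral_neg]
  refine ext_inner_right ℝ fun c => ?_
  have key : ∀ j, inner ℝ (∫ x, fderiv ℝ ψ x (basisVec i) • w x) (basisVec j) =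
      inner ℝ (∫ x, -(ψ x • A x i)) (basisVec j) := by
    intro j
    have m1 := memLp_of_contDiff (hd.smul (continuous_const (y := basisVec j))) hds.smul_right 2
    have m2 := memLp_of_contDiff (hψ.continuous.smul (continuous_const
      (y := (WithLp.toLp 2 (Pi.single i (basisVec j)) : Grad3)))) hs.smul_right 2
    have h1 := h (m1.toLp _, m2.toLp _) ⟨ψ, i, j, hψ, hs, m1.coeFn_toLp, m2.coeFn_toLp⟩
    rw [inner_toLp, inner_toLp] at h1
    have hi2n : Integrable fun x => -(ψ x • A x i) := hi2.neg
    rw [real_inner_comm, ← integral_inner hi1, real_inner_comm (basisVec j),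
      ← integral_inner hi2n]
    have e1 : ∀ x, inner ℝ (basisVec j) (fderiv ℝ ψ x (basisVec i) • w x) =
        inner ℝ (w x) (fderiv ℝ ψ x (basisVec i) • basisVec j) := fun x => by
      rw [inner_smul_right, inner_smul_right, real_inner_comm]
    have e2 : ∀ x, inner ℝ (basisVec j) (-(ψ x • A x i)) =
        -inner ℝ (A x) (ψ x • (WithLp.toLp 2 (Pi.single i (basisVec j)) : Grad3)) := fun x => by
      rw [inner_neg_right, inner_smul_right, inner_smul_right, inner_gradUnit, basisVec,
        EuclideanSpace.inner_single_left]
      simp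
    simp only [e1, e2]
    rw [integral_neg]
    exact eq_neg_of_add_eq_zero_left h1
  rw [r3_eq_sum c]
  simp only [inner_sum, inner_smul_right, key]

lemma IsSobolevField.pairing_eq_zero {w : R3 → R3} {A : R3 → Grad3} (h : IsSobolevField w A)
    {p : Lp R3 2 (volume : Measure R3) × Lp Grad3 2 (volume : Measure R3)}
    (hp : p ∈ gradientTestSet) :
    (∫ x, inner ℝ (w x) (p.1 x)) + ∫ x, inner ℝ (A x) (p.2 x) = 0 := by
  obtain ⟨ψ, i, j, hψ, hs, h1, h2⟩ := hp
  have hd : Continuous fun x => fderiv ℝ ψ x (basisVec i) :=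
    (contDiff_fderiv_apply_const hψ _).continuous
  have hds : HasCompactSupport fun x => fderiv ℝ ψ x (basisVec i) := hs.fderiv_apply (𝕜 := ℝ) _
  have hi1 : Integrable fun x => fderiv ℝ ψ x (basisVec i) • w x :=
    (memLp_two_locallyIntegrable h.memLp).integrable_smul_left_of_hasCompactSupport hd hds
  have hAi : LocallyIntegrable fun x => A x i := memLp_two_locallyIntegrable
    ((PiLp.proj 2 (fun _ : Fin 3 => R3) i (𝕜 := ℝ)).comp_memLp' h.grad_memLp)
  have hi2 : Integrable fun x => ψ x • A x i :=
    hAi.integrable_smul_left_of_hasCompactSupport hψ.continuous hs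
  have e1 : ∫ x, inner ℝ (w x) (p.1 x) =
      inner ℝ (basisVec j) (∫ x, fderiv ℝ ψ x (basisVec i) • w x) := by
    rw [← integral_inner hi1]
    refine integral_congr_ae ?_
    filter_upwards [h1] with x hx
    rw [hx, inner_smul_right, inner_smul_right, real_inner_comm]
  have e2 : ∫ x, inner ℝ (A x) (p.2 x) = inner ℝ (basisVec j) (∫ x, ψ x • A x i) := by
    rw [← integral_inner hi2]
    refine integral_congr_ae ?_
    filter_upwards [h2] with x hx
    rw [hx, inner_smul_right, inner_smul_right, inner_gradUnit, basisVec,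
      EuclideanSpace.inner_single_left]
    simp
  rw [e1, e2, h.grad.2.2 ψ hψ hs i, inner_neg_right, neg_add_cancel]

/-- Almost all time slices are weak gradients if almost all pairings with each single test pair
vanish. -/
lemma ae_hasWeakGradient {w : ℝ → R3 → R3} {A : ℝ → R3 → Grad3} {μ : Measure ℝ}
    (hw : ∀ᵐ t ∂μ, MemLp (w t) 2 volume) (hA : ∀ᵐ t ∂μ, MemLp (A t) 2 volume)
    (h : ∀ p ∈ gradientTestSet, ∀ᵐ t ∂μ,
      (∫ x, inner ℝ (w t x) (p.1 x)) + ∫ x, inner ℝ (A t x) (p.2 x) = 0) :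
    ∀ᵐ t ∂μ, HasWeakGradient (w t) (A t) := by
  have : Fact ((2 : ℝ≥0∞) ≠ ∞) := ⟨by norm_num⟩
  have hs1 : TopologicalSpace.SeparableSpace (Lp R3 2 (volume : Measure R3)) := inferInstance
  have hs2 : TopologicalSpace.SeparableSpace (Lp Grad3 2 (volume : Measure R3)) := inferInstance
  -- Each test pair has its own exceptional null set of times. By separability countably many pairs
  -- suffice, and continuity of the pairings recovers the others.
  obtain ⟨D, hDs, hDc, hD⟩ := (TopologicalSpace.IsSeparable.of_separableSpace
    gradientTestSet).exists_countable_dense_subset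
  have h1 : ∀ᵐ t ∂μ, ∀ p ∈ D,
      (∫ x, inner ℝ (w t x) (p.1 x)) + ∫ x, inner ℝ (A t x) (p.2 x) = 0 :=
    (ae_ball_iff hDc).2 fun p hp => h p (hDs hp)
  filter_upwards [hw, hA, h1] with t hwt hAt ht
  refine hasWeakGradient_of_forall_test hwt hAt fun p hp => ?_
  have hcl : IsClosed {p : Lp R3 2 (volume : Measure R3) × Lp Grad3 2 (volume : Measure R3) |
      inner ℝ (hwt.toLp (w t)) p.1 + inner ℝ (hAt.toLp (A t)) p.2 = 0} :=
    isClosed_eq (by fun_prop) continuous_const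
  refine closure_minimal (fun q hq => ?_) hcl (hD hp)
  have h2 := ht q hq
  have e1 : ∫ x, inner ℝ (w t x) (q.1 x) = inner ℝ (hwt.toLp (w t)) q.1 := by
    rw [real_inner_comm, inner_Lp_toLp]
    simp only [real_inner_comm]
  have e2 : ∫ x, inner ℝ (A t x) (q.2 x) = inner ℝ (hAt.toLp (A t)) q.2 := by
    rw [real_inner_comm, inner_Lp_toLp]
    simp only [real_inner_comm]
  rwa [e1, e2] at h2

variable {F : Type*} [NormedAddCommGroup F]

lemma spaceTime_restrict {I J : Set ℝ} (hI : MeasurableSet I) (hIJ : I ⊆ J) :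
    (spaceTime J).restrict (I ×ˢ univ) = spaceTime I := by
  rw [spaceTime_eq_restrict, spaceTime_eq_restrict,
    Measure.restrict_restrict (hI.prod MeasurableSet.univ), prod_inter_prod, inter_univ,
    inter_eq_left.2 hIJ]

/-- Weak convergence in `L²` of time and space passes to subsets of times. -/
lemma tendsto_integral_inner_of_subset [InnerProductSpace ℝ F] {I J : Set ℝ}
    (hI : MeasurableSet I) (hIJ : I ⊆ J) {fs : ℕ → ℝ × R3 → F} {f : ℝ × R3 → F}
    (h : ∀ Ψ : ℝ × R3 → F, MemLp Ψ 2 (spaceTime J) →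
      Tendsto (fun k => ∫ z, inner ℝ (fs k z) (Ψ z) ∂spaceTime J) atTop
        (𝓝 (∫ z, inner ℝ (f z) (Ψ z) ∂spaceTime J)))
    {Ψ : ℝ × R3 → F} (hΨ : MemLp Ψ 2 (spaceTime I)) :
    Tendsto (fun k => ∫ z, inner ℝ (fs k z) (Ψ z) ∂spaceTime I) atTop
        (𝓝 (∫ z, inner ℝ (f z) (Ψ z) ∂spaceTime I)) := by
  have hm : MeasurableSet (I ×ˢ (univ : Set R3)) := hI.prod MeasurableSet.univ
  have e : ∀ g : ℝ × R3 → F, ∫ z, inner ℝ (g z) ((I ×ˢ univ).indicator Ψ z) ∂spaceTime J =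
      ∫ z, inner ℝ (g z) (Ψ z) ∂spaceTime I := fun g => by
    rw [← spaceTime_restrict hI hIJ, ← integral_indicator hm]
    refine integral_congr_ae (Eventually.of_forall fun z => ?_)
    by_cases hz : z ∈ I ×ˢ (univ : Set R3) <;> simp only [hz, indicator_of_mem,
      indicator_of_notMem, not_false_eq_true, inner_zero_right]
  have h1 := h ((I ×ˢ univ).indicator Ψ) (by
    rw [memLp_indicator_iff_restrict hm, spaceTime_restrict hI hIJ]
    exact hΨ)
  simpa only [e] using h1

lemma memLp_spaceTime_const {I : Set ℝ} (hI : volume I < ∞) {g : R3 → F}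
    (hg : MemLp g 2 volume) : MemLp (Function.uncurry fun _ : ℝ => g) 2 (spaceTime I) := by
  have hm : AEStronglyMeasurable (Function.uncurry fun _ : ℝ => g) (spaceTime I) := hg.1.comp_snd
  refine memLp_two_iff_lintegral.2 ⟨hm, ?_⟩
  rw [lintegral_spaceTime hm, lintegral_const, Measure.restrict_apply_univ]
  exact ENNReal.mul_lt_top (memLp_two_iff_lintegral.1 hg).2 hI

variable {ν E : ℝ} {u₀s : ℕ → R3 → R3} {us : ℕ → ℝ → R3 → R3} {Gs : ℕ → ℝ → R3 → Grad3}

lemma IsVanishingBodySequence.velocity_bounds (H : IsVanishingBodySequence ν E u₀s us Gs) (k : ℕ)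
    {t : ℝ} (ht : 0 ≤ t) :
    MemLp (us k t) 2 volume ∧ eLpNorm (us k t) 2 volume ≤ (√E).toNNReal := by
  obtain ⟨δ, -, h⟩ := H
  obtain ⟨ρ, e, m, S₀, h', om, R, hf, -⟩ := h k
  exact ⟨hf.solution.weaklyContinuous.1 t ht, hf.eLpNorm_velocity_le ht⟩

lemma IsVanishingBodySequence.measurable (H : IsVanishingBodySequence ν E u₀s us Gs) (k : ℕ)
    {I : Set ℝ} (hI : I ⊆ Ioi 0) : AEStronglyMeasurable (Function.uncurry (us k)) (spaceTime I) := by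
  obtain ⟨δ, -, h⟩ := H
  obtain ⟨ρ, e, m, S₀, h', om, R, hf, -⟩ := h k
  exact hf.solution.energyClass.measurable.mono_measure (spaceTime_mono hI)

lemma IsVanishingBodySequence.grad_bounds (H : IsVanishingBodySequence ν E u₀s us Gs) (k : ℕ) :
    MemLp (Function.uncurry (Gs k)) 2 (spaceTime (Ioi 0)) ∧
      ∫⁻ z, ‖Function.uncurry (Gs k) z‖ₑ ^ 2 ∂spaceTime (Ioi 0) ≤ ENNReal.ofReal E := by
  obtain ⟨δ, -, h⟩ := H
  obtain ⟨ρ, e, m, S₀, h', om, R, hf, -⟩ := h k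
  exact ⟨hf.grad_memLp, hf.grad_le⟩

lemma IsVanishingBodySequence.ae_isSobolevField (H : IsVanishingBodySequence ν E u₀s us Gs)
    (k : ℕ) : ∀ᵐ t ∂volume.restrict (Ioi (0 : ℝ)), IsSobolevField (us k t) (Gs k t) := by
  obtain ⟨δ, -, h⟩ := H
  obtain ⟨ρ, e, m, S₀, h', om, R, hf, -⟩ := h k
  exact hf.solution.ae_isSobolevField

lemma IsVanishingBodySequence.bound_nonneg (H : IsVanishingBodySequence ν E u₀s us Gs) :
    0 ≤ E := by
  obtain ⟨δ, -, h⟩ := H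
  obtain ⟨ρ, e, m, S₀, h', om, R, hf, -⟩ := h 0
  exact hf.bound_nonneg

/-- A subsequence of the gradients converges weakly to a weak gradient of the limit. -/
theorem exists_weak_limit_gradient (H : IsVanishingBodySequence ν E u₀s us Gs)
    {v : ℝ → R3 → R3} (hv : StronglyMeasurable (Function.uncurry v))
    (hvc : IsWeaklyContinuousL2 v) (hvE : ∀ t, 0 ≤ t → ∫ x, ‖v t x‖ ^ 2 ≤ E)
    (hlim : ∀ t, 0 ≤ t → ∀ g : R3 → R3, MemLp g 2 volume →
      Tendsto (fun k => ∫ x, inner ℝ (us k t x) (g x)) atTop (𝓝 (∫ x, inner ℝ (v t x) (g x)))) :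
    ∃ σ : ℕ → ℕ, StrictMono σ ∧ ∃ Gv : ℝ → R3 → Grad3,
      MemLp (Function.uncurry Gv) 2 (spaceTime (Ioi 0)) ∧
      (∀ Ψ : ℝ × R3 → Grad3, MemLp Ψ 2 (spaceTime (Ioi 0)) →
        Tendsto (fun k => ∫ z, inner ℝ (Function.uncurry (Gs (σ k)) z) (Ψ z) ∂spaceTime (Ioi 0))
          atTop (𝓝 (∫ z, inner ℝ (Function.uncurry Gv z) (Ψ z) ∂spaceTime (Ioi 0)))) ∧
      ∀ᵐ t ∂volume.restrict (Ioi (0 : ℝ)), IsSobolevField (v t) (Gv t) := by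
  have : Fact ((2 : ℝ≥0∞) ≠ ∞) := ⟨by norm_num⟩
  obtain ⟨σ, hσ, y, -, hy⟩ := exists_weakly_convergent_subseq
    (fun k => (H.grad_bounds k).1.toLp _) (√E) fun k => by
      refine Real.le_sqrt_of_sq_le ?_
      rw [norm_toLp_sq, ← ENNReal.ofReal_le_ofReal_iff H.bound_nonneg,
        ofReal_integral_norm_sq (H.grad_bounds k).1]
      exact (H.grad_bounds k).2
  let Gv : ℝ → R3 → Grad3 := fun t x => y (t, x)
  have hGv : MemLp (Function.uncurry Gv) 2 (spaceTime (Ioi 0)) := Lp.memLp y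
  have hW : ∀ Ψ : ℝ × R3 → Grad3, MemLp Ψ 2 (spaceTime (Ioi 0)) →
        Tendsto (fun k => ∫ z, inner ℝ (Function.uncurry (Gs (σ k)) z) (Ψ z) ∂spaceTime (Ioi 0))
          atTop (𝓝 (∫ z, inner ℝ (Function.uncurry Gv z) (Ψ z) ∂spaceTime (Ioi 0))) := by
    intro Ψ hΨ
    have h1 := hy (hΨ.toLp Ψ)
    rw [inner_Lp_toLp] at h1
    refine h1.congr fun k => ?_
    rw [inner_toLp]
  refine ⟨σ, hσ, Gv, hGv, hW, ?_⟩
  have hGm := ae_memLp_of_memLp_spaceTime hGv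
  have hvm : ∀ᵐ t ∂volume.restrict (Ioi (0 : ℝ)), MemLp (v t) 2 volume :=
    (ae_restrict_mem measurableSet_Ioi).mono fun t ht => hvc.1 t (le_of_lt ht)
  have Hσ := H.subseq hσ
  suffices hg : ∀ᵐ t ∂volume.restrict (Ioi (0 : ℝ)), HasWeakGradient (v t) (Gv t) by
    filter_upwards [hGm, hvm, hg] with t h1 h2 h3 using ⟨h2, h1, h3⟩
  refine ae_hasWeakGradient hvm hGm fun p hp => ?_
  have hn : ∀ n : ℕ, ∀ᵐ t ∂volume.restrict (Ioc (0 : ℝ) n),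
      (∫ x, inner ℝ (v t x) (p.1 x)) + ∫ x, inner ℝ (Gv t x) (p.2 x) = 0 := by
    intro n
    have hp1 := Lp.memLp p.1
    have hp2 := Lp.memLp p.2
    have hIn : Ioc (0 : ℝ) n ⊆ Ioi 0 := Ioc_subset_Ioi_self
    have hi2 : ∀ {A : ℝ → R3 → Grad3}, MemLp (Function.uncurry A) 2 (spaceTime (Ioi 0)) →
        Integrable (fun z : ℝ × R3 => inner ℝ (Function.uncurry A z) (p.2 z.2))
          (spaceTime (Ioc 0 n)) := fun hA =>
      integrable_inner_of_memLp_two (hA.mono_measure (spaceTime_mono hIn))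
        (memLp_spaceTime_const (by simp) hp2)
    have hi1 : ∀ {w : ℝ → R3 → R3}, MemLp (Function.uncurry w) 2 (spaceTime (Ioc 0 n)) →
        Integrable (fun z : ℝ × R3 => inner ℝ (Function.uncurry w z) (p.1 z.2))
          (spaceTime (Ioc 0 n)) := fun hw =>
      integrable_inner_of_memLp_two hw (memLp_spaceTime_const (by simp) hp1)
    have hvL : MemLp (Function.uncurry v) 2 (spaceTime (Ioc 0 n)) := by
      refine memLp_spaceTime_of_eLpNorm_le hv.aestronglyMeasurable (C := (√E).toNNReal) ?_
      filter_upwards [ae_restrict_mem measurableSet_Ioc] with t ht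
      exact eLpNorm_le_of_integral_sq_le (hvc.1 t ht.1.le) (hvE t ht.1.le)
    -- The defining relation of the weak gradient is linear in both fields, so its integral over any
    -- bounded measurable set of times survives the weak limits. Vanishing on all such sets gives it
    -- for almost every time.
    refine Integrable.ae_eq_zero_of_forall_setIntegral_eq_zero
      ((integrable_spaceTime_left (hi1 hvL)).add (integrable_spaceTime_left (hi2 hGv))) ?_
    intro s hs _
    rw [Measure.restrict_restrict hs]
    have hI : MeasurableSet (s ∩ Ioc (0 : ℝ) n) := hs.inter measurableSet_Ioc
    have hI0 : s ∩ Ioc (0 : ℝ) n ⊆ Ioi 0 := inter_subset_right.trans hIn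
    have hIfin : volume (s ∩ Ioc (0 : ℝ) n) < ∞ :=
      (measure_mono inter_subset_right).trans_lt (by simp)
    have hle := spaceTime_mono (inter_subset_right (s := s) (t := Ioc (0 : ℝ) n))
    have t1 := tendsto_integral_inner_of_slices (I := s ∩ Ioc (0 : ℝ) n) hI hI0
      (fun k => Hσ.measurable k hI0) (fun k t ht => Hσ.velocity_bounds k ht)
      (fun t ht g hg => (hlim t ht g hg).comp hσ.tendsto_atTop) (Φ := fun _ => p.1)
      hp1.1.comp_snd (by
        rw [lintegral_const, Measure.restrict_apply_univ]
        exact ENNReal.mul_lt_top hp1.2 hIfin)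
    have t2 := tendsto_integral_inner_of_subset hI hI0 hW
      (memLp_spaceTime_const hIfin hp2)
    have e2 : ∀ {A : ℝ → R3 → Grad3}, MemLp (Function.uncurry A) 2 (spaceTime (Ioi 0)) →
        ∫ z, inner ℝ (Function.uncurry A z) (Function.uncurry (fun _ : ℝ => ⇑p.2) z)
          ∂spaceTime (s ∩ Ioc (0 : ℝ) n) =
        ∫ t in s ∩ Ioc (0 : ℝ) n, ∫ x, inner ℝ (A t x) (p.2 x) := fun hA =>
      integral_spaceTime ((hi2 hA).mono_measure hle)
    simp only [e2 hGv, e2 (Hσ.grad_bounds _).1] at t2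
    have t3 := t1.add t2
    have hz : ∀ k, (∫ t in s ∩ Ioc (0 : ℝ) n, ∫ x, inner ℝ (us (σ k) t x) (p.1 x)) +
        ∫ t in s ∩ Ioc (0 : ℝ) n, ∫ x, inner ℝ (Gs (σ k) t x) (p.2 x) = 0 := by
      intro k
      have j1 : Integrable (fun t => ∫ x, inner ℝ (us (σ k) t x) (p.1 x))
          (volume.restrict (s ∩ Ioc (0 : ℝ) n)) :=
        integrable_spaceTime_left ((hi1 (memLp_spaceTime_of_eLpNorm_le (Hσ.measurable k hIn)
          ((ae_restrict_mem measurableSet_Ioc).mono fun t ht =>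
            (Hσ.velocity_bounds k ht.1.le).2))).mono_measure hle)
      have j2 : Integrable (fun t => ∫ x, inner ℝ (Gs (σ k) t x) (p.2 x))
          (volume.restrict (s ∩ Ioc (0 : ℝ) n)) :=
        integrable_spaceTime_left ((hi2 (Hσ.grad_bounds k).1).mono_measure hle)
      rw [← integral_add j1 j2]
      refine integral_eq_zero_of_ae ?_
      filter_upwards [ae_restrict_of_ae_restrict_of_subset hI0 (Hσ.ae_isSobolevField k)] with t ht
      exact ht.pairing_eq_zero hp
    simp only [hz] at t3
    have j1 : Integrable (fun t => ∫ x, inner ℝ (v t x) (p.1 x))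
        (volume.restrict (s ∩ Ioc (0 : ℝ) n)) :=
      integrable_spaceTime_left ((hi1 hvL).mono_measure hle)
    have j2 : Integrable (fun t => ∫ x, inner ℝ (Gv t x) (p.2 x))
        (volume.restrict (s ∩ Ioc (0 : ℝ) n)) :=
      integrable_spaceTime_left ((hi2 hGv).mono_measure hle)
    exact (integral_add j1 j2).trans (tendsto_nhds_unique tendsto_const_nhds t3).symm
  have hU : Ioi (0 : ℝ) = ⋃ n : ℕ, Ioc (0 : ℝ) n := by
    ext t
    simp only [mem_Ioi, mem_iUnion, mem_Ioc]
    exact ⟨fun h => (exists_nat_ge t).imp fun n hn => ⟨h, hn⟩, fun ⟨n, h, _⟩ => h⟩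
  rw [hU, ae_restrict_iUnion_iff]
  exact hn

end GradientLimit

/-! ### Strong convergence on bounded sets of times and positions -/

section StrongConvergence

/-- Lebesgue measure on `(0, T) × B(0, K)`. -/
def localSpaceTime (T K : ℝ) : Measure (ℝ × R3) :=
  (spaceTime (Ioc 0 T)).restrict (univ ×ˢ Metric.closedBall 0 K)

instance (T K : ℝ) : IsFiniteMeasure (localSpaceTime T K) := by
  refine ⟨?_⟩
  rw [localSpaceTime, Measure.restrict_apply_univ, spaceTime, Measure.prod_prod]
  exact ENNReal.mul_lt_top (by simp) measure_closedBall_lt_top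

lemma localSpaceTime_le (T K : ℝ) : localSpaceTime T K ≤ spaceTime (Ioc 0 T) :=
  Measure.restrict_le_self

/-- Cauchy–Schwarz. The bound does not depend on the point and provides the dominating constant for
mollified velocities. -/
lemma norm_conv_le {k : R3 → ℝ} (hk : Continuous k) (hs : HasCompactSupport k) {f : R3 → R3}
    (hf : MemLp f 2 volume) (x : R3) :
    ‖conv k f x‖ ≤ (eLpNorm f 2 volume).toReal * (eLpNorm k 2 volume).toReal := by
  have hkm : MemLp k 2 volume := hk.memLp_of_hasCompactSupport hs
  have hmp : MeasurePreserving (fun y : R3 => x - y) volume volume :=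
    Measure.measurePreserving_sub_left volume x
  have h1 := norm_integral_inner_le (F := ℝ) hf.norm (hkm.comp_measurePreserving hmp).norm
  have e1 : eLpNorm (fun y => ‖(k ∘ fun y => x - y) y‖) 2 volume = eLpNorm k 2 volume := by
    rw [eLpNorm_norm, eLpNorm_comp_measurePreserving hkm.1 hmp]
  rw [e1, eLpNorm_norm] at h1
  refine le_trans ?_ ((le_abs_self _).trans h1)
  refine (norm_integral_le_integral_norm _).trans_eq ?_
  refine integral_congr_ae (Eventually.of_forall fun y => ?_)
  simp [norm_smul]

lemma enorm_sub_sq_le (a b c d : R3) :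
    ‖a - d‖ₑ ^ 2 ≤ 3 * (‖b - a‖ₑ ^ 2 + ‖b - c‖ₑ ^ 2 + ‖c - d‖ₑ ^ 2) := by
  have h1 : ‖a - d‖ ≤ ‖b - a‖ + ‖b - c‖ + ‖c - d‖ := by
    have : a - d = -(b - a) + (b - c) + (c - d) := by abel
    rw [this, ← norm_neg (b - a)]
    exact norm_add₃_le
  have h2 : ‖a - d‖ ^ 2 ≤ 3 * (‖b - a‖ ^ 2 + ‖b - c‖ ^ 2 + ‖c - d‖ ^ 2) := by
    have h3 := pow_le_pow_left₀ (norm_nonneg _) h1 2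
    nlinarith [sq_nonneg (‖b - a‖ - ‖b - c‖), sq_nonneg (‖b - a‖ - ‖c - d‖),
      sq_nonneg (‖b - c‖ - ‖c - d‖)]
  have e : ∀ z : R3, ‖z‖ₑ ^ 2 = ENNReal.ofReal (‖z‖ ^ 2) := fun z => by
    rw [ENNReal.ofReal_pow (norm_nonneg _), ofReal_norm]
  have e3 : (3 : ℝ≥0∞) = ENNReal.ofReal 3 := by norm_num
  rw [e, e, e, e, e3, ← ENNReal.ofReal_add (by positivity) (by positivity),
    ← ENNReal.ofReal_add (by positivity) (by positivity), ← ENNReal.ofReal_mul (by norm_num)]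
  exact ENNReal.ofReal_le_ofReal h2

/-- Mollification in space, integrated over time. -/
lemma lintegral_spaceTime_mollify_sub {w : ℝ → R3 → R3} {A : ℝ → R3 → Grad3}
    (hwc : IsWeaklyContinuousL2 w)
    (hw : AEStronglyMeasurable (Function.uncurry w) (spaceTime (Ioi 0)))
    (hA : MemLp (Function.uncurry A) 2 (spaceTime (Ioi 0)))
    (hwA : ∀ᵐ t ∂volume.restrict (Ioi (0 : ℝ)), IsSobolevField (w t) (A t)) (n : ℕ) :
    ∫⁻ z, ‖conv (mollifier n) (w (max z.1 0)) z.2 - Function.uncurry w z‖ₑ ^ 2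
      ∂spaceTime (Ioi 0) ≤
    ENNReal.ofReal (1 / (n + 1)) ^ 2 *
      ∫⁻ z, ‖Function.uncurry A z‖ₑ ^ 2 ∂spaceTime (Ioi 0) := by
  have h1 : AEStronglyMeasurable (Function.uncurry fun t x =>
      conv (mollifier n) (w (max t 0)) x - w t x) (spaceTime (Ioi 0)) :=
    (stronglyMeasurable_mollify hwc n).aestronglyMeasurable.sub hw
  refine (lintegral_spaceTime h1).trans_le ?_
  rw [lintegral_spaceTime hA.1, ← lintegral_const_mul' _ _ (by finiteness)]
  refine lintegral_mono_ae ?_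
  filter_upwards [hwA, ae_restrict_mem measurableSet_Ioi] with t ht ht0
  rw [max_eq_left (le_of_lt ht0)]
  exact lintegral_mollify_sub ht n

variable {ν E : ℝ} {u₀s : ℕ → R3 → R3} {us : ℕ → ℝ → R3 → R3} {Gs : ℕ → ℝ → R3 → Grad3}

lemma IsVanishingBodySequence.weaklyContinuous (H : IsVanishingBodySequence ν E u₀s us Gs)
    (k : ℕ) : IsWeaklyContinuousL2 (us k) := by
  obtain ⟨δ, -, h⟩ := H
  obtain ⟨ρ, e, m, S₀, h', om, R, hf, -⟩ := h k
  exact hf.solution.weaklyContinuous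

/-- The velocities converge strongly on bounded sets of times and positions. -/
theorem tendsto_local_of_weak_limit (H : IsVanishingBodySequence ν E u₀s us Gs)
    {v : ℝ → R3 → R3} {Gv : ℝ → R3 → Grad3} (hv : StronglyMeasurable (Function.uncurry v))
    (hvc : IsWeaklyContinuousL2 v)
    (hlim : ∀ t, 0 ≤ t → ∀ g : R3 → R3, MemLp g 2 volume →
      Tendsto (fun k => ∫ x, inner ℝ (us k t x) (g x)) atTop (𝓝 (∫ x, inner ℝ (v t x) (g x))))
    (hGv : MemLp (Function.uncurry Gv) 2 (spaceTime (Ioi 0)))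
    (hvG : ∀ᵐ t ∂volume.restrict (Ioi (0 : ℝ)), IsSobolevField (v t) (Gv t)) (T K : ℝ) :
    Tendsto (fun k => ∫⁻ z, ‖Function.uncurry (us k) z - Function.uncurry v z‖ₑ ^ 2
      ∂localSpaceTime T K) atTop (𝓝 0) := by
  set μ := localSpaceTime T K
  have hμ : μ ≤ spaceTime (Ioi 0) :=
    (localSpaceTime_le T K).trans (spaceTime_mono Ioc_subset_Ioi_self)
  let M : (ℝ → R3 → R3) → ℕ → ℝ × R3 → R3 := fun w n z =>
    conv (mollifier n) (w (max z.1 0)) z.2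
  have hM : ∀ {w}, IsWeaklyContinuousL2 w → ∀ n, StronglyMeasurable (M w n) := fun hw n =>
    stronglyMeasurable_mollify hw n
  let B : ℝ≥0∞ := ∫⁻ z, ‖Function.uncurry Gv z‖ₑ ^ 2 ∂spaceTime (Ioi 0)
  have hB : B < ∞ := (memLp_two_iff_lintegral.1 hGv).2
  let a : ℕ → ℝ≥0∞ := fun n => ENNReal.ofReal (1 / (n + 1)) ^ 2 * (ENNReal.ofReal E + B)
  let b : ℕ → ℕ → ℝ≥0∞ := fun n k => ∫⁻ z, ‖M (us k) n z - M v n z‖ₑ ^ 2 ∂μ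
  have ha : Tendsto a atTop (𝓝 0) := by
    have h1 : Tendsto (fun n : ℕ => ENNReal.ofReal (1 / ((n : ℝ) + 1)) ^ 2) atTop (𝓝 0) := by
      have h2 := ENNReal.tendsto_ofReal tendsto_one_div_add_atTop_nhds_zero_nat
      simpa using ENNReal.Tendsto.pow (n := 2) h2
    have h3 := ENNReal.Tendsto.mul_const (b := ENNReal.ofReal E + B) h1 (Or.inr (by finiteness))
    rwa [zero_mul] at h3
  -- For a fixed mollifier the fields converge at every time and every point and are uniformly
  -- bounded; dominated convergence applies because the local measure is finite.
  have hb : ∀ n, Tendsto (b n) atTop (𝓝 0) := by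
    intro n
    have hk := (mollifier_contDiff n).continuous
    have hs := mollifier_hasCompactSupport n
    have hpt : ∀ z : ℝ × R3, Tendsto (fun k => M (us k) n z) atTop (𝓝 (M v n z)) := fun z =>
      tendsto_conv_of_weak hk hs (fun k => (H.weaklyContinuous k).1 _ (le_max_right _ _))
        (hvc.1 _ (le_max_right _ _)) (fun c hc => hlim _ (le_max_right _ _) c hc) z.2
    let c : ℝ := √E * (eLpNorm (mollifier n) 2 volume).toReal
    have hbd : ∀ k z, ‖M (us k) n z‖ ≤ c := fun k z => by
      have h1 := H.velocity_bounds k (le_max_right z.1 0)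
      refine (norm_conv_le hk hs h1.1 z.2).trans ?_
      refine mul_le_mul_of_nonneg_right ?_ ENNReal.toReal_nonneg
      exact (ENNReal.toReal_le_coe_of_le_coe h1.2).trans_eq
        (Real.coe_toNNReal _ (Real.sqrt_nonneg _))
    have hbv : ∀ z, ‖M v n z‖ ≤ c := fun z =>
      le_of_tendsto (hpt z).norm (Eventually.of_forall fun k => hbd k z)
    have h0 : ∫⁻ _, 0 ∂μ = 0 := lintegral_zero
    rw [← h0]
    refine tendsto_lintegral_of_dominated_convergence' (fun _ => ENNReal.ofReal (c + c) ^ 2)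
      (fun k => ?_) (fun k => Eventually.of_forall fun z => ?_) ?_
      (Eventually.of_forall fun z => ?_)
    · exact (((hM (H.weaklyContinuous k) n).sub (hM hvc n)).enorm.pow_const 2).aemeasurable
    · dsimp only
      gcongr
      rw [← ofReal_norm]
      exact ENNReal.ofReal_le_ofReal ((norm_sub_le _ _).trans (add_le_add (hbd k z) (hbv z)))
    · rw [lintegral_const]
      finiteness
    · have h2 : Tendsto (fun k => ‖M (us k) n z - M v n z‖ₑ ^ 2) atTop (𝓝 (‖(0 : R3)‖ₑ ^ 2)) :=
        ENNReal.Tendsto.pow (Tendsto.enorm (by simpa using (hpt z).sub_const (M v n z)))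
      simpa using h2
  -- The two outer terms of the triangle inequality are mollification errors, bounded by the
  -- gradients uniformly in `k`. No compactness in time is needed beyond weak convergence at each
  -- time.
  have hmain : ∀ n k, ∫⁻ z, ‖Function.uncurry (us k) z - Function.uncurry v z‖ₑ ^ 2 ∂μ ≤
      3 * (a n + b n k) := by
    intro n k
    have hum := H.measurable k (le_refl (Ioi (0 : ℝ)))
    have hu := lintegral_spaceTime_mollify_sub (H.weaklyContinuous k) hum (H.grad_bounds k).1
      (H.ae_isSobolevField k) n
    have hv' := lintegral_spaceTime_mollify_sub hvc hv.aestronglyMeasurable hGv hvG n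
    have m1 : AEMeasurable (fun z => ‖M (us k) n z - Function.uncurry (us k) z‖ₑ ^ 2) μ :=
      ((hM (H.weaklyContinuous k) n).aestronglyMeasurable.sub
        (hum.mono_measure hμ)).enorm.pow_const 2
    have m2 : AEMeasurable (fun z => ‖M (us k) n z - M v n z‖ₑ ^ 2) μ :=
      (((hM (H.weaklyContinuous k) n).sub (hM hvc n)).enorm.pow_const 2).aemeasurable
    calc ∫⁻ z, ‖Function.uncurry (us k) z - Function.uncurry v z‖ₑ ^ 2 ∂μ
        ≤ ∫⁻ z, 3 * (‖M (us k) n z - Function.uncurry (us k) z‖ₑ ^ 2 +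
            ‖M (us k) n z - M v n z‖ₑ ^ 2 + ‖M v n z - Function.uncurry v z‖ₑ ^ 2) ∂μ :=
          lintegral_mono fun z => enorm_sub_sq_le _ _ _ _
      _ = 3 * ((∫⁻ z, ‖M (us k) n z - Function.uncurry (us k) z‖ₑ ^ 2 ∂μ) + b n k +
            ∫⁻ z, ‖M v n z - Function.uncurry v z‖ₑ ^ 2 ∂μ) := by
          have m3 : AEMeasurable (fun z => ‖M (us k) n z - Function.uncurry (us k) z‖ₑ ^ 2 +
              ‖M (us k) n z - M v n z‖ₑ ^ 2) μ := m1.add m2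
          rw [lintegral_const_mul' _ _ (by simp), lintegral_add_left' m3,
            lintegral_add_left' m1]
      _ ≤ 3 * (ENNReal.ofReal (1 / (n + 1)) ^ 2 * ENNReal.ofReal E + b n k +
            ENNReal.ofReal (1 / (n + 1)) ^ 2 * B) := by
          gcongr
          · exact (lintegral_mono' hμ le_rfl).trans (hu.trans
              (mul_le_mul_right (H.grad_bounds k).2 _))
          · exact (lintegral_mono' hμ le_rfl).trans hv'
      _ = 3 * (a n + b n k) := by
          simp only [a]
          ring
  rw [ENNReal.tendsto_nhds_zero]
  intro η hη
  -- The mollifier is fixed first, independently of `k`; then `k` is large depending on it. The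
  -- final sum is `3 (η/6 + η/6) = η`.
  have hη6 : 0 < η / 6 := ENNReal.div_pos hη.ne' (by simp)
  obtain ⟨n, hn⟩ := ((ENNReal.tendsto_nhds_zero.1 ha) (η / 6) hη6).exists
  filter_upwards [(ENNReal.tendsto_nhds_zero.1 (hb n)) (η / 6) hη6] with k hk
  refine (hmain n k).trans ?_
  calc 3 * (a n + b n k) ≤ 3 * (η / 6 + η / 6) := by gcongr
    _ = η := by
      rw [← two_mul, ← mul_assoc, show (3 : ℝ≥0∞) * 2 = 6 by norm_num]
      exact ENNReal.mul_div_cancel (by norm_num) (by norm_num)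

end StrongConvergence

/-! ### Passage to the limit in the momentum equation -/

section LimitEquation

lemma convect_sub_left (w w' : R3) (A : Grad3) : convect (w - w') A = convect w A - convect w' A := by
  simp [convect, sub_smul]

lemma convect_zero (w : R3) : convect w 0 = 0 := by simp [convect]

lemma integrable_inner_convect_of_bound {α : Type*} [MeasurableSpace α] {μ : Measure α}
    {f w : α → R3} {b : α → Grad3} {c : ℝ} (hf : MemLp f 2 μ) (hw : MemLp w 2 μ)
    (hb : AEStronglyMeasurable b μ) (hbc : ∀ z, ‖b z‖ ≤ c) :
    Integrable (fun z => inner ℝ (f z) (convect (w z) (b z))) μ := by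
  have hm : AEStronglyMeasurable (fun z => convect (w z) (b z)) μ :=
    continuous_convect.comp_aestronglyMeasurable (hw.1.prodMk hb)
  refine integrable_inner_of_memLp_two hf ((hw.const_smul c).mono hm (Eventually.of_forall fun z => ?_))
  rw [Pi.smul_apply, norm_smul, mul_comm]
  exact (norm_convect_le _ _).trans (mul_le_mul_of_nonneg_left ((hbc z).trans (le_abs_self c))
    (norm_nonneg _))

/-- Convergence of the nonlinear term under strong convergence. -/
lemma tendsto_integral_inner_convect {α : Type*} [MeasurableSpace α] {μ : Measure α}
    {fs : ℕ → α → R3} {f : α → R3} {b : α → Grad3} {c : ℝ} (hfs : ∀ k, MemLp (fs k) 2 μ)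
    (hf : MemLp f 2 μ) (hb : AEStronglyMeasurable b μ) (hbc : ∀ z, ‖b z‖ ≤ c)
    (h : Tendsto (fun k => ∫⁻ z, ‖fs k z - f z‖ₑ ^ 2 ∂μ) atTop (𝓝 0)) :
    Tendsto (fun k => ∫ z, inner ℝ (fs k z) (convect (fs k z) (b z)) ∂μ) atTop
      (𝓝 (∫ z, inner ℝ (f z) (convect (f z) (b z)) ∂μ)) := by
  have int : ∀ {g w : α → R3}, MemLp g 2 μ → MemLp w 2 μ →
      Integrable (fun z => inner ℝ (g z) (convect (w z) (b z))) μ := fun hg hw =>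
    integrable_inner_convect_of_bound hg hw hb hbc
  have hle : ∀ (w : R3) (z : α), ‖convect w (b z)‖ ≤ c * ‖w‖ := fun w z => by
    rw [mul_comm]
    exact (norm_convect_le _ _).trans (mul_le_mul_of_nonneg_left (hbc z) (norm_nonneg _))
  have t1 : Tendsto (fun k => ∫ z, inner ℝ (f z) (convect (fs k z) (b z)) ∂μ) atTop
      (𝓝 (∫ z, inner ℝ (f z) (convect (f z) (b z)) ∂μ)) := by
    refine tendsto_integral_of_tendsto_two h (fun k => (hfs k).1) hf.1 (hf.norm.const_mul c)
      (fun k => int hf (hfs k)) (int hf hf) fun k => Eventually.of_forall fun z => ?_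
    rw [← inner_sub_right, ← convect_sub_left]
    refine (abs_real_inner_le_norm _ _).trans ?_
    calc ‖f z‖ * ‖convect (fs k z - f z) (b z)‖ ≤ ‖f z‖ * (c * ‖fs k z - f z‖) := by
          gcongr; exact hle _ z
      _ = c * ‖f z‖ * ‖fs k z - f z‖ := by ring
  have t2 : Tendsto (fun k => ∫ z, inner ℝ (fs k z) (convect (f z) (b z)) ∂μ) atTop
      (𝓝 (∫ z, inner ℝ (f z) (convect (f z) (b z)) ∂μ)) := by
    refine tendsto_integral_of_tendsto_two h (fun k => (hfs k).1) hf.1 (hf.norm.const_mul c)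
      (fun k => int (hfs k) hf) (int hf hf) fun k => Eventually.of_forall fun z => ?_
    rw [← inner_sub_left]
    refine (abs_real_inner_le_norm _ _).trans ?_
    rw [mul_comm]
    gcongr
    exact hle _ z
  have t3 : Tendsto (fun k => ∫ z, inner ℝ (fs k z - f z) (convect (fs k z - f z) (b z)) ∂μ) atTop
      (𝓝 0) := by
    have h1 : Tendsto (fun k => c * (∫⁻ z, ‖fs k z - f z‖ₑ ^ 2 ∂μ).toReal) atTop (𝓝 0) := by
      simpa using ((ENNReal.tendsto_toReal ENNReal.zero_ne_top).comp h).const_mul c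
    refine squeeze_zero_norm (fun k => ?_) h1
    have hd : MemLp (fun z => fs k z - f z) 2 μ := (hfs k).sub hf
    have e : (∫⁻ z, ‖fs k z - f z‖ₑ ^ 2 ∂μ).toReal = ∫ z, ‖fs k z - f z‖ ^ 2 ∂μ := by
      rw [← ofReal_integral_norm_sq hd,
        ENNReal.toReal_ofReal (integral_nonneg fun z => sq_nonneg _)]
    rw [e, ← integral_const_mul]
    refine norm_integral_le_of_norm_le
      (((memLp_two_iff_integrable_sq_norm hd.1).1 hd).const_mul c) (Eventually.of_forall fun z => ?_)
    refine (norm_inner_le_norm _ _).trans ?_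
    calc ‖fs k z - f z‖ * ‖convect (fs k z - f z) (b z)‖
        ≤ ‖fs k z - f z‖ * (c * ‖fs k z - f z‖) := by gcongr; exact hle _ z
      _ = c * ‖fs k z - f z‖ ^ 2 := by ring
  -- The form being bilinear, `B(fₖ, fₖ) = B(fₖ - f, fₖ - f) + B(fₖ, f) + B(f, fₖ) - B(f, f)`.
  have t4 := (t3.add (t2.add t1)).sub_const (∫ z, inner ℝ (f z) (convect (f z) (b z)) ∂μ)
  rw [zero_add, add_sub_cancel_right] at t4
  refine t4.congr fun k => ?_
  have hd : MemLp (fun z => fs k z - f z) 2 μ := (hfs k).sub hf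
  rw [← integral_add (int (hfs k) hf) (int hf (hfs k))]
  have i2 : Integrable (fun z => inner ℝ (fs k z) (convect (f z) (b z)) +
      inner ℝ (f z) (convect (fs k z) (b z))) μ := (int (hfs k) hf).add (int hf (hfs k))
  rw [← integral_add (int hd hd) i2]
  have i3 : Integrable (fun z => inner ℝ (fs k z - f z) (convect (fs k z - f z) (b z)) +
      (inner ℝ (fs k z) (convect (f z) (b z)) + inner ℝ (f z) (convect (fs k z) (b z)))) μ :=
    (int hd hd).add i2
  rw [← integral_sub i3 (int hf hf)]
  refine integral_congr_ae (Eventually.of_forall fun z => ?_)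
  simp only [convect_sub_left, inner_sub_left, inner_sub_right]
  ring

variable {φ : ℝ × R3 → R3}

lemma exists_radius_of_hasCompactSupport (hs : HasCompactSupport φ) :
    ∃ r : ℝ, 0 < r ∧ ∀ z, r < ‖z‖ → φ z = 0 ∧ fderiv ℝ φ z = 0 ∧ partialGrad φ z = 0 := by
  obtain ⟨r, hr0, hr⟩ := hs.isCompact.isBounded.exists_pos_norm_le
  refine ⟨r, hr0, fun z hz => ?_⟩
  have h1 : z ∉ tsupport φ := fun h => absurd (hr z h) (not_le.2 hz)
  have h2 : fderiv ℝ φ z = 0 := by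
    by_contra hn
    exact h1 (support_fderiv_subset ℝ hn)
  exact ⟨image_eq_zero_of_notMem_tsupport h1, h2, by rw [partialGrad, h2]; simp⟩

lemma deriv_slice (hφ : ContDiff ℝ (⊤ : ℕ∞) φ) (t : ℝ) (x : R3) :
    deriv (fun s => φ (s, x)) t = fderiv ℝ φ (t, x) (1, 0) := by
  have h1 : HasDerivAt (fun s : ℝ => (s, x)) ((1 : ℝ), (0 : R3)) t :=
    (hasDerivAt_id t).prodMk (hasDerivAt_const t x)
  have h2 : HasFDerivAt φ (fderiv ℝ φ (t, x)) (t, x) :=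
    ((hφ.differentiable (by simp)) (t, x)).hasFDerivAt
  exact (h2.comp_hasDerivAt t h1).deriv

variable {ν E : ℝ} {u₀s : ℕ → R3 → R3} {us : ℕ → ℝ → R3 → R3} {Gs : ℕ → ℝ → R3 → Grad3}

/-- The limit satisfies the momentum equation. -/
theorem integral_momentum_of_limit (hν : 0 < ν) (H : IsVanishingBodySequence ν E u₀s us Gs)
    {u₀ : R3 → R3}
    (hweak : ∀ g : R3 → R3, MemLp g 2 volume →
      Tendsto (fun k => ∫ x, inner ℝ (u₀s k x) (g x)) atTop (𝓝 (∫ x, inner ℝ (u₀ x) (g x))))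
    {v : ℝ → R3 → R3} {Gv : ℝ → R3 → Grad3}
    (hvT : ∀ T, MemLp (Function.uncurry v) 2 (spaceTime (Ioc 0 T)))
    (hS : ∀ T K, Tendsto (fun k => ∫⁻ z, ‖Function.uncurry (us k) z - Function.uncurry v z‖ₑ ^ 2
      ∂localSpaceTime T K) atTop (𝓝 0))
    (hGv : MemLp (Function.uncurry Gv) 2 (spaceTime (Ioi 0)))
    (hW : ∀ Ψ : ℝ × R3 → Grad3, MemLp Ψ 2 (spaceTime (Ioi 0)) →
        Tendsto (fun k => ∫ z, inner ℝ (Function.uncurry (Gs k) z) (Ψ z) ∂spaceTime (Ioi 0))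
          atTop (𝓝 (∫ z, inner ℝ (Function.uncurry Gv z) (Ψ z) ∂spaceTime (Ioi 0))))
    (hφ : ContDiff ℝ (⊤ : ℕ∞) φ) (hs : HasCompactSupport φ)
    (hd : ∀ t x, 0 ≤ t → ∑ i, partialGrad φ (t, x) i i = 0) {r : ℝ} (hr0 : 0 < r)
    (hr : ∀ z, r < ‖z‖ → φ z = 0 ∧ fderiv ℝ φ z = 0 ∧ partialGrad φ z = 0) :
    (∫ z, momentum ν (v z.1 z.2) (Gv z.1 z.2) (fderiv ℝ φ z (1, 0)) (partialGrad φ z)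
      ∂spaceTime (Ioc 0 (r + 2))) + ∫ x, inner ℝ (u₀ x) (φ (0, x)) = 0 := by
  obtain ⟨C, hC0, hC⟩ := exists_consistency_bound hν hφ hs hd
  obtain ⟨c, hc⟩ := exists_partialGrad_bound hφ hs
  set T : ℝ := r + 2 with hT
  let a : ℝ × R3 → R3 := fun z => fderiv ℝ φ z (1, 0)
  have hbcont := (contDiff_partialGrad hφ).continuous
  have ham : MemLp a 2 (spaceTime (Ioc 0 T)) :=
    memLp_spaceTime_of_continuous ((hφ.continuous_fderiv (by simp)).clm_apply continuous_const)
      (hs.fderiv_apply (𝕜 := ℝ) _) T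
  have hbm : MemLp (partialGrad φ) 2 (spaceTime (Ioc 0 T)) :=
    memLp_spaceTime_of_continuous hbcont (hasCompactSupport_partialGrad hs) T
  have hum : ∀ k, MemLp (Function.uncurry (us k)) 2 (spaceTime (Ioc 0 T)) := fun k =>
    memLp_spaceTime_of_eLpNorm_le (H.measurable k Ioc_subset_Ioi_self)
      ((ae_restrict_mem measurableSet_Ioc).mono fun t ht => (H.velocity_bounds k ht.1.le).2)
  have hGm : ∀ k, MemLp (Function.uncurry (Gs k)) 2 (spaceTime (Ioc 0 T)) := fun k =>
    (H.grad_bounds k).1.mono_measure (spaceTime_mono Ioc_subset_Ioi_self)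
  -- The two terms to be treated with strong convergence are restricted to the ball that contains
  -- the support of `φ`, where that convergence is available. The viscous term is linear and only
  -- needs weak convergence.
  have hsplit : ∀ {w : ℝ → R3 → R3} {A : ℝ → R3 → Grad3},
      MemLp (Function.uncurry w) 2 (spaceTime (Ioc 0 T)) →
      MemLp (Function.uncurry A) 2 (spaceTime (Ioc 0 T)) →
      ∫ z, momentum ν (w z.1 z.2) (A z.1 z.2) (a z) (partialGrad φ z) ∂spaceTime (Ioc 0 T) =
        (∫ z, inner ℝ (Function.uncurry w z) (a z) ∂localSpaceTime T r) +
        (∫ z, inner ℝ (Function.uncurry w z) (convect (Function.uncurry w z) (partialGrad φ z))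
          ∂localSpaceTime T r) -
        2 * ν * ∫ z, inner ℝ (Function.uncurry A z) (symGrad (partialGrad φ z))
          ∂spaceTime (Ioc 0 T) := by
    intro w A hw hA
    have i1 := integrable_inner_of_memLp_two hw ham
    have i2 := integrable_inner_convect (c := c) hw hbm.1 (Eventually.of_forall hc)
    have i3 := integrable_inner_symGrad hA hbm
    have i12 : Integrable (fun z => inner ℝ (Function.uncurry w z) (a z) +
        inner ℝ (Function.uncurry w z) (convect (Function.uncurry w z) (partialGrad φ z)))
        (spaceTime (Ioc 0 T)) := i1.add i2
    have hout : ∀ z : ℝ × R3, z ∉ (univ : Set ℝ) ×ˢ Metric.closedBall (0 : R3) r → r < ‖z‖ := by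
      intro z hz
      simp only [mem_prod, mem_univ, true_and, mem_closedBall_zero_iff, not_le] at hz
      exact hz.trans_le (norm_snd_le z)
    have e1 : ∫ z, inner ℝ (Function.uncurry w z) (a z) ∂localSpaceTime T r =
        ∫ z, inner ℝ (Function.uncurry w z) (a z) ∂spaceTime (Ioc 0 T) :=
      setIntegral_eq_integral_of_forall_compl_eq_zero fun z hz => by
        simp only [a, (hr z (hout z hz)).2.1, _root_.zero_apply, inner_zero_right]
    have e2 : ∫ z, inner ℝ (Function.uncurry w z) (convect (Function.uncurry w z)
          (partialGrad φ z)) ∂localSpaceTime T r =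
        ∫ z, inner ℝ (Function.uncurry w z) (convect (Function.uncurry w z)
          (partialGrad φ z)) ∂spaceTime (Ioc 0 T) :=
      setIntegral_eq_integral_of_forall_compl_eq_zero fun z hz => by
        simp only [(hr z (hout z hz)).2.2, convect_zero, inner_zero_right]
    rw [e1, e2, ← integral_add i1 i2, ← integral_const_mul, ← integral_sub i12 (i3.const_mul _)]
    refine integral_congr_ae (Eventually.of_forall fun z => ?_)
    simp only [momentum, inner_add_right, Function.uncurry]
  have hle := localSpaceTime_le T r
  have hGvT : MemLp (Function.uncurry Gv) 2 (spaceTime (Ioc 0 T)) :=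
    hGv.mono_measure (spaceTime_mono Ioc_subset_Ioi_self)
  have t1 : Tendsto (fun k => ∫ z, inner ℝ (Function.uncurry (us k) z) (a z) ∂localSpaceTime T r)
      atTop (𝓝 (∫ z, inner ℝ (Function.uncurry v z) (a z) ∂localSpaceTime T r)) := by
    refine tendsto_integral_of_tendsto_two (hS T r) (fun k => ((hum k).mono_measure hle).1)
      ((hvT T).mono_measure hle).1 (ham.mono_measure hle).norm
      (fun k => integrable_inner_of_memLp_two ((hum k).mono_measure hle) (ham.mono_measure hle))
      (integrable_inner_of_memLp_two ((hvT T).mono_measure hle) (ham.mono_measure hle))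
      fun k => Eventually.of_forall fun z => ?_
    rw [← inner_sub_left, mul_comm]
    exact abs_real_inner_le_norm _ _
  have t2 := tendsto_integral_inner_convect (c := c) (fun k => (hum k).mono_measure hle)
    ((hvT T).mono_measure hle) (hbm.1.mono_measure hle) hc (hS T r)
  have t3 := tendsto_integral_inner_of_subset measurableSet_Ioc
    (show Ioc 0 T ⊆ Ioi (0 : ℝ) from Ioc_subset_Ioi_self) hW (symGrad.comp_memLp' hbm)
  simp only [Function.comp_apply] at t3
  have t4 := (t1.add t2).sub (t3.const_mul (2 * ν))
  rw [← hsplit (hvT T) hGvT] at t4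
  have hφ0 : MemLp (fun x => φ (0, x)) 2 volume :=
    memLp_of_contDiff (contDiff_slice hφ 0).continuous (hasCompactSupport_slice hs 0) 2
  have t5 := t4.add (hweak _ hφ0)
  refine tendsto_nhds_unique t5 ?_
  obtain ⟨δ, hδ, hk⟩ := H
  have hδ2 : Tendsto (fun k => C * δ k * ((1 + T) * (1 + E))) atTop (𝓝 0) := by
    simpa using (hδ.const_mul C).mul_const ((1 + T) * (1 + E))
  refine squeeze_zero_norm (fun k => ?_) hδ2
  obtain ⟨ρ, e, m, S₀, h', om, R, hf, hem⟩ := hk k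
  have hE := hf.bound_nonneg
  -- The cut-off equals `1` up to time `r + 1`, past the support of `φ`, and reaches `0` at `T = r +
  -- 2`. It only serves to meet the requirement that `θ` vanishes at the end of the interval.
  have h1 := hC hf (θ := ramp (r + 1) 1) (T := T) (by positivity) (lipschitzWith_ramp one_pos)
    (fun t => ramp_nonneg) (fun t => ramp_le_one)
    (fun t ht => ramp_eq_zero one_pos (by linarith)) (integral_abs_deriv_ramp_le one_pos T)
  rw [ramp_eq_one one_pos (by linarith), one_mul] at h1
  rw [← hsplit (hum k) (hGm k), Real.norm_eq_abs]
  have h2 : C * (√e + m) * ((1 + T) * (1 + E)) ≤ C * δ k * ((1 + T) * (1 + E)) := by gcongr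
  refine le_trans (le_of_eq ?_) (h1.trans h2)
  congr 2
  refine integral_congr_ae (Eventually.of_forall fun z => ?_)
  simp only [momentumDensity, a]
  rcases lt_or_ge z.1 (r + 1) with hz | hz
  · rw [deriv_ramp_of_lt one_pos hz, ramp_eq_one one_pos hz.le, zero_smul, zero_add, one_smul,
      one_smul]
  · have hz' : r < ‖z‖ := by
      refine lt_of_lt_of_le ?_ (norm_fst_le z)
      rw [Real.norm_eq_abs]
      exact lt_of_lt_of_le (by linarith) (le_abs_self z.1)
    obtain ⟨h3, h4, h5⟩ := hr z hz'
    rw [h3, h4, h5, smul_zero, smul_zero, _root_.zero_apply, smul_zero, zero_add]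

/-- The weak formulation of the Navier--Stokes equations, from the momentum equation. -/
lemma navierStokes_of_momentum {u₀ : R3 → R3} {v : ℝ → R3 → R3} {Gv : ℝ → R3 → Grad3}
    (hvT : ∀ T, MemLp (Function.uncurry v) 2 (spaceTime (Ioc 0 T)))
    (hGv : MemLp (Function.uncurry Gv) 2 (spaceTime (Ioi 0)))
    (hvG : ∀ᵐ t ∂volume.restrict (Ioi (0 : ℝ)), IsSobolevField (v t) (Gv t))
    (hvd : ∀ t, 0 ≤ t → IsWeakDivFree (v t))
    (hφ : ContDiff ℝ (⊤ : ℕ∞) φ) (hs : HasCompactSupport φ)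
    (hd : ∀ t x, 0 ≤ t → ∑ i, partialGrad φ (t, x) i i = 0) {r : ℝ}
    (hr : ∀ z, r < ‖z‖ → φ z = 0 ∧ fderiv ℝ φ z = 0 ∧ partialGrad φ z = 0)
    (h : (∫ z, momentum ν (v z.1 z.2) (Gv z.1 z.2) (fderiv ℝ φ z (1, 0)) (partialGrad φ z)
      ∂spaceTime (Ioc 0 (r + 2))) + ∫ x, inner ℝ (u₀ x) (φ (0, x)) = 0) :
    -(∫ t in Ioi (0 : ℝ), ∫ x, inner ℝ (v t x) (deriv (fun s => φ (s, x)) t))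
        + ν * (∫ t in Ioi (0 : ℝ), ∫ x,
            ddot (gradMatrix (Gv t x)) (gradMatrix (gradField (fun y => φ (t, y)) x)))
        + (∫ t in Ioi (0 : ℝ), ∫ x, inner ℝ (convect (v t x) (Gv t x)) (φ (t, x)))
      = ∫ x, inner ℝ (u₀ x) (φ (0, x)) := by
  obtain ⟨c, hc⟩ := exists_partialGrad_bound hφ hs
  set T : ℝ := r + 2 with hT
  have hbig : ∀ t x, t ∈ Ioi (0 : ℝ) \ Ioc 0 T → r < ‖((t, x) : ℝ × R3)‖ := by
    intro t x ht
    simp only [Set.mem_sdiff, mem_Ioi, mem_Ioc, not_and, not_le] at ht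
    refine lt_of_lt_of_le ?_ (norm_fst_le (t, x))
    rw [Real.norm_eq_abs]
    exact lt_of_lt_of_le (by linarith [ht.2 ht.1]) (le_abs_self t)
  have hcut : ∀ f : ℝ → R3 → ℝ, (∀ t x, r < ‖((t, x) : ℝ × R3)‖ → f t x = 0) →
      ∫ t in Ioi (0 : ℝ), ∫ x, f t x = ∫ t in Ioc 0 T, ∫ x, f t x := fun f hf => by
    refine setIntegral_eq_of_subset_of_forall_sdiff_eq_zero measurableSet_Ioi Ioc_subset_Ioi_self
      fun t ht => ?_
    simp only [hf _ _ (hbig t _ ht), integral_zero]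
  simp only [deriv_slice hφ, gradField_slice hφ, ddot_gradMatrix]
  rw [hcut _ fun t x ht => by rw [(hr _ ht).2.1, _root_.zero_apply, inner_zero_right],
    hcut _ fun t x ht => by rw [(hr _ ht).2.2, inner_zero_right],
    hcut _ fun t x ht => by rw [(hr _ ht).1, inner_zero_right]]
  have ham : MemLp (fun z => fderiv ℝ φ z (1, 0)) 2 (spaceTime (Ioc 0 T)) :=
    memLp_spaceTime_of_continuous ((hφ.continuous_fderiv (by simp)).clm_apply continuous_const)
      (hs.fderiv_apply (𝕜 := ℝ) _) T
  have hbm : MemLp (partialGrad φ) 2 (spaceTime (Ioc 0 T)) :=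
    memLp_spaceTime_of_continuous (contDiff_partialGrad hφ).continuous
      (hasCompactSupport_partialGrad hs) T
  have hGvT : MemLp (Function.uncurry Gv) 2 (spaceTime (Ioc 0 T)) :=
    hGv.mono_measure (spaceTime_mono Ioc_subset_Ioi_self)
  have i1 := integrable_inner_of_memLp_two (hvT T) ham
  have i2 := integrable_inner_convect (c := c) (hvT T) hbm.1 (Eventually.of_forall hc)
  have i3 := integrable_inner_symGrad hGvT hbm
  have i12 : Integrable (fun z => inner ℝ (Function.uncurry v z) (fderiv ℝ φ z (1, 0)) +
      inner ℝ (Function.uncurry v z) (convect (Function.uncurry v z) (partialGrad φ z)))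
      (spaceTime (Ioc 0 T)) := i1.add i2
  have e0 : ∫ z, momentum ν (v z.1 z.2) (Gv z.1 z.2) (fderiv ℝ φ z (1, 0)) (partialGrad φ z)
      ∂spaceTime (Ioc 0 T) =
      (∫ z, inner ℝ (Function.uncurry v z) (fderiv ℝ φ z (1, 0)) ∂spaceTime (Ioc 0 T)) +
      (∫ z, inner ℝ (Function.uncurry v z) (convect (Function.uncurry v z) (partialGrad φ z))
        ∂spaceTime (Ioc 0 T)) -
      2 * ν * ∫ z, inner ℝ (Function.uncurry Gv z) (symGrad (partialGrad φ z))
        ∂spaceTime (Ioc 0 T) := by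
    rw [← integral_add i1 i2, ← integral_const_mul, ← integral_sub i12 (i3.const_mul _)]
    refine integral_congr_ae (Eventually.of_forall fun z => ?_)
    simp only [momentum, inner_add_right, Function.uncurry]
  have hae : ∀ᵐ t ∂volume.restrict (Ioc 0 T), IsSobolevField (v t) (Gv t) ∧ 0 ≤ t := by
    filter_upwards [ae_restrict_of_ae_restrict_of_subset Ioc_subset_Ioi_self hvG,
      ae_restrict_mem measurableSet_Ioc] with t h1 h2 using ⟨h1, h2.1.le⟩
  -- Incompressibility of the limit moves the derivative from the test field to the velocity in the
  -- nonlinear term.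
  have e2 : ∫ z, inner ℝ (Function.uncurry v z) (convect (Function.uncurry v z) (partialGrad φ z))
      ∂spaceTime (Ioc 0 T) =
      -∫ t in Ioc 0 T, ∫ x, inner ℝ (convect (v t x) (Gv t x)) (φ (t, x)) := by
    rw [integral_spaceTime i2, ← integral_neg]
    refine integral_congr_ae ?_
    filter_upwards [hae] with t ht
    have := integral_inner_convect ht.1 (hvd t ht.2) (contDiff_slice hφ t)
      (hasCompactSupport_slice hs t)
    simp only [gradField_slice hφ] at this
    exact this
  -- Incompressibility of the test field turns `2 D(v) : D(φ)` into `∇v : ∇φ`.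
  have e3 : 2 * ν * ∫ z, inner ℝ (Function.uncurry Gv z) (symGrad (partialGrad φ z))
      ∂spaceTime (Ioc 0 T) =
      ν * ∫ t in Ioc 0 T, ∫ x, inner ℝ (Gv t x) (partialGrad φ (t, x)) := by
    rw [integral_spaceTime i3, mul_comm 2 ν, mul_assoc, ← integral_const_mul]
    congr 1
    refine integral_congr_ae ?_
    filter_upwards [hae] with t ht
    have := two_mul_integral_deform ht.1 (contDiff_slice hφ t) (hasCompactSupport_slice hs t)
      fun x => by rw [gradField_slice hφ]; exact hd t x ht.2
    simp only [gradField_slice hφ, ddot_gradMatrix, ddot_deform'] at this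
    exact this
  have e1 := integral_spaceTime i1
  rw [e0, e2, e3, e1] at h
  simp only [Function.uncurry] at h
  linarith

end LimitEquation

/-! ### Lower semicontinuity of the energy and the limit theorem for sequences of flows -/

section Limit

/-- Nonnegativity of `‖f - g‖²`. With `g` the weak limit, the left side passes to the limit, which
gives lower semicontinuity simultaneously for the kinetic energy and for the dissipation. -/
lemma two_mul_integral_inner_sub_le {α F : Type*} [MeasurableSpace α] {μ : Measure α}
    [NormedAddCommGroup F] [InnerProductSpace ℝ F] {f g : α → F} (hf : MemLp f 2 μ)
    (hg : MemLp g 2 μ) :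
    2 * (∫ x, inner ℝ (f x) (g x) ∂μ) - ∫ x, ‖g x‖ ^ 2 ∂μ ≤ ∫ x, ‖f x‖ ^ 2 ∂μ := by
  rw [← norm_toLp_sq hf, ← norm_toLp_sq hg, ← inner_toLp hf hg]
  have := norm_sub_sq_real (hf.toLp f) (hg.toLp g)
  nlinarith [sq_nonneg ‖hf.toLp f - hg.toLp g‖]

lemma inner_symGrad_symGrad (A B : Grad3) : inner ℝ (symGrad A) (symGrad B) = inner ℝ A (symGrad B) := by
  rw [← ddot_deform, ddot_deform']

lemma integral_dissipation {A : ℝ → R3 → Grad3} {I : Set ℝ}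
    (hA : MemLp (Function.uncurry A) 2 (spaceTime I)) :
    ∫ s in I, ∫ x, ddot (deform (A s x)) (deform (A s x)) =
      ∫ z, ‖symGrad (Function.uncurry A z)‖ ^ 2 ∂spaceTime I := by
  have h1 : MemLp (fun z => symGrad (Function.uncurry A z)) 2 (spaceTime I) :=
    symGrad.comp_memLp' hA
  rw [integral_spaceTime ((memLp_two_iff_integrable_sq_norm h1.1).1 h1)]
  simp only [ddot_deform_self, Function.uncurry]

/-- The energy is lower semicontinuous under weak convergence. -/
lemma energy_le_of_weak_limit {ν : ℝ} (hν : 0 < ν) {us : ℕ → ℝ → R3 → R3}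
    {Gs : ℕ → ℝ → R3 → Grad3} {v : ℝ → R3 → R3} {Gv : ℝ → R3 → Grad3} {t : ℝ}
    (hu : ∀ k, MemLp (us k t) 2 volume) (hv : MemLp (v t) 2 volume)
    (hlim : ∀ g : R3 → R3, MemLp g 2 volume →
      Tendsto (fun k => ∫ x, inner ℝ (us k t x) (g x)) atTop (𝓝 (∫ x, inner ℝ (v t x) (g x))))
    (hG : ∀ k, MemLp (Function.uncurry (Gs k)) 2 (spaceTime (Ioc 0 t)))
    (hGv : MemLp (Function.uncurry Gv) 2 (spaceTime (Ioc 0 t)))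
    (hW : ∀ Ψ : ℝ × R3 → Grad3, MemLp Ψ 2 (spaceTime (Ioc 0 t)) →
      Tendsto (fun k => ∫ z, inner ℝ (Function.uncurry (Gs k) z) (Ψ z) ∂spaceTime (Ioc 0 t))
        atTop (𝓝 (∫ z, inner ℝ (Function.uncurry Gv z) (Ψ z) ∂spaceTime (Ioc 0 t))))
    {b : ℕ → ℝ} {B : ℝ} (hb : Tendsto b atTop (𝓝 B))
    (hle : ∀ k, (∫ x, ‖us k t x‖ ^ 2) + 4 * ν * (∫ s in Ioc 0 t, ∫ x,
      ddot (deform (Gs k s x)) (deform (Gs k s x))) ≤ b k) :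
    (∫ x, ‖v t x‖ ^ 2) + 4 * ν * (∫ s in Ioc 0 t, ∫ x,
      ddot (deform (Gv s x)) (deform (Gv s x))) ≤ B := by
  set μ := spaceTime (Ioc 0 t)
  have hΨ : MemLp (fun z => symGrad (Function.uncurry Gv z)) 2 μ := symGrad.comp_memLp' hGv
  have t1 := ((hlim _ hv).const_mul 2).sub_const (∫ x, ‖v t x‖ ^ 2)
  have t2 := (((hW _ hΨ).const_mul 2).sub_const
    (∫ z, ‖symGrad (Function.uncurry Gv z)‖ ^ 2 ∂μ)).const_mul (4 * ν)
  have t3 := t1.add t2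
  have e1 : ∫ z, inner ℝ (Function.uncurry Gv z) (symGrad (Function.uncurry Gv z)) ∂μ =
      ∫ z, ‖symGrad (Function.uncurry Gv z)‖ ^ 2 ∂μ := by
    simp only [← inner_symGrad_symGrad, real_inner_self_eq_norm_sq]
  simp only [e1, real_inner_self_eq_norm_sq] at t3
  rw [integral_dissipation hGv]
  refine le_trans (le_of_eq (by ring)) (le_of_tendsto_of_tendsto' t3 hb fun k => ?_)
  refine le_trans ?_ (hle k)
  rw [integral_dissipation (hG k)]
  have hk : MemLp (fun z => symGrad (Function.uncurry (Gs k) z)) 2 μ := symGrad.comp_memLp' (hG k)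
  have h2 := two_mul_integral_inner_sub_le hk hΨ
  simp only [inner_symGrad_symGrad] at h2
  gcongr
  exact two_mul_integral_inner_sub_le (hu k) hv

variable {ν E : ℝ} {u₀s : ℕ → R3 → R3} {us : ℕ → ℝ → R3 → R3} {Gs : ℕ → ℝ → R3 → Grad3}

/-- Flows that contain bodies of vanishing size have a subsequence that converges to a solution of
the Navier--Stokes equations. -/
theorem exists_navierStokes_limit (hν : 0 < ν) (H : IsVanishingBodySequence ν E u₀s us Gs)
    {u₀ : R3 → R3} (hu₀ : MemLp u₀ 2 volume) (hdiv : ∀ k, IsWeakDivFree (u₀s k))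
    (hweak : ∀ g : R3 → R3, MemLp g 2 volume →
      Tendsto (fun k => ∫ x, inner ℝ (u₀s k x) (g x)) atTop (𝓝 (∫ x, inner ℝ (u₀ x) (g x)))) :
    ∃ σ : ℕ → ℕ, StrictMono σ ∧ ∃ (v : ℝ → R3 → R3) (Gv : ℝ → R3 → Grad3),
      TendstoWeakStar (fun k => us (σ k)) v ∧
      TendstoWeakL2H1 (fun k => us (σ k)) (fun k => Gs (σ k)) v Gv ∧
      IsNavierStokesSolution ν u₀ v Gv ∧
      ∀ (b : ℕ → ℝ) (B t : ℝ), Tendsto b atTop (𝓝 B) → 0 < t →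
        (∀ k, (∫ x, ‖us (σ k) t x‖ ^ 2) + 4 * ν * (∫ s in Ioc 0 t, ∫ x,
          ddot (deform (Gs (σ k) s x)) (deform (Gs (σ k) s x))) ≤ b k) →
        (∫ x, ‖v t x‖ ^ 2) + 4 * ν * (∫ s in Ioc 0 t, ∫ x,
          ddot (deform (Gv s x)) (deform (Gv s x))) ≤ B := by
  obtain ⟨σ₁, hσ₁, v, hv, hvc, hvE, hlim₁, hv0⟩ := exists_weak_limit_velocity hν H hu₀ hdiv hweak
  obtain ⟨σ₂, hσ₂, Gv, hGv, hW, hvG⟩ := exists_weak_limit_gradient (H.subseq hσ₁) hv hvc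
    (fun t ht => (hvE t ht).1) hlim₁
  have hσ := hσ₁.comp hσ₂
  refine ⟨σ₁ ∘ σ₂, hσ, v, Gv, ?_⟩
  have Hσ : IsVanishingBodySequence ν E (fun k => u₀s (σ₁ (σ₂ k))) (fun k => us (σ₁ (σ₂ k)))
    fun k => Gs (σ₁ (σ₂ k)) := H.subseq hσ
  have hlim : ∀ t, 0 ≤ t → ∀ g : R3 → R3, MemLp g 2 volume →
      Tendsto (fun k => ∫ x, inner ℝ (us (σ₁ (σ₂ k)) t x) (g x)) atTop
        (𝓝 (∫ x, inner ℝ (v t x) (g x))) := fun t ht g hg =>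
    (hlim₁ t ht g hg).comp hσ₂.tendsto_atTop
  have hweakσ : ∀ g : R3 → R3, MemLp g 2 volume →
      Tendsto (fun k => ∫ x, inner ℝ (u₀s (σ₁ (σ₂ k)) x) (g x)) atTop
        (𝓝 (∫ x, inner ℝ (u₀ x) (g x))) := fun g hg => (hweak g hg).comp hσ.tendsto_atTop
  have hsub : ∀ T : ℝ, Ioc 0 T ⊆ Ioi 0 := fun T => Ioc_subset_Ioi_self
  have hvb : ∀ t, 0 ≤ t → eLpNorm (v t) 2 volume ≤ (√E).toNNReal := fun t ht =>
    eLpNorm_le_of_integral_sq_le (hvc.1 t ht) (hvE t ht).1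
  have hvT : ∀ T, MemLp (Function.uncurry v) 2 (spaceTime (Ioc 0 T)) := fun T =>
    memLp_spaceTime_of_eLpNorm_le hv.aestronglyMeasurable
      ((ae_restrict_mem measurableSet_Ioc).mono fun t ht => hvb t ht.1.le)
  have hS := fun T K => tendsto_local_of_weak_limit Hσ hv hvc hlim hGv hvG T K
  have hGT : ∀ T k, MemLp (Function.uncurry (Gs (σ₁ (σ₂ k)))) 2 (spaceTime (Ioc 0 T)) := fun T k =>
    (Hσ.grad_bounds k).1.mono_measure (spaceTime_mono (hsub T))
  have hGvT : ∀ T, MemLp (Function.uncurry Gv) 2 (spaceTime (Ioc 0 T)) := fun T =>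
    hGv.mono_measure (spaceTime_mono (hsub T))
  have hWT : ∀ (T : ℝ) (Ψ : ℝ × R3 → Grad3), MemLp Ψ 2 (spaceTime (Ioc 0 T)) →
      Tendsto (fun k => ∫ z, inner ℝ (Function.uncurry (Gs (σ₁ (σ₂ k))) z) (Ψ z)
        ∂spaceTime (Ioc 0 T)) atTop
        (𝓝 (∫ z, inner ℝ (Function.uncurry Gv z) (Ψ z) ∂spaceTime (Ioc 0 T))) := fun T Ψ hΨ =>
    tendsto_integral_inner_of_subset measurableSet_Ioc (hsub T) hW hΨ
  refine ⟨fun Φ hΦ hΦ1 => ?_, fun T hT => ⟨fun Φ hΦ => ?_, fun Ψ hΨ => ?_⟩, ⟨⟨?_, ?_, ?_, ?_⟩, hvc,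
    fun t ht => (hvE t ht).2, hv0, fun φ hφ hs hd => ?_⟩, fun b B t hb ht hle => ?_⟩
  · exact tendsto_integral_inner_of_slices measurableSet_Ioi le_rfl
      (fun k => Hσ.measurable k le_rfl) (fun k t ht => Hσ.velocity_bounds k ht) hlim hΦ hΦ1
  · exact tendsto_integral_inner_of_slices measurableSet_Ioc (hsub T)
      (fun k => Hσ.measurable k (hsub T)) (fun k t ht => Hσ.velocity_bounds k ht) hlim hΦ.1
      (lintegral_eLpNorm_slice_lt_top hΦ)
  · have h1 := hWT T _ hΨ
    have e : ∀ {A : ℝ → R3 → Grad3}, MemLp (Function.uncurry A) 2 (spaceTime (Ioc 0 T)) →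
        ∫ z, inner ℝ (Function.uncurry A z) (Function.uncurry Ψ z) ∂spaceTime (Ioc 0 T) =
        ∫ t in Ioc 0 T, ∫ x, ddot (gradMatrix (A t x)) (gradMatrix (Ψ t x)) := fun hA => by
      rw [integral_spaceTime (integrable_inner_of_memLp_two hA hΨ)]
      simp only [ddot_gradMatrix, Function.uncurry]
    simp only [e (hGvT T), e (hGT T _)] at h1
    exact h1
  · exact hv.aestronglyMeasurable
  · exact ⟨_, (ae_restrict_mem measurableSet_Ioi).mono fun t ht => hvb t (le_of_lt ht)⟩
  · exact fun T _ => hGvT T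
  · exact hvG.mono fun t ht => ht.grad
  · obtain ⟨r, hr0, hr⟩ := exists_radius_of_hasCompactSupport hs
    have hd' : ∀ t x, 0 ≤ t → ∑ i, partialGrad φ (t, x) i i = 0 := fun t x ht => by
      rw [← gradField_slice hφ, ← trace_gradMatrix]
      exact hd t x ht
    exact navierStokes_of_momentum hvT hGv hvG (fun t ht => (hvE t ht).2) hφ hs hd' hr
      (integral_momentum_of_limit hν Hσ hweakσ hvT hS hGv hW hφ hs hd' hr0 hr)
  · exact energy_le_of_weak_limit hν (fun k => (Hσ.velocity_bounds k ht.le).1) (hvc.1 t ht.le)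
      (hlim t ht.le) (hGT t) (hGvT t) (hWT t) hb hle

end Limit

/-! ### From the hypotheses on the bodies to uniform bounds for the flows -/

section BodySequences

/-- The uniform boundedness principle, applied to the functionals `⟨fₖ, ·⟩`: weakly convergent
sequences are bounded. -/
lemma exists_integral_norm_sq_bound_of_weak {f : ℕ → R3 → R3} {g : R3 → R3}
    (hf : ∀ k, MemLp (f k) 2 volume) (h : ∀ c : R3 → R3, MemLp c 2 volume →
      Tendsto (fun k => ∫ x, inner ℝ (f k x) (c x)) atTop (𝓝 (∫ x, inner ℝ (g x) (c x)))) :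
    ∃ C : ℝ, ∀ k, ∫ x, ‖f k x‖ ^ 2 ≤ C := by
  obtain ⟨C, hC⟩ := banach_steinhaus (g := fun k => innerSL ℝ ((hf k).toLp (f k))) fun y => by
    obtain ⟨C, hC⟩ := (Metric.isBounded_range_of_tendsto _ (h y (Lp.memLp y))).exists_norm_le
    refine ⟨C, fun k => ?_⟩
    have h1 := hC _ ⟨k, rfl⟩
    have e : innerSL ℝ ((hf k).toLp (f k)) y = ∫ x, inner ℝ (f k x) (y x) := by
      rw [innerSL_apply_apply, real_inner_comm, inner_Lp_toLp]
      simp only [real_inner_comm]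
    rwa [e]
  refine ⟨C ^ 2, fun k => ?_⟩
  rw [← norm_toLp_sq (hf k)]
  have := hC k
  rw [innerSL_apply_norm] at this
  exact pow_le_pow_left₀ (norm_nonneg _) this 2

lemma tendsto_integral_norm_sq {f : ℕ → R3 → R3} {g : R3 → R3}
    (hf : ∀ k, MemLp (f k) 2 volume) (hg : MemLp g 2 volume)
    (h : Tendsto (fun k => eLpNorm (f k - g) 2 volume) atTop (𝓝 0)) :
    Tendsto (fun k => ∫ x, ‖f k x‖ ^ 2) atTop (𝓝 (∫ x, ‖g x‖ ^ 2)) := by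
  have : Fact ((1 : ℝ≥0∞) ≤ 2) := ⟨by norm_num⟩
  have h1 := (Lp.tendsto_Lp_iff_tendsto_eLpNorm'' f hf g hg).2 h
  have h2 := h1.norm.pow 2
  simpa only [norm_toLp_sq] using h2

/-- Bodies of large mass relative to their size have a density at least one. -/
lemma one_le_density {ρ e : ℝ} {S : Set R3} (hρ : 0 < ρ) (he : 0 < e) (hS : S ⊆ Metric.ball 0 e)
    (hm : volume.real (Metric.ball (0 : R3) 1) ≤ bodyMass ρ S / e ^ 3) : 1 ≤ ρ := by
  have h1 : volume.real S ≤ e ^ 3 * volume.real (Metric.ball (0 : R3) 1) := by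
    refine (measureReal_mono hS measure_ball_lt_top.ne).trans_eq ?_
    rw [Measure.real, Measure.addHaar_ball _ _ he.le, ENNReal.toReal_mul, finrank_euclideanSpace,
      Fintype.card_fin, ENNReal.toReal_ofReal (by positivity)]
    rfl
  have h2 : 0 < volume.real (Metric.ball (0 : R3) 1) :=
    ENNReal.toReal_pos (Metric.measure_ball_pos _ _ one_pos).ne' measure_ball_lt_top.ne
  rw [le_div_iff₀ (by positivity), bodyMass] at hm
  have h3 : volume.real (Metric.ball (0 : R3) 1) * e ^ 3 ≤
      ρ * (e ^ 3 * volume.real (Metric.ball (0 : R3) 1)) :=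
    hm.trans (mul_le_mul_of_nonneg_left h1 hρ.le)
  have h4 : 0 < e ^ 3 * volume.real (Metric.ball (0 : R3) 1) := by positivity
  nlinarith

variable {ν ρ e E₁ : ℝ} {S₀ : Set R3} {u₀ : R3 → R3} {u : ℝ → R3 → R3}
    {G : ℝ → R3 → Grad3} {h om : ℝ → R3} {R : ℝ → Matrix (Fin 3) (Fin 3) ℝ}

/-- Since the density is at least one, the kinetic energy with constant density is no larger than
the true one. This form passes to the limit. -/
lemma fluid_energy_le (hsol : IsWeakLeraySolution ν ρ S₀ u₀ u G h om R)
    (hen : SatisfiesBodyEnergyEstimate ν ρ S₀ u₀ u G h R) (hρ : 1 ≤ ρ) (hS : IsCompact S₀)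
    {t : ℝ} (ht : 0 < t) :
    (∫ x, ‖u t x‖ ^ 2) + 4 * ν * (∫ s in Ioc 0 t, ∫ x, ddot (deform (G s x)) (deform (G s x))) ≤
      ∫ x, globalDensity ρ S₀ x * ‖u₀ x‖ ^ 2 := by
  refine le_trans ?_ (hen t ht)
  have hL := hsol.weaklyContinuous.1 t ht.le
  have hm := (isCompact_movedBody hS (hsol.motion.rotation_mem t ht.le) (h t)).measurableSet
  refine add_le_add_left (integral_mono ((memLp_two_iff_integrable_sq_norm hL.1).1 hL)
    (integrable_globalDensity_mul_sq hρ hm hL) fun x => ?_) _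
  exact le_mul_of_one_le_left (sq_nonneg _) (one_le_globalDensity hρ _ x)

/-- `E₁` bounds the kinetic energy and `E₁ / (2 ν)` the squared gradient; their sum serves for both.
The bound for the speed rewrites `m^ε |h'|² ≤ E₁` as `(|h'| e^{3/2})² ≤ E₁ / (m^ε / e³)`, which
tends to zero exactly because of the hypothesis on the mass. -/
lemma isBoundedBodyFlow_of_energy (hν : 0 < ν) (he : 0 < e) (he1 : e ≤ 1)
    (hsol : IsWeakLeraySolution ν ρ S₀ u₀ u G h om R)
    (hen : SatisfiesBodyEnergyEstimate ν ρ S₀ u₀ u G h R) (hρ : 1 ≤ ρ) (hS : IsCompact S₀)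
    (hball : S₀ ⊆ Metric.ball 0 e) (hc : ∫ x in S₀, x = 0) (hu₀ : MemLp u₀ 2 volume)
    (hm : 0 < bodyMass ρ S₀) (hE : ∫ x, globalDensity ρ S₀ x * ‖u₀ x‖ ^ 2 ≤ E₁) :
    IsBoundedBodyFlow ν ρ e (E₁ + E₁ / (2 * ν)) (√(E₁ / (bodyMass ρ S₀ / e ^ 3))) S₀ u₀ u G h om R := by
  have h0 : ∫ x, ‖u₀ x‖ ^ 2 ≤ ∫ x, globalDensity ρ S₀ x * ‖u₀ x‖ ^ 2 :=
    integral_mono ((memLp_two_iff_integrable_sq_norm hu₀.1).1 hu₀)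
      (integrable_globalDensity_mul_sq hρ hS.measurableSet hu₀) fun x =>
        le_mul_of_one_le_left (sq_nonneg _) (one_le_globalDensity hρ _ x)
  have hE0 : 0 ≤ E₁ := (integral_nonneg fun _ => sq_nonneg _).trans (h0.trans hE)
  have hE1 : 0 ≤ E₁ / (2 * ν) := by positivity
  obtain ⟨hg1, hg2⟩ := gradient_energy_le hν hsol hen hρ
  refine ⟨he, he1, hball, hsol, hu₀, by linarith, fun t ht => ?_, hg1, hg2.trans ?_, ?_⟩
  · have := kinetic_energy_le hν hsol hen hρ hS ht
    linarith
  · refine ENNReal.ofReal_le_ofReal (le_trans ?_ (le_add_of_nonneg_left hE0))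
    gcongr
  · filter_upwards [body_momentum_le hν hsol hen hρ hS hc] with t ht
    refine Real.le_sqrt_of_sq_le ?_
    have hs : (√e ^ 3) ^ 2 = e ^ 3 := by
      rw [← pow_mul, mul_comm, pow_mul, Real.sq_sqrt he.le]
    rw [mul_pow, hs, div_div_eq_mul_div, le_div_iff₀ hm]
    calc ‖deriv h t‖ ^ 2 * e ^ 3 * bodyMass ρ S₀ = bodyMass ρ S₀ * ‖deriv h t‖ ^ 2 * e ^ 3 := by ring
      _ ≤ E₁ * e ^ 3 := by gcongr; exact ht.trans hE

end BodySequences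

end

/-! ### The massive small body limit -/

theorem theorem1
    (ν : ℝ) (hν : 0 < ν)
    -- the parameter `ε` ranges over `(0, ε₀)`
    (ε₀ : ℝ) (hε₀ : 0 < ε₀)
    -- the bodies at time `0`, their densities, and the initial data
    (S₀ : ℝ → Set R3) (ρ : ℝ → ℝ) (l₀ om₀ : ℝ → R3) (u₀ε : ℝ → R3 → R3)
    -- the solutions: velocity, its weak gradient, centre of mass, angular velocity, rotation
    (u : ℝ → ℝ → R3 → R3) (G : ℝ → ℝ → R3 → Grad3)
    (h om : ℝ → ℝ → R3) (R : ℝ → ℝ → Matrix (Fin 3) (Fin 3) ℝ)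
    -- the limit of the initial data
    (u₀ : R3 → R3)
    -- smooth homogeneous bodies inside the balls, with centre of mass at the origin
    (hbody : ∀ ε ∈ Ioo 0 ε₀, IsSmoothBody (S₀ ε))
    (hball : ∀ ε ∈ Ioo 0 ε₀, S₀ ε ⊆ Metric.ball 0 ε)
    (hcenter : ∀ ε ∈ Ioo 0 ε₀, ∫ x in S₀ ε, x = 0)
    (hρ : ∀ ε ∈ Ioo 0 ε₀, 0 < ρ ε)
    (hmass : Tendsto (fun ε => bodyMass (ρ ε) (S₀ ε) / ε ^ 3) (𝓝[>] 0) atTop)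
    -- divergence free, square integrable initial data, rigid in the body
    (hdata : ∀ ε ∈ Ioo 0 ε₀, MemLp (u₀ε ε) 2 volume ∧ IsWeakDivFree (u₀ε ε) ∧
      ∀ᵐ x, x ∈ S₀ ε → u₀ε ε x = l₀ ε + cross (om₀ ε) x)
    -- weak convergence of the initial data
    (hu₀ : MemLp u₀ 2 volume)
    (hweak : ∀ g : R3 → R3, MemLp g 2 volume →
      Tendsto (fun ε => ∫ x, inner ℝ (u₀ε ε x) (g x)) (𝓝[>] 0)
        (𝓝 (∫ x, inner ℝ (u₀ x) (g x))))
    -- boundedness of the initial rigid kinetic energies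
    (hbound : ∃ C : ℝ, ∀ ε ∈ Ioo 0 ε₀,
      ‖√(bodyMass (ρ ε) (S₀ ε)) • l₀ ε‖ ≤ C ∧
        inertia (ρ ε) (S₀ ε) 0 (om₀ ε) (om₀ ε) ≤ C)
    -- global weak solutions with their energy estimate
    (hsol : ∀ ε ∈ Ioo 0 ε₀,
      IsWeakLeraySolution ν (ρ ε) (S₀ ε) (u₀ε ε) (u ε) (G ε) (h ε) (om ε) (R ε) ∧
        SatisfiesBodyEnergyEstimate ν (ρ ε) (S₀ ε) (u₀ε ε) (u ε) (G ε) (h ε) (R ε)) :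
    ∃ (e : ℕ → ℝ) (v : ℝ → R3 → R3) (Gv : ℝ → R3 → Grad3),
      (∀ k, e k ∈ Ioo 0 ε₀) ∧ StrictAnti e ∧ Tendsto e atTop (𝓝 0) ∧
      TendstoWeakStar (fun k => u (e k)) v ∧
      TendstoWeakL2H1 (fun k => u (e k)) (fun k => G (e k)) v Gv ∧
      IsNavierStokesSolution ν u₀ v Gv ∧
      ((Tendsto (fun ε => eLpNorm (u₀ε ε - u₀) 2 volume) (𝓝[>] 0) (𝓝 0) ∧
          Tendsto (fun ε => √(bodyMass (ρ ε) (S₀ ε)) • l₀ ε) (𝓝[>] 0) (𝓝 0) ∧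
          Tendsto (fun ε => inertia (ρ ε) (S₀ ε) 0 (om₀ ε) (om₀ ε)) (𝓝[>] 0) (𝓝 0)) →
        ∀ t, 0 ≤ t →
          (∫ x, ‖v t x‖ ^ 2)
            + 4 * ν * (∫ s in Ioc 0 t, ∫ x, ddot (deform (Gv s x)) (deform (Gv s x)))
          ≤ ∫ x, ‖u₀ x‖ ^ 2) := by
  obtain ⟨C₀, hC₀⟩ := hbound
  -- Below `s` three conditions hold: the flow is defined, `ε ≤ 1` as the corrector requires, and
  -- `m^ε / ε³` exceeds the volume of the unit ball, which forces the density to be at least one.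
  obtain ⟨s, hs0, hs⟩ := mem_nhdsGT_iff_exists_Ioo_subset.1
    (inter_mem (inter_mem (Ioo_mem_nhdsGT hε₀) (Ioo_mem_nhdsGT (zero_lt_one' ℝ)))
      (hmass.eventually (eventually_ge_atTop (volume.real (Metric.ball (0 : R3) 1)))))
  have hs0' : 0 < s := hs0
  -- The shift by `2` keeps every term strictly between `0` and `s`.
  let a : ℕ → ℝ := fun k => s / ((k : ℝ) + 2)
  have ha : ∀ k, a k ∈ Ioo 0 s := fun k =>
    ⟨by positivity, div_lt_self hs0' (by linarith [(Nat.cast_nonneg k : (0 : ℝ) ≤ k)])⟩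
  have haε : ∀ k, a k ∈ Ioo 0 ε₀ := fun k => (hs (ha k)).1.1
  have haanti : StrictAnti a := fun i j hij => by
    simp only [a]
    gcongr
  have ha0 : Tendsto a atTop (𝓝 0) :=
    tendsto_const_nhds.div_atTop (tendsto_natCast_atTop_atTop.atTop_add tendsto_const_nhds)
  have haw : Tendsto a atTop (𝓝[>] 0) :=
    tendsto_nhdsWithin_iff.2 ⟨ha0, Eventually.of_forall fun k => (ha k).1⟩
  have hρ1 : ∀ k, 1 ≤ ρ (a k) := fun k =>
    one_le_density (hρ _ (haε k)) (ha k).1 (hball _ (haε k)) (hs (ha k)).2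
  have hV : 0 < volume.real (Metric.ball (0 : R3) 1) :=
    ENNReal.toReal_pos (Metric.measure_ball_pos _ _ one_pos).ne' measure_ball_lt_top.ne
  have hmpos : ∀ k, 0 < bodyMass (ρ (a k)) (S₀ (a k)) := fun k => by
    have h1 : 0 < bodyMass (ρ (a k)) (S₀ (a k)) / a k ^ 3 := hV.trans_le (hs (ha k)).2
    exact (div_pos_iff_of_pos_right (pow_pos (ha k).1 3)).1 h1
  have hE0 : ∀ k, ∫ x, globalDensity (ρ (a k)) (S₀ (a k)) x * ‖u₀ε (a k) x‖ ^ 2 ≤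
      (∫ x, ‖u₀ε (a k) x‖ ^ 2) + 2 * ‖√(bodyMass (ρ (a k)) (S₀ (a k))) • l₀ (a k)‖ ^ 2 +
        2 * inertia (ρ (a k)) (S₀ (a k)) 0 (om₀ (a k)) (om₀ (a k)) := fun k =>
    initial_energy_le (hρ1 k) (hbody _ (haε k)).isCompact (hdata _ (haε k)).1
      (hdata _ (haε k)).2.2
  have hweaka : ∀ g : R3 → R3, MemLp g 2 volume →
      Tendsto (fun k => ∫ x, inner ℝ (u₀ε (a k) x) (g x)) atTop
        (𝓝 (∫ x, inner ℝ (u₀ x) (g x))) := fun g hg => (hweak g hg).comp haw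
  obtain ⟨B, hB⟩ := exists_integral_norm_sq_bound_of_weak (fun k => (hdata _ (haε k)).1) hweaka
  -- `B` bounds the initial kinetic energy with density one, and the other two terms bound the
  -- translational and rotational energies of the body.
  set E₁ : ℝ := B + 2 * C₀ ^ 2 + 2 * C₀ with hE₁
  have hE0' : ∀ k, ∫ x, globalDensity (ρ (a k)) (S₀ (a k)) x * ‖u₀ε (a k) x‖ ^ 2 ≤ E₁ :=
    fun k => (hE0 k).trans (by
      have h1 := hC₀ _ (haε k)
      have h2 := pow_le_pow_left₀ (norm_nonneg _) h1.1 2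
      linarith [hB k, h1.2])
  have H : IsVanishingBodySequence ν (E₁ + E₁ / (2 * ν)) (fun k => u₀ε (a k)) (fun k => u (a k))
      fun k => G (a k) := by
    refine ⟨fun k => √(a k) + √(E₁ / (bodyMass (ρ (a k)) (S₀ (a k)) / a k ^ 3)), ?_, fun k =>
      ⟨ρ (a k), a k, _, S₀ (a k), h (a k), om (a k), R (a k),
        isBoundedBodyFlow_of_energy hν (ha k).1 (hs (ha k)).1.2.2.le (hsol _ (haε k)).1
          (hsol _ (haε k)).2 (hρ1 k) (hbody _ (haε k)).isCompact (hball _ (haε k))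
          (hcenter _ (haε k)) (hdata _ (haε k)).1 (hmpos k) (hE0' k), le_rfl⟩⟩
    have h1 : Tendsto (fun k => √(a k)) atTop (𝓝 0) := by
      simpa using ha0.sqrt
    have h2 : Tendsto (fun k => √(E₁ / (bodyMass (ρ (a k)) (S₀ (a k)) / a k ^ 3))) atTop (𝓝 0) := by
      have h3 : Tendsto (fun k => E₁ / (bodyMass (ρ (a k)) (S₀ (a k)) / a k ^ 3)) atTop (𝓝 0) :=
        tendsto_const_nhds.div_atTop (hmass.comp haw)
      simpa using h3.sqrt
    simpa using h1.add h2
  obtain ⟨σ, hσ, v, Gv, hv1, hv2, hv3, hv4⟩ :=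
    exists_navierStokes_limit hν H hu₀ (fun k => (hdata _ (haε k)).2.1) hweaka
  refine ⟨fun k => a (σ k), v, Gv, fun k => haε _, haanti.comp_strictMono hσ,
    ha0.comp hσ.tendsto_atTop, hv1, hv2, hv3, fun ⟨hs1, hs2, hs3⟩ t ht => ?_⟩
  -- At `t = 0` the dissipation integral is over the empty set and the initial condition gives
  -- equality. For positive times lower semicontinuity applies with an upper bound that converges.
  rcases ht.eq_or_lt with rfl | ht
  · rw [Ioc_self, Measure.restrict_empty, integral_zero_measure, mul_zero, add_zero]
    refine le_of_eq (integral_congr_ae ?_)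
    filter_upwards [hv3.initial] with x hx
    rw [hx]
  · have hlim := haw.comp hσ.tendsto_atTop
    refine hv4 _ _ t ?_ ht fun k => (fluid_energy_le (hsol _ (haε _)).1 (hsol _ (haε _)).2
      (hρ1 _) (hbody _ (haε _)).isCompact ht).trans (hE0 _)
    -- Strong convergence of the initial data gives convergence of the kinetic energies, and the two
    -- rigid energies tend to zero, so their larger coefficient `2` is immaterial.
    have t1 := tendsto_integral_norm_sq (fun k => (hdata _ (haε (σ k))).1) hu₀ (hs1.comp hlim)
    have t2 := ((hs2.comp hlim).norm.pow 2).const_mul 2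
    have t3 := (hs3.comp hlim).const_mul 2
    have t4 := (t1.add t2).add t3
    simpa using t4
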